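/- **Conventions.** $\mathbf{Pol}$ is the set of polynomially bounded functions $\mathbb N\to\mathbb N$; $\iota$ is the identity and $\lceil\lg\rceil(n)=\lceil\log_2 n\rceil$ (with value $0$ at $n=0$). A parametrized game has sets of opponent and player moves (encoded as strings) and, for every security parameter $n$, a non-empty prefix-closed set of legal plays (alternating sequences that start with an opponent move), of total length polynomially bounded in $n$. In $\mathbf B$, $\mathbf{Str}_p$, $\mathbf{Str}_{\le p}$ the opponent asks $?$ once and the player answers with a bit, a string of length $p(n)$, a string of length at most $p(n)$. In the oracle game $\mathbf O^q$ the opponent asks for a bit at most $q(n)$ times. In $!_pG$ the opponent plays, possibly interleaved, up to $p(n)$ copies of $G$, opened in order; $G\multimap H$ has the alternating sequences whose restrictions to $G$ (with the roles exchanged) and to $H$ are legal. A strategy is a deterministic total way for the player to answer at each $n$, identified with the set of plays it characterizes; it is polytime if a polynomial-time Turing machine returns its answer to $s$ on input $(1^n,s)$; $\mathsf f;\mathsf g$ is composition through interaction sequences. A probabilistic strategy on $G$ is a strategy on $\mathbf O^q\multimap G$ for some $q\in\mathbf{Pol}$, the oracle bits being uniform and independent. A function $\varepsilon$ is negligible if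 $n^c\varepsilon(n)\to0$ for every $c$. Write $\mathbf{SOF}_p={!_\iota}(\mathbf{Str}_{\lceil\lg\rceil}\multimap\mathbf B)\multimap\mathbf{Str}_p$. *Random strategy.* At parameter $n$, $\mathsf{randsof}$ on $\mathbf{SOF}_p$ queries its functional argument $n$ times, one query after the other: given the answers $t_1,\dots,t_i$ ($i<n$), the next query is uniform in $\{0,1\}^{\lceil\lg n\rceil}\setminus\{s_1,\dots,s_i\}$, where $s_1,\dots,s_i$ are the previous queries; given $t_1,\dots,t_n$, the result is uniform in $\{0,1\}^{p(n)}$; all these choices (over all possible sequences of answers) are independent. An answer given without asking for the query string is treated as any other answer. *Second-order pseudorandomness.* A deterministic polytime strategy $\mathsf f$ on $\mathbf{Str}_\iota\multimap\mathbf{SOF}_p$ is second-order pseudorandom if for all $s,q\in\mathbf{Pol}$ and every polytime strategy $\mathcal A$ on $\mathbf O^q\multimap(!_s\mathbf{SOF}_p\multimap\mathbf B)$ the function $$n\mapsto\bigl|\Pr[\mathcal A\text{ answers }1\text{ against }s(n)\text{ copies of }\mathsf f_k]-\Pr[\mathcal A\text{ answers }1\text{ against }s(n)\text{ copies of }\mathsf{randsof}]\bigr|$$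 is negligible. Here $\mathsf f_k$ is $\mathsf f$ with its $\mathbf{Str}_\iota$ argument answered by $k$; the key $k\in\{0,1\}^n$, respectively all the random choices of $\mathsf{randsof}$, is drawn uniformly once and shared by all copies, independently of the coins of $\mathcal A$. *The strategies.* Let $p,w\in\mathbf{Pol}$ with $w\ge\lceil\lg\rceil$ and $w\ge p$, where $1^n\mapsto1^{p(n)}$ is computable in polynomial time and $2^{-w(n)}$ is negligible. Let $F$ map $(k,x)\in\{0,1\}^n\times\{0,1\}^{\le n}$ to $F(k,x)\in\{0,1\}^{w(n)}$, for all $n$. - $\mathsf f_F$, on $\mathbf{Str}_\iota\multimap{!_{\iota+1}}(\mathbf{Str}_{\le\iota}\multimap\mathbf{Str}_w)$: at the first question it asks for the key $k$, once; in every copy it asks for the argument $x$ and answers $F(k,x)$. - $\mathsf{first2second}$, on ${!_{\iota+1}}(\mathbf{Str}_{\le\iota}\multimap\mathbf{Str}_w)\multimap\mathbf{SOF}_p$: for $i=1,\dots,n$, it obtains from the $i$-th copy of its first argument the value $j_i$ at $z_1\cdots z_{i-1}$, then queries its functional argument at $s_i=\alpha(j_i,\{s_1,\dots,s_{i-1}\})$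 and obtains the bit $z_i$ (if this bit is given without asking for the query string, it goes on in the same way). Finally it obtains from the $(n+1)$-st copy the value $v$ at $z_1\cdots z_n$ and returns the first $p(n)$ bits of $v$. Here, for $j\in\{0,1\}^{w(n)}$ read as a binary number and $T\subsetneq\{0,1\}^{\lceil\lg n\rceil}$, $\alpha(j,T)$ is the element of index $j\bmod m$ (counted from $0$) in the lexicographic list of the $m$ elements of $\{0,1\}^{\lceil\lg n\rceil}\setminus T$. **Theorem.** Suppose that $F$ is a pseudorandom function: $F$ is computable in polynomial time, and for every probabilistic polynomial-time oracle algorithm $D$ (querying its oracle on strings of length at most $n$), $$n\mapsto\bigl|\Pr_{k\in\{0,1\}^n}[D^{F(k,\cdot)}(1^n)=1]-\Pr_{g:\{0,1\}^{\le n}\to\{0,1\}^{w(n)}}[D^{g}(1^n)=1]\bigr|$$ is negligible, for uniform $k$ and $g$. Then the composition $\mathsf f_F;\mathsf{first2second}$ is second-order pseudorandom on $\mathbf{Str}_\iota\multimap\mathbf{SOF}_p$; in particular it is a deterministic polytime strategy. -/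

import Mathlib

namespace HOCrypto

/-! ### Polynomially bounded functions, negligible functions, polynomial time -/

/-- Polynomially bounded total functions on the natural numbers. -/
structure Pol where
  toFun : ℕ → ℕ
  bounded : ∃ P : Polynomial ℕ, ∀ n, toFun n ≤ P.eval n

instance : CoeFun Pol (fun _ => ℕ → ℕ) := ⟨Pol.toFun⟩

/-- The identity `ι`. -/
def Pol.iota : Pol := ⟨fun n => n, Polynomial.X, fun n => by simp⟩

/-- The function `ι + 1`. -/
def Pol.iotaSucc : Pol := ⟨fun n => n + 1, Polynomial.X + 1, fun n => by simp⟩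

/-- The function `⌈lg⌉`, the base-2 logarithm rounded up (with value `0` at `0`). -/
def Pol.lg : Pol :=
  ⟨fun n => Nat.clog 2 n, Polynomial.X, fun n => by
    simpa using Nat.clog_le_of_le_pow (Nat.lt_two_pow_self (n := n)).le⟩

/-- Negligible functions: decay faster than the inverse of any polynomial. -/
def Negligible (f : ℕ → ℝ) : Prop :=
  Asymptotics.SuperpolynomialDecay Filter.atTop (fun n : ℕ => (n : ℝ)) f

/-- A finite list of binary strings, written on a tape; `none` is the end marker of a string. -/
def encList (l : List (List Bool)) : List (Option Bool) :=
  l.flatMap (fun x => x.map some ++ [none])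

/-- `1^n`. -/
def unary (n : ℕ) : List Bool := List.replicate n true

/-- There is a polynomial-time Turing machine which, for every `a` in `S`, outputs the string that
encodes `f a` when started on the list of strings that encodes `a`. -/
def PolyTimeOn {α β : Type} (ea : α → List (List Bool)) (eb : β → List Bool)
    (S : Set α) (f : α → β) : Prop :=
  Nonempty (Turing.TM2ComputableInPolyTime
    (fun a : S => encList (ea a)) eb (fun a : S => f a))

/-- `1^n ↦ 1^{p(n)}` is computable in polynomial time. -/
def Pol.UnaryPolyTime (p : Pol) : Prop :=
  PolyTimeOn (fun n : ℕ => [unary n]) unary Set.univ p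

/-! ### Parametrized games -/

/-- `AltFrom o b s`: the polarities (`true` for opponent) of the moves of `s` alternate,
starting with `b`. -/
def AltFrom {M : Type} (o : M → Bool) : Bool → List M → Prop
  | _, [] => True
  | b, m :: s => o m = b ∧ AltFrom o (!b) s

/-- The total length of a play, when moves are written as strings with an end marker. -/
def playSize {M : Type} (enc : M → List Bool) (s : List M) : ℕ :=
  (s.map (fun m => (enc m).length + 1)).sum

/-- Parametrized games with set of moves `M`. A move is an opponent move if `isOpp` is `true` on it,
and a player move otherwise; `enc` is the encoding of moves as strings, and `legal n` is the set of
legal plays at security parameter `n`. -/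
structure Game (M : Type) where
  isOpp : M → Bool
  enc : M → List Bool
  enc_injective : Function.Injective enc
  legal : ℕ → Set (List M)
  nil_mem : ∀ n, [] ∈ legal n
  prefix_mem : ∀ n s t, s ++ t ∈ legal n → s ∈ legal n
  alternating : ∀ n s, s ∈ legal n → AltFrom isOpp true s
  bounded : ∃ P : Polynomial ℕ, ∀ n s, s ∈ legal n → playSize enc s ≤ P.eval n

theorem AltFrom.of_append {M : Type} {o : M → Bool} {s t : List M} :
    ∀ {b : Bool}, AltFrom o b (s ++ t) → AltFrom o b s := by
  induction s with
  | nil => intro b _; trivial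
  | cons m s ih => intro b h; exact ⟨h.1, ih h.2⟩

/-- Games in which the opponent asks one question (`none`) and the player answers it once, at
parameter `n` with an element of `ok n`. -/
def ground {A : Type} (enc : A → List Bool) (inj : Function.Injective enc) (ok : ℕ → Set A)
    (bdd : ∃ P : Polynomial ℕ, ∀ n, ∀ a ∈ ok n, (enc a).length ≤ P.eval n) : Game (Option A) where
  isOpp m := m.isNone
  enc
    | none => []
    | some a => true :: enc a
  enc_injective := by
    intro a b h
    cases a <;> cases b <;> simp at h ⊢
    exact inj h
  legal n := {s | s = [] ∨ s = [none] ∨ ∃ a ∈ ok n, s = [none, some a]}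
  nil_mem n := Or.inl rfl
  prefix_mem n s t h := by
    match s, h with
    | [], _ => exact Or.inl rfl
    | [x], h => simp_all; grind
    | [x, y], h => simp_all; grind
    | x :: y :: z :: s, h => simp_all
  alternating n s h := by
    rcases h with rfl | rfl | ⟨a, -, rfl⟩ <;> simp [AltFrom]
  bounded := by
    obtain ⟨P, hP⟩ := bdd
    refine ⟨P + 3, fun n s h => ?_⟩
    rcases h with rfl | rfl | ⟨a, ha, rfl⟩
    · simp [playSize]
    · simp [playSize]
    · have := hP n a ha
      simp [playSize]; omega

/-- The boolean game `B`. -/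
def boolGame : Game (Option Bool) :=
  ground (fun b => [b]) (fun a b h => by simpa using h) (fun _ => Set.univ) ⟨1, by simp⟩

/-- The game `Str_p` of strings of length `p(n)`. -/
def strGame (p : Pol) : Game (Option (List Bool)) :=
  ground id Function.injective_id (fun n => {x | x.length = p n})
    (by obtain ⟨P, hP⟩ := p.bounded; exact ⟨P, fun n a ha => le_trans (le_of_eq ha) (hP n)⟩)

/-- The game of strings of length at most `p(n)`. -/
def strLEGame (p : Pol) : Game (Option (List Bool)) :=
  ground id Function.injective_id (fun n => {x | x.length ≤ p n})
    (by obtain ⟨P, hP⟩ := p.bounded; exact ⟨P, fun n a ha => le_trans ha (hP n)⟩)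

theorem size_oracle (s : List (Option Bool)) :
    ∀ b, AltFrom Option.isNone b s →
      playSize Option.toList s ≤ 3 * s.count none + (if b then 0 else 2) := by
  induction s with
  | nil => intro b _; simp [playSize]
  | cons m s ih =>
    intro b h
    have := ih _ h.2
    have h1 := h.1
    cases m <;> cases b <;> simp_all [playSize] <;> omega

/-- The oracle game `O^q`: at most `q(n)` times, the opponent asks (`none`) and the player answers
with a bit. -/
def oracleGame (q : Pol) : Game (Option Bool) where
  isOpp := Option.isNone
  enc := Option.toList
  enc_injective := by
    intro a b h
    cases a <;> cases b <;> simp_all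
  legal n := {s | AltFrom Option.isNone true s ∧ s.count none ≤ q n}
  nil_mem n := ⟨trivial, by simp⟩
  prefix_mem n s t h := ⟨h.1.of_append, le_trans (by simp) h.2⟩
  alternating n s h := h.1
  bounded := by
    obtain ⟨P, hP⟩ := q.bounded
    refine ⟨3 * P, fun n s h => ?_⟩
    have h1 := size_oracle s _ h.1
    have h2 := hP n
    have h3 := h.2
    simp at h1 ⊢
    omega

/-- The restriction of a sequence to its moves in the left component. -/
def onLeft {M N : Type} (s : List (M ⊕ N)) : List M := s.filterMap Sum.getLeft?

/-- The restriction of a sequence to its moves in the right component. -/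
def onRight {M N : Type} (s : List (M ⊕ N)) : List N := s.filterMap Sum.getRight?

theorem size_sum {M N : Type} (e : M → List Bool) (f : N → List Bool) (s : List (M ⊕ N)) :
    playSize (Sum.elim (fun m => false :: e m) (fun m => true :: f m)) s
      ≤ 2 * (playSize e (onLeft s) + playSize f (onRight s)) := by
  induction s with
  | nil => simp [playSize]
  | cons m s ih =>
    cases m <;> simp [playSize, onLeft, onRight, List.filterMap_cons] at ih ⊢ <;> omega

/-- The functional game `G ⊸ H`. -/
def lolli {M N : Type} (G : Game M) (H : Game N) : Game (M ⊕ N) where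
  isOpp := Sum.elim (fun m => !G.isOpp m) H.isOpp
  enc := Sum.elim (fun m => false :: G.enc m) (fun m => true :: H.enc m)
  enc_injective := by
    rintro (a | a) (b | b) h <;> simp at h ⊢
    · exact G.enc_injective h
    · exact H.enc_injective h
  legal n := {s | AltFrom (Sum.elim (fun m => !G.isOpp m) H.isOpp) true s ∧
    onLeft s ∈ G.legal n ∧ onRight s ∈ H.legal n}
  nil_mem n := ⟨trivial, G.nil_mem n, H.nil_mem n⟩
  prefix_mem n s t h := by
    obtain ⟨h0, h1, h2⟩ := h
    refine ⟨h0.of_append, G.prefix_mem n _ (onLeft t) ?_, H.prefix_mem n _ (onRight t) ?_⟩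
    · simpa [onLeft] using h1
    · simpa [onRight] using h2
  alternating n s h := h.1
  bounded := by
    obtain ⟨P, hP⟩ := G.bounded
    obtain ⟨Q, hQ⟩ := H.bounded
    refine ⟨2 * (P + Q), fun n s h => ?_⟩
    have h1 := hP n _ h.2.1
    have h2 := hQ n _ h.2.2
    have h3 := size_sum G.enc H.enc s
    simp
    omega

/-- The `i`-th projection of a sequence of indexed moves. -/
def proj {M : Type} (i : ℕ) (s : List (ℕ × M)) : List M :=
  s.filterMap (fun m => if m.1 = i then some m.2 else none)

/-- The encoding of indexed moves. -/
def encIdx {M : Type} (e : M → List Bool) (m : ℕ × M) : List Bool :=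
  List.replicate m.1 true ++ false :: e m.2

theorem encIdx_injective {M : Type} {e : M → List Bool} (he : Function.Injective e) :
    Function.Injective (encIdx e) := by
  rintro ⟨i, a⟩ ⟨j, b⟩ h
  simp only [encIdx] at h
  induction i generalizing j with
  | zero =>
    cases j with
    | zero => simp at h; simp [he h]
    | succ j => simp [List.replicate_succ] at h
  | succ i ih =>
    cases j with
    | zero => simp [List.replicate_succ] at h
    | succ j =>
      simp only [List.replicate_succ, List.cons_append, List.cons.injEq, true_and] at h
      have := ih j h
      simp_all

theorem size_idx {M : Type} (e : M → List Bool) (k : ℕ) (s : List (ℕ × M))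
    (h : ∀ m ∈ s, m.1 < k) :
    playSize (encIdx e) s ≤ (k + 1) * ∑ i ∈ Finset.range k, playSize e (proj i s) := by
  induction s with
  | nil => simp [playSize]
  | cons m s ih =>
    obtain ⟨j, m⟩ := m
    have hj : j < k := h (j, m) (by simp)
    have ih := ih (fun x hx => h x (by simp [hx]))
    have e1 : ∀ i, playSize e (proj i ((j, m) :: s)) =
        (if j = i then (e m).length + 1 else 0) + playSize e (proj i s) := by
      intro i
      by_cases hi : j = i <;> simp [proj, playSize, hi]
    have e2 : playSize (encIdx e) ((j, m) :: s) =
        (j + ((e m).length + 1) + 1) + playSize (encIdx e) s := by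
      simp [playSize, encIdx]
    rw [e2]
    simp only [e1, Finset.sum_add_distrib, Finset.sum_ite_eq, Finset.mem_range, hj, if_true]
    nlinarith

/-- The bounded exponential `!_p G`: the opponent may play up to `p(n)` copies of `G`, which are
numbered from `0` and opened in this order. -/
def bang {M : Type} (p : Pol) (G : Game M) : Game (ℕ × M) where
  isOpp m := G.isOpp m.2
  enc := encIdx G.enc
  enc_injective := encIdx_injective G.enc_injective
  legal n := {s | AltFrom (fun m : ℕ × M => G.isOpp m.2) true s ∧
    (∀ i, proj i s ∈ G.legal n) ∧ (∀ m ∈ s, m.1 < p n) ∧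
    ∀ u v i x, s = u ++ (i + 1, x) :: v → ∃ y, (i, y) ∈ u}
  nil_mem n := ⟨trivial, fun _ => G.nil_mem n, by simp, by simp⟩
  prefix_mem n s t h := by
    obtain ⟨h0, h1, h2, h3⟩ := h
    refine ⟨h0.of_append, fun i => G.prefix_mem n _ (proj i t) ?_,
      fun m hm => h2 m (by simp [hm]), fun u v i x e => h3 u (v ++ t) i x (by simp [e])⟩
    have := h1 i
    simpa [proj] using this
  alternating n s h := h.1
  bounded := by
    obtain ⟨P, hP⟩ := G.bounded
    obtain ⟨Q, hQ⟩ := p.bounded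
    refine ⟨(Q + 1) * (Q * P), fun n s h => ?_⟩
    have h1 := size_idx G.enc (p n) s h.2.2.1
    have h2 : ∑ i ∈ Finset.range (p n), playSize G.enc (proj i s) ≤ p n * P.eval n := by
      simpa using Finset.sum_le_card_nsmul (Finset.range (p n)) _ (P.eval n)
        (fun i _ => hP n _ (h.2.1 i))
    have h3 := hQ n
    simp only [Polynomial.eval_mul, Polynomial.eval_add, Polynomial.eval_one]
    calc _ ≤ _ := h1
      _ ≤ (p n + 1) * (p n * P.eval n) := by gcongr
      _ ≤ _ := by gcongr

/-! ### Strategies -/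

/-- A strategy is given by the family of the sets of (even-length) plays that characterise it: the
answer of the player to an odd-length play `s` is the `x` such that `s x` is in the set, if any. -/
abbrev Plays (M : Type) : Type := ℕ → Set (List M)

/-- `σ` is a (deterministic, total) strategy on the parametrized game `G`. -/
structure IsStrategy {M : Type} (G : Game M) (σ : Plays M) : Prop where
  nil_mem : ∀ n, [] ∈ σ n
  legal : ∀ n s, s ∈ σ n → s ∈ G.legal n ∧ Even s.length
  prefix_mem : ∀ n s x y, s ++ [x, y] ∈ σ n → s ∈ σ n
  deterministic : ∀ n s x y z, s ++ [x, y] ∈ σ n → s ++ [x, z] ∈ σ n → y = z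
  total : ∀ n s x, s ∈ σ n → s ++ [x] ∈ G.legal n → ∃ y, s ++ [x, y] ∈ σ n

/-- `σ` is polytime computable: some polynomial-time Turing machine returns, on `(1^n, s)`, the
answer `x` of the strategy to `s`, for every play `s` at parameter `n` to which there is one. -/
def IsPolyTime {M : Type} (G : Game M) (σ : Plays M) : Prop :=
  PolyTimeOn (fun a : ℕ × List M × M => unary a.1 :: a.2.1.map G.enc) G.enc
    {a | a.2.1 ++ [a.2.2] ∈ σ a.1} (fun a => a.2.2)

/-- The even-length plays in `L` in which every player move is the one prescribed by `next` (a
function of the odd-length play before it). -/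
def playsOf {M : Type} (L : Set (List M)) (next : List M → M) : Set (List M) :=
  {s | s ∈ L ∧ Even s.length ∧ ∀ u v x, s = u ++ x :: v → Odd u.length → x = next u}

/-- Composition of strategies on `G ⊸ H` and `H ⊸ K`, through interaction sequences. -/
def comp {M N K : Type} (σ : Plays (M ⊕ N)) (τ : Plays (N ⊕ K)) : Plays (M ⊕ K) :=
  fun n => {s | ∃ u : List (M ⊕ (N ⊕ K)),
    u.filterMap (Sum.elim (fun m => some (Sum.inl m))
      (Sum.elim (fun m => some (Sum.inr m)) (fun _ => none))) ∈ σ n ∧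
    onRight u ∈ τ n ∧
    s = u.filterMap (Sum.elim (fun m => some (Sum.inl m))
      (Sum.elim (fun _ => none) (fun m => some (Sum.inr m))))}

/-- A strategy for `H ⊸ K` played (at a fixed parameter) against a strategy for `H`. -/
def app {N K : Type} (σ : Set (List N)) (τ : Set (List (N ⊕ K))) : Set (List K) :=
  {s | ∃ u ∈ τ, onLeft u ∈ σ ∧ s = onRight u}

/-- The strategy on `!_s G` (at parameter `n`) which plays copies of one and the same strategy
on `G`. -/
def bangPlays {M : Type} (s : Pol) (G : Game M) (n : ℕ) (σ : Set (List M)) : Set (List (ℕ × M)) :=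
  {t | t ∈ (bang s G).legal n ∧ Even t.length ∧ ∀ i, proj i t ∈ σ}

/-- The play of `O^q ⊸ B` in which the player asks for the random bits `r`, and then answers `b`. -/
def coinPlay (r : List Bool) (b : Bool) : List (Option Bool ⊕ Option Bool) :=
  Sum.inr none :: r.flatMap (fun c => [Sum.inl none, Sum.inl (some c)]) ++ [Sum.inr (some b)]

open Classical in
/-- The probability of observing `b` when executing a strategy on `O^q ⊸ B` (at parameter `n`). -/
noncomputable def prObs (q : Pol) (n : ℕ) (σ : Set (List (Option Bool ⊕ Option Bool)))
    (b : Bool) : ℝ :=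
  ∑ k ∈ Finset.range (q n + 1), ∑ r : List.Vector Bool k,
    if coinPlay r.toList b ∈ σ then (1 / 2 : ℝ) ^ k else 0

/-- A strategy on `O^q ⊸ (H ⊸ K)` played (at a fixed parameter) against a strategy on `H`; the
result is a strategy on `O^q ⊸ K`. -/
def appProb {O N K : Type} (σ : Set (List N)) (τ : Set (List (O ⊕ (N ⊕ K)))) :
    Set (List (O ⊕ K)) :=
  {s | ∃ u ∈ τ, onLeft (onRight u) ∈ σ ∧
    s = u.filterMap (Sum.elim (fun m => some (Sum.inl m))
      (Sum.elim (fun _ => none) (fun m => some (Sum.inr m))))}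

/-! ### Second-order pseudorandom functions -/

/-- Moves of the games of strings. -/
abbrev StrM : Type := Option (List Bool)

/-- Moves of `!_ι(Str_{⌈lg⌉} ⊸ B) ⊸ Str_p`. -/
abbrev LogSofM : Type := (ℕ × (StrM ⊕ Option Bool)) ⊕ StrM

/-- The game `!_ι(Str_{⌈lg⌉} ⊸ B) ⊸ Str_p`. -/
def logSof (p : Pol) : Game LogSofM :=
  lolli (bang Pol.iota (lolli (strGame Pol.lg) boolGame)) (strGame p)

/-- The bits answered so far by the argument function, in order. -/
def argBits (s : List LogSofM) : List Bool :=
  s.filterMap fun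
    | Sum.inl (_, Sum.inr (some z)) => some z
    | _ => none

/-- The sample space of the random strategy at parameter `n`. After the answers `t` of the argument
function, the next query is `query t` (if `t` has less than `n` bits), and the final result is
`result t` (if `t` has `n` bits). Queries on the same branch are pairwise distinct. Under the
uniform distribution, every query is uniform among the strings not queried before on its branch,
every result is uniform, and all these choices are independent. -/
structure RandTree (l m n : ℕ) where
  query : {t : List Bool // t.length < n} → List.Vector Bool l
  result : {t : List Bool // t.length = n} → List.Vector Bool m
  distinct : ∀ t t', t.1 <+: t'.1 → t ≠ t' → query t ≠ query t'

instance finite_lt (n : ℕ) : Finite {t : List Bool // t.length < n} :=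
  (List.finite_length_lt Bool n).to_subtype

instance finite_eq (n : ℕ) : Finite {t : List Bool // t.length = n} :=
  (List.finite_length_eq Bool n).to_subtype

instance finite_le (n : ℕ) : Finite {t : List Bool // t.length ≤ n} :=
  (List.finite_length_le Bool n).to_subtype

instance (l m n : ℕ) : Finite (RandTree l m n) :=
  Finite.of_injective (fun T => (T.query, T.result)) (by
    rintro ⟨a, b, _⟩ ⟨c, d, _⟩ h
    simp only [Prod.mk.injEq] at h
    obtain ⟨rfl, rfl⟩ := h
    rfl)

noncomputable instance (l m n : ℕ) : Fintype (RandTree l m n) := Fintype.ofFinite _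

/-- What the strategy of a tree does once the argument function has answered the bits `t`. -/
def RandTree.advance {l m n : ℕ} (T : RandTree l m n) (t : List Bool) : LogSofM :=
  if h : t.length = n then Sum.inr (some (T.result ⟨t, h⟩).toList)
  else Sum.inl (t.length, Sum.inr none)

/-- The next move of the strategy of a tree; it depends on the last opponent move. -/
def RandTree.next {l m n : ℕ} (T : RandTree l m n) (s : List LogSofM) : LogSofM :=
  match s.getLast? with
  | some (Sum.inl (i, Sum.inl _)) =>
    Sum.inl (i, Sum.inl (some
      (if h : (argBits s).length < n then (T.query ⟨argBits s, h⟩).toList else [])))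
  | _ => T.advance (argBits s)

/-- The strategy `randsof`, at parameter `n` and for a fixed random choice `T`. -/
def randSof (p : Pol) (n : ℕ) (T : RandTree (Pol.lg n) (p n) n) : Set (List LogSofM) :=
  playsOf ((logSof p).legal n) T.next

/-- The strategy on `Str_ι` (at parameter `n = k.length`) that answers `k`. -/
def keyPlays (k : List Bool) : Set (List StrM) := {[], [none, some k]}

/-- The probability that the adversary `A` on `O^q ⊸ (!_s H ⊸ B)` answers `1` when playing against
`s(n)` copies of the strategy `σ` on `H`. -/
noncomputable def prAccept {M : Type} (q s : Pol) (H : Game M) (n : ℕ)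
    (A : Plays (Option Bool ⊕ ((ℕ × M) ⊕ Option Bool))) (σ : Set (List M)) : ℝ :=
  prObs q n (appProb (bangPlays s H n σ) (A n)) true

/-- A deterministic polytime strategy `f` on `Str_ι ⊸ (!_ι(Str_{⌈lg⌉} ⊸ B) ⊸ Str_p)` is a
second-order pseudorandom function if no probabilistic polytime strategy on
`!_s(!_ι(Str_{⌈lg⌉} ⊸ B) ⊸ Str_p) ⊸ B` distinguishes `f`, with a uniformly random key of length
`n` drawn once and for all, from `randsof`, drawn once and for all. -/
def IsSecondOrderPRF (p : Pol) (f : Plays (StrM ⊕ LogSofM)) : Prop :=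
  IsStrategy (lolli (strGame Pol.iota) (logSof p)) f ∧
  IsPolyTime (lolli (strGame Pol.iota) (logSof p)) f ∧
  ∀ (s q : Pol) (A : Plays (Option Bool ⊕ ((ℕ × LogSofM) ⊕ Option Bool))),
    IsStrategy (lolli (oracleGame q) (lolli (bang s (logSof p)) boolGame)) A →
    IsPolyTime (lolli (oracleGame q) (lolli (bang s (logSof p)) boolGame)) A →
    Negligible fun n =>
      |(Finset.univ.expect fun k : List.Vector Bool n =>
          prAccept q s (logSof p) n A (app (keyPlays k.toList) (f n))) -
        (Finset.univ.expect fun T : RandTree (Pol.lg n) (p n) n =>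
          prAccept q s (logSof p) n A (randSof p n T))|

/-! ### Pseudorandom functions -/

/-- A probabilistic polytime oracle algorithm with parameter `n`, for oracles with answers in
`{0,1}^{w(n)}`: from `1^n`, the coins `r` and the oracle answers received so far, `step` determines
in polynomial time the next oracle query, or else the final output. It uses `coins(n)` random bits
and makes at most `queries(n)` queries. -/
structure OracleAlg (w : Pol) where
  coins : Polynomial ℕ
  queries : Polynomial ℕ
  step : ℕ → List Bool → List (List Bool) → List Bool ⊕ Bool
  polytime : PolyTimeOn
    (fun a : ℕ × List Bool × List (List Bool) => unary a.1 :: a.2.1 :: a.2.2)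
    (Sum.elim (fun x => false :: x) (fun b => [true, b]))
    {a | a.2.1.length = coins.eval a.1 ∧ a.2.2.length ≤ queries.eval a.1 ∧
      ∀ y ∈ a.2.2, y.length = w a.1}
    (fun a => step a.1 a.2.1 a.2.2)

/-- The run of an algorithm which may still make `fuel` queries to the oracle `O` and has already
received the answers `ys`. It fails if it exceeds the number of queries or makes a query longer than
`n`. -/
def runOracle (n : ℕ) (step : List (List Bool) → List Bool ⊕ Bool) (O : List Bool → List Bool) :
    ℕ → List (List Bool) → Bool
  | fuel, ys =>
    match step ys with
    | Sum.inr b => b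
    | Sum.inl x =>
      match fuel with
      | 0 => false
      | fuel + 1 => if x.length ≤ n then runOracle n step O fuel (ys ++ [O x]) else false

/-- The probability that the algorithm outputs `1` with parameter `n` and oracle `O`. -/
noncomputable def OracleAlg.prAccept {w : Pol} (D : OracleAlg w) (n : ℕ)
    (O : List Bool → List Bool) : ℝ :=
  Finset.univ.expect fun r : List.Vector Bool (D.coins.eval n) =>
    if runOracle n (D.step n r.toList) O (D.queries.eval n) [] = true then 1 else 0

/-- Functions from `{0,1}^{≤ n}` to `{0,1}^m`. -/
abbrev FunLE (n m : ℕ) : Type := {x : List Bool // x.length ≤ n} → List.Vector Bool m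

noncomputable instance (n m : ℕ) : Fintype (FunLE n m) := Fintype.ofFinite _

/-- An element of `FunLE n m` as an oracle. -/
def FunLE.toOracle {n m : ℕ} (g : FunLE n m) (x : List Bool) : List Bool :=
  if h : x.length ≤ n then (g ⟨x, h⟩).toList else []

/-- `F` (key first) is a pseudorandom function `{0,1}^n × {0,1}^{≤ n} → {0,1}^{w(n)}`. -/
structure IsPRF (w : Pol) (F : List Bool → List Bool → List Bool) : Prop where
  length : ∀ k x, x.length ≤ k.length → (F k x).length = w k.length
  polytime : PolyTimeOn (fun a : List Bool × List Bool => [a.1, a.2]) id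
    {a | a.2.length ≤ a.1.length} (fun a => F a.1 a.2)
  secure : ∀ D : OracleAlg w, Negligible fun n =>
    |(Finset.univ.expect fun k : List.Vector Bool n => D.prAccept n (F k.toList)) -
      (Finset.univ.expect fun g : FunLE n (w n) => D.prAccept n g.toOracle)|

/-! ### The strategies `f_F` and `first2second` -/

/-- Moves of `!_{ι+1}(Str_{≤ι} ⊸ Str_w)`. -/
abbrev FunM : Type := ℕ × (StrM ⊕ StrM)

/-- The game `!_{ι+1}(Str_{≤ι} ⊸ Str_w)`. -/
def funGame (w : Pol) : Game FunM :=
  bang Pol.iotaSucc (lolli (strLEGame Pol.iota) (strGame w))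

/-- The key received in a play (the empty string if there is none). -/
def keyIn (s : List (StrM ⊕ FunM)) : List Bool :=
  ((onLeft s).filterMap id).headD []

/-- The next move of `f_F`, by the last opponent move. Asked for a value of the function, it asks
for the argument, but the very first time it first asks for the key `k`; given an argument `x`, it
answers `F k x`. -/
def prfNext (F : List Bool → List Bool → List Bool) (s : List (StrM ⊕ FunM)) : StrM ⊕ FunM :=
  match s.reverse with
  | Sum.inr (i, Sum.inl (some x)) :: _ => Sum.inr (i, Sum.inr (some (F (keyIn s) x)))
  | Sum.inl (some _) :: Sum.inl none :: Sum.inr (i, Sum.inr none) :: _ =>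
    Sum.inr (i, Sum.inl none)
  | Sum.inr (i, Sum.inr none) :: u =>
    if u.isEmpty then Sum.inl none else Sum.inr (i, Sum.inl none)
  | _ => Sum.inl none

/-- The strategy `f_F` on `Str_ι ⊸ !_{ι+1}(Str_{≤ι} ⊸ Str_w)`. -/
def prfStrategy (w : Pol) (F : List Bool → List Bool → List Bool) : Plays (StrM ⊕ FunM) :=
  fun n => playsOf ((lolli (strGame Pol.iota) (funGame w)).legal n) (prfNext F)

/-- All binary strings of length `l`, in lexicographic order. -/
def allStr : ℕ → List (List Bool)
  | 0 => [[]]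
  | l + 1 => (allStr l).map (List.cons false) ++ (allStr l).map (List.cons true)

/-- The number with binary representation `y`, most significant bit first. -/
def strVal (y : List Bool) : ℕ := y.foldl (fun a b => 2 * a + b.toNat) 0

/-- `α(y, T)`: the string `y`, read as a number modulo the number of strings of length `l` outside
`T`, designates one of these strings. -/
def alpha (l : ℕ) (y : List Bool) (T : List (List Bool)) : List Bool :=
  let rest := (allStr l).filter (fun x => !T.contains x)
  rest.getD (strVal y % rest.length) []

/-- The queries `s_1, s_2, …` determined by `j_1, j_2, …`, with
`s_i = α(j_i, {s_1, …, s_{i-1}})`. -/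
def queriesOf (l : ℕ) (ys : List (List Bool)) : List (List Bool) :=
  ys.foldl (fun T y => T ++ [alpha l y T]) []

/-- The values of the first-order function obtained in a play, in order. -/
def funVals (s : List (FunM ⊕ LogSofM)) : List (List Bool) :=
  (onLeft s).filterMap fun
    | (_, Sum.inr (some y)) => some y
    | _ => none

/-- The next move of `first2second`, by the last opponent move. It obtains the value `j` of the
first-order function at the bits `z_1 ⋯ z_i` answered so far by its functional argument; if `i < n`,
this value determines the next query to the functional argument, and if `i = n`, the final result,
namely the first `p(n)` bits of `j`. -/
def f2sNext (p : Pol) (n : ℕ) (s : List (FunM ⊕ LogSofM)) : FunM ⊕ LogSofM :=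
  match s.getLast? with
  | some (Sum.inl (i, Sum.inl _)) => Sum.inl (i, Sum.inl (some (argBits (onRight s))))
  | some (Sum.inl (i, Sum.inr (some y))) =>
    if i < n then Sum.inr (Sum.inl (i, Sum.inr none)) else Sum.inr (Sum.inr (some (y.take (p n))))
  | some (Sum.inr (Sum.inl (i, Sum.inl _))) =>
    Sum.inr (Sum.inl (i, Sum.inl (some ((queriesOf (Pol.lg n) (funVals s)).getD i []))))
  | some (Sum.inr (Sum.inl (i, Sum.inr _))) => Sum.inl (i + 1, Sum.inr none)
  | _ => Sum.inl (0, Sum.inr none)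

/-- The strategy `first2second` on
`!_{ι+1}(Str_{≤ι} ⊸ Str_w) ⊸ (!_ι(Str_{⌈lg⌉} ⊸ B) ⊸ Str_p)`. -/
def first2second (w p : Pol) : Plays (FunM ⊕ LogSofM) :=
  fun n => playsOf ((lolli (funGame w) (logSof p)).legal n) (f2sNext p n)

end HOCrypto

/-! For a fixed key `k`, every choice of the composite strategy is read off the function `F k`: once
the bits `t` have been answered, the next query is `alpha` applied to `F k t` and to the earlier
queries of the branch, and the result is a prefix of `F k t`. So the composite is the strategy
`randSof` of one particular tree, `treeOf` of `F k` (`app_comp`). The two experiments are then the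
same game against the strategy of a tree, with two different laws for the tree.

An adversary against copies of the strategy of `treeOf O` becomes an algorithm with oracle `O`
(`exists_oracleAlg`). It runs the adversary, feeds it its coins, and answers a move in a copy after
querying `O` at all prefixes of the bits already given in that copy. Plays have polynomial size, so
there are polynomially many steps and queries, and the probability of acceptance is exactly the same
(`prAccept_eq`). Pseudorandomness of `F` therefore replaces `F k` by a uniform function at
negligible cost.

What remains is statistical. The tree of a uniform function is not quite uniform, because a uniform
number of `w` bits reduced modulo `m` is slightly biased. Give instead independent values to the
function, each uniform below the largest multiple of the relevant `m` (`treeWeight`). For a given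
tree `T`, all the queries on every branch are known in advance, so the event that the function
yields `T` is a conjunction of conditions on single values (`treeOf_eq_iff`). These conditions are
independent, with probabilities that do not depend on `T` (`sum_fits`), hence the tree is exactly
uniform (`prodExpect_treeWeight`). Each value has moved by at most `(4n+2)/2^w` in total variation
norm, and revealing the queried values one at a time shows that an algorithm notices at most this
amount per query (`abs_sub_runOracle_le`). The total is negligible because `2^{-w}` is.

The composite must also be a polynomial-time strategy. It is shown to be given by an explicit next
move `compNext` (`comp_eq`): interaction sequences are deterministic between two moves of the
environment, and the internal exchange after each such move is finite and known. For the machines, a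
small while language with calls is compiled to `FinTM2`; above it stands a calculus `PT` of
polynomial-time functions between types coded by binary trees, closed under composition, pairs, case
distinctions and folds whose accumulator keeps polynomial size. -/

namespace HOCrypto

/-! ### A while language compiled to Turing machines -/

/-- Tape symbols. -/
abbrev Sym : Type := Option Bool

/-- Registers, holding lists of symbols. -/
abbrev Reg : Type := Fin 6

/-- While programs over the registers with a single variable, which can call the machines `i : ι`. -/
inductive Prog (ι : Type) : Type
  | push (r : Reg) (f : Option Sym → Sym)
  | pop (r : Reg)
  | peek (r : Reg)
  | load (f : Option Sym → Option Sym)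
  | seq (P Q : Prog ι)
  | ite (c : Option Sym → Bool) (P Q : Prog ι)
  | loop (c : Option Sym → Bool) (P : Prog ι)
  | call (i : ι) (r r' : Reg)

open Function in
/-- `Exec spec P v S v' S' t`: from the value `v` of the variable and the contents `S` of the
registers, `P` terminates within time `t` with `v'` and `S'`. A call of `i` on `r`, `r'` consumes
the contents of `r`, which is the input in reverse, and adds the output to `r'`, in reverse. -/
inductive Exec {ι : Type} (spec : ι → List Sym → List Sym → ℕ → Prop) :
    Prog ι → Option Sym → (Reg → List Sym) → Option Sym → (Reg → List Sym) → ℕ → Prop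
  | push r f v S : Exec spec (.push r f) v S v (update S r (f v :: S r)) 1
  | pop r v S : Exec spec (.pop r) v S (S r).head? (update S r (S r).tail) 1
  | peek r v S : Exec spec (.peek r) v S (S r).head? S 1
  | load f v S : Exec spec (.load f) v S (f v) S 1
  | seq {P Q v S v' S' t v'' S'' t'} : Exec spec P v S v' S' t → Exec spec Q v' S' v'' S'' t' →
      Exec spec (.seq P Q) v S v'' S'' (t + t')
  | ite_true {c P Q v S v' S' t} : c v = true → Exec spec P v S v' S' t →
      Exec spec (.ite c P Q) v S v' S' (t + 1)
  | ite_false {c P Q v S v' S' t} : c v = false → Exec spec Q v S v' S' t →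
      Exec spec (.ite c P Q) v S v' S' (t + 1)
  | loop_false {c P v S} : c v = false → Exec spec (.loop c P) v S v S 1
  | loop_true {c P v S v' S' t v'' S'' t'} : c v = true → Exec spec P v S v' S' t →
      Exec spec (.loop c P) v' S' v'' S'' t' → Exec spec (.loop c P) v S v'' S'' (t + t' + 1)
  | call {i r r' v S x y t} : spec i x y t → S r = x.reverse → r ≠ r' →
      Exec spec (.call i r r') v S none
        (update (update S r []) r' (y.reverse ++ S r')) (t + x.length + y.length + 2)
  | mono {P v S v' S' t t'} : Exec spec P v S v' S' t → t ≤ t' → Exec spec P v S v' S' t'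

/-- A machine that can be called, with translations of its input and output alphabets. -/
structure Callee where
  tm : Turing.FinTM2
  toIn : Sym → tm.Γ tm.k₀
  fromOut : tm.Γ tm.k₁ → Sym

/-- The input-output behaviour of a machine. -/
def Callee.Spec (M : Callee) (x y : List Sym) (t : ℕ) : Prop :=
  ∃ z, Nonempty (Turing.TM2OutputsInTime M.tm (x.map M.toIn) (some z) t) ∧ y = z.map M.fromOut

section Compile

open Turing Function

variable {ι : Type} (M : ι → Callee) (B : Type)

/-- The stacks of the compiled machine: registers, stacks of the called machines, output. -/
abbrev CK : Type := (Reg ⊕ Unit) ⊕ (Σ i, (M i).tm.K)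

/-- Stack alphabets of the compiled machine. -/
@[reducible] def CΓ : CK M → Type
  | .inl (.inl _) => Sym
  | .inl (.inr _) => B
  | .inr x => (M x.1).tm.Γ x.2

/-- States of the compiled machine. -/
abbrev Cσ : Type := Option Sym × (∀ i, (M i).tm.σ)

/-- Labels of a compiled program. -/
def Lab : Prog ι → Type
  | .push _ _ => Unit
  | .pop _ => Unit
  | .peek _ => Unit
  | .load _ => Unit
  | .seq P Q => Lab P ⊕ Lab Q
  | .ite _ P Q => Unit ⊕ (Lab P ⊕ Lab Q)
  | .loop _ P => Unit ⊕ Lab P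
  | .call i _ _ => Bool ⊕ (M i).tm.Λ

/-- The entry point of a compiled program. -/
def entry : (P : Prog ι) → Lab M P
  | .push _ _ => ()
  | .pop _ => ()
  | .peek _ => ()
  | .load _ => ()
  | .seq P _ => .inl (entry P)
  | .ite _ _ _ => .inl ()
  | .loop _ _ => .inl ()
  | .call _ _ _ => .inl false

noncomputable instance labFintype : (P : Prog ι) → Fintype (Lab M P)
  | .push _ _ => inferInstanceAs (Fintype Unit)
  | .pop _ => inferInstanceAs (Fintype Unit)
  | .peek _ => inferInstanceAs (Fintype Unit)
  | .load _ => inferInstanceAs (Fintype Unit)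
  | .seq P Q => @instFintypeSum _ _ (labFintype P) (labFintype Q)
  | .ite _ P Q => @instFintypeSum _ _ _ (@instFintypeSum _ _ (labFintype P) (labFintype Q))
  | .loop _ P => @instFintypeSum _ _ _ (labFintype P)
  | .call i _ _ => @instFintypeSum _ _ _ (M i).tm.ΛFin

variable {Λ' : Type}

/-- A statement of a called machine as a statement of the compiled machine. -/
def embStmt [DecidableEq ι] (i : ι) (inj : (M i).tm.Λ → Λ') (exit : TM2.Stmt (CΓ M B) Λ' (Cσ M)) :
    TM2.Stmt (M i).tm.Γ (M i).tm.Λ (M i).tm.σ → TM2.Stmt (CΓ M B) Λ' (Cσ M)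
  | .push k f q => .push (.inr ⟨i, k⟩) (fun v => f (v.2 i)) (embStmt i inj exit q)
  | .peek k f q => .peek (.inr ⟨i, k⟩) (fun v o => (v.1, update v.2 i (f (v.2 i) o)))
      (embStmt i inj exit q)
  | .pop k f q => .pop (.inr ⟨i, k⟩) (fun v o => (v.1, update v.2 i (f (v.2 i) o)))
      (embStmt i inj exit q)
  | .load f q => .load (fun v => (v.1, update v.2 i (f (v.2 i)))) (embStmt i inj exit q)
  | .branch f q q' => .branch (fun v => f (v.2 i)) (embStmt i inj exit q) (embStmt i inj exit q')
  | .goto f => .goto (fun v => inj (f (v.2 i)))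
  | .halt => exit

/-- The code of a compiled program, whose labels are embedded by `inj` and which continues with
`exit`. -/
def progCode [DecidableEq ι] : (P : Prog ι) → (Lab M P → Λ') → TM2.Stmt (CΓ M B) Λ' (Cσ M) →
    Lab M P → TM2.Stmt (CΓ M B) Λ' (Cσ M)
  | .push r f, _, exit => fun _ => .push (.inl (.inl r)) (fun v => f v.1) exit
  | .pop r, _, exit => fun _ => .pop (.inl (.inl r)) (fun v o => (o, v.2)) exit
  | .peek r, _, exit => fun _ => .peek (.inl (.inl r)) (fun v o => (o, v.2)) exit
  | .load f, _, exit => fun _ => .load (fun v => (f v.1, v.2)) exit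
  | .seq P Q, inj, exit => Sum.elim
      (progCode P (inj ∘ .inl) (.goto fun _ => inj (.inr (entry M Q))))
      (progCode Q (inj ∘ .inr) exit)
  | .ite c P Q, inj, exit => Sum.elim
      (fun _ => .branch (fun v => c v.1) (.goto fun _ => inj (.inr (.inl (entry M P))))
        (.goto fun _ => inj (.inr (.inr (entry M Q)))))
      (Sum.elim (progCode P (inj ∘ .inr ∘ .inl) exit) (progCode Q (inj ∘ .inr ∘ .inr) exit))
  | .loop c P, inj, exit => Sum.elim
      (fun _ => .branch (fun v => c v.1) (.goto fun _ => inj (.inr (entry M P))) exit)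
      (progCode P (inj ∘ .inr) (.goto fun _ => inj (.inl ())))
  | .call i r r', inj, exit => Sum.elim
      (fun b => cond b
        (.pop (.inr ⟨i, (M i).tm.k₁⟩) (fun v o => (o.map (M i).fromOut, v.2))
          (.branch (fun v => v.1.isSome)
            (.push (.inl (.inl r')) (fun v => v.1.getD none) (.goto fun _ => inj (.inl true)))
            exit))
        (.pop (.inl (.inl r)) (fun v o => (o, v.2))
          (.branch (fun v => v.1.isSome)
            (.push (.inr ⟨i, (M i).tm.k₀⟩) (fun v => (M i).toIn (v.1.getD none))
              (.goto fun _ => inj (.inl false)))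
            (.goto fun _ => inj (.inr (M i).tm.main)))))
      (fun l => embStmt M B i (inj ∘ .inr) (.goto fun _ => inj (.inl true)) ((M i).tm.m l))

/-- `c` reaches `c'` in exactly `t` steps. -/
def ReachIn {C : Type} (f : C → Option C) (t : ℕ) (c c' : C) : Prop :=
  (flip bind f)^[t] (some c) = some c'

theorem ReachIn.trans {C : Type} {f : C → Option C} {t t' : ℕ} {a b c : C}
    (h : ReachIn f t a b) (h' : ReachIn f t' b c) : ReachIn f (t + t') a c := by
  unfold ReachIn at *
  rw [add_comm, Function.iterate_add_apply, h, h']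

theorem ReachIn.one {C : Type} {f : C → Option C} {a b : C} (h : f a = some b) :
    ReachIn f 1 a b := h

theorem ReachIn.succ {C : Type} {f : C → Option C} {t : ℕ} {a b c : C} (h : f a = some b)
    (h' : ReachIn f t b c) : ReachIn f (t + 1) a c := by
  rw [add_comm]; exact (ReachIn.one h).trans h'

/-- The stacks of the compiled machine when all stacks but the registers and the output are empty. -/
def mkStk (S : Reg → List Sym) (o : List B) : ∀ k : CK M, List (CΓ M B k)
  | .inl (.inl r) => S r
  | .inl (.inr _) => o
  | .inr _ => []

/-- The initial state. -/
def mkVar (v : Option Sym) : Cσ M := (v, fun i => (M i).tm.initialState)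

variable [DecidableEq ι]

theorem mkStk_update (S : Reg → List Sym) (o : List B) (r : Reg) (x : List Sym) :
    update (mkStk M B S o) (.inl (.inl r)) x = mkStk M B (update S r x) o := by
  funext k
  rcases k with (k | k) | k
  · by_cases h : k = r
    · subst h; simp [mkStk]
    · simp [mkStk, h]
  · simp [mkStk]
  · simp [mkStk]

/-- Configurations of a called machine, and how they are embedded. -/
structure EmbRel (i : ι) (v : Cσ M) (S : ∀ k, List (CΓ M B k))
    (v₀ : (M i).tm.σ) (S₀ : ∀ k, List ((M i).tm.Γ k))
    (a : Option Sym) (R : Reg → List Sym) (o : List B) : Prop where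
  var : v.2 = update (mkVar M a).2 i v₀
  cur : v.1 = a
  stk : ∀ k, S (.inr ⟨i, k⟩) = S₀ k
  other : ∀ x : Σ i, (M i).tm.K, x.1 ≠ i → S (.inr x) = []
  reg : ∀ r, S (.inl (.inl r)) = R r
  out : S (.inl (.inr ())) = o

variable {M B}

theorem EmbRel.update {i : ι} {v S v₀ S₀ a R o} (h : EmbRel M B i v S v₀ S₀ a R o)
    (k : (M i).tm.K) (x : List ((M i).tm.Γ k)) :
    EmbRel M B i v (Function.update S (.inr ⟨i, k⟩) x) v₀ (Function.update S₀ k x) a R o where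
  var := h.var
  cur := h.cur
  stk k' := by
    by_cases hk : k' = k
    · subst hk; simp
    · rw [Function.update_of_ne hk, Function.update_of_ne (by simpa using hk), h.stk]
  other x' hx := by
    rw [Function.update_of_ne (by rintro ⟨⟩; exact hx rfl), h.other x' hx]
  reg r := by rw [Function.update_of_ne (by simp), h.reg]
  out := by rw [Function.update_of_ne (by simp), h.out]

theorem EmbRel.set {i : ι} {v S v₀ S₀ a R o} (h : EmbRel M B i v S v₀ S₀ a R o)
    (w : (M i).tm.σ) :
    EmbRel M B i (v.1, Function.update v.2 i w) S w S₀ a R o where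
  var := by simp [h.var]
  cur := h.cur
  stk := h.stk
  other := h.other
  reg := h.reg
  out := h.out

theorem EmbRel.val {i : ι} {v S v₀ S₀ a R o} (h : EmbRel M B i v S v₀ S₀ a R o) :
    v.2 i = v₀ := by
  simp [h.var]

/-- A machine executes a whole statement in one step, so the translated statement takes a single
step as well. A `halt` is replaced by `exit`, which is run inside that same step; this is the case
where no label remains. -/
theorem embStmt_spec {i : ι} (inj : (M i).tm.Λ → Λ') (exit : TM2.Stmt (CΓ M B) Λ' (Cσ M))
    (q : TM2.Stmt (M i).tm.Γ (M i).tm.Λ (M i).tm.σ) {a R o} :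
    ∀ {v S v₀ S₀}, EmbRel M B i v S v₀ S₀ a R o →
      ∃ v' S', EmbRel M B i v' S' (TM2.stepAux q v₀ S₀).var (TM2.stepAux q v₀ S₀).stk a R o ∧
        TM2.stepAux (embStmt M B i inj exit q) v S =
          match (TM2.stepAux q v₀ S₀).l with
          | some l => ⟨some (inj l), v', S'⟩
          | none => TM2.stepAux exit v' S' := by
  induction q with
  | push k f q ih =>
    intro v S v₀ S₀ h
    have := h.update k (f v₀ :: S₀ k)
    simp only [embStmt, TM2.stepAux, h.val, h.stk]
    exact ih this
  | peek k f q ih =>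
    intro v S v₀ S₀ h
    simp only [embStmt, TM2.stepAux, h.val, h.stk]
    exact ih (h.set _)
  | pop k f q ih =>
    intro v S v₀ S₀ h
    simp only [embStmt, TM2.stepAux, h.val, h.stk]
    exact ih ((h.set _).update k (S₀ k).tail)
  | load f q ih =>
    intro v S v₀ S₀ h
    simp only [embStmt, TM2.stepAux, h.val]
    exact ih (h.set _)
  | branch f q q' ih ih' =>
    intro v S v₀ S₀ h
    simp only [embStmt, TM2.stepAux, h.val]
    cases f v₀
    · exact ih' h
    · exact ih h
  | goto f =>
    intro v S v₀ S₀ h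
    simp only [embStmt, TM2.stepAux, h.val]
    exact ⟨v, S, h, rfl⟩
  | halt =>
    intro v S v₀ S₀ h
    exact ⟨v, S, h, rfl⟩

theorem flip_bind_iterate_none {C : Type} (f : C → Option C) (t : ℕ) :
    (flip bind f)^[t] none = none := by
  induction t with
  | zero => rfl
  | succ t ih => rw [Function.iterate_succ_apply]; exact ih

/-- The translation goes step by step, so the running time is unchanged. The last step is the one
that jumps to `next`; a machine that halted earlier would be stuck and could not reach `c'` in
exactly `t` steps. -/
theorem emb_run {i : ι} {m : Λ' → TM2.Stmt (CΓ M B) Λ' (Cσ M)} {inj : (M i).tm.Λ → Λ'}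
    {next : Λ'} (hm : ∀ l, m (inj l) = embStmt M B i inj (.goto fun _ => next) ((M i).tm.m l))
    {a R o} {c' : (M i).tm.Cfg} (hc' : c'.l = none) (t : ℕ) :
    ∀ (l : (M i).tm.Λ) {v S v₀ S₀}, EmbRel M B i v S v₀ S₀ a R o →
      ReachIn (M i).tm.step t ⟨some l, v₀, S₀⟩ c' →
      ∃ v' S', EmbRel M B i v' S' c'.var c'.stk a R o ∧
        ReachIn (TM2.step m) t ⟨some (inj l), v, S⟩ ⟨some next, v', S'⟩ := by
  induction t with
  | zero =>
    intro l v S v₀ S₀ _ hr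
    obtain rfl := Option.some.inj hr
    cases hc'
  | succ t ih =>
    intro l v S v₀ S₀ h hr
    unfold ReachIn at hr
    rw [Function.iterate_succ_apply] at hr
    obtain ⟨v', S', h', e⟩ := embStmt_spec inj (.goto fun _ => next) ((M i).tm.m l) h
    have hs : TM2.step m ⟨some (inj l), v, S⟩ =
        some (TM2.stepAux (embStmt M B i inj (.goto fun _ => next) ((M i).tm.m l)) v S) := by
      simp [TM2.step, hm]
    change (flip bind (M i).tm.step)^[t] (some (TM2.stepAux ((M i).tm.m l) v₀ S₀)) = some c' at hr
    generalize hd : TM2.stepAux ((M i).tm.m l) v₀ S₀ = d at *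
    obtain ⟨dl, dv, dS⟩ := d
    rw [e] at hs
    cases dl with
    | some l' =>
      obtain ⟨v'', S'', h'', e''⟩ := ih l' h' hr
      exact ⟨v'', S'', h'', ReachIn.succ hs e''⟩
    | none =>
      cases t with
      | zero =>
        obtain rfl := Option.some.inj hr
        exact ⟨v', S', h', ReachIn.one hs⟩
      | succ t =>
        rw [Function.iterate_succ_apply] at hr
        have : flip bind (M i).tm.step (some ⟨none, dv, dS⟩) = none := rfl
        rw [this, flip_bind_iterate_none] at hr
        cases hr

theorem step_eq {K : Type} [DecidableEq K] {Γ : K → Type} {Λ σ : Type}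
    {m : Λ → TM2.Stmt Γ Λ σ} {l : Λ} {q : TM2.Stmt Γ Λ σ} (h : m l = q) (v : σ)
    (S : ∀ k, List (Γ k)) : TM2.step m ⟨some l, v, S⟩ = some (TM2.stepAux q v S) := by
  rw [← h]; rfl

theorem mkStk_reg (S : Reg → List Sym) (o : List B) (r : Reg) :
    mkStk M B S o (.inl (.inl r)) = S r := rfl

theorem mkStk_update_nil (S : Reg → List Sym) (o : List B) (x : Σ i, (M i).tm.K) :
    update (mkStk M B S o) (.inr x) [] = mkStk M B S o :=
  update_eq_self_iff.2 rfl

/-- Popping the register and pushing on the input stack reverses the word, which is why a call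
expects its input in reverse. The additional step is the one that finds the register empty. -/
theorem call_load {i : ι} {r : Reg} {l₀ l₁ : Λ'} {m : Λ' → TM2.Stmt (CΓ M B) Λ' (Cσ M)}
    (hm : m l₀ = .pop (.inl (.inl r)) (fun v o => (o, v.2))
      (.branch (fun v => v.1.isSome)
        (.push (.inr ⟨i, (M i).tm.k₀⟩) (fun v => (M i).toIn (v.1.getD none))
          (.goto fun _ => l₀))
        (.goto fun _ => l₁))) (o : List B) (y : List Sym) :
    ∀ (v : Option Sym) (S : Reg → List Sym) (z : List ((M i).tm.Γ (M i).tm.k₀)), S r = y →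
      ReachIn (TM2.step m) (y.length + 1)
        ⟨some l₀, mkVar M v, update (mkStk M B S o) (.inr ⟨i, (M i).tm.k₀⟩) z⟩
        ⟨some l₁, mkVar M none,
          update (mkStk M B (update S r []) o) (.inr ⟨i, (M i).tm.k₀⟩)
            ((y.map (M i).toIn).reverse ++ z)⟩ := by
  induction y with
  | nil =>
    intro v S z hy
    refine ReachIn.one ((step_eq hm _ _).trans ?_)
    simp only [TM2.stepAux]
    rw [update_of_ne (by simp)]
    simp only [mkStk_reg, hy, List.head?_nil, Option.isSome_none, cond_false, List.tail_nil]
    rw [update_comm (by simp), mkStk_update]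
    simp [mkVar]
  | cons a y ih =>
    intro v S z hy
    refine ReachIn.succ ((step_eq hm _ _).trans ?_) (by
      have := ih (some a) (update S r y) ((M i).toIn a :: z) (by simp)
      simpa using this)
    simp only [TM2.stepAux]
    rw [update_of_ne (by simp)]
    simp only [mkStk_reg, hy, List.head?_cons, Option.isSome_some, cond_true, List.tail_cons]
    have hcomm : update (update (mkStk M B S o) (.inr ⟨i, (M i).tm.k₀⟩) z) (.inl (.inl r)) y =
        update (mkStk M B (update S r y) o) (.inr ⟨i, (M i).tm.k₀⟩) z := by
      rw [update_comm (by simp), mkStk_update]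
    rw [hcomm, update_self, update_idem]
    simp [mkVar]

theorem call_unload {i : ι} {r' : Reg} {l₀ : Λ'}
    {exit : TM2.Stmt (CΓ M B) Λ' (Cσ M)} {m : Λ' → TM2.Stmt (CΓ M B) Λ' (Cσ M)}
    (hm : m l₀ = .pop (.inr ⟨i, (M i).tm.k₁⟩) (fun v o => (o.map (M i).fromOut, v.2))
      (.branch (fun v => v.1.isSome)
        (.push (.inl (.inl r')) (fun v => v.1.getD none) (.goto fun _ => l₀)) exit))
    (o : List B) (z : List ((M i).tm.Γ (M i).tm.k₁)) :
    ∀ (v : Option Sym) (S : Reg → List Sym),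
      ReachIn (TM2.step m) (z.length + 1)
        ⟨some l₀, mkVar M v, update (mkStk M B S o) (.inr ⟨i, (M i).tm.k₁⟩) z⟩
        (TM2.stepAux exit (mkVar M none)
          (mkStk M B (update S r' ((z.map (M i).fromOut).reverse ++ S r')) o)) := by
  induction z with
  | nil =>
    intro v S
    refine ReachIn.one ((step_eq hm _ _).trans ?_)
    simp only [TM2.stepAux]
    rw [update_self, update_idem, List.tail_nil, mkStk_update_nil]
    simp [mkVar]
  | cons a z ih =>
    intro v S
    refine ReachIn.succ ((step_eq hm _ _).trans ?_) (by
      have := ih (some ((M i).fromOut a)) (update S r' ((M i).fromOut a :: S r'))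
      simpa using this)
    simp only [TM2.stepAux]
    rw [update_self, update_idem, update_of_ne (by simp), update_comm (by simp), mkStk_update]
    simp [mkVar, mkStk]

/-- Induction on the derivation of `Exec`. The embedding of labels, the machine and the continuation
are arbitrary because a subprogram occurs inside a larger one; since `exit` is run within the last
step, sequencing costs nothing. -/
theorem code_run {P : Prog ι} {v S v' S' t}
    (h : Exec (fun i => (M i).Spec) P v S v' S' t) :
    ∀ {Λ' : Type} {inj : Lab M P → Λ'} {exit : TM2.Stmt (CΓ M B) Λ' (Cσ M)}
      {m : Λ' → TM2.Stmt (CΓ M B) Λ' (Cσ M)}, (∀ l, m (inj l) = progCode M B P inj exit l) →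
      ∀ o : List B, ∃ k ≤ t, ReachIn (TM2.step m) k
        ⟨some (inj (entry M P)), mkVar M v, mkStk M B S o⟩
        (TM2.stepAux exit (mkVar M v') (mkStk M B S' o)) := by
  induction h with
  | push r f v S =>
    intro Λ' inj exit m hm o
    refine ⟨1, le_rfl, ReachIn.one ((step_eq (hm _) _ _).trans ?_)⟩
    simp only [progCode, TM2.stepAux, mkStk_update]
    rfl
  | pop r v S =>
    intro Λ' inj exit m hm o
    refine ⟨1, le_rfl, ReachIn.one ((step_eq (hm _) _ _).trans ?_)⟩
    simp only [progCode, TM2.stepAux, mkStk_update]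
    rfl
  | peek r v S =>
    intro Λ' inj exit m hm o
    exact ⟨1, le_rfl, ReachIn.one (step_eq (hm _) _ _)⟩
  | load r v S =>
    intro Λ' inj exit m hm o
    exact ⟨1, le_rfl, ReachIn.one (step_eq (hm _) _ _)⟩
  | seq _ _ ih ih' =>
    intro Λ' inj exit m hm o
    obtain ⟨k, hk, e⟩ := ih (fun l => hm (.inl l)) o
    obtain ⟨k', hk', e'⟩ := ih' (fun l => hm (.inr l)) o
    exact ⟨k + k', by omega, e.trans e'⟩
  | ite_true hc _ ih =>
    intro Λ' inj exit m hm o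
    obtain ⟨k, hk, e⟩ := ih (inj := inj ∘ .inr ∘ .inl) (fun l => hm (.inr (.inl l))) o
    refine ⟨k + 1, by omega, ReachIn.succ ((step_eq (hm (.inl ())) _ _).trans
      (congrArg (fun b => some (cond b _ _)) hc)) e⟩
  | ite_false hc _ ih =>
    intro Λ' inj exit m hm o
    obtain ⟨k, hk, e⟩ := ih (inj := inj ∘ .inr ∘ .inr) (fun l => hm (.inr (.inr l))) o
    refine ⟨k + 1, by omega, ReachIn.succ ((step_eq (hm (.inl ())) _ _).trans
      (congrArg (fun b => some (cond b _ _)) hc)) e⟩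
  | loop_false hc =>
    intro Λ' inj exit m hm o
    refine ⟨1, le_rfl, ReachIn.one ((step_eq (hm (.inl ())) _ _).trans
      (congrArg (fun b => some (cond b _ _)) hc))⟩
  | loop_true hc _ _ ih ih' =>
    intro Λ' inj exit m hm o
    obtain ⟨k, hk, e⟩ := ih (inj := inj ∘ .inr) (fun l => hm (.inr l)) o
    obtain ⟨k', hk', e'⟩ := ih' hm o
    refine ⟨k + k' + 1, by omega, ReachIn.succ ((step_eq (hm (.inl ())) _ _).trans
      (congrArg (fun b => some (cond b _ _)) hc)) (e.trans e')⟩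
  | @call i r r' v S x y t hspec hr hne =>
    intro Λ' inj exit m hm o
    obtain ⟨z, ⟨⟨k, hk⟩, hkt⟩, rfl⟩ := hspec
    have h1 := call_load (hm (.inl false)) o x.reverse v S [] hr
    rw [mkStk_update_nil] at h1
    have hrel : EmbRel M B i (mkVar M none)
        (update (mkStk M B (update S r []) o) (.inr ⟨i, (M i).tm.k₀⟩)
          ((x.reverse.map (M i).toIn).reverse ++ []))
        (M i).tm.initialState (initList (M i).tm (x.map (M i).toIn)).stk none (update S r []) o := by
      refine ⟨?_, rfl, ?_, ?_, ?_, ?_⟩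
      · simp [mkVar]
      · intro k
        by_cases hk : k = (M i).tm.k₀
        · subst hk
          rw [update_self]
          simp [initList]
        · rw [update_of_ne (by simpa using hk)]
          simp [initList, mkStk, hk]
      · intro x hx
        rw [update_of_ne (by rintro ⟨⟩; exact hx rfl)]
        rfl
      · intro r
        rw [update_of_ne (by simp)]
        rfl
      · rw [update_of_ne (by simp)]
        rfl
    obtain ⟨v', S', hrel', h2⟩ := emb_run (m := m) (inj := inj ∘ .inr) (next := inj (.inl true))
      (fun l => hm (.inr l)) (c' := haltList (M i).tm z) rfl k _ hrel hk
    -- A final configuration `haltList` has the initial state and all stacks empty except the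
    -- output. Hence, after unloading, the called machine is ready for another call, for instance
    -- inside a loop.
    have hv : v' = mkVar M none :=
      Prod.ext hrel'.cur (by rw [hrel'.var]; simp [haltList, mkVar])
    have hS : S' = update (mkStk M B (update S r []) o) (.inr ⟨i, (M i).tm.k₁⟩) z := by
      funext k
      rcases k with (k | k) | ⟨j, k⟩
      · rw [update_of_ne (by simp), hrel'.reg]; rfl
      · rw [update_of_ne (by simp), hrel'.out]; rfl
      · by_cases hj : j = i
        · subst hj
          rw [hrel'.stk]
          by_cases hk : k = (M j).tm.k₁
          · subst hk
            rw [update_self]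
            simp [haltList]
          · rw [update_of_ne (by simpa using hk)]
            simp [haltList, mkStk, hk]
        · rw [update_of_ne (by rintro ⟨⟩; exact hj rfl), hrel'.other _ hj]
          rfl
    have h3 := call_unload (hm (.inl true)) o z none (update S r [])
    rw [hv, hS] at h2
    rw [update_of_ne hne.symm] at h3
    exact ⟨_, by simp at hkt ⊢; omega, (h1.trans h2).trans h3⟩
  | mono _ hle ih =>
    intro Λ' inj exit m hm o
    obtain ⟨k, hk, e⟩ := ih hm o
    exact ⟨k, hk.trans hle, e⟩

variable (M B)

/-- The machine that runs a program with input in register `0`, and then moves the contents of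
register `1` to the output stack. -/
noncomputable def compile [Fintype ι] (toB : Sym → B) (P : Prog ι) : FinTM2 :=
  letI : ∀ i, Fintype (M i).tm.K := fun i => (M i).tm.kFin
  letI : ∀ i, Fintype (M i).tm.σ := fun i => (M i).tm.σFin
  { K := CK M
    k₀ := .inl (.inl 0)
    k₁ := .inl (.inr ())
    Γ := CΓ M B
    Λ := Lab M P ⊕ Unit
    main := .inl (entry M P)
    σ := Cσ M
    initialState := mkVar M none
    Γk₀Fin := inferInstanceAs (Fintype Sym)
    m := Sum.elim (progCode M B P .inl (.goto fun _ => .inr ()))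
      (fun _ => .pop (.inl (.inl 1)) (fun v o => (o, v.2)) (.branch (fun v => v.1.isSome)
        (.push (.inl (.inr ())) (fun v => toB (v.1.getD none)) (.goto fun _ => .inr ())) .halt)) }

variable {M B} in
theorem compile_unload {l₀ : Λ'} {m : Λ' → TM2.Stmt (CΓ M B) Λ' (Cσ M)} {toB : Sym → B}
    (hm : m l₀ = .pop (.inl (.inl 1)) (fun v o => (o, v.2)) (.branch (fun v => v.1.isSome)
        (.push (.inl (.inr ())) (fun v => toB (v.1.getD none)) (.goto fun _ => l₀)) .halt))
    (y : List Sym) :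
    ∀ (v : Option Sym) (S : Reg → List Sym) (o : List B), S 1 = y →
      ReachIn (TM2.step m) (y.length + 1) ⟨some l₀, mkVar M v, mkStk M B S o⟩
        ⟨none, mkVar M none, mkStk M B (update S 1 []) ((y.map toB).reverse ++ o)⟩ := by
  induction y with
  | nil =>
    intro v S o hy
    refine ReachIn.one ((step_eq hm _ _).trans ?_)
    simp only [TM2.stepAux, mkStk_reg, hy, mkStk_update]
    simp [mkVar]
  | cons a y ih =>
    intro v S o hy
    refine ReachIn.succ ((step_eq hm _ _).trans ?_) (by
      have := ih (some a) (update S 1 y) (toB a :: o) (by simp)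
      simpa using this)
    simp only [TM2.stepAux, mkStk_reg, hy, mkStk_update]
    simp only [List.head?_cons, mkVar, Option.isSome_some, cond_true, List.tail_cons,
      Option.getD_some, Option.some.injEq, TM2.Cfg.mk.injEq, true_and]
    rw [update_eq_iff]
    refine ⟨rfl, ?_⟩
    rintro ((k | k) | k) hk
    · rfl
    · exact absurd rfl hk
    · rfl

/-- A polynomial-time machine from a program that leaves its output, in reverse, in register `1`. -/
theorem polyTime_of_exec [Fintype ι] {α β : Type} {ea : α → List Sym} {eb : β → List B} {f : α → β}
    (toB : Sym → B) (P : Prog ι) (time : Polynomial ℕ)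
    (h : ∀ a, ∃ v y, Exec (fun i => (M i).Spec) P none (update (fun _ => []) 0 (ea a)) v
      (update (fun _ => []) 1 y) (time.eval (ea a).length) ∧
      (y.map toB).reverse = eb (f a) ∧ y.length ≤ time.eval (ea a).length) :
    Nonempty (TM2ComputableInPolyTime ea eb f) := by
  refine ⟨⟨⟨compile M B toB P, Equiv.refl _, Equiv.refl _⟩, 2 * time + 1, fun a => ?_⟩⟩
  refine Classical.choice ?_
  obtain ⟨v, y, hx, hy, hl⟩ := h a
  obtain ⟨k, hk, e⟩ := code_run (B := B) hx (m := (compile M B toB P).m) (inj := .inl)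
    (exit := .goto fun _ => .inr ()) (fun l => rfl) []
  have e' := e.trans (compile_unload (m := (compile M B toB P).m) (l₀ := .inr ()) (toB := toB) rfl
    y v (update (fun _ => []) 1 y) [] (by simp))
  have h1 : initList (compile M B toB P) (ea a) =
      ⟨some (Sum.inl (entry M P)), mkVar M none, mkStk M B (update (fun _ => []) 0 (ea a)) []⟩ := by
    unfold initList
    congr 1
    funext j
    rcases j with (j | j) | j
    · by_cases hj : j = 0
      · subst hj
        simp [mkStk, compile]
        rfl
      · simp [mkStk, compile, hj]
    · simp [mkStk, compile]
    · simp [mkStk, compile]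
  have h2 : haltList (compile M B toB P) (eb (f a)) =
      ⟨none, mkVar M none, mkStk M B (update (update (fun _ => []) 1 y) 1 [])
        ((y.map toB).reverse ++ [])⟩ := by
    unfold haltList
    congr 1
    funext j
    rcases j with (j | j) | j
    · simp [mkStk, compile]
    · simp [mkStk, compile, ← hy]
      rfl
    · simp [mkStk, compile]
  have key : (flip bind (compile M B toB P).step)^[k + (y.length + 1)]
      (some (initList (compile M B toB P) (ea a))) =
      some (haltList (compile M B toB P) (eb (f a))) := by
    rw [h1, h2]
    exact e'
  exact ⟨⟨⟨_, (congrArg (fun z => (flip bind (compile M B toB P).step)^[k + (y.length + 1)]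
    (some (initList (compile M B toB P) z))) (List.map_id (ea a))).trans (key.trans
      (congrArg (fun z => some (haltList (compile M B toB P) z)) (List.map_id (eb (f a))).symm))⟩, by
    simp only [Polynomial.eval_add, Polynomial.eval_mul, Polynomial.eval_ofNat,
      Polynomial.eval_one]
    omega⟩⟩

end Compile


open Turing

/-! ### Programming -/

/-- The contents of the registers. -/
def regs (a b c d e f : List Sym) : Reg → List Sym := ![a, b, c, d, e, f]

section
variable (a b c d e f x : List Sym)
@[simp] theorem regs_0 : regs a b c d e f 0 = a := rfl
@[simp] theorem regs_1 : regs a b c d e f 1 = b := rfl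
@[simp] theorem regs_2 : regs a b c d e f 2 = c := rfl
@[simp] theorem regs_3 : regs a b c d e f 3 = d := rfl
@[simp] theorem regs_4 : regs a b c d e f 4 = e := rfl
@[simp] theorem regs_5 : regs a b c d e f 5 = f := rfl
@[simp] theorem update_regs_0 : Function.update (regs a b c d e f) 0 x = regs x b c d e f := by
  funext i; fin_cases i <;> rfl
@[simp] theorem update_regs_1 : Function.update (regs a b c d e f) 1 x = regs a x c d e f := by
  funext i; fin_cases i <;> rfl
@[simp] theorem update_regs_2 : Function.update (regs a b c d e f) 2 x = regs a b x d e f := by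
  funext i; fin_cases i <;> rfl
@[simp] theorem update_regs_3 : Function.update (regs a b c d e f) 3 x = regs a b c x e f := by
  funext i; fin_cases i <;> rfl
@[simp] theorem update_regs_4 : Function.update (regs a b c d e f) 4 x = regs a b c d x f := by
  funext i; fin_cases i <;> rfl
@[simp] theorem update_regs_5 : Function.update (regs a b c d e f) 5 x = regs a b c d e x := by
  funext i; fin_cases i <;> rfl
end

theorem regs_input (x : List Sym) : Function.update (fun _ => []) 0 x = regs x [] [] [] [] [] := by
  funext i; fin_cases i <;> rfl

theorem regs_output (x : List Sym) : Function.update (fun _ => []) 1 x = regs [] x [] [] [] [] := by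
  funext i; fin_cases i <;> rfl

variable {ι : Type} {spec : ι → List Sym → List Sym → ℕ → Prop}

namespace Exec

theorem cast {P : Prog ι} {v S v₁ S₁ t₁ v₂ S₂ t₂} (h : Exec spec P v S v₁ S₁ t₁) (hv : v₁ = v₂)
    (hS : S₁ = S₂) (ht : t₁ ≤ t₂) : Exec spec P v S v₂ S₂ t₂ := by
  subst hv hS; exact h.mono ht

theorem seq' {P Q : Prog ι} {v S v' S' t v'' S'' t' u} (h : Exec spec P v S v' S' t)
    (h' : Exec spec Q v' S' v'' S'' t') (hu : t + t' ≤ u) :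
    Exec spec (.seq P Q) v S v'' S'' u := (h.seq h').mono hu

end Exec

/-- Move the contents of register `r` in reverse to `r'`. -/
def Prog.move (r r' : Reg) : Prog ι :=
  .seq (.pop r) (.loop Option.isSome (.seq (.push r' (·.getD none)) (.pop r)))

theorem Exec.move {r r' : Reg} (hr : r ≠ r') (v : Option Sym) (S : Reg → List Sym) :
    Exec spec (Prog.move r r') v S none
      (Function.update (Function.update S r []) r' ((S r).reverse ++ S r'))
      (3 * (S r).length + 2) := by
  -- Loop invariant: the head of the part still to be moved is in the variable, its tail in the
  -- register.
  suffices H : ∀ (l : List Sym) (S : Reg → List Sym), S r = l.tail →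
      Exec spec (.loop Option.isSome (.seq (.push r' (·.getD none)) (.pop r))) l.head? S none
      (Function.update (Function.update S r []) r' (l.reverse ++ S r')) (3 * l.length + 1) by
    refine (Exec.pop r v S).seq' ((H (S r) _ (by simp)).cast rfl ?_ le_rfl) (by omega)
    simp [hr.symm]
  intro l
  induction l with
  | nil =>
    intro S hS
    refine (Exec.loop_false rfl).cast rfl ?_ (by simp)
    simp only [List.tail_nil] at hS
    have e : Function.update S r [] = S := Function.update_eq_self_iff.2 hS.symm
    simp [e]
  | cons a l ih =>
    intro S hS
    simp only [List.tail_cons] at hS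
    refine (Exec.loop_true rfl (t := 2) ((Exec.push r' _ _ _).seq' (Exec.pop r _ _) le_rfl) ?_).mono
      (t := 2 + (3 * l.length + 1) + 1) (by simp; omega)
    have h := ih (Function.update (Function.update S r' (a :: S r')) r l.tail) (by simp)
    simp only [ne_eq, hr, not_false_eq_true, Function.update_of_ne, hS, List.head?_cons,
      Option.getD_some]
    refine h.cast rfl ?_ le_rfl
    funext i
    by_cases h1 : i = r'
    · subst h1; simp [hr.symm]
    · by_cases h2 : i = r
      · subst h2; simp [h1]
      · simp [h1, h2]

/-- Move the contents of register `r` in reverse to `r₁` and to `r₂`. -/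
def Prog.move₂ (r r₁ r₂ : Reg) : Prog ι :=
  .seq (.pop r) (.loop Option.isSome
    (.seq (.push r₁ (·.getD none)) (.seq (.push r₂ (·.getD none)) (.pop r))))

theorem Exec.move₂ (v : Option Sym) (x : List Sym) :
    Exec spec (Prog.move₂ 0 2 3) v (regs x [] [] [] [] []) none
      (regs [] [] x.reverse x.reverse [] []) (4 * x.length + 2) := by
  suffices H : ∀ l y : List Sym, Exec spec (.loop Option.isSome
      (.seq (.push 2 (·.getD none)) (.seq (.push 3 (·.getD none)) (.pop 0)))) l.head?
      (regs l.tail [] y y [] []) none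
      (regs [] [] (l.reverse ++ y) (l.reverse ++ y) [] []) (4 * l.length + 1) by
    exact (Exec.pop 0 v _).seq' (t' := 4 * x.length + 1) (by simpa using H x []) (by omega)
  intro l
  induction l with
  | nil => exact fun y => (Exec.loop_false rfl).mono (by simp)
  | cons a l ih =>
    intro y
    refine (Exec.loop_true rfl (t := 3) ((Exec.push 2 _ _ _).seq' ((Exec.push 3 _ _ _).seq'
      (Exec.pop 0 _ _) le_rfl) le_rfl) ?_).mono (t := 3 + (4 * l.length + 1) + 1) (by simp; omega)
    have h := ih (a :: y)
    simpa using h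

/-- Empty the register `r`. -/
def Prog.clear (r : Reg) : Prog ι :=
  .seq (.pop r) (.loop Option.isSome (.pop r))

theorem Exec.clear (r : Reg) (v : Option Sym) (S : Reg → List Sym) :
    Exec spec (Prog.clear r) v S none (Function.update S r []) (2 * (S r).length + 2) := by
  suffices H : ∀ (l : List Sym) (S : Reg → List Sym), S r = l.tail →
      Exec spec (.loop Option.isSome (.pop r)) l.head? S none
      (Function.update S r []) (2 * l.length + 1) by
    refine (Exec.pop r v S).seq' ((H (S r) _ (by simp)).cast rfl ?_ le_rfl) (by omega)
    simp
  intro l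
  induction l with
  | nil =>
    intro S hS
    refine (Exec.loop_false rfl).cast rfl ?_ (by simp)
    simp only [List.tail_nil] at hS
    rw [← hS]
    simp
  | cons a l ih =>
    intro S hS
    simp only [List.tail_cons] at hS
    refine (Exec.loop_true rfl (t := 1) (Exec.pop r _ _) ?_).mono
      (t := 1 + (2 * l.length + 1) + 1) (by simp; omega)
    have h := ih (Function.update S r l.tail) (by simp)
    rw [hS]
    exact h.cast rfl (by simp) le_rfl

/-- Push the list `l` on the register `r`. -/
def Prog.pushes (r : Reg) : List Sym → Prog ι
  | [] => .load id
  | a :: l => .seq (.push r (fun _ => a)) (Prog.pushes r l)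

theorem Exec.pushes (r : Reg) (l : List Sym) : ∀ (v : Option Sym) (S : Reg → List Sym),
    Exec spec (Prog.pushes r l) v S v (Function.update S r (l.reverse ++ S r)) (l.length + 1) := by
  induction l with
  | nil => exact fun v S => (Exec.load id v S).cast rfl (by simp) (by simp)
  | cons a l ih =>
    intro v S
    refine (Exec.push r _ v S).seq' ((ih v _).cast rfl ?_ le_rfl) (by simp; omega)
    simp

/-! ### Polynomial-time functions between types with a tape encoding -/

/-- The coefficients are natural numbers, so every monomial is monotone. -/
theorem eval_mono (P : Polynomial ℕ) {m n : ℕ} (h : m ≤ n) : P.eval m ≤ P.eval n := by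
  rw [Polynomial.eval_eq_sum, Polynomial.eval_eq_sum]
  exact Finset.sum_le_sum fun i _ => Nat.mul_le_mul_left _ (Nat.pow_le_pow_left h i)

/-- Polynomial-time computable functions whose values have polynomially bounded size. -/
def PolyFun {α β B : Type} (ea : α → List Sym) (eb : β → List B) (f : α → β) : Prop :=
  Nonempty (TM2ComputableInPolyTime ea eb f) ∧
    ∃ P : Polynomial ℕ, ∀ a, (eb (f a)).length ≤ P.eval (ea a).length

/-- The machine of a polynomial-time function, ready to be called. -/
theorem PolyFun.callee {α β B : Type} {ea : α → List Sym} {eb : β → List B} {f : α → β}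
    (toS : B → Sym) (h : PolyFun ea eb f) : ∃ (M : Callee) (T : Polynomial ℕ), ∀ a,
      M.Spec (ea a) ((eb (f a)).map toS) (T.eval (ea a).length) ∧
        (eb (f a)).length ≤ T.eval (ea a).length := by
  obtain ⟨⟨⟨⟨tm, i, o⟩, T, hT⟩⟩, Q, hQ⟩ := h
  refine ⟨⟨tm, i.symm, toS ∘ o⟩, T + Q, fun a => ⟨⟨_, ⟨⟨(hT a).toEvalsTo, ?_⟩⟩, ?_⟩, ?_⟩⟩
  · have := (hT a).steps_le_m
    simp only [Polynomial.eval_add]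
    omega
  · simp
  · have := hQ a
    simp only [Polynomial.eval_add]
    omega

/-- A polynomial-time function from a program. -/
theorem PolyFun.of_exec [DecidableEq ι] [Fintype ι] (M : ι → Callee) {α β B : Type}
    {ea : α → List Sym} {eb : β → List B} {f : α → β} (toB : Sym → B) (P : Prog ι)
    (T : Polynomial ℕ) (h : ∀ a, ∃ v y,
      Exec (fun i => (M i).Spec) P none (regs (ea a) [] [] [] [] []) v
        (regs [] y [] [] [] []) (T.eval (ea a).length) ∧
      (y.map toB).reverse = eb (f a) ∧ y.length ≤ T.eval (ea a).length) : PolyFun ea eb f := by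
  refine ⟨polyTime_of_exec M B toB P T fun a => ?_, T, fun a => ?_⟩
  · obtain ⟨v, y, h1, h2⟩ := h a
    exact ⟨v, y, by rwa [regs_input, regs_output], h2⟩
  · obtain ⟨v, y, h1, h2, h3⟩ := h a
    rw [← h2]
    simpa using h3

/-- A call leaves its output in reverse, which is the form in which the next call takes its input.
The maps `toS`, `toC` carry the final alphabet through the registers without loss. -/
theorem PolyFun.comp {α β γ C : Type} {ea : α → List Sym} {eb : β → List Sym} {ec : γ → List C}
    {f : α → β} {g : β → γ} (toS : C → Sym) (toC : Sym → C) (hC : ∀ c, toC (toS c) = c)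
    (hg : PolyFun eb ec g) (hf : PolyFun ea eb f) : PolyFun ea ec (g ∘ f) := by
  obtain ⟨M, T, hM⟩ := hf.callee id
  obtain ⟨N, U, hN⟩ := hg.callee toS
  refine PolyFun.of_exec (fun b : Bool => cond b M N) toC
    (.seq (.move 0 2) (.seq (.call true 2 3) (.call false 3 1)))
    (4 * .X + 4 * T + 4 * U.comp T + 10) fun a => ?_
  have h1 := hM a
  have h2 := hN (f a)
  have h3 := eval_mono U h1.2
  have h4 := Exec.move (spec := fun i => (cond i M N).Spec) (r := 0) (r' := 2) (by decide) none
    (regs (ea a) [] [] [] [] [])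
  have h5 := Exec.call (spec := fun i => (cond i M N).Spec) (i := true) (r := 2) (r' := 3) (v := none)
    (S := regs [] [] (ea a).reverse [] [] []) h1.1 (by simp) (by decide)
  have h6 := Exec.call (spec := fun i => (cond i M N).Spec) (i := false) (r := 3) (r' := 1) (v := none)
    (S := regs [] [] [] (eb (f a)).reverse [] []) h2.1 (by simp) (by decide)
  simp at h4 h5 h6 h1 h2 h3
  refine ⟨none, (((ec (g (f a)))).map toS).reverse, (h4.seq (h5.seq h6)).cast rfl rfl ?_, ?_, ?_⟩
  · have := h2.2
    simp
    omega
  · simp [Function.comp_def, hC]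
  · have := h2.2
    simp
    omega


/-! ### Trees -/

/-- Binary trees. -/
inductive Tree : Type
  | leaf : Tree
  | node : Tree → Tree → Tree

/-- Trees on a tape, in Polish notation. -/
def Tree.code : Tree → List Sym
  | leaf => [some false]
  | node a b => some true :: (a.code ++ b.code)

/-- Types whose elements are represented by trees. -/
class Rep (α : Type) where
  rep : α → Tree

/-- The tape encoding of an element. -/
def code {α : Type} [Rep α] (a : α) : List Sym := (Rep.rep a).code

instance : Rep Tree := ⟨id⟩
instance : Rep Unit := ⟨fun _ => .leaf⟩
instance : Rep Bool := ⟨fun b => if b then .node .leaf .leaf else .leaf⟩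
instance {α β : Type} [Rep α] [Rep β] : Rep (α × β) := ⟨fun a => .node (Rep.rep a.1) (Rep.rep a.2)⟩
instance {α : Type} [Rep α] : Rep (List α) :=
  ⟨List.foldr (fun a t => .node (Rep.rep a) t) .leaf⟩
instance : Rep ℕ := ⟨Nat.rec .leaf (fun _ t => .node .leaf t)⟩
instance {α : Type} [Rep α] : Rep (Option α) :=
  ⟨fun o => o.elim .leaf (fun a => .node .leaf (Rep.rep a))⟩
instance {α β : Type} [Rep α] [Rep β] : Rep (α ⊕ β) :=
  ⟨Sum.elim (fun a => .node .leaf (Rep.rep a)) (fun b => .node (.node .leaf .leaf) (Rep.rep b))⟩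
instance {α : Type} [Rep α] (p : α → Prop) : Rep (Subtype p) := ⟨fun a => Rep.rep a.1⟩

section code
variable {α β : Type} [Rep α] [Rep β]

theorem code_pair (a : α) (b : β) : code (a, b) = some true :: (code a ++ code b) := rfl
theorem code_nil : code ([] : List α) = [some false] := rfl
theorem code_cons (a : α) (l : List α) : code (a :: l) = some true :: (code a ++ code l) := rfl
theorem code_false : code false = [some false] := rfl
theorem code_true : code true = [some true, some false, some false] := rfl
theorem code_subtype {p : α → Prop} (a : Subtype p) : code a = code a.1 := rfl

theorem Tree.code_length_pos (t : Tree) : 0 < t.code.length := by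
  cases t <;> simp [Tree.code]

theorem code_length_pos (a : α) : 0 < (code a).length := Tree.code_length_pos _
end code

variable {ι : Type} {spec : ι → List Sym → List Sym → ℕ → Prop}

/-! ### Projections -/

/-- Read a tree on register `0`, with the help of the counter `2`, and copy it to `1` if `keep`. -/
def Prog.scan (keep : Bool) : Prog ι :=
  .loop Option.isSome (.seq (.pop 0)
    (.seq (if keep then .push 1 (·.getD none) else .load id)
      (.seq (.ite (· == some (some true)) (.push 2 (fun _ => none)) (.pop 2)) (.peek 2))))

theorem Exec.scan_step (keep : Bool) (b : Bool) (w : Sym) (v : Option Sym) (x y z : List Sym) :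
    Exec spec (.seq (.pop 0)
    (.seq (if keep then .push 1 (·.getD none) else .load id)
      (.seq (.ite (· == some (some true)) (.push 2 (fun _ => none)) (.pop 2)) (.peek 2))))
      v (regs (some b :: x) y (w :: z) [] [] [])
      (if b then none :: w :: z else z).head?
      (regs x (if keep then some b :: y else y) (if b then none :: w :: z else z) [] [] []) 5 := by
  have h1 := Exec.pop (spec := spec) 0 v (regs (some b :: x) y (w :: z) [] [] [])
  simp at h1
  have h2 : Exec spec (if keep then .push 1 (·.getD none) else .load id) (some (some b))
      (regs x y (w :: z) [] [] []) (some (some b))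
      (regs x (if keep then some b :: y else y) (w :: z) [] [] []) 1 := by
    cases keep
    · exact Exec.load _ _ _
    · exact (Exec.push 1 _ _ _).cast rfl (by simp) le_rfl
  have h3 : ∃ v', Exec spec (.ite (· == some (some true)) (.push 2 (fun _ => none)) (.pop 2))
      (some (some b))
      (regs x (if keep then some b :: y else y) (w :: z) [] [] []) v'
      (regs x (if keep then some b :: y else y) (if b then none :: w :: z else z) [] [] []) 2 := by
    cases b
    · exact ⟨_, Exec.ite_false rfl ((Exec.pop 2 _ _).cast rfl (by simp) le_rfl)⟩
    · exact ⟨_, Exec.ite_true rfl ((Exec.push 2 _ _ _).cast rfl (by simp) le_rfl)⟩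
  obtain ⟨v', h3⟩ := h3
  exact (h1.seq (h2.seq (h3.seq (Exec.peek 2 _ _)))).cast (by simp) rfl (by simp)

/-- Polish notation is self-delimiting: the counter in register `2` holds the number of trees still
to be read, a node adds one and a leaf removes one. Hence reading `t` removes exactly one unit `w`.
The statement takes the execution of the rest as a hypothesis, so that the two subtrees of a node
can be chained. -/
theorem Exec.scan_tree (keep : Bool) (t : Tree) : ∀ {v' S' T} (w : Sym) (x y z : List Sym),
    Exec spec (Prog.scan keep) z.head? (regs x (if keep then t.code.reverse ++ y else y) z [] [] [])
      v' S' T →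
    Exec spec (Prog.scan keep) (some w) (regs (t.code ++ x) y (w :: z) [] [] []) v' S'
      (T + 6 * t.code.length) := by
  induction t with
  | leaf =>
    intro v' S' T w x y z h
    refine (Exec.loop_true (t := 5) rfl (Exec.scan_step keep false w _ _ _ _) (h.cast rfl rfl le_rfl)).cast
      rfl rfl ?_ |>.cast rfl rfl le_rfl
    simp [Tree.code]; omega
  | node a b iha ihb =>
    intro v' S' T w x y z h
    have h2 := ihb w x (if keep then (some true :: a.code).reverse ++ y else y) z (by
      cases keep <;> simpa [Tree.code] using h)
    have h3 := iha none (b.code ++ x) (if keep then some true :: y else y) (w :: z) (by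
      cases keep <;> simpa using h2)
    have h4 := Exec.loop_true (c := Option.isSome) (t := 5) rfl
      (Exec.scan_step keep true w (some w) (a.code ++ (b.code ++ x)) y z) h3
    rw [show (Tree.node a b).code ++ x = some true :: (a.code ++ (b.code ++ x)) by simp [Tree.code]]
    refine h4.cast rfl rfl ?_
    simp [Tree.code]; omega

theorem PolyFun.fst {α β : Type} [Rep α] [Rep β] :
    PolyFun (code : α × β → _) code (Prod.fst : α × β → α) := by
  refine PolyFun.of_exec (ι := Empty) Empty.elim id (.seq (.pop 0) (.seq (.push 2 (fun _ => none))
    (.seq (.load (fun _ => some none)) (.seq (Prog.scan true) (Prog.clear 0)))))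
    (10 * .X + 10) fun a => ⟨none, (code a.1).reverse, ?_, by simp, ?_⟩
  · have h1 := Exec.pop (spec := fun i : Empty => (Empty.elim i : Callee).Spec) 0 none
      (regs (code a) [] [] [] [] [])
    have h2 := Exec.push (spec := fun i : Empty => (Empty.elim i : Callee).Spec) 2 (fun _ => none)
      (some (some true)) (regs (code a.1 ++ code a.2) [] [] [] [] [])
    have h3 := Exec.load (spec := fun i : Empty => (Empty.elim i : Callee).Spec)
      (fun _ => some none) (some (some true)) (regs (code a.1 ++ code a.2) [] [none] [] [] [])
    have h4 := Exec.scan_tree (spec := fun i : Empty => (Empty.elim i : Callee).Spec) true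
      (Rep.rep a.1) none (code a.2) [] [] (Exec.loop_false rfl)
    have h5 := Exec.clear (spec := fun i : Empty => (Empty.elim i : Callee).Spec) 0
      none (regs (code a.2) (code a.1).reverse [] [] [] [])
    obtain ⟨a, b⟩ := a
    simp [code_pair] at h1 h2 h3 h4 h5
    refine (h1.seq (h2.seq (h3.seq (h4.seq h5)))).cast rfl rfl ?_
    simp [code_pair]
    have : (Rep.rep a).code = code a := rfl
    rw [this]
    omega
  · obtain ⟨a, b⟩ := a
    simp [code_pair]
    omega

theorem PolyFun.snd {α β : Type} [Rep α] [Rep β] :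
    PolyFun (code : α × β → _) code (Prod.snd : α × β → β) := by
  refine PolyFun.of_exec (ι := Empty) Empty.elim id (.seq (.pop 0) (.seq (.push 2 (fun _ => none))
    (.seq (.load (fun _ => some none)) (.seq (Prog.scan false) (Prog.move 0 1)))))
    (10 * .X + 10) fun a => ⟨none, (code a.2).reverse, ?_, by simp, ?_⟩
  · have h1 := Exec.pop (spec := fun i : Empty => (Empty.elim i : Callee).Spec) 0 none
      (regs (code a) [] [] [] [] [])
    have h2 := Exec.push (spec := fun i : Empty => (Empty.elim i : Callee).Spec) 2 (fun _ => none)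
      (some (some true)) (regs (code a.1 ++ code a.2) [] [] [] [] [])
    have h3 := Exec.load (spec := fun i : Empty => (Empty.elim i : Callee).Spec)
      (fun _ => some none) (some (some true)) (regs (code a.1 ++ code a.2) [] [none] [] [] [])
    have h4 := Exec.scan_tree (spec := fun i : Empty => (Empty.elim i : Callee).Spec) false
      (Rep.rep a.1) none (code a.2) [] [] (Exec.loop_false rfl)
    have h5 := Exec.move (spec := fun i : Empty => (Empty.elim i : Callee).Spec) (r := 0) (r' := 1)
      (by decide) none (regs (code a.2) [] [] [] [] [])
    obtain ⟨a, b⟩ := a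
    simp [code_pair] at h1 h2 h3 h4 h5
    refine (h1.seq (h2.seq (h3.seq (h4.seq h5)))).cast rfl rfl ?_
    simp [code_pair]
    have : (Rep.rep a).code = code a := rfl
    rw [this]
    omega
  · obtain ⟨a, b⟩ := a
    simp [code_pair]
    omega

/-! ### Identity, constants, pairing, branching and loops -/

theorem PolyFun.id {α : Type} (ea : α → List Sym) : PolyFun ea ea (fun a => a) := by
  refine PolyFun.of_exec (ι := Empty) Empty.elim _root_.id (Prog.move 0 1)
    (3 * .X + 2) fun a => ⟨none, (ea a).reverse, ?_, by simp, ?_⟩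
  · refine (Exec.move (by decide) _ _).cast rfl (by simp) (by simp)
  · simp; omega

theorem PolyFun.const {α β : Type} (ea : α → List Sym) (eb : β → List Sym) (b : β) :
    PolyFun ea eb (fun _ => b) := by
  refine PolyFun.of_exec (ι := Empty) Empty.elim _root_.id
    (.seq (Prog.clear 0) (Prog.pushes 1 (eb b)))
    (2 * .X + ((eb b).length + 3 : ℕ)) fun a => ⟨none, (eb b).reverse, ?_, by simp, ?_⟩
  · refine ((Exec.clear 0 _ _).seq (Exec.pushes 1 _ _ _)).cast rfl (by simp) ?_
    simp; omega
  · simp; omega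

theorem PolyFun.pair {α β γ : Type} [Rep β] [Rep γ] {ea : α → List Sym} {f : α → β}
    {g : α → γ} (hf : PolyFun ea code f) (hg : PolyFun ea code g) :
    PolyFun ea code (fun a => (f a, g a)) := by
  obtain ⟨M, T, hM⟩ := hf.callee _root_.id
  obtain ⟨N, U, hN⟩ := hg.callee _root_.id
  refine PolyFun.of_exec (fun b : Bool => cond b M N) _root_.id
    (.seq (.move₂ 0 2 3) (.seq (.call true 2 4) (.seq (.call false 3 5) (.seq
      (.push 1 (fun _ => some true)) (.seq (.move 4 0) (.seq (.move 0 1) (.seq (.move 5 0)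
        (.move 0 1))))))))
    (10 * .X + 10 * T + 10 * U + 20) fun a => ?_
  have e1 := hM a
  have e2 := hN a
  have h1 := Exec.move₂ (spec := fun i => (cond i M N).Spec) none (ea a)
  have h2 := Exec.call (spec := fun i => (cond i M N).Spec) (i := true) (r := 2) (r' := 4)
    (v := none) (S := regs [] [] (ea a).reverse (ea a).reverse [] []) e1.1 (by simp) (by decide)
  have h3 := Exec.call (spec := fun i => (cond i M N).Spec) (i := false) (r := 3) (r' := 5)
    (v := none) (S := regs [] [] [] (ea a).reverse (code (f a)).reverse []) e2.1 (by simp)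
    (by decide)
  have h4 := Exec.push (spec := fun i => (cond i M N).Spec) 1 (fun _ => some true) none
    (regs [] [] [] [] (code (f a)).reverse (code (g a)).reverse)
  have h5 := Exec.move (spec := fun i => (cond i M N).Spec) (r := 4) (r' := 0) (by decide) none
    (regs [] [some true] [] [] (code (f a)).reverse (code (g a)).reverse)
  have h6 := Exec.move (spec := fun i => (cond i M N).Spec) (r := 0) (r' := 1) (by decide) none
    (regs (code (f a)) [some true] [] [] [] (code (g a)).reverse)
  have h7 := Exec.move (spec := fun i => (cond i M N).Spec) (r := 5) (r' := 0) (by decide) none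
    (regs [] ((code (f a)).reverse ++ [some true]) [] [] [] (code (g a)).reverse)
  have h8 := Exec.move (spec := fun i => (cond i M N).Spec) (r := 0) (r' := 1) (by decide) none
    (regs (code (g a)) ((code (f a)).reverse ++ [some true]) [] [] [] [])
  simp at h1 h2 h3 h4 h5 h6 h7 h8 e1 e2
  refine ⟨none, _, (h1.seq (h2.seq (h3.seq (h4.seq (h5.seq (h6.seq (h7.seq h8))))))).cast rfl rfl ?_,
    ?_, ?_⟩
  · have := e1.2
    have := e2.2
    simp
    omega
  · simp [code_pair]
  · have := e1.2
    have := e2.2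
    simp
    omega

/-- Each branch is a machine on a subtype, so it only has to be correct where its side of the
condition holds. The condition is read from the first symbols of the input, which are then removed
before the call. -/
theorem PolyFun.ite {α β : Type} {ea : α → List Sym} {eb : β → List Sym} {c : α → Bool} {f : α → β}
    (hf : PolyFun (fun a : {a // c a = true} => ea a.1) eb (fun a => f a.1))
    (hg : PolyFun (fun a : {a // c a = false} => ea a.1) eb (fun a => f a.1)) :
    PolyFun (fun a => some true :: (code (c a) ++ ea a)) eb f := by
  obtain ⟨M, T, hM⟩ := hf.callee _root_.id
  obtain ⟨N, U, hN⟩ := hg.callee _root_.id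
  refine PolyFun.of_exec (fun b : Bool => cond b M N) _root_.id
    (.seq (.pop 0) (.seq (.pop 0) (.ite (· == some (some true))
      (.seq (.pop 0) (.seq (.pop 0) (.seq (.move 0 2) (.call true 2 1))))
      (.seq (.move 0 2) (.call false 2 1)))))
    (10 * .X + 10 * T + 10 * U + 20) fun a => ?_
  have h5 := Exec.move (spec := fun i => (cond i M N).Spec) (r := 0) (r' := 2) (by decide)
    (some (some false)) (regs (ea a) [] [] [] [] [])
  have h1 (x : Sym) (l : List Sym) (v : Option Sym) : Exec (fun i => (cond i M N).Spec) (Prog.pop 0) v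
      (regs (x :: l) [] [] [] [] []) (some x) (regs l [] [] [] [] []) 1 :=
    (Exec.pop 0 _ _).cast rfl (by simp) le_rfl
  cases hc : c a
  · have e := hN ⟨a, hc⟩
    have h2 := Exec.call (spec := fun i => (cond i M N).Spec) (i := false) (r := 2) (r' := 1)
      (v := none) (S := regs [] [] (ea a).reverse [] [] []) e.1 (by simp) (by decide)
    simp at h5 h2 e
    have m := eval_mono U (show (ea a).length ≤ (ea a).length + 1 + 1 by omega)
    refine ⟨none, _, ((h1 _ _ _).seq ((h1 _ _ _).seq (Exec.ite_false rfl (h5.seq h2)))).cast rfl rfl ?_,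
      ?_, ?_⟩
    · have := e.2
      simp [code_false]
      omega
    · simp
    · have := e.2
      simp [code_false]
      omega
  · have e := hM ⟨a, hc⟩
    have h2 := Exec.call (spec := fun i => (cond i M N).Spec) (i := true) (r := 2) (r' := 1)
      (v := none) (S := regs [] [] (ea a).reverse [] [] []) e.1 (by simp) (by decide)
    simp at h5 h2 e
    have m := eval_mono T (show (ea a).length ≤ (ea a).length + 1 + 1 + 1 + 1 by omega)
    refine ⟨none, _, ((h1 _ _ _).seq ((h1 _ _ _).seq (Exec.ite_true rfl ((h1 _ _ _).seq
      ((h1 _ _ _).seq (h5.seq h2)))))).cast rfl rfl ?_, ?_, ?_⟩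
    · have := e.2
      simp [code_true]
      omega
    · simp
    · have := e.2
      simp [code_true]
      omega

/-- Iteration of a polynomial-time function as long as a condition, which is the second symbol of
the encoding, holds. -/
theorem PolyFun.loop {α σ : Type} {es : σ → List Sym} {c : σ → Bool}
    (hes : ∀ s, ∃ l, es s = some true :: some (c s) :: l) {step : σ → σ}
    (hstep : PolyFun (fun s : {s // c s = true} => es s.1) es (fun s => step s.1))
    (init fin : α → σ) (P : Polynomial ℕ)
    (h : ∀ a, ∃ k ≤ P.eval (es (init a)).length, (∀ i < k, c (step^[i] (init a)) = true) ∧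
      c (step^[k] (init a)) = false ∧ fin a = step^[k] (init a) ∧
      ∀ i ≤ k, (es (step^[i] (init a))).length ≤ P.eval (es (init a)).length) :
    PolyFun (fun a => es (init a)) es fin := by
  obtain ⟨M, T, hM⟩ := hstep.callee _root_.id
  set body : Prog Unit := .seq (.move 0 2) (.seq (.call () 2 3) (.seq (.move 3 0)
    (.seq (.pop 0) (.seq (.peek 0) (.push 0 (fun _ => some true)))))) with hbody
  -- The condition is the second symbol: the first one is removed, the second is copied to the
  -- variable, and the first, which is always `some true`, is put back.
  have hget (s : σ) (v : Option Sym) : Exec (fun _ => M.Spec)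
      (.seq (.pop 0) (.seq (.peek 0) (.push 0 (fun _ => some true))) : Prog Unit) v
      (regs (es s) [] [] [] [] []) (some (some (c s))) (regs (es s) [] [] [] [] []) 3 := by
    obtain ⟨l, hl⟩ := hes s
    refine ((Exec.pop 0 _ _).seq ((Exec.peek 0 _ _).seq (Exec.push 0 _ _ _))).cast ?_ ?_ le_rfl
    · simp [hl]
    · simp [hl]
  have hb (s : σ) (hs : c s = true) : Exec (fun _ => M.Spec) body (some (some (c s)))
      (regs (es s) [] [] [] [] []) (some (some (c (step s)))) (regs (es (step s)) [] [] [] [] [])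
      (4 * (es s).length + 5 * T.eval (es s).length + 20) := by
    have e := hM ⟨s, hs⟩
    have h1 := Exec.move (spec := fun _ : Unit => M.Spec) (r := 0) (r' := 2) (by decide)
      (some (some (c s))) (regs (es s) [] [] [] [] [])
    have h2 := Exec.call (spec := fun _ : Unit => M.Spec) (i := ()) (r := 2) (r' := 3)
      (v := none) (S := regs [] [] (es s).reverse [] [] []) e.1 (by simp) (by decide)
    have h3 := Exec.move (spec := fun _ : Unit => M.Spec) (r := 3) (r' := 0) (by decide)
      none (regs [] [] [] (es (step s)).reverse [] [])
    simp at h1 h2 h3 e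
    refine (h1.seq (h2.seq (h3.seq (hget _ _)))).cast rfl rfl ?_
    omega
  refine PolyFun.of_exec (fun _ : Unit => M) _root_.id
    (.seq (.seq (.pop 0) (.seq (.peek 0) (.push 0 (fun _ => some true))))
      (.seq (.loop (· == some (some true)) body) (.move 0 1)))
    (P * (4 * P + 5 * T.comp P + 21) + 3 * P + 10) fun a => ?_
  obtain ⟨k, hk, hc, hck, hfin, hsize⟩ := h a
  set N := P.eval (es (init a)).length with hN
  have hloop (j : ℕ) : ∀ i, i + j = k → Exec (fun _ => M.Spec) (.loop (· == some (some true)) body)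
      (some (some (c (step^[i] (init a))))) (regs (es (step^[i] (init a))) [] [] [] [] [])
      (some (some (c (fin a)))) (regs (es (fin a)) [] [] [] [] [])
      (j * (4 * N + 5 * T.eval N + 21) + 1) := by
    induction j with
    | zero =>
      intro i hi
      obtain rfl : i = k := by omega
      rw [hfin]
      exact (Exec.loop_false (by simp [hck])).mono (by simp)
    | succ j ih =>
      intro i hi
      have h1 := hb _ (hc i (by omega))
      have h2 := ih (i + 1) (by omega)
      rw [← Function.iterate_succ_apply' step] at h1
      have h3 := hsize i (by omega)
      have h4 := eval_mono T h3
      refine (Exec.loop_true (by simp [hc i (by omega)]) h1 h2).mono ?_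
      rw [add_mul]
      omega
  have h1 := hloop k 0 (by omega)
  have h2 := Exec.move (spec := fun _ : Unit => M.Spec) (r := 0) (r' := 1) (by decide)
    (some (some (c (fin a)))) (regs (es (fin a)) [] [] [] [] [])
  have h3 := hsize k le_rfl
  rw [← hfin] at h3
  simp only [Function.iterate_zero, _root_.id] at h1
  simp at h2
  refine ⟨none, _, ((hget (init a) none).seq (h1.seq h2)).cast rfl rfl ?_, by simp, ?_⟩
  · have h4 := Nat.mul_le_mul_right (4 * N + 5 * T.eval N + 21) hk
    simp only [Polynomial.eval_add, Polynomial.eval_mul, Polynomial.eval_ofNat,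
      Polynomial.eval_comp, ← hN]
    omega
  · simp only [Polynomial.eval_add, Polynomial.eval_mul, Polynomial.eval_ofNat,
      Polynomial.eval_comp, ← hN, List.length_reverse]
    omega


/-! ### Conversion between strings on a tape and lists of bits as trees -/

variable {ι : Type} {spec : ι → List Sym → List Sym → ℕ → Prop}

/-- The encoding of a list of bits as a tree, without the end of the list. -/
def bitsCode (x : List Bool) : List Sym := x.flatMap (fun b => some true :: code b)

theorem code_eq_bitsCode (x : List Bool) : code x = bitsCode x ++ [some false] := by
  induction x with
  | nil => rfl
  | cons b x ih => rw [code_cons, ih]; simp [bitsCode]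

theorem bitsCode_length (x : List Bool) :
    2 * x.length ≤ (bitsCode x).length ∧ (bitsCode x).length ≤ 4 * x.length := by
  induction x with
  | nil => simp [bitsCode]
  | cons b x ih => cases b <;> simp [bitsCode, code_false, code_true] at ih ⊢ <;> omega

/-- Whether the variable is a bit. -/
def isBit : Option Sym → Bool
  | some (some _) => true
  | _ => false

/-- Read a string from register `0`, whose first symbol is in the variable, and write it as a tree,
in reverse, on register `1`, without the end of the list. -/
def Prog.readStr : Prog ι :=
  .loop isBit (.seq (.push 1 (fun _ => some true)) (.seq
    (.ite (· == some (some true)) (.pushes 1 [some true, some false, some false])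
      (.pushes 1 [some false])) (.pop 0)))

/-- The end of the string is recognised by a symbol that is not a bit, or by the end of the tape;
what follows is left intact, with its first symbol in the variable. -/
theorem Exec.readStr (rest : List Sym) (hrest : isBit rest.head? = false) (x : List Bool) :
    ∀ y : List Sym, Exec spec Prog.readStr ((x.map some ++ rest).head?)
      (regs (x.map some ++ rest).tail y [] [] [] []) rest.head?
      (regs rest.tail ((bitsCode x).reverse ++ y) [] [] [] []) (10 * x.length + 1) := by
  induction x with
  | nil => exact fun y => (Exec.loop_false hrest).cast rfl (by simp [bitsCode]) (by simp)
  | cons b x ih =>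
    intro y
    have h1 := ih ((some true :: code b).reverse ++ y)
    have h2 := Exec.push (spec := spec) 1 (fun _ => some true) (some (some b))
      (regs (x.map some ++ rest) y [] [] [] [])
    have h3 : Exec spec (.ite (· == some (some true))
        (.pushes 1 [some true, some false, some false]) (.pushes 1 [some false]))
        (some (some b)) (regs (x.map some ++ rest) (some true :: y) [] [] [] []) (some (some b))
        (regs (x.map some ++ rest) ((some true :: code b).reverse ++ y) [] [] [] []) 5 := by
      cases b
      · exact (Exec.ite_false rfl (Exec.pushes 1 _ _ _)).cast rfl (by simp [code_false]) (by simp)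
      · exact (Exec.ite_true rfl (Exec.pushes 1 _ _ _)).cast rfl (by simp [code_true]) (by simp)
    have h4 := Exec.pop (spec := spec) 0 (some (some b))
      (regs (x.map some ++ rest) ((some true :: code b).reverse ++ y) [] [] [] [])
    simp only [update_regs_0, update_regs_1, regs_0, regs_1] at h2 h4
    refine (Exec.loop_true rfl (h2.seq (h3.seq h4)) h1).cast rfl ?_ ?_
    · simp [bitsCode]
    · simp; omega

/-- A string on a tape is turned into a tree. -/
theorem polyFun_readStr {α : Type} (f : α → List Bool) :
    PolyFun (fun a => (f a).map some) code f := by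
  refine PolyFun.of_exec (ι := Empty) Empty.elim id (.seq (.pop 0) (.seq .readStr
    (.push 1 (fun _ => some false)))) (10 * .X + 10) fun a => ⟨none, (code (f a)).reverse, ?_, ?_, ?_⟩
  · have h1 := Exec.pop (spec := fun i : Empty => (Empty.elim i : Callee).Spec) 0 none
      (regs ((f a).map some) [] [] [] [] [])
    have h2 := Exec.readStr (spec := fun i : Empty => (Empty.elim i : Callee).Spec) [] rfl (f a) []
    have h3 := Exec.push (spec := fun i : Empty => (Empty.elim i : Callee).Spec) 1
      (fun _ => some false) none (regs [] (bitsCode (f a)).reverse [] [] [] [])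
    simp only [update_regs_0, update_regs_1, regs_0, regs_1, List.append_nil, List.tail_nil,
      List.head?_nil] at h1 h2 h3
    refine (h1.seq (h2.seq h3)).cast rfl ?_ ?_
    · simp [code_eq_bitsCode]
    · simp; omega
  · simp
  · have := bitsCode_length (f a)
    simp [code_eq_bitsCode]; omega

/-- Read a tree that represents a string from register `0`, whose first symbol is in the variable,
and write the string, in reverse, on register `1`. -/
def Prog.writeStr : Prog ι :=
  .loop (· == some (some true)) (.seq (.pop 0) (.seq
    (.ite (· == some (some true)) (.seq (.push 1 (fun _ => some true)) (.seq (.pop 0) (.pop 0)))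
      (.push 1 (fun _ => some false))) (.pop 0)))

theorem Exec.writeStr (rest : List Sym) (x : List Bool) :
    ∀ y : List Sym, Exec spec Prog.writeStr ((code x ++ rest).head?)
      (regs (code x ++ rest).tail y [] [] [] []) (some (some false))
      (regs rest ((x.map some).reverse ++ y) [] [] [] []) (10 * x.length + 1) := by
  induction x with
  | nil => exact fun y => (Exec.loop_false rfl).cast rfl (by simp [code_nil]) (by simp)
  | cons b x ih =>
    intro y
    have h1 := ih (some b :: y)
    have h5 : Exec spec (.seq (.pop 0) (.seq
        (.ite (· == some (some true)) (.seq (.push 1 (fun _ => some true))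
          (.seq (.pop 0) (.pop 0))) (.push 1 (fun _ => some false))) (.pop 0)))
        (some (some true)) (regs (code b ++ (code x ++ rest)) y [] [] [] [])
        (code x ++ rest).head? (regs (code x ++ rest).tail (some b :: y) [] [] [] []) 7 := by
      rcases hb : b
      all_goals subst hb
      · exact ((Exec.pop 0 _ _).seq ((Exec.ite_false rfl (Exec.push 1 _ _ _)).seq
          (Exec.pop 0 _ _))).cast (by simp [code_false]) (by simp [code_false]) (by simp)
      · exact ((Exec.pop 0 _ _).seq ((Exec.ite_true rfl ((Exec.push 1 _ _ _).seq
          ((Exec.pop 0 _ _).seq (Exec.pop 0 _ _)))).seq (Exec.pop 0 _ _))).cast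
          (by simp [code_true]) (by simp [code_true]) (by simp)
    rw [show code (b :: x) ++ rest = some true :: (code b ++ (code x ++ rest)) by simp [code_cons]]
    refine (Exec.loop_true rfl h5 h1).cast rfl ?_ ?_
    · simp
    · simp; omega

/-- A tree that represents a string is turned into the string on a tape. -/
theorem polyFun_writeStr {α : Type} (f : α → List Bool) :
    PolyFun (fun a => code (f a)) id f := by
  refine PolyFun.of_exec (ι := Empty) Empty.elim (fun s => s.getD false)
    (.seq (.pop 0) .writeStr) (10 * .X + 10) fun a => ⟨some (some false),
      ((f a).map some).reverse, ?_, ?_, ?_⟩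
  · have h1 := Exec.pop (spec := fun i : Empty => (Empty.elim i : Callee).Spec) 0 none
      (regs (code (f a)) [] [] [] [] [])
    have h2 := Exec.writeStr (spec := fun i : Empty => (Empty.elim i : Callee).Spec) [] (f a) []
    simp only [update_regs_0, regs_0, List.append_nil] at h1 h2
    refine (h1.seq h2).cast rfl rfl ?_
    have := bitsCode_length (f a)
    simp [code_eq_bitsCode]; omega
  · simp [Function.comp_def]
  · have := bitsCode_length (f a)
    simp [code_eq_bitsCode]; omega

/-- Read a list of strings from register `0` and write it as a tree, in reverse, on register `1`,
without the end of the list. -/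
def Prog.readList : Prog ι :=
  .loop Option.isSome (.seq (.push 1 (fun _ => some true)) (.seq (.pop 0) (.seq .readStr (.seq
    (.push 1 (fun _ => some false)) (.peek 0)))))

theorem code_list_length (l : List (List Bool)) :
    (code l).length ≤ 5 * (encList l).length + 1 ∧ (encList l).length ≤ (code l).length := by
  induction l with
  | nil => simp [code_nil, encList]
  | cons x l ih =>
    have := bitsCode_length x
    simp [code_cons, code_eq_bitsCode, encList] at ih ⊢
    omega

theorem encList_cons (x : List Bool) (l : List (List Bool)) :
    encList (x :: l) = x.map some ++ none :: encList l := by simp [encList]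

/-- The closing symbol `some false` of the list is written only after the loop, hence the `tail` of
the reversed code. -/
theorem Exec.readList (l : List (List Bool)) :
    ∀ y : List Sym, Exec spec Prog.readList (encList l).head?
      (regs (encList l) y [] [] [] []) none
      (regs [] ((code l).reverse.tail ++ y) [] [] [] []) (20 * (encList l).length + 1) := by
  induction l with
  | nil => exact fun y => (Exec.loop_false rfl).cast rfl (by simp [code_nil, encList]) (by simp)
  | cons x l ih =>
    intro y
    have h1 := ih (some false :: ((bitsCode x).reverse ++ some true :: y))
    have h0 (v : Option Sym) : Exec spec (.push 1 (fun _ => some true)) v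
      (regs (encList (x :: l)) y [] [] [] []) v
      (regs (encList (x :: l)) (some true :: y) [] [] [] []) 1 :=
      (Exec.push 1 _ _ _).cast rfl (by simp) le_rfl
    have h2 (v : Option Sym) := Exec.pop (spec := spec) 0 v
      (regs (encList (x :: l)) (some true :: y) [] [] [] [])
    have h3 := Exec.readStr (spec := spec) (none :: encList l) rfl x (some true :: y)
    have h4 := Exec.push (spec := spec) 1 (fun _ => some false) (some none)
      (regs (encList l) ((bitsCode x).reverse ++ some true :: y) [] [] [] [])
    have h5 := Exec.peek (spec := spec) 0 (some none)
      (regs (encList l) (some false :: ((bitsCode x).reverse ++ some true :: y)) [] [] [] [])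
    simp only [update_regs_0, update_regs_1, regs_0, regs_1] at h2 h4
    simp only [← encList_cons] at h3
    refine (Exec.loop_true ?_ ((h0 _).seq ((h2 _).seq (h3.seq (h4.seq h5)))) h1).cast rfl ?_ ?_
    · cases x <;> simp [encList_cons]
    · have : (code l).reverse ≠ [] := by simpa using List.ne_nil_of_length_pos (code_length_pos l)
      obtain ⟨a, z, hz⟩ := List.exists_cons_of_ne_nil this
      simp [code_cons, hz, code_eq_bitsCode x]
    · simp [encList_cons]; omega

theorem code_list_reverse (l : List (List Bool)) :
    (code l).reverse = some false :: (code l).reverse.tail := by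
  induction l with
  | nil => rfl
  | cons x l ih => rw [code_cons, List.reverse_cons, List.reverse_append, ih]; simp

/-- A list of strings on a tape is turned into a tree. -/
theorem polyFun_readList {α : Type} (f : α → List (List Bool)) :
    PolyFun (fun a => encList (f a)) code f := by
  refine PolyFun.of_exec (ι := Empty) Empty.elim id (.seq (.peek 0) (.seq .readList
    (.push 1 (fun _ => some false)))) (20 * .X + 10) fun a => ⟨none, (code (f a)).reverse, ?_, ?_, ?_⟩
  · have h1 := Exec.peek (spec := fun i : Empty => (Empty.elim i : Callee).Spec) 0 none
      (regs (encList (f a)) [] [] [] [] [])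
    have h2 := Exec.readList (spec := fun i : Empty => (Empty.elim i : Callee).Spec) (f a) []
    have h3 := Exec.push (spec := fun i : Empty => (Empty.elim i : Callee).Spec) 1
      (fun _ => some false) none (regs [] (code (f a)).reverse.tail [] [] [] [])
    simp only [update_regs_1, regs_0, regs_1, List.append_nil] at h1 h2 h3
    refine (h1.seq (h2.seq h3)).cast rfl ?_ ?_
    · rw [← code_list_reverse]
    · simp; omega
  · simp
  · have := code_list_length (f a)
    simp; omega

/-- Read a tree that represents a list of strings from register `0` and write the strings, in
reverse, on register `1`. -/
def Prog.writeList : Prog ι :=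
  .loop (· == some (some true)) (.seq (.pop 0) (.seq .writeStr (.seq
    (.push 1 (fun _ => none)) (.pop 0))))

theorem Exec.writeList (l : List (List Bool)) :
    ∀ y : List Sym, Exec spec Prog.writeList (code l).head?
      (regs (code l).tail y [] [] [] []) (some (some false))
      (regs [] ((encList l).reverse ++ y) [] [] [] []) (20 * (encList l).length + 1) := by
  induction l with
  | nil => exact fun y => (Exec.loop_false rfl).cast rfl (by simp [code_nil, encList]) (by simp)
  | cons x l ih =>
    intro y
    have h1 := ih (none :: (x.map some).reverse ++ y)
    have h2 (v : Option Sym) := Exec.pop (spec := spec) 0 v (regs (code x ++ code l) y [] [] [] [])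
    have h3 := Exec.writeStr (spec := spec) (code l) x y
    have h4 := Exec.push (spec := spec) 1 (fun _ => none) (some (some false))
      (regs (code l) ((x.map some).reverse ++ y) [] [] [] [])
    have h5 := Exec.pop (spec := spec) 0 (some (some false))
      (regs (code l) (none :: (x.map some).reverse ++ y) [] [] [] [])
    simp only [update_regs_0, update_regs_1, regs_0, regs_1] at h2 h4 h5
    rw [code_cons]
    refine (Exec.loop_true rfl ((h2 _).seq (h3.seq (h4.seq h5))) h1).cast rfl ?_ ?_
    · simp [encList_cons]
    · simp [encList_cons]; omega

/-- A tree that represents a list of strings is turned into a list of strings on a tape. -/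
theorem polyFun_writeList {α : Type} (f : α → List (List Bool)) :
    PolyFun (fun a => code (f a)) encList f := by
  refine PolyFun.of_exec (ι := Empty) Empty.elim id
    (.seq (.pop 0) .writeList) (20 * .X + 10) fun a => ⟨some (some false),
      (encList (f a)).reverse, ?_, ?_, ?_⟩
  · have h1 := Exec.pop (spec := fun i : Empty => (Empty.elim i : Callee).Spec) 0 none
      (regs (code (f a)) [] [] [] [] [])
    have h2 := Exec.writeList (spec := fun i : Empty => (Empty.elim i : Callee).Spec) (f a) []
    simp only [update_regs_0, regs_0, List.append_nil] at h1 h2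
    refine (h1.seq h2).cast rfl rfl ?_
    have := code_list_length (f a)
    simp; omega
  · simp
  · have := code_list_length (f a)
    simp; omega


/-! ### A calculus of polynomial-time functions -/

/-- Polynomial-time functions between types represented by trees. -/
def PT {α β : Type} [Rep α] [Rep β] (f : α → β) : Prop :=
  PolyFun (code : α → _) (code : β → _) f

theorem PolyFun.precomp {α β γ B : Type} {ea : α → List Sym} {eb : β → List B} {f : α → β}
    (h : PolyFun ea eb f) (i : γ → α) : PolyFun (fun c => ea (i c)) eb (fun c => f (i c)) := by
  obtain ⟨⟨⟨M, T, hT⟩⟩, P, hP⟩ := h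
  exact ⟨⟨⟨M, T, fun c => hT (i c)⟩⟩, P, fun c => hP (i c)⟩

theorem PolyFun.congr {α β β' B : Type} {ea ea' : α → List Sym} {eb : β → List B}
    {eb' : β' → List B} {f : α → β} {f' : α → β'} (h : PolyFun ea eb f)
    (h1 : ∀ a, ea' a = ea a) (h2 : ∀ a, eb' (f' a) = eb (f a)) : PolyFun ea' eb' f' := by
  obtain rfl : ea' = ea := funext h1
  obtain ⟨⟨⟨M, T, hT⟩⟩, P, hP⟩ := h
  exact ⟨⟨⟨M, T, fun c => by rw [h2]; exact hT c⟩⟩, P, fun c => by rw [h2]; exact hP c⟩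

namespace PT

variable {α β γ δ ε : Type} [Rep α] [Rep β] [Rep γ] [Rep δ] [Rep ε]

theorem id : PT (fun a : α => a) := PolyFun.id _

theorem const (b : β) : PT (fun _ : α => b) := PolyFun.const _ _ b

theorem comp {g : β → γ} {f : α → β} (hg : PT g) (hf : PT f) : PT (fun a => g (f a)) :=
  PolyFun.comp _root_.id _root_.id (fun _ => rfl) hg hf

/-- Only the code of the values matters. Thus a change of representation is free: an option, a sum
or a successor has the same code as a suitable pair. -/
theorem recode {f : α → β} {f' : α → γ} (h : PT f) (e : ∀ a, code (f' a) = code (f a)) : PT f' :=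
  PolyFun.congr h (fun _ => rfl) e

theorem congr {f f' : α → β} (h : PT f) (e : ∀ a, f' a = f a) : PT f' :=
  h.recode fun a => by rw [e]

theorem precomp {f : α → β} (h : PT f) {i : γ → α} (hi : ∀ c, code (i c) = code c) :
    PT (fun c => f (i c)) :=
  PolyFun.congr (PolyFun.precomp h i) (fun c => (hi c).symm) (fun _ => rfl)

theorem restrict {f : α → β} (h : PT f) (p : α → Prop) : PT (fun a : Subtype p => f a.1) :=
  h.precomp fun _ => rfl

theorem val {p : α → Prop} : PT (fun a : Subtype p => a.1) := PT.id.restrict p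

theorem sub {f : α → β} (h : PT f) {p : β → Prop} (hp : ∀ a, p (f a)) :
    PT (fun a => (⟨f a, hp a⟩ : Subtype p)) :=
  h.recode fun _ => rfl

/-- Partial functions are treated as functions on subtypes, whose elements have the code of the
underlying element. A machine then has to be correct only on the inputs that occur. -/
theorem comp_sub {p : β → Prop} {g : β → γ} {f : α → β} (hg : PT (fun b : Subtype p => g b.1))
    (hf : PT f) (hp : ∀ a, p (f a)) : PT (fun a => g (f a)) :=
  hg.comp (hf.sub hp)

theorem pair {f : α → β} {g : α → γ} (hf : PT f) (hg : PT g) : PT (fun a => (f a, g a)) :=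
  PolyFun.pair hf hg

theorem fst' : PT (Prod.fst : α × β → α) := PolyFun.fst

theorem snd' : PT (Prod.snd : α × β → β) := PolyFun.snd

theorem fst {f : α → β × γ} (hf : PT f) : PT (fun a => (f a).1) := fst'.comp hf

theorem snd {f : α → β × γ} (hf : PT f) : PT (fun a => (f a).2) := snd'.comp hf

theorem size {f : α → β} (h : PT f) :
    ∃ P : Polynomial ℕ, ∀ a, (code (f a)).length ≤ P.eval (code a).length := h.2

/-! #### Booleans and case distinctions -/

theorem ite {c : α → Bool} {f g : α → β} (hc : PT c)
    (hf : PT (fun a : {a // c a = true} => f a.1)) (hg : PT (fun a : {a // c a = false} => g a.1)) :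
    PT (fun a => if c a then f a else g a) := by
  have h1 : PT (fun a => (c a, a)) := hc.pair PT.id
  have h2 : PolyFun (fun a => some true :: (code (c a) ++ code a)) code
      (fun a => if c a then f a else g a) := by
    refine PolyFun.ite (hf.congr fun a => ?_) (hg.congr fun a => ?_)
    · simp [a.2]
    · simp [a.2]
  obtain ⟨⟨M1⟩, -⟩ := h1
  exact PolyFun.comp (f := fun a => a) (ea := code) _root_.id _root_.id (fun _ => rfl) h2
    (PolyFun.congr (f := fun a => (c a, a)) (eb := code) (hc.pair PT.id) (fun _ => rfl)
      (fun _ => rfl))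

theorem cases_bool {c : α → Bool} {f g h : α → β} (hc : PT c)
    (hf : PT (fun a : {a // c a = true} => f a.1)) (hg : PT (fun a : {a // c a = false} => g a.1))
    (h1 : ∀ a, c a = true → h a = f a) (h2 : ∀ a, c a = false → h a = g a) : PT h :=
  (hc.ite hf hg).congr fun a => by cases e : c a <;> simp [e, h1, h2]

/-- Whether a tree is a node. -/
def isNode : Tree → Bool
  | .leaf => false
  | .node _ _ => true

theorem node : PT isNode := by
  refine PolyFun.of_exec (ι := Empty) Empty.elim _root_.id (.seq (.pop 0)
    (.seq (.ite (· == some (some true)) (.pushes 1 (code true)) (.pushes 1 (code false)))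
      (Prog.clear 0)))
    (2 * .X + 10) fun a => ⟨none, (code (isNode a)).reverse, ?_, by simp, ?_⟩
  · cases a
    · refine ((Exec.pop 0 _ _).seq ((Exec.ite_false rfl (Exec.pushes 1 _ _ _)).seq
        (Exec.clear 0 _ _))).cast rfl ?_ ?_
      · simp [code, Rep.rep, Tree.code, isNode]
      · simp [code, Rep.rep, Tree.code]
    · refine ((Exec.pop 0 _ _).seq ((Exec.ite_true rfl (Exec.pushes 1 _ _ _)).seq
        (Exec.clear 0 _ _))).cast rfl ?_ ?_
      · simp [code, Rep.rep, Tree.code, isNode]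
      · simp [code, Rep.rep, Tree.code]; omega
  · cases a <;> simp [code, Rep.rep, Tree.code, isNode]

theorem rep {f : α → β} (hf : PT f) : PT (fun a => Rep.rep (f a)) := hf.recode fun _ => rfl

theorem not {f : α → Bool} (hf : PT f) : PT (fun a => !f a) :=
  cases_bool hf (f := fun _ => false) (g := fun _ => true) (const _) (const _) (by simp) (by simp)

theorem and {f g : α → Bool} (hf : PT f) (hg : PT g) : PT (fun a => f a && g a) :=
  cases_bool hf (g := fun _ => false) (hg.restrict _) (const false) (by simp_all) (by simp_all)

/-! #### Options and sums -/

theorem some {f : α → β} (hf : PT f) : PT (fun a => Option.some (f a)) :=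
  ((const ()).pair hf).recode fun _ => rfl

theorem isSome {f : α → Option β} (hf : PT f) : PT (fun a => (f a).isSome) :=
  (node.comp hf.rep).congr fun a => by cases h : f a <;> rfl

theorem get {f : α → Option β} (hf : PT f) (h : ∀ a, (f a).isSome) : PT (fun a => (f a).get (h a)) :=
  ((hf.recode (f' := fun a => ((), (f a).get (h a))) fun a => by
    obtain ⟨b, hb⟩ := Option.isSome_iff_exists.1 (h a)
    simp only [hb, Option.get_some]
    rfl)).snd

/-- The branch for a present value is only required on the graph of `o`, so it may use where the
value comes from. The cases for sums and lists have the same form. -/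
theorem cases_option {o : α → Option β} {f h : α → γ} {g : α → β → γ} (ho : PT o)
    (hf : PT (fun a : {a // o a = none} => f a.1))
    (hg : PT (fun x : {x : α × β // o x.1 = Option.some x.2} => g x.1.1 x.1.2))
    (h1 : ∀ a, o a = none → h a = f a) (h2 : ∀ a b, o a = Option.some b → h a = g a b) : PT h := by
  have hget : PT (fun a : {a // (o a).isSome = true} => (o a.1).get a.2) :=
    get (ho.restrict _) fun a => a.2
  have hg' : PT (fun a : {a // (o a).isSome = true} => g a.1 ((o a.1).get a.2)) :=
    hg.comp ((val.pair hget).sub (p := fun x : α × β => o x.1 = Option.some x.2) (by simp))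
  have hg'' : PT (fun a : {a // (o a).isSome = true} => h a.1) :=
    hg'.congr fun a => h2 _ _ (by simp)
  have hf' : PT (fun a : {a // (o a).isSome = false} => h a.1) :=
    (hf.precomp (i := fun a : {a // (o a).isSome = false} => ⟨a.1, by simpa using a.2⟩)
      fun _ => rfl).congr fun a => h1 _ (by simpa using a.2)
  exact ho.isSome.cases_bool hg'' hf' (fun _ _ => rfl) (fun _ _ => rfl)

theorem option_getD {f : α → Option β} {g : α → β} (hf : PT f) (hg : PT g) :
    PT (fun a => (f a).getD (g a)) :=
  cases_option hf (hg.restrict _) (g := fun _ b => b) ((snd' : PT (Prod.snd : α × β → β)).restrict _)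
    (fun a h => by simp [h]) (fun a b h => by simp [h])

theorem inl {f : α → β} (hf : PT f) : PT (fun a => (Sum.inl (f a) : β ⊕ γ)) :=
  ((const ()).pair hf).recode fun _ => rfl

theorem inr {f : α → γ} (hf : PT f) : PT (fun a => (Sum.inr (f a) : β ⊕ γ)) :=
  ((const true).pair hf).recode fun _ => rfl

theorem cases_sum {o : α → β ⊕ γ} {h : α → δ} {f : α → β → δ} {g : α → γ → δ} (ho : PT o)
    (hf : PT (fun x : {x : α × β // o x.1 = Sum.inl x.2} => f x.1.1 x.1.2))
    (hg : PT (fun x : {x : α × γ // o x.1 = Sum.inr x.2} => g x.1.1 x.1.2))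
    (h1 : ∀ a b, o a = Sum.inl b → h a = f a b) (h2 : ∀ a b, o a = Sum.inr b → h a = g a b) :
    PT h := by
  have hc : PT (fun a => (o a).isRight) := by
    have e : PT (fun a => ((o a).isRight, Sum.elim Rep.rep Rep.rep (o a))) := ho.recode fun a => by
      cases o a <;> rfl
    exact e.fst
  have hl : PT (fun a : {a // (o a).isRight = false} => (o a.1).getLeft (by simpa using a.2)) :=
    ((ho.restrict _).recode (f' := fun a : {a // (o a).isRight = false} =>
      ((), (o a.1).getLeft (by simpa using a.2))) fun a => by
      obtain ⟨b, hb⟩ := Sum.isLeft_iff.1 (show (o a.1).isLeft = true by simpa using a.2)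
      simp only [hb, Sum.getLeft_inl]
      rfl).snd
  have hr : PT (fun a : {a // (o a).isRight = true} => (o a.1).getRight a.2) :=
    ((ho.restrict _).recode (f' := fun a : {a // (o a).isRight = true} =>
      (true, (o a.1).getRight a.2)) fun a => by
      obtain ⟨b, hb⟩ := Sum.isRight_iff.1 a.2
      simp only [hb, Sum.getRight_inr]
      rfl).snd
  refine hc.cases_bool (f := h) (g := h) ?_ ?_ (fun _ _ => rfl) (fun _ _ => rfl)
  · exact (hg.comp ((val.pair hr).sub (p := fun x : α × γ => o x.1 = Sum.inr x.2)
      (by simp))).congr fun a => h2 _ _ (by simp)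
  · exact (hf.comp ((val.pair hl).sub (p := fun x : α × β => o x.1 = Sum.inl x.2)
      (by simp))).congr fun a => h1 _ _ (by simp)

/-! #### Lists -/

theorem cons {f : α → β} {g : α → List β} (hf : PT f) (hg : PT g) : PT (fun a => f a :: g a) :=
  (hf.pair hg).recode fun _ => rfl

theorem isCons {f : α → List β} (hf : PT f) : PT (fun a => !(f a).isEmpty) :=
  (node.comp hf.rep).congr fun a => by cases f a <;> rfl

theorem cases_list {l : α → List β} {f h : α → γ} {g : α → β → List β → γ} (hl : PT l)
    (hf : PT (fun a : {a // l a = []} => f a.1))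
    (hg : PT (fun x : {x : α × β × List β // l x.1 = x.2.1 :: x.2.2} => g x.1.1 x.1.2.1 x.1.2.2))
    (h1 : ∀ a, l a = [] → h a = f a) (h2 : ∀ a b t, l a = b :: t → h a = g a b t) : PT h := by
  have key (a : {a // (!(l a).isEmpty) = true}) : ∃ b t, l a.1 = b :: t := by
    have := a.2
    cases h : l a.1
    · simp [h] at this
    · exact ⟨_, _, rfl⟩
  choose b t hbt using key
  have hget : PT (fun a => (b a, t a)) :=
    (hl.restrict _).recode fun a => by rw [hbt a]; rfl
  have hg' : PT (fun a : {a // (!(l a).isEmpty) = true} => h a.1) :=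
    (hg.comp ((val.pair hget).sub (p := fun x : α × β × List β => l x.1 = x.2.1 :: x.2.2)
      hbt)).congr fun a => h2 _ _ _ (hbt a)
  have hf' : PT (fun a : {a // (!(l a).isEmpty) = false} => h a.1) :=
    (hf.precomp (i := fun a : {a // (!(l a).isEmpty) = false} => ⟨a.1, by simpa using a.2⟩)
      fun _ => rfl).congr fun a => h1 _ (by simpa using a.2)
  exact hl.isCons.cases_bool hg' hf' (fun _ _ => rfl) (fun _ _ => rfl)

theorem head? {l : α → List β} (hl : PT l) : PT (fun a => (l a).head?) :=
  hl.cases_list (f := fun _ => none) (const _) (g := fun _ b _ => Option.some b)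
    (val.snd.fst.some) (fun a h => by simp [h]) (fun a b t h => by simp [h])

theorem tail {l : α → List β} (hl : PT l) : PT (fun a => (l a).tail) :=
  hl.cases_list (f := fun _ => []) (const _) (g := fun _ _ t => t)
    (val.snd.snd) (fun a h => by simp [h]) (fun a b t h => by simp [h])

/-- The fold is a loop on triples of the remaining list, the parameter and the accumulator; the
second symbol of such a code tells whether the remaining list is non-empty. The invariant `Good` is
stored in the state, so `g` has to be polynomial time only on accumulators that are reached. The
bound on all partial folds cannot be dropped: iterating a polynomial-time function may let sizes
grow exponentially. -/
theorem foldl {l : α → List γ} {x : α → β} {g : α → β → γ → β} (hl : PT l) (hx : PT x)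
    (hg : PT (fun s : {s : α × β × γ // ∃ t, t ++ [s.2.2] <+: l s.1 ∧
      s.2.1 = t.foldl (g s.1) (x s.1)} => g s.1.1 s.1.2.1 s.1.2.2))
    (P : Polynomial ℕ)
    (hsize : ∀ a t, t <+: l a → (code (t.foldl (g a) (x a))).length ≤ P.eval (code a).length) :
    PT (fun a => (l a).foldl (g a) (x a)) := by
  let Good (s : List γ × α × β) : Prop := ∃ t, t ++ s.1 = l s.2.1 ∧ s.2.2 = t.foldl (g s.2.1) (x s.2.1)
  let σ := {s : List γ × α × β // Good s}
  let step (s : σ) : σ := match s with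
    | ⟨([], y), h⟩ => ⟨([], y), h⟩
    | ⟨(c :: r, a, b), h⟩ => ⟨(r, a, g a b c), by
        obtain ⟨t, h1, h2⟩ := h
        exact ⟨t ++ [c], by simpa using h1, by simp only at h2; simp [h2]⟩⟩
  let c (s : σ) : Bool := !s.1.1.isEmpty
  let init (a : α) : σ := ⟨(l a, a, x a), [], rfl, rfl⟩
  have hstep : PolyFun (fun s : {s : σ // c s = true} => code s.1) code (fun s => step s.1) := by
    have key (s : {s : σ // c s = true}) : ∃ b t, s.1.1.1 = b :: t := by
      have := s.2
      simp only [c] at this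
      cases h : s.1.1.1
      · simp [h] at this
      · exact ⟨_, _, rfl⟩
    choose b t hbt using key
    have hv : PT (fun s : {s : σ // c s = true} => s.1.1) := val.restrict _
    have hget : PT (fun s => (b s, t s)) := hv.fst.recode fun s => by rw [hbt s]; rfl
    have h1 : PT (fun s : {s : σ // c s = true} => g s.1.1.2.1 s.1.1.2.2 (b s)) :=
      hg.comp ((hv.snd.fst.pair (hv.snd.snd.pair hget.fst)).sub (fun s => by
        obtain ⟨u, h1, h2⟩ := s.1.2
        refine ⟨u, ⟨t s, ?_⟩, h2⟩
        simp only [← h1, hbt]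
        simp))
    have h2 : PT (fun s : {s : σ // c s = true} => (t s, s.1.1.2.1, g s.1.1.2.1 s.1.1.2.2 (b s))) :=
      hget.snd.pair (hv.snd.fst.pair h1)
    refine PolyFun.congr h2 (fun _ => rfl) fun s => ?_
    have aux : ∀ (r : List γ) (d : γ) (u : List γ) (a : α) (y : β) (h : Good (r, a, y)),
        r = d :: u → (step ⟨(r, a, y), h⟩).1 = (u, a, g a y d) := by
      rintro _ d u a y h rfl
      rfl
    exact congrArg code (aux _ _ _ _ _ s.1.2 (hbt s))
  have hiter (a : α) : ∀ k ≤ (l a).length,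
      (step^[k] (init a)).1 = ((l a).drop k, a, ((l a).take k).foldl (g a) (x a)) := by
    intro k
    induction k with
    | zero => intro _; simp [init]
    | succ k ih =>
      intro hk
      have := ih (by omega)
      rw [Function.iterate_succ_apply']
      generalize step^[k] (init a) = s at this
      obtain ⟨s, h⟩ := s
      simp only at this
      subst this
      have e : (l a).drop k = (l a)[k] :: (l a).drop (k + 1) := List.drop_eq_getElem_cons (by omega)
      have e' : (l a).take (k + 1) = (l a).take k ++ [(l a)[k]] := by
        rw [List.take_succ_eq_append_getElem]
      have : ∀ (r : List γ) (h : Good (r, a, ((l a).take k).foldl (g a) (x a))),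
          r = (l a)[k] :: (l a).drop (k + 1) → (step ⟨(r, a, ((l a).take k).foldl (g a) (x a)), h⟩).1 =
          ((l a).drop (k + 1), a, ((l a).take (k + 1)).foldl (g a) (x a)) := by
        rintro r h rfl
        rw [e', List.foldl_append]
        rfl
      exact this _ _ e
  have hinit : PT (fun a => (init a)) := (hl.pair (PT.id.pair hx)).recode fun _ => rfl
  have hlen (l : List γ) : l.length ≤ (code l).length := by
    induction l with
    | nil => simp
    | cons a l ih => simp [code_cons]; omega
  have hdrop (l : List γ) : ∀ k, (code (l.drop k)).length ≤ (code l).length := by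
    induction l with
    | nil => simp
    | cons a l ih =>
      intro k
      cases k with
      | zero => simp
      | succ k => have := ih k; simp [code_cons]; omega
  have hloop : PolyFun (fun a => code (init a)) code (fun a => step^[(l a).length] (init a)) := by
    refine PolyFun.loop (c := c) (fun s => ?_) hstep init _ (2 * .X + P + 2) fun a => ?_
    · obtain ⟨⟨l', a, b⟩, h⟩ := s
      cases l' with
      | nil => exact ⟨_, rfl⟩
      | cons d l' => exact ⟨_, rfl⟩
    · have e0 : (code (init a)).length = (code (l a)).length + (code a).length +
          (code (x a)).length + 2 := by
        change (code (l a, a, x a)).length = _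
        simp [code_pair]; omega
      have e1 := eval_mono P (show (code a).length ≤ (code (init a)).length by omega)
      have e2 := hlen (l a)
      refine ⟨(l a).length, ?_, ?_, ?_, rfl, ?_⟩
      · simp; omega
      · intro i hi
        simp only [c, hiter a i hi.le]
        simpa using hi
      · simp [c, hiter a _ le_rfl]
      · intro i hi
        have : code (step^[i] (init a)) = code (step^[i] (init a)).1 := rfl
        rw [this, hiter a i hi]
        have e3 := hsize a _ (List.take_prefix i (l a))
        have e4 := hdrop (l a) i
        simp [code_pair]
        omega
  have hfin : PT (fun a => step^[(l a).length] (init a)) :=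
    PolyFun.comp (f := fun a => a) (eb := fun a => code (init a)) _root_.id _root_.id
      (fun _ => rfl) hloop (PolyFun.congr hinit (fun _ => rfl) fun _ => rfl)
  exact (val.comp hfin).snd.snd.congr fun a => by rw [hiter a _ le_rfl]; simp

end PT


/-! ### Sizes of codes, and operations on lists and numbers -/

theorem length_le_code {γ : Type} [Rep γ] (l : List γ) : l.length ≤ (code l).length := by
  induction l with
  | nil => simp
  | cons a l ih => simp [code_cons]; omega

theorem code_length_mem {γ : Type} [Rep γ] {l : List γ} {c : γ} (h : c ∈ l) :
    (code c).length ≤ (code l).length := by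
  induction l with
  | nil => simp at h
  | cons a l ih =>
    simp only [List.mem_cons] at h
    rcases h with rfl | h
    · simp [code_cons]; omega
    · have := ih h
      simp [code_cons]; omega

theorem code_length_drop {γ : Type} [Rep γ] (l : List γ) :
    ∀ k, (code (l.drop k)).length ≤ (code l).length := by
  induction l with
  | nil => simp
  | cons a l ih =>
    intro k
    cases k with
    | zero => simp
    | succ k => have := ih k; simp [code_cons]; omega

theorem code_nat_length (n : ℕ) : (code n).length = 2 * n + 1 := by
  induction n with
  | zero => rfl
  | succ n ih =>
    have : code (n + 1) = some true :: some false :: code n := rfl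
    rw [this]; simp; omega

theorem code_replicate (n : ℕ) : code (List.replicate n ()) = code n := by
  induction n with
  | zero => rfl
  | succ n ih =>
    have : code (n + 1) = some true :: some false :: code n := rfl
    rw [this, ← ih, List.replicate_succ, code_cons]
    rfl

namespace PT

variable {α β γ δ ε : Type} [Rep α] [Rep β] [Rep γ] [Rep δ] [Rep ε]

/-- If a step enlarges the accumulator by an amount that depends on the parameter only, the growth
over the whole list is polynomial, and no bound on the partial folds has to be given. -/
theorem foldl_add {l : α → List γ} {x : α → β} {g : α → β → γ → β} (hl : PT l) (hx : PT x)
    (hg : PT (fun s : {s : α × β × γ // s.2.2 ∈ l s.1} => g s.1.1 s.1.2.1 s.1.2.2))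
    (Q : Polynomial ℕ)
    (hsize : ∀ a b, ∀ c ∈ l a, (code (g a b c)).length ≤ (code b).length + Q.eval (code a).length) :
    PT (fun a => (l a).foldl (g a) (x a)) := by
  obtain ⟨P, hP⟩ := hx.size
  obtain ⟨R, hR⟩ := hl.size
  refine foldl hl hx (hg.precomp (i := fun s : {s : α × β × γ // ∃ t, t ++ [s.2.2] <+: l s.1 ∧
    s.2.1 = t.foldl (g s.1) (x s.1)} => ⟨s.1, ?_⟩) fun _ => rfl) (P + R * Q) fun a t ht => ?_
  · obtain ⟨t, h, -⟩ := s.2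
    exact h.subset (by simp)
  · have key : ∀ t : List γ, t ⊆ l a → ∀ y,
        (code (t.foldl (g a) y)).length ≤ (code y).length + t.length * Q.eval (code a).length := by
      intro t
      induction t with
      | nil => simp
      | cons c t ih =>
        intro h y
        have h1 := ih (fun _ hx => h (by simp [hx])) (g a y c)
        have h2 := hsize a y c (h (by simp))
        simp only [List.foldl_cons, List.length_cons]
        linarith
    have h1 := key t ht.subset (x a)
    have h2 : t.length ≤ R.eval (code a).length :=
      ht.length_le.trans ((length_le_code _).trans (hR a))
    have h3 := Nat.mul_le_mul_right (Q.eval (code a).length) h2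
    have := hP a
    simp
    omega

theorem revFilterMap {l : α → List γ} {f : α → γ → Option δ} (hl : PT l)
    (hf : PT (fun s : {s : α × γ // s.2 ∈ l s.1} => f s.1.1 s.1.2)) :
    PT (fun a => ((l a).filterMap (f a)).reverse) := by
  obtain ⟨P, hP⟩ := hf.size
  obtain ⟨R, hR⟩ := hl.size
  refine (foldl_add (g := fun a (b : List δ) c => (f a c).elim b (fun d => d :: b)) hl
    (const ([] : List δ)) ?_ (P.comp (.X + R + 1) + 1) ?_).congr fun a => ?_
  · refine cases_option (o := fun s : {s : α × List δ × γ // s.2.2 ∈ l s.1} => f s.1.1 s.1.2.2)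
      (f := fun s => s.1.2.1) (g := fun s d => d :: s.1.2.1) ?_ ?_ ?_ ?_ ?_
    · exact hf.comp ((val.fst.pair val.snd.snd).sub fun s => s.2)
    · exact (PT.val.snd.fst).restrict _
    · exact val.snd.cons (val.comp val.fst).snd.fst
    · intro a h; simp [h]
    · intro a b h; simp [h]
  · intro a b c hc
    have h1 := hP ⟨(a, c), hc⟩
    have h2 : (code (⟨(a, c), hc⟩ : {s : α × γ // s.2 ∈ l s.1})).length ≤
        (code a).length + R.eval (code a).length + 1 := by
      have := code_length_mem hc
      have := hR a
      rw [code_subtype, code_pair]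
      simp; omega
    have h3 := h1.trans (eval_mono P h2)
    cases h : f a c with
    | none => simp
    | some d =>
      have : code (Option.some d) = Option.some true :: Option.some false :: code d := rfl
      simp only [h, this] at h3
      simp [code_cons] at h3 ⊢
      omega
  · suffices ∀ y, (l a).foldl (fun (b : List δ) c => (f a c).elim b (fun d => d :: b)) y =
        ((l a).filterMap (f a)).reverse ++ y by simpa using (this []).symm
    induction l a with
    | nil => simp
    | cons c t ih =>
      intro y
      rw [List.foldl_cons, ih]
      cases h : f a c <;> simp [h]

theorem reverse {f : α → List γ} (hf : PT f) : PT (fun a => (f a).reverse) :=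
  (revFilterMap (f := fun _ c => Option.some c) hf val.snd.some).congr fun a => by simp

theorem filterMap {l : α → List γ} {f : α → γ → Option δ} (hl : PT l)
    (hf : PT (fun s : {s : α × γ // s.2 ∈ l s.1} => f s.1.1 s.1.2)) :
    PT (fun a => (l a).filterMap (f a)) :=
  (revFilterMap hl hf).reverse.congr fun a => by simp

theorem map {l : α → List γ} {f : α → γ → δ} (hl : PT l)
    (hf : PT (fun s : {s : α × γ // s.2 ∈ l s.1} => f s.1.1 s.1.2)) :
    PT (fun a => (l a).map (f a)) :=
  (filterMap (f := fun a c => Option.some (f a c)) hl hf.some).congr fun a => by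
    induction l a <;> simp_all

theorem filter {l : α → List γ} {f : α → γ → Bool} (hl : PT l)
    (hf : PT (fun s : {s : α × γ // s.2 ∈ l s.1} => f s.1.1 s.1.2)) :
    PT (fun a => (l a).filter (f a)) :=
  (filterMap (f := fun a c => if f a c then Option.some c else none) hl
    (hf.ite (f := fun s => Option.some s.1.2) ((val.snd.some).restrict _) (g := fun _ => none)
      (const _))).congr fun a => by
    induction l a with
    | nil => rfl
    | cons c t ih => cases h : f a c <;> simp [h, ih]

theorem append {f g : α → List γ} (hf : PT f) (hg : PT g) : PT (fun a => f a ++ g a) := by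
  obtain ⟨R, hR⟩ := hf.reverse.size
  refine (foldl_add (g := fun _ b c => c :: b) hf.reverse hg
    ((val.snd.snd).cons val.snd.fst) (R + 1) ?_).congr fun a => by
      simp [List.foldl_reverse]
  intro a b c hc
  have := (code_length_mem hc).trans (hR a)
  simp [code_cons]; omega

theorem getLast? {l : α → List β} (hl : PT l) : PT (fun a => (l a).getLast?) :=
  hl.reverse.head?.congr fun a => by simp

/-! #### Natural numbers -/

/-- Numbers are coded in unary and share their code with lists of units, so forgetting the entries
of a list computes its length. -/
theorem length {l : α → List β} (hl : PT l) : PT (fun a => (l a).length) :=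
  (map (f := fun _ _ => ()) hl (const ())).recode fun a => by
    rw [← code_replicate]; simp [List.map_const']

theorem units {n : α → ℕ} (hn : PT n) : PT (fun a => List.replicate (n a) ()) :=
  hn.recode fun _ => code_replicate _

theorem iterate {n : α → ℕ} {x : α → β} {g : α → β → β} (hn : PT n) (hx : PT x)
    (hg : PT (fun s : {s : α × β // ∃ k < n s.1, s.2 = (g s.1)^[k] (x s.1)} => g s.1.1 s.1.2))
    (P : Polynomial ℕ)
    (hsize : ∀ a, ∀ k ≤ n a, (code ((g a)^[k] (x a))).length ≤ P.eval (code a).length) :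
    PT (fun a => (g a)^[n a] (x a)) := by
  have e : ∀ (a : α) (t : List Unit) y, t.foldl (fun b _ => g a b) y = (g a)^[t.length] y := by
    intro _ t
    induction t with
    | nil => simp
    | cons c t ih => intro y; simp [ih]
  refine (foldl (g := fun a b _ => g a b) hn.units hx (hg.comp
    ((val.fst.pair val.snd.fst).sub fun s => ?_)) P fun a t ht => ?_).congr fun a => ?_
  · obtain ⟨t, h1, h2⟩ := s.2
    refine ⟨t.length, ?_, by rw [h2, e]⟩
    have := h1.length_le
    simpa using this
  · rw [e]
    exact hsize a _ (by simpa using ht.length_le)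
  · rw [e]; simp

theorem succ {n : α → ℕ} (hn : PT n) : PT (fun a => n a + 1) :=
  ((const ()).pair hn).recode fun _ => rfl

theorem add {m n : α → ℕ} (hm : PT m) (hn : PT n) : PT (fun a => m a + n a) :=
  (hm.units.append hn.units).length.congr fun a => by simp

theorem replicate {n : α → ℕ} {f : α → β} (hn : PT n) (hf : PT f) :
    PT (fun a => List.replicate (n a) (f a)) :=
  (map (f := fun a _ => f a) hn.units (hf.comp val.fst)).congr fun a => by simp

theorem mul {m n : α → ℕ} (hm : PT m) (hn : PT n) : PT (fun a => m a * n a) := by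
  obtain ⟨P, hP⟩ := hn.size
  refine (foldl_add (g := fun a (b : ℕ) (_ : Unit) => b + n a) (x := fun _ => 0) hm.units (const _)
    ((val.snd.fst).add (hn.comp val.fst)) P fun a b c _ => ?_).congr fun a => ?_
  · have := hP a
    simp only [code_nat_length] at this ⊢
    omega
  · generalize m a = k
    suffices ∀ y, (List.replicate k ()).foldl (fun b _ => b + n a) y = y + k * n a by
      simpa using (this 0).symm
    induction k with
    | zero => simp
    | succ k ih => intro y; rw [List.replicate_succ, List.foldl_cons, ih]; ring

theorem pow {n : α → ℕ} (hn : PT n) : ∀ k : ℕ, PT (fun a => n a ^ k)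
  | 0 => const 1
  | k + 1 => ((pow hn k).mul hn).congr fun a => by rw [pow_succ]

theorem eval {n : α → ℕ} (hn : PT n) (P : Polynomial ℕ) : PT (fun a => P.eval (n a)) := by
  induction P using Polynomial.induction_on' with
  | add p q hp hq => exact (hp.add hq).congr fun a => by simp
  | monomial k c => exact ((const c).mul (hn.pow k)).congr fun a => by simp

theorem drop {k : α → ℕ} {l : α → List β} (hk : PT k) (hl : PT l) :
    PT (fun a => (l a).drop (k a)) := by
  obtain ⟨P, hP⟩ := hl.size
  have e : ∀ (k : ℕ) (l : List β), List.tail^[k] l = l.drop k := by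
    intro k
    induction k with
    | zero => simp
    | succ k ih => intro l; simp [ih]
  refine (iterate (g := fun _ => List.tail) hk hl (val.snd.tail) P fun a k _ => ?_).congr
    fun a => (e _ _).symm
  rw [e]
  exact (code_length_drop _ _).trans (hP a)

theorem sub_nat {m n : α → ℕ} (hm : PT m) (hn : PT n) : PT (fun a => m a - n a) :=
  (hn.drop hm.units).length.congr fun a => by simp

theorem take {k : α → ℕ} {l : α → List β} (hk : PT k) (hl : PT l) :
    PT (fun a => (l a).take (k a)) :=
  ((hl.length.sub_nat hk).drop hl.reverse).reverse.congr fun a => by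
    rw [List.drop_reverse, List.reverse_reverse]
    by_cases h : k a ≤ (l a).length
    · congr 1; omega
    · rw [List.take_of_length_le (by omega), List.take_of_length_le (by omega)]

theorem lt {m n : α → ℕ} (hm : PT m) (hn : PT n) : PT (fun a => decide (m a < n a)) :=
  (hn.sub_nat hm).units.isCons.congr fun a => by
    rw [Bool.eq_iff_iff]
    simp
    omega

theorem le {m n : α → ℕ} (hm : PT m) (hn : PT n) : PT (fun a => decide (m a ≤ n a)) :=
  (hm.lt hn.succ).congr fun a => by simp

theorem eq_nat {m n : α → ℕ} (hm : PT m) (hn : PT n) : PT (fun a => decide (m a = n a)) :=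
  ((hm.le hn).and (hn.le hm)).congr fun a => by
    rw [Bool.eq_iff_iff]
    simp [le_antisymm_iff]

theorem getElem? {k : α → ℕ} {l : α → List β} (hk : PT k) (hl : PT l) :
    PT (fun a => (l a)[k a]?) :=
  (hk.drop hl).head?.congr fun a => by simp

theorem getD {k : α → ℕ} {l : α → List β} {d : α → β} (hk : PT k) (hl : PT l) (hd : PT d) :
    PT (fun a => (l a).getD (k a) (d a)) :=
  ((hk.getElem? hl).option_getD hd).congr fun a => by simp

end PT


theorem code_bits_length_le (x : List Bool) : (code x).length ≤ 4 * x.length + 1 := by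
  induction x with
  | nil => simp [code_nil]
  | cons b x ih => cases b <;> simp [code_cons, code_true, code_false] <;> omega

theorem code_append_singleton {γ : Type} [Rep γ] (l : List γ) (x : γ) :
    (code (l ++ [x])).length = (code l).length + (code x).length + 1 := by
  induction l with
  | nil => simp [code_cons, code_nil]; omega
  | cons a l ih => simp [code_cons, ih]; omega

/-! ### Strings in lexicographic order -/

theorem mem_allStr {l : ℕ} {x : List Bool} : x ∈ allStr l ↔ x.length = l := by
  induction l generalizing x with
  | zero => simp [allStr]
  | succ l ih =>
    cases x with
    | nil => simp [allStr]
    | cons b x => cases b <;> simp [allStr, ih]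

theorem length_allStr (l : ℕ) : (allStr l).length = 2 ^ l := by
  induction l with
  | zero => rfl
  | succ l ih => simp [allStr, ih, pow_succ]; omega

theorem nodup_allStr (l : ℕ) : (allStr l).Nodup := by
  induction l with
  | zero => simp [allStr]
  | succ l ih =>
    refine List.Nodup.append (ih.map (List.cons_injective)) (ih.map (List.cons_injective)) ?_
    simp [List.disjoint_left]

theorem code_list_bits_le {l : ℕ} : ∀ L : List (List Bool), (∀ x ∈ L, x.length ≤ l) →
    (code L).length ≤ L.length * (4 * l + 2) + 1 := by
  intro L
  induction L with
  | nil => simp [code_nil]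
  | cons x L ih =>
    intro h
    have h1 := ih fun y hy => h y (by simp [hy])
    have h2 := code_bits_length_le x
    have h3 := h x (by simp)
    simp only [code_cons, List.length_cons, List.length_append]
    linarith

theorem length_alpha_le (l : ℕ) (y : List Bool) (T : List (List Bool)) :
    (alpha l y T).length ≤ l := by
  unfold alpha
  simp only [List.getD_eq_getElem?_getD]
  cases h : ((allStr l).filter (fun x => !T.contains x))[strVal y %
    ((allStr l).filter (fun x => !T.contains x)).length]? with
  | none => simp
  | some x =>
    have := List.mem_of_getElem? h
    simp only [List.mem_filter, mem_allStr] at this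
    simp [this.1]

/-! ### Polynomial-time computation of `alpha` and of the queries -/

namespace PT

variable {α β γ δ ε : Type} [Rep α] [Rep β] [Rep γ] [Rep δ] [Rep ε]

theorem ite' {c : α → Bool} {f g : α → β} (hc : PT c) (hf : PT f) (hg : PT g) :
    PT (fun a => if c a then f a else g a) :=
  hc.ite (hf.restrict _) (hg.restrict _)

theorem beq_bool {f g : α → Bool} (hf : PT f) (hg : PT g) : PT (fun a => f a == g a) :=
  hf.cases_bool (f := g) (g := fun a => !g a) (hg.restrict _) (hg.not.restrict _)
    (fun a h => by simp [h]) (fun a h => by cases e : g a <;> simp [h])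

theorem beq_option {f g : α → Option Bool} (hf : PT f) (hg : PT g) :
    PT (fun a => decide (f a = g a)) := by
  refine hf.cases_option (f := fun a => !(g a).isSome)
    (g := fun a b => decide (g a = Option.some b)) (hg.isSome.not.restrict _) ?_
    (fun a h => by cases e : g a <;> simp [h]) (fun a b h => by
      rw [h]; exact decide_eq_decide.2 eq_comm)
  have : PT (fun x : α × Bool => decide (g x.1 = Option.some x.2)) := by
    refine (hg.comp fst').cases_option (f := fun _ => false) (g := fun x b => b == x.2) (const _)
      (beq_bool val.snd val.fst.snd) (fun a h => by simp [h]) (fun a b h => by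
        cases b <;> cases e : a.2 <;> simp [h])
  exact this.restrict _

/-- The first string is folded over the second one, removing equal letters and remembering a
mismatch as `none`. The strings are equal when what remains in the end is the empty string. -/
theorem beq_str {f g : α → List Bool} (hf : PT f) (hg : PT g) : PT (fun a => f a == g a) := by
  obtain ⟨P, hP⟩ := hg.size
  have h1 : PT (fun a => (f a).foldl (fun (o : Option (List Bool)) c => o.elim none fun r =>
      if decide (r.head? = Option.some c) then Option.some r.tail else none)
      (Option.some (g a))) := by
    refine foldl_add (g := fun _ (o : Option (List Bool)) c => o.elim none fun r =>
      if decide (r.head? = Option.some c) then Option.some r.tail else none)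
      hf hg.some ?_ 0 fun a b c _ => ?_
    · refine PT.restrict (f := fun s : α × Option (List Bool) × Bool => s.2.1.elim none fun r =>
        if decide (r.head? = Option.some s.2.2) then Option.some r.tail else none) ?_ _
      refine cases_option (o := fun s : α × Option (List Bool) × Bool => s.2.1) snd'.fst
        (f := fun _ => none) (g := fun s r =>
          if decide (r.head? = Option.some s.2.2) then Option.some r.tail else none)
        (const _) ?_ (fun a h => by simp [h]) (fun a b h => by simp [h])
      refine PT.restrict (f := fun x : (α × Option (List Bool) × Bool) × List Bool =>
        if decide (x.2.head? = Option.some x.1.2.2) then Option.some x.2.tail else none) ?_ _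
      exact (snd'.head?.beq_option fst'.snd.snd.some).ite' snd'.tail.some (const none)
    · cases b with
      | none => simp
      | some r =>
        simp only [Option.elim_some]
        split_ifs
        · have := code_length_drop r 1
          have e : ∀ r : List Bool, code (Option.some r) =
            Option.some true :: Option.some false :: code r := fun _ => rfl
          simp [e] at this ⊢
          exact this
        · have e : code (none : Option (List Bool)) = [Option.some false] := rfl
          rw [e]
          have := code_length_pos (Option.some r)
          simp; omega
  have h2 := h1.cases_option (f := fun _ => false) (g := fun _ r => r.isEmpty)
    (h := fun a => f a == g a) (const _) (val.snd.isCons.not.congr fun a => by simp)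
  have key : ∀ x y : List Bool, x.foldl (fun (o : Option (List Bool)) c => o.elim none fun r =>
      if decide (r.head? = Option.some c) then Option.some r.tail else none) (Option.some y) =
      if x <+: y then Option.some (y.drop x.length) else none := by
    have hnone : ∀ x : List Bool, x.foldl (fun (o : Option (List Bool)) c => o.elim none fun r =>
      if decide (r.head? = Option.some c) then Option.some r.tail else none) none = none := by
      intro x
      induction x with
      | nil => rfl
      | cons c x ih => simpa using ih
    intro x
    induction x with
    | nil => intro y; simp
    | cons c x ih =>
      intro y
      cases y with
      | nil => simpa using hnone x
      | cons d y =>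
        by_cases h : d = c
        · subst h; simpa using ih y
        · simpa [h, List.cons_prefix_cons, Ne.symm h] using hnone x
  refine h2 (fun a h => ?_) (fun a r h => ?_)
  · rw [key] at h
    split_ifs at h with h'
    simp only [beq_eq_false_iff_ne, ne_eq]
    rintro h
    exact h' (h ▸ List.prefix_rfl)
  · rw [key] at h
    split_ifs at h with h'
    obtain ⟨t, ht⟩ := h'
    simp only [Option.some.injEq] at h
    subst h
    rw [Bool.eq_iff_iff, ← ht]
    simp

theorem contains {T : α → List (List Bool)} {x : α → List Bool} (hT : PT T) (hx : PT x) :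
    PT (fun a => (T a).contains (x a)) :=
  (filter (f := fun a c => x a == c) hT ((hx.comp val.fst).beq_str val.snd)).isCons.congr
    fun a => by
      rw [Bool.eq_iff_iff]
      simp

/-- The list is doubled as long as it has fewer than `n` elements, which stops at length `⌈lg n⌉`
without computing a logarithm. Since `⌈lg n⌉ ≤ n`, `n` rounds are enough. -/
theorem allStr {n : α → ℕ} (hn : PT n) : PT (fun a => allStr (Pol.lg (n a))) := by
  have step : ∀ (k : ℕ) (n : ℕ), (fun L : List (List Bool) => if decide (L.length < n) then
      L.map (List.cons false) ++ L.map (List.cons true) else L)^[k] [[]] =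
      HOCrypto.allStr (min k (Nat.clog 2 n)) := by
    intro k n
    induction k with
    | zero => simp [HOCrypto.allStr]
    | succ k ih =>
      rw [Function.iterate_succ_apply', ih]
      simp only [length_allStr, decide_eq_true_eq]
      by_cases h : k < Nat.clog 2 n
      · rw [min_eq_left h.le, min_eq_left h, if_pos ((Nat.lt_clog_iff_pow_lt one_lt_two).1 h)]
        rfl
      · rw [min_eq_right (by omega), min_eq_right (by omega), if_neg]
        rw [← Nat.lt_clog_iff_pow_lt one_lt_two]
        omega
  have hclog (n : ℕ) : Nat.clog 2 n ≤ n := Nat.clog_le_of_le_pow (Nat.lt_two_pow_self (n := n)).le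
  obtain ⟨P, hP⟩ := hn.size
  refine (iterate (g := fun a (L : List (List Bool)) => if decide (L.length < n a) then
      L.map (List.cons false) ++ L.map (List.cons true) else L) (x := fun _ => [[]]) hn (const _) ?_
      ((2 * P + 1) * (4 * P + 2) + 1) fun a k hk => ?_).congr fun a => ?_
  · refine PT.restrict (f := fun s : α × List (List Bool) => if decide (s.2.length < n s.1) then
      s.2.map (List.cons false) ++ s.2.map (List.cons true) else s.2) ?_ _
    refine (snd'.length.lt (hn.comp fst')).ite' ?_ snd'
    exact (map (f := fun _ x => false :: x) snd' ((const false).cons val.snd)).append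
      (map (f := fun _ x => true :: x) snd' ((const true).cons val.snd))
  · rw [step]
    have h1 := hP a
    rw [code_nat_length] at h1
    have h2 := code_list_bits_le (HOCrypto.allStr (min k (Nat.clog 2 (n a))))
      (l := min k (Nat.clog 2 (n a))) (fun x hx => (mem_allStr.1 hx).le)
    rw [length_allStr] at h2
    set l := min k (Nat.clog 2 (n a)) with hl
    have h3 : l ≤ n a := (min_le_right _ _).trans (hclog _)
    -- The list before the last doubling had fewer than `n` elements; the `+ 1` covers `n = 0`,
    -- where there is one string.
    have h4 : 2 ^ l ≤ 2 * n a + 1 := by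
      rcases Nat.eq_zero_or_pos l with h | h
      · simp [h]
      · have : 2 ^ (l - 1) < n a := by
          rw [← Nat.lt_clog_iff_pow_lt one_lt_two]; omega
        have e : 2 ^ l = 2 * 2 ^ (l - 1) := by rw [← pow_succ']; congr 1; omega
        omega
    simp only [Polynomial.eval_add, Polynomial.eval_mul, Polynomial.eval_one,
      Polynomial.eval_ofNat]
    calc _ ≤ _ := h2
      _ ≤ (2 * P.eval (code a).length + 1) * (4 * P.eval (code a).length + 2) + 1 := by
        gcongr <;> omega
  · rw [step, min_eq_right (hclog _)]
    rfl

/-- Numbers are in unary, so the value of a binary string cannot be written down in polynomial time.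
Horner's scheme is run modulo `m` instead: a digit leads from `r < m` to a number below `2m`, which
one subtraction reduces. -/
theorem strVal_mod {y : α → List Bool} {m : α → ℕ} (hy : PT y) (hm : PT m) (h0 : ∀ a, 0 < m a) :
    PT (fun a => strVal (y a) % m a) := by
  obtain ⟨P, hP⟩ := hm.size
  have key : ∀ (m : ℕ), 0 < m → ∀ (y : List Bool) (k : ℕ), k < m →
      y.foldl (fun r b => if decide (2 * r + b.toNat < m) then 2 * r + b.toNat
        else 2 * r + b.toNat - m) k = y.foldl (fun a b => 2 * a + b.toNat) k % m := by
    intro m hm y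
    suffices ∀ k r, r < m → r = k % m → y.foldl (fun r b => if decide (2 * r + b.toNat < m) then
        2 * r + b.toNat else 2 * r + b.toNat - m) r = y.foldl (fun a b => 2 * a + b.toNat) k % m from
      fun k hk => this k k hk (Nat.mod_eq_of_lt hk).symm
    induction y with
    | nil => intro k r _ h; simpa using h
    | cons b y ih =>
      intro k r hr h
      have hb := Bool.toNat_le b
      have e : (2 * k + b.toNat) % m = (2 * r + b.toNat) % m := by
        rw [h, Nat.add_mod, Nat.mul_mod, ← Nat.mul_mod_mod, Nat.add_mod (2 * (k % m)),
          Nat.mul_mod 2 (k % m)]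
      simp only [List.foldl_cons]
      apply ih
      · simp only [decide_eq_true_eq]
        split_ifs <;> omega
      · rw [e]
        simp only [decide_eq_true_eq]
        split_ifs with h1
        · exact (Nat.mod_eq_of_lt h1).symm
        · rw [Nat.mod_eq_sub_mod (by omega), Nat.mod_eq_of_lt (by omega)]
  refine (foldl (g := fun a r (b : Bool) => if decide (2 * r + b.toNat < m a) then 2 * r + b.toNat
    else 2 * r + b.toNat - m a) (x := fun _ => 0) hy (const 0) ?_ P fun a t _ => ?_).congr
      fun a => (key _ (h0 a) _ _ (h0 a)).symm
  · refine PT.restrict (f := fun s : α × ℕ × Bool => if decide (2 * s.2.1 + s.2.2.toNat < m s.1) then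
      2 * s.2.1 + s.2.2.toNat else 2 * s.2.1 + s.2.2.toNat - m s.1) ?_ _
    have hb : PT (fun s : α × ℕ × Bool => s.2.2.toNat) :=
      cases_bool snd'.snd (f := fun _ => 1) (g := fun _ => 0) (const _) (const _)
        (fun a h => by simp [h]) (fun a h => by simp [h])
    have h1 : PT (fun s : α × ℕ × Bool => 2 * s.2.1 + s.2.2.toNat) :=
      ((const 2).mul snd'.fst).add hb
    exact (h1.lt (hm.comp fst')).ite' h1 (h1.sub_nat (hm.comp fst'))
  · rw [key _ (h0 a) _ _ (h0 a)]
    have := hP a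
    have := Nat.mod_lt (t.foldl (fun a b => 2 * a + b.toNat) 0) (h0 a)
    simp only [code_nat_length] at *
    omega

theorem alpha {n : α → ℕ} {y : α → List Bool} {T : α → List (List Bool)} (hn : PT n) (hy : PT y)
    (hT : PT T) : PT (fun a => alpha (Pol.lg (n a)) (y a) (T a)) := by
  have hr : PT (fun a => (HOCrypto.allStr (Pol.lg (n a))).filter (fun x => !(T a).contains x)) :=
    filter (f := fun a x => !(T a).contains x) (allStr hn)
      ((hT.comp val.fst).contains val.snd).not
  -- The reduction is only available for a positive modulus, so the case where no string is left is
  -- separated; there the default value `[]` is returned.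
  refine hr.isCons.cases_bool (f := fun a => HOCrypto.alpha (Pol.lg (n a)) (y a) (T a))
    (g := fun _ => []) ?_ (const _)
    (fun _ _ => rfl) (fun a h => ?_)
  · exact ((hy.restrict _).strVal_mod (hr.restrict _).length (fun a => by
      have := a.2
      rw [Bool.not_eq_true', List.isEmpty_eq_false_iff] at this
      exact List.length_pos_iff.2 this)).getD (hr.restrict _) (const [])
  · have h : (HOCrypto.allStr (Pol.lg (n a))).filter (fun x => !(T a).contains x) = [] := by
      simpa [-List.filter_eq_nil_iff] using h
    simp only [HOCrypto.alpha, h]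
    rfl

theorem queriesOf {n : α → ℕ} {ys : α → List (List Bool)} (hn : PT n) (hy : PT ys) :
    PT (fun a => queriesOf (Pol.lg (n a)) (ys a)) := by
  obtain ⟨P, hP⟩ := hn.size
  refine foldl_add (g := fun a T y => T ++ [HOCrypto.alpha (Pol.lg (n a)) y T]) hy
    (const ([] : List (List Bool))) ?_ (4 * P + 2) fun a T y _ => ?_
  · exact PT.restrict (f := fun s : α × List (List Bool) × List Bool =>
      s.2.1 ++ [HOCrypto.alpha (Pol.lg (n s.1)) s.2.2 s.2.1])
      (snd'.fst.append (((hn.comp fst').alpha snd'.snd snd'.fst).cons (const []))) _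
  · rw [code_append_singleton]
    have h1 := code_bits_length_le (HOCrypto.alpha (Pol.lg (n a)) y T)
    have h2 := length_alpha_le (Pol.lg (n a)) y T
    have h3 := hP a
    have h4 : Pol.lg (n a) ≤ n a := Nat.clog_le_of_le_pow (Nat.lt_two_pow_self (n := n a)).le
    rw [code_nat_length] at h3
    simp
    omega

end PT


/-! ### Machines on strings -/

theorem PolyFun.mapSym {α β B : Type} {ea : α → List Sym} {eb : β → List B} {f : α → β}
    (toS : B → Sym) (h : PolyFun ea eb f) : PolyFun ea (fun b => (eb b).map toS) f := by
  obtain ⟨M, T, hM⟩ := h.callee toS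
  refine PolyFun.of_exec (fun _ : Unit => M) _root_.id (.seq (.move 0 2) (.call () 2 1))
    (4 * .X + 4 * T + 10) fun a => ?_
  have h1 := hM a
  have h4 := Exec.move (spec := fun _ : Unit => M.Spec) (r := 0) (r' := 2) (by decide) none
    (regs (ea a) [] [] [] [] [])
  have h5 := Exec.call (spec := fun _ : Unit => M.Spec) (i := ()) (r := 2) (r' := 1) (v := none)
    (S := regs [] [] (ea a).reverse [] [] []) h1.1 (by simp) (by decide)
  simp at h4 h5 h1
  refine ⟨none, ((eb (f a)).map toS).reverse, (h4.seq h5).cast rfl rfl ?_, ?_, ?_⟩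
  · simp
    omega
  · simp
  · have := h1.2
    simp
    omega

/-- From the calculus to machines on tapes: the input is parsed into a tree, `g` is applied, and the
result is written as a string. Only inputs that encode an element of `S` have to be treated. -/
theorem polyTimeOn_of {α β : Type} {ea : α → List (List Bool)} {eb : β → List Bool} {S : Set α}
    {f : α → β} (g : List (List Bool) → List Bool)
    (hg : PT (fun l : {l // ∃ a ∈ S, ea a = l} => g l.1))
    (h : ∀ a ∈ S, g (ea a) = eb (f a)) : PolyTimeOn ea eb S f := by
  have h1 : PolyFun (fun a : S => code (ea a)) code (fun a : S => eb (f a)) :=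
    PolyFun.congr (PolyFun.precomp hg (fun a : S => ⟨ea a.1, a.1, a.2, rfl⟩)) (fun _ => rfl)
      fun a => by rw [← h a.1 a.2]
  have h3 : PolyFun (fun a : S => encList (ea a)) code (fun a : S => eb (f a)) :=
    PolyFun.comp (f := fun a : S => a) (eb := fun a : S => code (ea a)) _root_.id _root_.id
      (fun _ => rfl) h1 (polyFun_readList (fun a : S => ea a) |>.congr (fun _ => rfl) fun _ => rfl)
  have h4 := PolyFun.comp some (fun s => s.getD false) (fun _ => rfl)
    (polyFun_writeStr (fun x : List Bool => x)) h3
  exact (h4.congr (eb' := eb) (f' := fun a : S => f a) (fun _ => rfl) fun _ => rfl).1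

/-- From machines on tapes to the calculus. A polynomial bound on the length of the output is part
of `PolyFun`, hence the hypothesis on `P`. -/
theorem PT.of_polyTimeOn {α β γ : Type} [Rep γ] {ea : α → List (List Bool)} {eb : β → List Bool}
    {S : Set α} {f : α → β} (h : PolyTimeOn ea eb S f) (i : γ → α) (hi : ∀ c, i c ∈ S)
    (hc : PT (fun c => ea (i c))) (P : Polynomial ℕ)
    (hP : ∀ a ∈ S, (eb (f a)).length ≤ P.eval (encList (ea a)).length) :
    PT (fun c => eb (f (i c))) := by
  have h0 : PolyFun (fun a : S => encList (ea a)) (fun b => (eb b).map Option.some)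
      (fun a : S => f a) := PolyFun.mapSym _ ⟨h, P, fun a => hP a.1 a.2⟩
  have h1 : PolyFun (code : γ → _) (fun c => encList (ea (i c))) (fun c => c) :=
    PolyFun.comp _root_.id _root_.id (fun _ => rfl) (polyFun_writeList fun l : List (List Bool) => l)
      hc |>.congr (fun _ => rfl) fun _ => rfl
  have h2 : PolyFun (code : γ → _) (fun c => (eb (f (i c))).map Option.some) (fun c => c) :=
    PolyFun.comp _root_.id _root_.id (fun _ => rfl) (h0.precomp fun c => ⟨i c, hi c⟩) h1
      |>.congr (fun _ => rfl) fun _ => rfl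
  exact (PolyFun.comp _root_.id _root_.id (fun _ => rfl) (polyFun_readStr fun c => eb (f (i c)))
    h2).congr (fun _ => rfl) fun _ => rfl


/-! ### Encodings of moves -/

/-- The moves of `G` can be written as strings and read off in polynomial time. -/
structure Game.Coded {M : Type} [Rep M] (G : Game M) : Prop where
  enc : PT G.enc
  dec : ∃ d : List Bool → M, PT d ∧ ∀ m, d (G.enc m) = m

namespace Game.Coded

variable {M N A : Type} [Rep M] [Rep N] [Rep A]

theorem ground {e : A → List Bool} {inj : Function.Injective e} {ok : ℕ → Set A}
    {bdd : ∃ P : Polynomial ℕ, ∀ n, ∀ a ∈ ok n, (e a).length ≤ P.eval n} (he : PT e)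
    {d : List Bool → A} (hd : PT d) (h : ∀ a, d (e a) = a) :
    (HOCrypto.ground e inj ok bdd).Coded where
  enc := PT.cases_option (o := fun m : Option A => m) PT.id (f := fun _ => [])
    (g := fun _ a => true :: e a) (PT.const _) ((PT.const true).cons (he.comp PT.val.snd))
    (fun a h => by subst h; rfl) (fun a b h => by subst h; rfl)
  dec := ⟨fun x => if x.isEmpty then none else some (d x.tail),
    ((PT.ite' (PT.isCons PT.id).not (PT.const none) (hd.comp (PT.tail PT.id)).some)).congr
      fun a => by simp, fun m => by cases m <;> simp [HOCrypto.ground, h]⟩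

theorem str (p : Pol) : (strGame p).Coded := ground PT.id PT.id fun _ => rfl

theorem bool : boolGame.Coded :=
  ground (PT.id.cons (PT.const [])) (d := fun x => x.head?.getD false)
    ((PT.head? PT.id).option_getD (PT.const false)) fun _ => rfl

theorem oracle (q : Pol) : (oracleGame q).Coded where
  enc := PT.cases_option (o := fun m : Option Bool => m) PT.id (f := fun _ => [])
    (g := fun _ a => [a]) (PT.const _) (PT.val.snd.cons (PT.const []))
    (fun a h => by subst h; rfl) (fun a b h => by subst h; rfl)
  dec := ⟨List.head?, PT.head? PT.id, fun m => by cases m <;> rfl⟩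

theorem lolli {G : Game M} {H : Game N} (hG : G.Coded) (hH : H.Coded) : (lolli G H).Coded where
  enc := PT.cases_sum (o := fun m : M ⊕ N => m) PT.id (f := fun _ m => false :: G.enc m)
    (g := fun _ m => true :: H.enc m) ((PT.const false).cons (hG.enc.comp PT.val.snd))
    ((PT.const true).cons (hH.enc.comp PT.val.snd))
    (fun a b h => by subst h; rfl) (fun a b h => by subst h; rfl)
  dec := by
    obtain ⟨d, hd, h⟩ := hG.dec
    obtain ⟨d', hd', h'⟩ := hH.dec
    refine ⟨fun x => if x.head?.getD false then Sum.inr (d' x.tail) else Sum.inl (d x.tail),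
      PT.ite' ((PT.head? PT.id).option_getD (PT.const false)) (hd'.comp (PT.tail PT.id)).inr
        (hd.comp (PT.tail PT.id)).inl, fun m => ?_⟩
    cases m <;> simp [HOCrypto.lolli, h, h']

/-- The length of the first run of `true`. -/
def run (x : List Bool) : ℕ :=
  (x.foldl (fun (s : Bool × ℕ) b => if s.1 && b then (true, s.2 + 1) else (false, s.2))
    (true, 0)).2

theorem pt_run : PT run := by
  refine (PT.foldl_add (g := fun _ (s : Bool × ℕ) b =>
    if s.1 && b then (true, s.2 + 1) else (false, s.2)) PT.id (PT.const (true, 0)) ?_ 2 ?_).snd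
  · refine PT.restrict (f := fun s : List Bool × (Bool × ℕ) × Bool =>
      if s.2.1.1 && s.2.2 then (true, s.2.1.2 + 1) else (false, s.2.1.2)) ?_ _
    exact (PT.snd'.fst.fst.and PT.snd'.snd).ite' ((PT.const true).pair PT.snd'.fst.snd.succ)
      ((PT.const false).pair PT.snd'.fst.snd)
  · rintro a ⟨b, n⟩ c -
    cases b <;> cases c <;> simp [code_pair, code_nat_length, code_true, code_false] <;> omega

theorem run_encIdx (i : ℕ) (x : List Bool) : run (List.replicate i true ++ false :: x) = i := by
  have h1 : ∀ (x : List Bool) k, x.foldl (fun (s : Bool × ℕ) b =>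
      if s.1 && b then (true, s.2 + 1) else (false, s.2)) (false, k) = (false, k) := by
    intro x
    induction x with
    | nil => simp
    | cons b x ih => simpa using ih
  suffices ∀ k, ((List.replicate i true ++ false :: x).foldl (fun (s : Bool × ℕ) b =>
      if s.1 && b then (true, s.2 + 1) else (false, s.2)) (true, k)).2 = k + i by
    have := this 0
    rw [Nat.zero_add] at this
    exact this
  induction i with
  | zero => intro k; simp only [Bool.and_eq_true] at h1; simp [h1]
  | succ i ih =>
    intro k
    rw [List.replicate_succ, List.cons_append, List.foldl_cons]
    simp only [Bool.and_self, if_true]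
    rw [ih]; omega

theorem bang {p : Pol} {G : Game M} (hG : G.Coded) : (bang p G).Coded where
  enc := (PT.replicate PT.fst' (PT.const true)).append
    ((PT.const false).cons (hG.enc.comp PT.snd'))
  dec := by
    obtain ⟨d, hd, h⟩ := hG.dec
    refine ⟨fun x => (run x, d (x.drop (run x + 1))),
      pt_run.pair (hd.comp (PT.drop pt_run.succ PT.id)), fun m => ?_⟩
    obtain ⟨i, m⟩ := m
    simp only [HOCrypto.bang, encIdx, run_encIdx, Prod.mk.injEq, true_and]
    rw [List.drop_append]
    simp [h]

theorem logSof (p : Pol) : (logSof p).Coded :=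
  (((str _).lolli bool).bang).lolli (str p)

end Game.Coded

/-! ### Restrictions of plays -/

namespace PT

variable {α M N : Type} [Rep α] [Rep M] [Rep N]

theorem getLeft? {f : α → M ⊕ N} (hf : PT f) : PT (fun a => (f a).getLeft?) :=
  hf.cases_sum (f := fun _ m => Option.some m) (g := fun _ _ => none) val.snd.some (const _)
    (fun a b h => by simp [h]) (fun a b h => by simp [h])

theorem getRight? {f : α → M ⊕ N} (hf : PT f) : PT (fun a => (f a).getRight?) :=
  hf.cases_sum (f := fun _ _ => none) (g := fun _ m => Option.some m) (const _) val.snd.some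
    (fun a b h => by simp [h]) (fun a b h => by simp [h])

theorem onLeft {f : α → List (M ⊕ N)} (hf : PT f) : PT (fun a => onLeft (f a)) :=
  (hf.filterMap (f := fun _ m => m.getLeft?) val.snd.getLeft?).congr fun _ => rfl

theorem onRight {f : α → List (M ⊕ N)} (hf : PT f) : PT (fun a => onRight (f a)) :=
  (hf.filterMap (f := fun _ m => m.getRight?) val.snd.getRight?).congr fun _ => rfl

theorem proj {i : α → ℕ} {f : α → List (ℕ × M)} (hi : PT i) (hf : PT f) :
    PT (fun a => proj (i a) (f a)) :=
  (hf.filterMap (f := fun a m => if decide (m.1 = i a) then Option.some m.2 else none)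
    ((val.snd.fst.eq_nat (hi.comp val.fst)).ite' val.snd.snd.some (const none))).congr fun a => by
      simp [HOCrypto.proj]

theorem bind {o : α → Option M} {g : α → M → Option N} (ho : PT o)
    (hg : PT (fun x : α × M => g x.1 x.2)) : PT (fun a => (o a).bind (g a)) :=
  ho.cases_option (f := fun _ => none) (const _) (hg.restrict _) (fun a h => by simp [h])
    (fun a b h => by simp [h])

theorem argBits {f : α → List LogSofM} (hf : PT f) : PT (fun a => argBits (f a)) := by
  refine (hf.filterMap (f := fun _ m => m.getLeft?.bind fun x => x.2.getRight?.bind fun o => o)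
    ?_).congr fun a => ?_
  · exact val.snd.getLeft?.bind (snd'.snd.getRight?.bind snd')
  · refine List.filterMap_congr fun m _ => ?_
    rcases m with ⟨i, m | _ | z⟩ | m <;> rfl

end PT

/-! ### Responses -/

/-- The values of `O` at the prefixes of `t`. -/
def prefixVals (O : List Bool → List Bool) (t : List Bool) : List (List Bool) :=
  (List.range (t.length + 1)).map fun k => O (t.take k)

/-- The response in the play `u` of `logSof p` determined by the values `ys` at the prefixes of the
bits answered so far. -/
def respond (p : Pol) (n : ℕ) (ys : List (List Bool)) (u : List LogSofM) : LogSofM :=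
  match u.getLast? with
  | some (Sum.inl (i, Sum.inl _)) => Sum.inl (i, Sum.inl (some
      ((queriesOf (Pol.lg n) ys).getD (argBits u).length [])))
  | _ => if (argBits u).length = n then Sum.inr (some ((ys.getD n []).take (p n)))
    else Sum.inl ((argBits u).length, Sum.inr none)

theorem PT.pol {p : Pol} (hp : p.UnaryPolyTime) {α : Type} [Rep α] {n : α → ℕ} (hn : PT n) :
    PT (fun a => p (n a)) := by
  obtain ⟨P, hP⟩ := p.bounded
  refine (PT.of_polyTimeOn hp n (fun _ => Set.mem_univ _)
    ((hn.replicate (const true)).cons (const [])) P fun a _ => ?_).length.congr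
      fun a => by simp [unary]
  have h := hP a
  simp only [unary, List.length_replicate, encList]
  refine h.trans (eval_mono P ?_)
  simp

theorem PT.respond {p : Pol} (hp : p.UnaryPolyTime) {α : Type} [Rep α] {n : α → ℕ}
    {ys : α → List (List Bool)} {u : α → List LogSofM} (hn : PT n) (hy : PT ys) (hu : PT u) :
    PT (fun a => respond p (n a) (ys a) (u a)) := by
  have hb : PT (fun a => HOCrypto.argBits (u a)) := hu.argBits
  have h1 : PT (fun a => if decide ((HOCrypto.argBits (u a)).length = n a) then
      (Sum.inr (Option.some (((ys a).getD (n a) []).take (p (n a)))) : LogSofM)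
      else Sum.inl ((HOCrypto.argBits (u a)).length, Sum.inr none)) :=
    (hb.length.eq_nat hn).ite' (((PT.pol hp hn).take (hn.getD hy (const []))).some.inr)
      ((hb.length.pair (const (Sum.inr none))).inl)
  have h2 : PT (fun a => (u a).getLast?.bind fun m => m.getLeft?.bind fun x =>
      x.2.getLeft?.bind fun _ => Option.some x.1) :=
    hu.getLast?.bind (snd'.getLeft?.bind (snd'.snd.getLeft?.bind (fst'.snd.fst.some)))
  have h3 : PT (fun x : α × ℕ => (Sum.inl (x.2, Sum.inl (Option.some
      ((HOCrypto.queriesOf (Pol.lg (n x.1)) (ys x.1)).getD (HOCrypto.argBits (u x.1)).length []))) :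
        LogSofM)) :=
    (snd'.pair ((((hb.comp fst').length).getD ((hn.comp fst').queriesOf (hy.comp fst'))
      (const [])).some.inl)).inl
  refine h2.cases_option (f := fun a => if decide ((HOCrypto.argBits (u a)).length = n a) then
      (Sum.inr (Option.some (((ys a).getD (n a) []).take (p (n a)))) : LogSofM)
      else Sum.inl ((HOCrypto.argBits (u a)).length, Sum.inr none))
    (g := fun a i => Sum.inl (i, Sum.inl (Option.some
      ((HOCrypto.queriesOf (Pol.lg (n a)) (ys a)).getD (HOCrypto.argBits (u a)).length []))))
    (h1.restrict _) (h3.restrict _) (fun a h => ?_) (fun a i h => ?_)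
  · unfold HOCrypto.respond
    rcases e : (u a).getLast? with _ | (⟨j, _ | _⟩ | _) <;> simp [e] at h ⊢
  · unfold HOCrypto.respond
    rcases e : (u a).getLast? with _ | (⟨j, _ | _⟩ | _) <;> simp [e] at h ⊢
    exact h


/-! ### Alternation and prescribed moves -/

theorem altFrom_snoc {M : Type} {o : M → Bool} {s : List M} {x : M} : ∀ {b : Bool},
    AltFrom o b (s ++ [x]) ↔ AltFrom o b s ∧ o x = (b == decide (Even s.length)) := by
  induction s with
  | nil => intro b; cases b <;> simp [AltFrom]
  | cons y s ih =>
    intro b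
    rw [List.cons_append]
    simp only [AltFrom, ih, and_assoc, List.length_cons, Nat.even_add_one]
    by_cases h : Even s.length <;> cases b <;> simp [h]

theorem Game.isOpp_of_snoc {M : Type} {G : Game M} {n : ℕ} {s : List M} {x : M}
    (h : s ++ [x] ∈ G.legal n) : G.isOpp x = decide (Even s.length) := by
  simpa using (altFrom_snoc.1 (G.alternating n _ h)).2

theorem Game.mem_of_prefix {M : Type} {G : Game M} {n : ℕ} {s t : List M}
    (h : t ∈ G.legal n) (hs : s <+: t) : s ∈ G.legal n := by
  obtain ⟨r, rfl⟩ := hs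
  exact G.prefix_mem n s r h

/-- The player moves in `l`, played after `s`, are those prescribed by `next`. -/
def Obeys {M : Type} (next : List M → M) : List M → List M → Prop
  | _, [] => True
  | s, x :: l => (Odd s.length → x = next s) ∧ Obeys next (s ++ [x]) l

theorem obeys_append {M : Type} {next : List M → M} {l r : List M} : ∀ {s : List M},
    Obeys next s (l ++ r) ↔ Obeys next s l ∧ Obeys next (s ++ l) r := by
  induction l with
  | nil => intro s; simp [Obeys]
  | cons x l ih => intro s; simp [Obeys, ih, and_assoc]

theorem obeys_iff {M : Type} {next : List M → M} {l : List M} : ∀ {s : List M},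
    Obeys next s l ↔ ∀ u v x, l = u ++ x :: v → Odd (s ++ u).length → x = next (s ++ u) := by
  induction l with
  | nil => intro s; simp [Obeys]
  | cons y l ih =>
    intro s
    simp only [Obeys, ih]
    constructor
    · rintro ⟨h1, h2⟩ u v x h ho
      cases u with
      | nil => simp at h ho ⊢; rw [← h.1]; exact h1 ho
      | cons z u =>
        simp only [List.cons_append, List.cons.injEq] at h
        obtain ⟨rfl, rfl⟩ := h
        have := h2 u v x rfl (by simpa using ho)
        simpa using this
    · intro h
      refine ⟨fun ho => by simpa using h [] l y rfl (by simpa using ho), fun u v x e ho => ?_⟩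
      subst e
      have := h (y :: u) v x rfl (by simpa using ho)
      simpa using this

theorem mem_playsOf {M : Type} {L : Set (List M)} {next : List M → M} {s : List M} :
    s ∈ playsOf L next ↔ s ∈ L ∧ Even s.length ∧ Obeys next [] s := by
  simp only [playsOf, obeys_iff, List.nil_append]
  rfl

theorem mem_playsOf_snoc {M : Type} {G : Game M} {n : ℕ} {next : List M → M} {s : List M}
    {x y : M} : s ++ [x, y] ∈ playsOf (G.legal n) next ↔
      s ∈ playsOf (G.legal n) next ∧ s ++ [x, y] ∈ G.legal n ∧ y = next (s ++ [x]) := by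
  simp only [mem_playsOf, obeys_append, Obeys, List.nil_append, and_true]
  constructor
  · rintro ⟨h1, h2, h3, h4, h5⟩
    have he : Even s.length := by simpa [Nat.even_add] using h2
    exact ⟨⟨G.mem_of_prefix h1 (by simp), he, h3⟩, h1,
      h5 (by simpa [Nat.odd_add_one] using he)⟩
  · rintro ⟨⟨h1, h2, h3⟩, h4, h5⟩
    refine ⟨h4, by simpa [Nat.even_add] using h2, h3, fun ho => ?_, fun _ => h5⟩
    exact absurd h2 (Nat.not_even_iff_odd.2 ho)

theorem exists_snoc₂ {M : Type} {s : List M} (h : Even s.length) (h0 : s ≠ []) :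
    ∃ t x y, s = t ++ [x, y] := by
  rcases List.eq_nil_or_concat s with rfl | ⟨t, y, rfl⟩
  · exact absurd rfl h0
  rcases List.eq_nil_or_concat t with rfl | ⟨t, x, rfl⟩
  · simp at h
  · exact ⟨t, x, y, by simp⟩

/-- Induction on the plays of a strategy. -/
theorem playsOf_induction {M : Type} {G : Game M} {n : ℕ} {next : List M → M}
    {C : List M → Prop} (h0 : C [])
    (h : ∀ s x, s ∈ playsOf (G.legal n) next → C s → s ++ [x] ∈ G.legal n →
      s ++ [x, next (s ++ [x])] ∈ G.legal n → C (s ++ [x, next (s ++ [x])])) :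
    ∀ s ∈ playsOf (G.legal n) next, C s := by
  intro s
  induction hn : s.length using Nat.strong_induction_on generalizing s with
  | _ k ih =>
    intro hs
    by_cases h0' : s = []
    · rwa [h0']
    · obtain ⟨t, x, y, rfl⟩ := exists_snoc₂ hs.2.1 h0'
      obtain ⟨h1, h2, rfl⟩ := mem_playsOf_snoc.1 hs
      subst hn
      exact h t x h1 (ih _ (by simp) t rfl h1) (G.mem_of_prefix h2 (by simp)) h2

/-- For prescribed moves, determinism and closure under prefixes are automatic; totality is the only
condition with content, and it amounts to the legality of the prescribed answer. -/
theorem isStrategy_playsOf {M : Type} {G : Game M} (next : ℕ → List M → M)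
    (h : ∀ n s x, s ∈ playsOf (G.legal n) (next n) → s ++ [x] ∈ G.legal n →
      s ++ [x, next n (s ++ [x])] ∈ G.legal n) :
    IsStrategy G fun n => playsOf (G.legal n) (next n) where
  nil_mem n := mem_playsOf.2 ⟨G.nil_mem n, by simp, trivial⟩
  legal n s hs := ⟨hs.1, hs.2.1⟩
  prefix_mem n s x y hs := (mem_playsOf_snoc.1 hs).1
  deterministic n s x y z h1 h2 := by
    rw [(mem_playsOf_snoc.1 h1).2.2, (mem_playsOf_snoc.1 h2).2.2]
  total n s x hs hx := ⟨_, mem_playsOf_snoc.2 ⟨hs, h n s x hs hx, rfl⟩⟩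

/-! ### Copies used one after the other -/

section

variable {M N : Type} (s : List (M ⊕ N))

@[simp] theorem onLeft_nil : onLeft ([] : List (M ⊕ N)) = [] := rfl
@[simp] theorem onLeft_inl (m : M) : onLeft (Sum.inl m :: s) = m :: onLeft s := rfl
@[simp] theorem onLeft_inr (m : N) : onLeft (Sum.inr m :: s) = onLeft s := rfl
@[simp] theorem onRight_nil : onRight ([] : List (M ⊕ N)) = [] := rfl
@[simp] theorem onRight_inl (m : M) : onRight (Sum.inl m :: s) = onRight s := rfl
@[simp] theorem onRight_inr (m : N) : onRight (Sum.inr m :: s) = m :: onRight s := rfl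

end

@[simp] theorem onLeft_append {M N : Type} (s t : List (M ⊕ N)) : onLeft (s ++ t) = onLeft s ++ onLeft t := by
  simp [onLeft]

@[simp] theorem onRight_append {M N : Type} (s t : List (M ⊕ N)) :
    onRight (s ++ t) = onRight s ++ onRight t := by
  simp [onRight]

theorem proj_append {M : Type} (i : ℕ) (s t : List (ℕ × M)) :
    proj i (s ++ t) = proj i s ++ proj i t := by
  simp [proj]

theorem proj_map {M : Type} (i c : ℕ) (x : List M) :
    proj i (x.map fun m => (c, m)) = if c = i then x else [] := by
  induction x with
  | nil => simp [proj]
  | cons m x ih =>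
    simp only [proj] at ih ⊢
    by_cases h : c = i <;> simp [h] at ih ⊢

theorem proj_eq_nil {M : Type} {i : ℕ} {l : List (ℕ × M)} (h : ∀ m ∈ l, m.1 ≠ i) :
    proj i l = [] := by
  simp only [proj, List.filterMap_eq_nil_iff]
  intro m hm
  simp [h m hm]

/-- The copies `0, …, c - 1` have been opened in `l`, and it is the turn of the opponent everywhere. -/
structure Slots {M : Type} (G : Game M) (q : Pol) (n : ℕ) (l : List (ℕ × M)) (c : ℕ) : Prop where
  legal : l ∈ (bang q G).legal n
  even_proj : ∀ i, Even (proj i l).length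
  even : Even l.length
  lt : ∀ m ∈ l, m.1 < c
  opened : ∀ i < c, ∃ y, (i, y) ∈ l

theorem Slots.nil {M : Type} (G : Game M) (q : Pol) (n : ℕ) : Slots G q n [] 0 :=
  ⟨Game.nil_mem _ n, by simp [proj], by simp, by simp, by simp⟩

/-- The moves of `x` are played consecutively in the fresh copy `c`. No earlier move belongs to this
copy, and alternation continues because `l` has even length; copy `c - 1` has been opened already,
so the order of opening is respected. -/
theorem Slots.extend {M : Type} {G : Game M} {q : Pol} {n : ℕ} {l : List (ℕ × M)} {c : ℕ}
    (h : Slots G q n l c) (hc : c < q n) {x : List M} (hx : x ∈ G.legal n) :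
    l ++ x.map (fun m => (c, m)) ∈ (bang q G).legal n := by
  obtain ⟨h0, h1, h2, h3⟩ := h.legal
  refine ⟨?_, fun i => ?_, ?_, ?_⟩
  · have hx' := G.alternating n x hx
    clear hx
    induction x using List.reverseRecOn with
    | nil => simpa using h0
    | append_singleton x m ih =>
      rw [List.map_append, ← List.append_assoc]
      obtain ⟨h4, h5⟩ := altFrom_snoc.1 hx'
      refine altFrom_snoc.2 ⟨ih h4, ?_⟩
      have := h.even
      simp [h5, Nat.even_add, this]
  · rw [proj_append, proj_map]
    split_ifs with e
    · rw [proj_eq_nil fun m hm => (e ▸ h.lt m hm).ne]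
      exact hx
    · simpa using h1 i
  · intro m hm
    simp only [List.mem_append, List.mem_map] at hm
    rcases hm with hm | ⟨y, -, rfl⟩
    · exact h2 m hm
    · exact hc
  · intro u v i y e
    rcases List.append_eq_append_iff.1 e with ⟨r, h4, h5⟩ | ⟨r, h4, h5⟩
    · have : (i + 1, y) ∈ x.map (fun m => (c, m)) := by rw [h5]; simp
      simp only [List.mem_map, Prod.mk.injEq] at this
      obtain ⟨_, _, h6, _⟩ := this
      obtain ⟨z, hz⟩ := h.opened i (by omega)
      exact ⟨z, by rw [h4]; simp [hz]⟩
    · cases r with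
      | nil =>
        simp only [List.append_nil, List.nil_append] at h4 h5
        have : (i + 1, y) ∈ x.map (fun m => (c, m)) := by rw [← h5]; simp
        simp only [List.mem_map, Prod.mk.injEq] at this
        obtain ⟨_, _, h6, _⟩ := this
        obtain ⟨z, hz⟩ := h.opened i (by omega)
        exact ⟨z, by rw [← h4]; exact hz⟩
      | cons a r =>
        simp only [List.cons_append, List.cons.injEq] at h5
        obtain ⟨rfl, -⟩ := h5
        exact h3 u r i y h4

theorem Slots.succ {M : Type} {G : Game M} {q : Pol} {n : ℕ} {l : List (ℕ × M)} {c : ℕ}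
    (h : Slots G q n l c) (hc : c < q n) {x : List M} (hx : x ∈ G.legal n) (he : Even x.length)
    (h0 : x ≠ []) : Slots G q n (l ++ x.map (fun m => (c, m))) (c + 1) where
  legal := h.extend hc hx
  even_proj i := by
    rw [proj_append, proj_map]
    have := h.even_proj i
    split_ifs <;> simp [Nat.even_add, this, he]
  even := by simp [Nat.even_add, h.even, he]
  lt m hm := by
    simp only [List.mem_append, List.mem_map] at hm
    rcases hm with hm | ⟨y, -, rfl⟩
    · exact (h.lt m hm).trans (by omega)
    · simp
  opened i hi := by
    rcases Nat.lt_succ_iff_lt_or_eq.1 hi with hi | rfl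
    · obtain ⟨y, hy⟩ := h.opened i hi
      exact ⟨y, by simp [hy]⟩
    · obtain ⟨y, hy⟩ := List.exists_mem_of_ne_nil x h0
      exact ⟨y, by simp [hy]⟩

/-! ### Interaction -/

section Interaction

variable {M N K : Type}

/-- The moves of an interaction sequence that are seen by the first strategy. -/
def seenLeft (u : List (M ⊕ (N ⊕ K))) : List (M ⊕ N) :=
  u.filterMap (Sum.elim (fun m => some (Sum.inl m))
    (Sum.elim (fun m => some (Sum.inr m)) (fun _ => none)))

/-- The moves of an interaction sequence that are seen from outside. -/
def seenOut {M N K : Type} (u : List (M ⊕ (N ⊕ K))) : List (M ⊕ K) :=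
  u.filterMap (Sum.elim (fun m => some (Sum.inl m))
    (Sum.elim (fun _ => none) (fun m => some (Sum.inr m))))

section

variable (u : List (M ⊕ (N ⊕ K)))

@[simp] theorem seenLeft_nil : seenLeft ([] : List (M ⊕ (N ⊕ K))) = [] := rfl
@[simp] theorem seenLeft_left (m : M) :
    seenLeft (Sum.inl m :: u) = Sum.inl m :: seenLeft u := rfl
@[simp] theorem seenLeft_mid (m : N) :
    seenLeft (Sum.inr (Sum.inl m) :: u) = Sum.inr m :: seenLeft u := rfl
@[simp] theorem seenLeft_right (m : K) :
    seenLeft (Sum.inr (Sum.inr m) :: u) = seenLeft u := rfl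
@[simp] theorem seenOut_nil : seenOut ([] : List (M ⊕ (N ⊕ K))) = [] := rfl
@[simp] theorem seenOut_left (m : M) :
    seenOut (Sum.inl m :: u) = Sum.inl m :: seenOut u := rfl
@[simp] theorem seenOut_mid (m : N) :
    seenOut (Sum.inr (Sum.inl m) :: u) = seenOut u := rfl
@[simp] theorem seenOut_right (m : K) :
    seenOut (Sum.inr (Sum.inr m) :: u) = Sum.inr m :: seenOut u := rfl

end

@[simp] theorem seenLeft_append (u v : List (M ⊕ (N ⊕ K))) :
    seenLeft (u ++ v) = seenLeft u ++ seenLeft v := by simp [seenLeft]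

@[simp] theorem seenOut_append (u v : List (M ⊕ (N ⊕ K))) :
    seenOut (u ++ v) = seenOut u ++ seenOut v := by simp [seenOut]

theorem onLeft_seenLeft (u : List (M ⊕ (N ⊕ K))) : onLeft (seenLeft u) = onLeft u := by
  induction u with
  | nil => rfl
  | cons x u ih => rcases x with m | m | m <;> simp_all

theorem onRight_seenLeft (u : List (M ⊕ (N ⊕ K))) : onRight (seenLeft u) = onLeft (onRight u) := by
  induction u with
  | nil => rfl
  | cons x u ih => rcases x with m | m | m <;> simp_all

theorem onLeft_seenOut (u : List (M ⊕ (N ⊕ K))) : onLeft (seenOut u) = onLeft u := by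
  induction u with
  | nil => rfl
  | cons x u ih => rcases x with m | m | m <;> simp_all

theorem onRight_seenOut (u : List (M ⊕ (N ⊕ K))) : onRight (seenOut u) = onRight (onRight u) := by
  induction u with
  | nil => rfl
  | cons x u ih => rcases x with m | m | m <;> simp_all

theorem length_onLeft_add {M N : Type} (u : List (M ⊕ N)) :
    (onLeft u).length + (onRight u).length = u.length := by
  induction u with
  | nil => rfl
  | cons x u ih => rcases x with m | m <;> simp <;> omega

theorem length_seenLeft (u : List (M ⊕ (N ⊕ K))) :
    (seenLeft u).length = (onLeft u).length + (onLeft (onRight u)).length := by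
  rw [← length_onLeft_add, onLeft_seenLeft, onRight_seenLeft]

theorem length_seenOut (u : List (M ⊕ (N ⊕ K))) :
    (seenOut u).length = (onLeft u).length + (onRight (onRight u)).length := by
  rw [← length_onLeft_add, onLeft_seenOut, onRight_seenOut]

variable (G : Game M) (H : Game N) (E : Game K) (n : ℕ) (f : List (M ⊕ N) → M ⊕ N)
  (g : List (N ⊕ K) → N ⊕ K)

/-- Interaction sequences of two strategies given by prescribed moves. -/
structure Interaction (u : List (M ⊕ (N ⊕ K))) : Prop where
  left : seenLeft u ∈ (lolli G H).legal n
  right : onRight u ∈ (lolli H E).legal n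
  obeys_left : Obeys f [] (seenLeft u)
  obeys_right : Obeys g [] (onRight u)

variable {G H E n f g}

theorem Interaction.of_append {u v : List (M ⊕ (N ⊕ K))} (h : Interaction G H E n f g (u ++ v)) :
    Interaction G H E n f g u := by
  obtain ⟨h1, h2, h3, h4⟩ := h
  rw [seenLeft_append] at h1 h3
  rw [onRight_append] at h2 h4
  exact ⟨Game.prefix_mem _ _ _ _ h1, Game.prefix_mem _ _ _ _ h2, (obeys_append.1 h3).1,
    (obeys_append.1 h4).1⟩

/-- The polarity of the move can be computed from its own game and from a functional game that
contains it. Comparing the two parities determines the parity of the other component. The two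
theorems that follow use the same argument; a middle move belongs to two functional games and gives
two conditions. -/
theorem Interaction.of_left {u : List (M ⊕ (N ⊕ K))} {m : M}
    (h : Interaction G H E n f g (u ++ [Sum.inl m])) : Odd (onLeft (onRight u)).length := by
  have h1 := h.left
  rw [seenLeft_append] at h1
  have h2 := Game.isOpp_of_snoc h1
  have h3 := h1.2.1
  rw [onLeft_append, onLeft_seenLeft] at h3
  have h4 := Game.isOpp_of_snoc (G := G) (x := m) h3
  rw [length_seenLeft] at h2
  simp only [lolli, Sum.elim_inl, h4] at h2
  by_contra h5
  rw [Nat.not_odd_iff_even] at h5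
  simp [Nat.even_add, h5] at h2

theorem Interaction.of_mid {u : List (M ⊕ (N ⊕ K))} {m : N}
    (h : Interaction G H E n f g (u ++ [Sum.inr (Sum.inl m)])) :
    Even (onLeft u).length ∧ Odd (onRight (onRight u)).length := by
  have h1 := h.left
  have h1' := h.right
  rw [seenLeft_append] at h1
  rw [onRight_append] at h1'
  have h2 := Game.isOpp_of_snoc h1
  have h2' := Game.isOpp_of_snoc (x := Sum.inl m) h1'
  have h3 := h1'.2.1
  rw [onLeft_append] at h3
  have h4 := Game.isOpp_of_snoc (G := H) (x := m) h3
  rw [length_seenLeft] at h2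
  rw [← length_onLeft_add] at h2'
  simp only [lolli, Sum.elim_inl, Sum.elim_inr, h4] at h2 h2'
  by_contra h5
  rw [not_and_or, Nat.not_odd_iff_even] at h5
  by_cases h6 : Even (onLeft (onRight u)).length <;> simp [Nat.even_add, h6] at h2 h2' <;>
    rcases h5 with h5 | h5 <;> simp_all [← Nat.not_even_iff_odd]

theorem Interaction.of_right {u : List (M ⊕ (N ⊕ K))} {m : K}
    (h : Interaction G H E n f g (u ++ [Sum.inr (Sum.inr m)])) :
    Even (onLeft (onRight u)).length := by
  have h1' := h.right
  rw [onRight_append] at h1'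
  have h2' := Game.isOpp_of_snoc (x := Sum.inr m) h1'
  have h3 := h1'.2.2
  rw [onRight_append] at h3
  have h4 := Game.isOpp_of_snoc (G := E) (x := m) h3
  rw [← length_onLeft_add] at h2'
  simp only [lolli, Sum.elim_inr, h4] at h2'
  by_contra h5
  by_cases h6 : Even (onRight (onRight u)).length <;> simp [Nat.even_add, h5, h6] at h2'

/-- This is the state diagram of an interaction. Writing the parities of the left, middle and right
parts, only even-even-even, even-even-odd, even-odd-odd and odd-odd-odd occur. In the two extreme
states the environment moves; in the others the second and the first strategy do, respectively. -/
theorem Interaction.parity {u : List (M ⊕ (N ⊕ K))} (h : Interaction G H E n f g u) :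
    (Odd (onLeft u).length → Odd (onLeft (onRight u)).length) ∧
      (Odd (onLeft (onRight u)).length → Odd (onRight (onRight u)).length) := by
  induction u using List.reverseRecOn with
  | nil => simp [onLeft, onRight]
  | append_singleton u x ih =>
    obtain ⟨ih1, ih2⟩ := ih h.of_append
    rcases x with m | m | m
    · have := h.of_left
      have h0 : onRight (u ++ [Sum.inl m]) = onRight u := by simp [onRight]
      rw [h0]
      exact ⟨fun _ => this, ih2⟩
    · have := h.of_mid
      have h0 : onRight (u ++ [Sum.inr (Sum.inl m)]) = onRight u ++ [Sum.inl m] := by simp [onRight]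
      have h1 : onLeft (u ++ [Sum.inr (Sum.inl m)]) = onLeft u := by simp [onLeft]
      rw [h0, h1, onRight_append]
      refine ⟨fun h => absurd this.1 (Nat.not_even_iff_odd.2 h), fun _ => ?_⟩
      simpa using this.2
    · have := h.of_right
      have h0 : onRight (u ++ [Sum.inr (Sum.inr m)]) = onRight u ++ [Sum.inr m] := by simp [onRight]
      have h1 : onLeft (u ++ [Sum.inr (Sum.inr m)]) = onLeft u := by simp [onLeft]
      have h2 : onLeft (onRight u ++ [Sum.inr m]) = onLeft (onRight u) := by simp [onLeft]
      rw [h0, h1, h2]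
      exact ⟨ih1, fun h => absurd this (Nat.not_even_iff_odd.2 h)⟩

/-- It is the turn of the environment. -/
def EnvTurn (u : List (M ⊕ (N ⊕ K))) : Prop :=
  Even (seenLeft u).length ∧ Even (onRight u).length

/-- By the state diagram, when it is not the turn of the environment exactly one of the two
strategies is to move, and neither the environment nor the other strategy can. The next move is
therefore prescribed by `f` or by `g`. -/
theorem Interaction.deterministic {u : List (M ⊕ (N ⊕ K))} {x y : M ⊕ (N ⊕ K)}
    (hx : Interaction G H E n f g (u ++ [x])) (hy : Interaction G H E n f g (u ++ [y]))
    (h : ¬ EnvTurn u) : x = y := by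
  obtain ⟨h1, h2⟩ := hx.of_append.parity
  have hl : ∀ z, Interaction G H E n f g (u ++ [z]) → Odd (seenLeft u).length →
      z = (f (seenLeft u)).elim Sum.inl fun m => Sum.inr (Sum.inl m) := by
    intro z hz ho
    rcases z with m | m | m
    · have := hz.obeys_left
      rw [seenLeft_append, obeys_append] at this
      have := this.2.1 (by simpa using ho)
      simp only [List.nil_append] at this
      rw [← this]
      rfl
    · have := hz.obeys_left
      rw [seenLeft_append, obeys_append] at this
      have := this.2.1 (by simpa using ho)
      simp only [List.nil_append] at this
      rw [← this]
      rfl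
    · have := hz.of_right
      rw [length_seenLeft] at ho
      rw [Nat.odd_add] at ho
      have := h1 (ho.2 this)
      rw [← Nat.not_even_iff_odd] at this
      contradiction
  have hr : ∀ z, Interaction G H E n f g (u ++ [z]) → Odd (onRight u).length →
      z = Sum.inr (g (onRight u)) := by
    intro z hz ho
    rcases z with m | m
    · have := hz.of_left
      rw [← length_onLeft_add] at ho
      have h3 := h2 this
      rw [Nat.odd_add] at ho
      exact absurd (ho.1 this) (Nat.not_even_iff_odd.2 h3)
    · have := hz.obeys_right
      rw [onRight_append, obeys_append] at this
      have := this.2.1 (by simpa using ho)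
      simp only [List.nil_append] at this
      rw [← this]
  rw [EnvTurn, not_and_or, Nat.not_even_iff_odd, Nat.not_even_iff_odd] at h
  rcases h with h | h
  · exact (hl x hx h).trans (hl y hy h).symm
  · exact (hr x hx h).trans (hr y hy h).symm

theorem Interaction.seenOut_mem {u : List (M ⊕ (N ⊕ K))} (h : Interaction G H E n f g u) :
    seenOut u ∈ (lolli G E).legal n := by
  refine ⟨?_, ?_, ?_⟩
  · induction u using List.reverseRecOn with
    | nil => trivial
    | append_singleton u x ih =>
      have ih := ih h.of_append
      obtain ⟨h1, h2⟩ := h.of_append.parity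
      rw [seenOut_append]
      rcases x with m | m | m
      · have h5 := h.left.2.1
        rw [onLeft_seenLeft, onLeft_append] at h5
        have h6 := Game.isOpp_of_snoc (G := G) (x := m) h5
        have h7 := h.of_left
        have h8 := h2 h7
        refine altFrom_snoc.2 ⟨ih, ?_⟩
        rw [length_seenOut]
        rw [← Nat.not_even_iff_odd] at h8
        by_cases h9 : Even (onLeft u).length <;> simp [h6, Nat.even_add, h8, h9]
      · simpa using ih
      · have h5 := h.right.2.2
        rw [onRight_append, onRight_append] at h5
        have h6 := Game.isOpp_of_snoc (G := E) (x := m) h5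
        have h7 := h.of_right
        have h8 : Even (onLeft u).length := by
          by_contra h8
          rw [Nat.not_even_iff_odd] at h8
          exact Nat.not_even_iff_odd.2 (h1 h8) h7
        refine altFrom_snoc.2 ⟨ih, ?_⟩
        rw [length_seenOut]
        simp [h6, Nat.even_add, h8]
  · rw [onLeft_seenOut, ← onLeft_seenLeft]
    exact h.left.2.1
  · rw [onRight_seenOut]
    exact h.right.2.2

/-- An outside move as a move of an interaction sequence. -/
def ofOut : M ⊕ K → M ⊕ (N ⊕ K) := Sum.map id Sum.inr

theorem Interaction.env {u : List (M ⊕ (N ⊕ K))} {x : M ⊕ (N ⊕ K)}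
    (hx : Interaction G H E n f g (u ++ [x])) (h : EnvTurn u) : ∃ o, x = ofOut o := by
  obtain ⟨h3, h4⟩ := h
  rw [length_seenLeft] at h3
  rw [← length_onLeft_add] at h4
  rcases x with m | m | m
  · exact ⟨Sum.inl m, rfl⟩
  · obtain ⟨h5, h6⟩ := hx.of_mid
    rw [Nat.even_add] at h3 h4
    exact absurd (h4.1 (h3.1 h5)) (Nat.not_even_iff_odd.2 h6)
  · exact ⟨Sum.inr m, rfl⟩

theorem seenOut_ofOut (o : M ⊕ K) : seenOut [(ofOut o : M ⊕ (N ⊕ K))] = [o] := by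
  cases o <;> rfl

theorem EnvTurn.even_seenOut {u : List (M ⊕ (N ⊕ K))} (h : EnvTurn u) :
    Even (seenOut u).length := by
  obtain ⟨h3, h4⟩ := h
  rw [length_seenLeft] at h3
  rw [← length_onLeft_add] at h4
  rw [length_seenOut]
  rw [Nat.even_add] at h3 h4 ⊢
  rw [h3, h4]

/-- A composition of strategies given by prescribed moves is again given by prescribed moves, if
every outside move leads to a finite exchange that ends with an outside move. -/
theorem comp_playsOf {C : List (M ⊕ (N ⊕ K)) → Prop} {next : List (M ⊕ K) → M ⊕ K}
    {σ : Plays (M ⊕ N)} {τ : Plays (N ⊕ K)} (hσ : σ n = playsOf ((lolli G H).legal n) f)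
    (hτ : τ n = playsOf ((lolli H E).legal n) g) (h0 : C [])
    (hC : ∀ e, C e → Interaction G H E n f g e ∧ EnvTurn e)
    (hstep : ∀ e o, C e → seenOut e ++ [o] ∈ (lolli G E).legal n →
      ∃ I : List N, C (e ++ ofOut o :: I.map (fun m => Sum.inr (Sum.inl m)) ++
        [ofOut (next (seenOut e ++ [o]))])) :
    comp σ τ n = playsOf ((lolli G E).legal n) next ∧
      (∀ s ∈ playsOf ((lolli G E).legal n) next, ∃ e, C e ∧ seenOut e = s) ∧
      ∀ s ∈ playsOf ((lolli G E).legal n) next, ∀ o, s ++ [o] ∈ (lolli G E).legal n →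
        s ++ [o, next (s ++ [o])] ∈ playsOf ((lolli G E).legal n) next := by
  have hmid (I : List N) : seenOut (I.map fun m => (Sum.inr (Sum.inl m) : M ⊕ (N ⊕ K))) = [] := by
    induction I <;> simp_all
  have hout (e : List (M ⊕ (N ⊕ K))) (o r : M ⊕ K) (I : List N) :
      seenOut (e ++ ofOut o :: I.map (fun m => Sum.inr (Sum.inl m)) ++ [ofOut r]) =
      seenOut e ++ [o, r] := by
    rw [← List.singleton_append, ← List.append_assoc, seenOut_append, seenOut_append,
      seenOut_append, hmid, seenOut_ofOut, seenOut_ofOut]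
    simp
  have key : ∀ e, C e → seenOut e ∈ playsOf ((lolli G E).legal n) next →
      ∀ o, seenOut e ++ [o] ∈ (lolli G E).legal n →
      seenOut e ++ [o, next (seenOut e ++ [o])] ∈ playsOf ((lolli G E).legal n) next := by
    intro e he hs o ho
    obtain ⟨I, hI⟩ := hstep e o he ho
    have h1 := (hC _ hI).1.seenOut_mem
    rw [hout] at h1
    exact mem_playsOf_snoc.2 ⟨hs, h1, rfl⟩
  have hex : ∀ s ∈ playsOf ((lolli G E).legal n) next, ∃ e, C e ∧ seenOut e = s := by
    refine playsOf_induction (C := fun s => ∃ e, C e ∧ seenOut e = s) ⟨[], h0, rfl⟩ ?_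
    rintro _ o - ⟨e, he, rfl⟩ ho -
    obtain ⟨I, hI⟩ := hstep e o he ho
    exact ⟨_, hI, hout _ _ _ _⟩
  refine ⟨Set.ext fun s => ⟨?_, fun hs => ?_⟩, hex, fun s hs o ho => ?_⟩
  · rintro ⟨u, hu1, hu2, rfl⟩
    rw [hσ] at hu1
    rw [hτ] at hu2
    obtain ⟨h1, h2, h3⟩ := mem_playsOf.1 hu1
    obtain ⟨h4, h5, h6⟩ := mem_playsOf.1 hu2
    have hu : Interaction G H E n f g u := ⟨h1, h4, h3, h6⟩
    have het : EnvTurn u := ⟨h2, h5⟩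
    clear hu1 hu2 h1 h2 h3 h4 h5 h6
    -- Every interaction, finished or not, is shown to be either a known one or an initial part of
    -- the scripted exchange after one more outside move: `I` has been played, `J` and then `r` are
    -- still to come. Determinism forces each new move to follow the script, so at a turn of the
    -- environment the second case is impossible.
    suffices ∃ e, C e ∧ seenOut e ∈ playsOf ((lolli G E).legal n) next ∧ (u = e ∨
        ∃ (o : M ⊕ K) (I J : List N) (r : M ⊕ K), u = e ++ ofOut o :: I.map (fun m => Sum.inr (Sum.inl m)) ∧
        seenOut e ++ [o] ∈ (lolli G E).legal n ∧
        C (e ++ ofOut o :: (I ++ J).map (fun m => Sum.inr (Sum.inl m)) ++ [ofOut r]) ∧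
        r = next (seenOut e ++ [o])) by
      obtain ⟨e, -, he, rfl | ⟨o, I, J, r, rfl, -⟩⟩ := this
      · exact he
      · have := het.even_seenOut
        rw [← List.singleton_append, ← List.append_assoc, seenOut_append, seenOut_append,
          hmid, seenOut_ofOut] at this
        have h2 := he.2.1
        simp [Nat.even_add_one, h2] at this
    clear het
    induction u using List.reverseRecOn with
    | nil => exact ⟨[], h0, mem_playsOf.2 ⟨Game.nil_mem _ _, by simp, trivial⟩, Or.inl rfl⟩
    | append_singleton u x ih =>
      obtain ⟨e, he, hs, rfl | ⟨o, I, J, r, rfl, ho, hI, hr⟩⟩ := ih hu.of_append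
      · obtain ⟨o, rfl⟩ := hu.env (hC _ he).2
        have ho := hu.seenOut_mem
        rw [seenOut_append, seenOut_ofOut] at ho
        obtain ⟨J, hJ⟩ := hstep _ o he ho
        exact ⟨u, he, hs, Or.inr ⟨o, [], J, _, by simp, ho, by simpa using hJ, rfl⟩⟩
      · have hne : ¬ EnvTurn (e ++ ofOut o :: I.map (fun m => Sum.inr (Sum.inl m))) := by
          intro het
          have := het.even_seenOut
          rw [← List.singleton_append, ← List.append_assoc, seenOut_append, seenOut_append,
            hmid, seenOut_ofOut] at this
          have h2 := hs.2.1
          simp [Nat.even_add_one, h2] at this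
        cases J with
        | nil =>
          rw [List.append_nil] at hI
          have := hu.deterministic (hC _ hI).1 hne
          refine ⟨_, hI, ?_, Or.inl (by rw [this])⟩
          rw [hout, hr]
          exact key e he hs o ho
        | cons y J =>
          have h1 := (hC _ hI).1
          rw [show e ++ ofOut o :: (I ++ y :: J).map (fun m => Sum.inr (Sum.inl m)) ++ [ofOut r] =
            (e ++ ofOut o :: I.map (fun m => Sum.inr (Sum.inl m)) ++ [Sum.inr (Sum.inl y)]) ++
              (J.map (fun m => Sum.inr (Sum.inl m)) ++ [ofOut r]) by simp] at h1
          have := hu.deterministic h1.of_append hne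
          exact ⟨e, he, hs, Or.inr ⟨o, I ++ [y], J, r, by simp [this], ho, by simpa using hI, hr⟩⟩
  · obtain ⟨e, he, rfl⟩ := hex s hs
    obtain ⟨⟨h1, h2, h3, h4⟩, h5, h6⟩ := hC e he
    refine ⟨e, ?_, ?_, rfl⟩
    · rw [hσ]
      exact mem_playsOf.2 ⟨h1, h5, h3⟩
    · rw [hτ]
      exact mem_playsOf.2 ⟨h2, h6, h4⟩
  · obtain ⟨e, he, rfl⟩ := hex s hs
    exact key e he hs o ho

end Interaction


/-! ### The plays of nested strategies -/

/-- The game of the functional argument. -/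
abbrev queryGame : Game (StrM ⊕ Option Bool) := lolli (strGame Pol.lg) boolGame

theorem strGame_legal {p : Pol} {n : ℕ} {x : List Bool} (h : x.length = p n) :
    [none, some x] ∈ (strGame p).legal n := Or.inr (Or.inr ⟨x, h, rfl⟩)

theorem boolGame_legal {n : ℕ} (z : Bool) : [none, some z] ∈ boolGame.legal n :=
  Or.inr (Or.inr ⟨z, Set.mem_univ _, rfl⟩)

theorem queryGame_legal_bit {n : ℕ} (z : Bool) :
    [Sum.inr none, Sum.inr (some z)] ∈ queryGame.legal n :=
  ⟨by simp [AltFrom, boolGame, ground, strGame], Game.nil_mem _ _, boolGame_legal z⟩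

theorem queryGame_legal_query {n : ℕ} {q : List Bool} (hq : q.length = Pol.lg n) (z : Bool) :
    [Sum.inr none, Sum.inl none, Sum.inl (some q), Sum.inr (some z)] ∈ queryGame.legal n :=
  ⟨by simp [AltFrom, boolGame, ground, strGame], strGame_legal hq, boolGame_legal z⟩

theorem argBits_append (s t : List LogSofM) : argBits (s ++ t) = argBits s ++ argBits t := by
  simp [argBits]

/-- After `u`, the argument function has been queried and has answered with the bits `t`, in this
order and one query after the other; it is the turn of the player. -/
structure Ready (p : Pol) (n : ℕ) (u : List LogSofM) (t : List Bool) : Prop where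
  length_le : t.length ≤ n
  slots : Slots queryGame Pol.iota n (onLeft u) t.length
  right : onRight u = [none]
  alt : AltFrom (logSof p).isOpp true u
  bits : argBits u = t
  last : ∀ i m, u.getLast? ≠ some (Sum.inl (i, Sum.inl m))

/-- The even-length plays of `logSof p` in which the player queries its argument `n` times, one
query after the other, and then returns a result. -/
inductive Nested (p : Pol) (n : ℕ) : List LogSofM → Prop
  | nil : Nested p n []
  | ask {u t} (h : Ready p n u t) (ht : t.length < n) :
    Nested p n (u ++ [Sum.inl (t.length, Sum.inr none)])
  | query {u t} (h : Ready p n u t) (ht : t.length < n) {q : List Bool}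
    (hq : q.length = Pol.lg n) :
    Nested p n (u ++ [Sum.inl (t.length, Sum.inr none), Sum.inl (t.length, Sum.inl none),
      Sum.inl (t.length, Sum.inl (some q))])
  | result {u t} (h : Ready p n u t) (ht : t.length = n) {r : List Bool} (hr : r.length = p n) :
    Nested p n (u ++ [Sum.inr (some r)])

variable {p : Pol} {n : ℕ}

theorem Ready.length {u : List LogSofM} {t : List Bool} (h : Ready p n u t) : Odd u.length := by
  rw [← length_onLeft_add, h.right, List.length_singleton]
  exact h.slots.even.add_one

theorem ready_start : Ready p n [Sum.inr none] [] :=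
  ⟨by simp, Slots.nil _ _ _, rfl, by simp [AltFrom, logSof, lolli, strGame, ground], rfl, by simp⟩

theorem onLeft_map {M N : Type} (x : List M) : onLeft (x.map (Sum.inl : M → M ⊕ N)) = x := by
  induction x <;> simp_all

theorem onRight_map {M N : Type} (x : List M) : onRight (x.map (Sum.inl : M → M ⊕ N)) = [] := by
  induction x <;> simp_all

theorem altFrom_append {M : Type} {o : M → Bool} {s r : List M} {b : Bool} :
    AltFrom o b (s ++ r) ↔ AltFrom o b s ∧ AltFrom o (b == decide (Even s.length)) r := by
  induction s generalizing b with
  | nil => cases b <;> simp [AltFrom]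
  | cons x s ih =>
    simp only [List.cons_append, AltFrom, ih, and_assoc, List.length_cons, Nat.even_add_one]
    by_cases h : Even s.length <;> cases b <;> simp [h]

theorem Ready.alt_extend {u : List LogSofM} {t : List Bool} (h : Ready p n u t)
    {x : List (StrM ⊕ Option Bool)} (hx : AltFrom queryGame.isOpp true x) :
    AltFrom (logSof p).isOpp true (u ++ x.map (fun m => Sum.inl (t.length, m))) := by
  rw [altFrom_append]
  refine ⟨h.alt, ?_⟩
  have h1 := h.length
  rw [← Nat.not_even_iff_odd] at h1
  simp only [h1, decide_false]
  suffices ∀ b, AltFrom queryGame.isOpp b x →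
      AltFrom (logSof p).isOpp (!b) (x.map (fun m => Sum.inl (t.length, m))) from this true hx
  clear hx
  induction x with
  | nil => intros; trivial
  | cons m x ih =>
    rintro b ⟨h1, h2⟩
    refine ⟨?_, ih _ h2⟩
    rw [← h1]
    rfl

theorem Ready.legal_extend {u : List LogSofM} {t : List Bool} (h : Ready p n u t)
    (ht : t.length < n) {x : List (StrM ⊕ Option Bool)} (hx : x ∈ queryGame.legal n) :
    u ++ x.map (fun m => Sum.inl (t.length, m)) ∈ (logSof p).legal n := by
  refine ⟨h.alt_extend (queryGame.alternating n x hx), ?_, ?_⟩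
  · have := h.slots.extend ht hx
    rw [onLeft_append]
    have e : x.map (fun m => (Sum.inl (t.length, m) : LogSofM)) =
      (x.map fun m => (t.length, m)).map Sum.inl := by simp
    rwa [e, onLeft_map]
  · have e : x.map (fun m => (Sum.inl (t.length, m) : LogSofM)) =
      (x.map fun m => (t.length, m)).map Sum.inl := by simp
    rw [onRight_append, h.right, e, onRight_map]
    exact Or.inr (Or.inl rfl)

theorem Ready.legal {u : List LogSofM} {t : List Bool} (h : Ready p n u t) :
    u ∈ (logSof p).legal n :=
  ⟨h.alt, h.slots.legal, by rw [h.right]; exact Or.inr (Or.inl rfl)⟩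

theorem Ready.succ {u : List LogSofM} {t : List Bool} (h : Ready p n u t)
    (ht : t.length < n) {x : List (StrM ⊕ Option Bool)} {z : Bool}
    (hx : x ++ [Sum.inr (some z)] ∈ queryGame.legal n) (he : Odd x.length)
    (hb : argBits (x.map (fun m => Sum.inl (t.length, m))) = []) :
    Ready p n (u ++ x.map (fun m => Sum.inl (t.length, m)) ++
      [Sum.inl (t.length, Sum.inr (some z))]) (t ++ [z]) := by
  have e : ∀ x : List (StrM ⊕ Option Bool), x.map (fun m => (Sum.inl (t.length, m) : LogSofM)) =
    (x.map fun m => (t.length, m)).map Sum.inl := by simp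
  have e' : u ++ x.map (fun m => Sum.inl (t.length, m)) ++ [Sum.inl (t.length, Sum.inr (some z))] =
      u ++ (x ++ [Sum.inr (some z)]).map (fun m => Sum.inl (t.length, m)) := by simp
  refine ⟨by simpa using ht, ?_, ?_, ?_, ?_, by simp⟩
  · rw [e', onLeft_append, e, onLeft_map, List.length_append]
    exact h.slots.succ ht hx (by simpa using he.add_one) (by simp)
  · rw [e', onRight_append, e, onRight_map, h.right]
    rfl
  · rw [e']
    exact h.alt_extend (queryGame.alternating n _ hx)
  · rw [argBits_append, argBits_append, h.bits, hb]
    simp [argBits]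

theorem Ready.succ_bit {u : List LogSofM} {t : List Bool} (h : Ready p n u t)
    (ht : t.length < n) (z : Bool) :
    Ready p n (u ++ [Sum.inl (t.length, Sum.inr none)] ++ [Sum.inl (t.length, Sum.inr (some z))])
      (t ++ [z]) :=
  h.succ (x := [Sum.inr none]) ht (queryGame_legal_bit z) (by simp) rfl

theorem Ready.succ_query {u : List LogSofM} {t : List Bool} (h : Ready p n u t)
    (ht : t.length < n) {q : List Bool} (hq : q.length = Pol.lg n) (z : Bool) :
    Ready p n (u ++ [Sum.inl (t.length, Sum.inr none), Sum.inl (t.length, Sum.inl none),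
      Sum.inl (t.length, Sum.inl (some q))] ++ [Sum.inl (t.length, Sum.inr (some z))])
      (t ++ [z]) :=
  h.succ (x := [Sum.inr none, Sum.inl none, Sum.inl (some q)]) ht (queryGame_legal_query hq z)
    ⟨1, rfl⟩ rfl

theorem Ready.legal_result {u : List LogSofM} {t : List Bool} (h : Ready p n u t)
    {r : List Bool} (hr : r.length = p n) : u ++ [Sum.inr (some r)] ∈ (logSof p).legal n := by
  refine ⟨altFrom_snoc.2 ⟨h.alt, ?_⟩, ?_, ?_⟩
  · have := h.length
    rw [← Nat.not_even_iff_odd] at this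
    simp [this, strGame, ground]
  · simpa using h.slots.legal
  · simpa [h.right] using strGame_legal hr

theorem Nested.legal {v : List LogSofM} (h : Nested p n v) : v ∈ (logSof p).legal n := by
  cases h with
  | nil => exact Game.nil_mem _ _
  | ask h ht =>
    exact h.legal_extend (x := [Sum.inr none]) ht
      (Game.mem_of_prefix (queryGame_legal_bit true) (by simp))
  | query h ht hq =>
    exact h.legal_extend (x := [Sum.inr none, Sum.inl none, Sum.inl (some _)]) ht
      (Game.mem_of_prefix (queryGame_legal_query hq true) (by simp))
  | result h ht hr => exact h.legal_result hr

theorem Nested.even {v : List LogSofM} (h : Nested p n v) : Even v.length := by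
  cases h with
  | nil => simp
  | ask h ht => simpa [Nat.even_add] using h.length
  | query h ht hq =>
    have := h.length
    rw [← Nat.not_even_iff_odd] at this
    simp [Nat.even_add, this]
    decide
  | result h ht hr => simpa [Nat.even_add] using h.length

theorem Slots.not_opp {M : Type} {G : Game M} {q : Pol} {l : List (ℕ × M)} {c i : ℕ} {m : M}
    (h : Slots G q n l c) (hm : proj i l ++ [m] ∈ G.legal n) : G.isOpp m = true := by
  rw [Game.isOpp_of_snoc hm]
  simpa using h.even_proj i

/-- What the opponent can do in a nested play. -/
theorem Nested.opponent {v : List LogSofM} {x : LogSofM} (hv : Nested p n v)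
    (hx : v ++ [x] ∈ (logSof p).legal n) :
    (v = [] ∧ x = Sum.inr none) ∨
    (∃ z, x = Sum.inl ((argBits v).length, Sum.inr (some z)) ∧
      Ready p n (v ++ [x]) (argBits v ++ [z])) ∨
    ∃ u t, Ready p n u t ∧ t.length < n ∧
      v = u ++ [Sum.inl (t.length, Sum.inr none)] ∧ x = Sum.inl (t.length, Sum.inl none) := by
  have hopp := Game.isOpp_of_snoc hx
  simp only [hv.even, decide_true] at hopp
  have hleft : ∀ i m, x = Sum.inl (i, m) →
      proj i (onLeft v) ++ [m] ∈ queryGame.legal n ∧ queryGame.isOpp m = false := by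
    rintro i m rfl
    refine ⟨?_, by simpa [logSof, lolli, bang] using hopp⟩
    have h1 := hx.2.1.2.1 i
    rw [onLeft_append, proj_append] at h1
    simpa [proj] using h1
  have hright : ∀ m, x = Sum.inr m → onRight v ++ [m] ∈ (strGame p).legal n ∧ m = none := by
    rintro m rfl
    refine ⟨by simpa using hx.2.2, ?_⟩
    cases m with
    | none => rfl
    | some y => simp [logSof, lolli, strGame, ground] at hopp
  -- The opponent has to stay in the current copy: in any other copy an even number of moves has
  -- been made, so the next move there belongs to the player, and the final result has been asked
  -- for but not returned.
  have hask {u t} (h : Ready p n u t) (a : List (StrM ⊕ Option Bool))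
      (hv' : v = u ++ a.map (fun m => Sum.inl (t.length, m))) :
      ∃ m, x = Sum.inl (t.length, m) ∧ a ++ [m] ∈ queryGame.legal n ∧ queryGame.isOpp m = false := by
    have e : a.map (fun m => (Sum.inl (t.length, m) : LogSofM)) =
      (a.map fun m => (t.length, m)).map Sum.inl := by simp
    rcases x with ⟨i, m⟩ | m
    · obtain ⟨h1, h2⟩ := hleft i m rfl
      rw [hv', onLeft_append, e, onLeft_map, proj_append, proj_map] at h1
      by_cases hi : t.length = i
      · subst hi
        rw [if_pos rfl, proj_eq_nil fun m hm => (h.slots.lt m hm).ne, List.nil_append] at h1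
        exact ⟨m, rfl, h1, h2⟩
      · rw [if_neg hi, List.append_nil] at h1
        have := h.slots.not_opp h1
        rw [this] at h2
        simp at h2
    · obtain ⟨h1, rfl⟩ := hright m rfl
      rw [hv', onRight_append, h.right, e, onRight_map] at h1
      simp [strGame, ground] at h1
  have hm : ∀ m, queryGame.isOpp m = false → m = Sum.inl none ∨ ∃ z, m = Sum.inr (some z) := by
    rintro (_ | _) h <;> rename_i o <;> cases o <;> simp [queryGame, lolli, strGame, boolGame, ground] at h ⊢
  cases hv with
  | nil =>
    refine Or.inl ⟨rfl, ?_⟩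
    rcases x with ⟨i, m⟩ | m
    · obtain ⟨h1, h2⟩ := hleft i m rfl
      have := Game.isOpp_of_snoc (s := []) h1
      rw [this] at h2
      simp at h2
    · obtain ⟨h1, rfl⟩ := hright m rfl
      rfl
  | @ask u t h ht =>
    obtain ⟨m, rfl, h1, h2⟩ := hask h [Sum.inr none] rfl
    rcases hm m h2 with rfl | ⟨z, rfl⟩
    · exact Or.inr (Or.inr ⟨_, _, h, ht, rfl, rfl⟩)
    · have e : argBits (u ++ [Sum.inl (t.length, Sum.inr none)]) = t := by
        rw [argBits_append, h.bits]; simp [argBits]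
      rw [e]
      exact Or.inr (Or.inl ⟨z, rfl, h.succ_bit ht z⟩)
  | @query u t h ht q hq =>
    obtain ⟨m, rfl, h1, h2⟩ := hask h [Sum.inr none, Sum.inl none, Sum.inl (some q)] rfl
    rcases hm m h2 with rfl | ⟨z, rfl⟩
    · have h3 := h1.2.1
      simp [strGame, ground] at h3
    · have e : argBits (u ++ [Sum.inl (t.length, Sum.inr none), Sum.inl (t.length, Sum.inl none),
          Sum.inl (t.length, Sum.inl (some q))]) = t := by
        rw [argBits_append, h.bits]; simp [argBits]
      rw [e]
      exact Or.inr (Or.inl ⟨z, rfl, h.succ_query ht hq z⟩)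
  | @result u t h ht r hr =>
    exfalso
    rcases x with ⟨i, m⟩ | m
    · obtain ⟨h1, h2⟩ := hleft i m rfl
      rw [onLeft_append] at h1
      have := h.slots.not_opp (by simpa using h1)
      rw [this] at h2
      simp at h2
    · obtain ⟨h1, rfl⟩ := hright m rfl
      rw [onRight_append, h.right] at h1
      simp [strGame, ground] at h1

theorem Nested.step {v : List LogSofM} {x : LogSofM} (hv : Nested p n v)
    (hx : v ++ [x] ∈ (logSof p).legal n) :
    (∃ t, Ready p n (v ++ [x]) t) ∨ ∃ u t, Ready p n u t ∧ t.length < n ∧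
      v = u ++ [Sum.inl (t.length, Sum.inr none)] ∧ x = Sum.inl (t.length, Sum.inl none) := by
  rcases hv.opponent hx with ⟨rfl, rfl⟩ | ⟨z, -, h⟩ | h
  · exact Or.inl ⟨_, ready_start⟩
  · exact Or.inl ⟨_, h⟩
  · exact Or.inr h

/-! ### Responses -/

theorem length_queriesOf (l : ℕ) (ys : List (List Bool)) :
    (queriesOf l ys).length = ys.length := by
  induction ys using List.reverseRecOn with
  | nil => rfl
  | append_singleton ys y ih => simpa [queriesOf] using ih

theorem queriesOf_snoc (l : ℕ) (ys : List (List Bool)) (y : List Bool) :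
    queriesOf l (ys ++ [y]) = queriesOf l ys ++ [alpha l y (queriesOf l ys)] := by
  simp [queriesOf]

/-- The strings of length `l` outside `T`. -/
def unused (l : ℕ) (T : List (List Bool)) : List (List Bool) :=
  (allStr l).filter (fun x => !T.contains x)

theorem mem_unused {l : ℕ} {T : List (List Bool)} {x : List Bool} :
    x ∈ unused l T ↔ x.length = l ∧ x ∉ T := by
  simp [unused, mem_allStr]

theorem length_unused_pos {l : ℕ} {T : List (List Bool)} (h : T.length < 2 ^ l) :
    0 < (unused l T).length := by
  by_contra h0
  have h1 : unused l T = [] := by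
    rw [← List.length_eq_zero_iff]; omega
  have h2 : allStr l ⊆ T := by
    intro x hx
    by_contra hx'
    have : x ∈ unused l T := mem_unused.2 ⟨mem_allStr.1 hx, hx'⟩
    simp [h1] at this
  have h3 := (List.subperm_of_subset (nodup_allStr l) h2).length_le
  rw [length_allStr] at h3
  omega

theorem alpha_mem {l : ℕ} {y : List Bool} {T : List (List Bool)} (h : T.length < 2 ^ l) :
    alpha l y T ∈ unused l T := by
  have h0 := length_unused_pos h
  have h1 : strVal y % (unused l T).length < (unused l T).length := Nat.mod_lt _ h0
  have : alpha l y T = (unused l T)[strVal y % (unused l T).length] := by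
    change (unused l T).getD (strVal y % (unused l T).length) [] = _
    rw [List.getD_eq_getElem _ _ h1]
  rw [this]
  exact List.getElem_mem h1

theorem length_getD_queriesOf {l : ℕ} {ys : List (List Bool)} {i : ℕ} (hi : i < ys.length)
    (hl : ys.length ≤ 2 ^ l) : ((queriesOf l ys).getD i []).length = l := by
  induction ys using List.reverseRecOn with
  | nil => simp at hi
  | append_singleton ys y ih =>
    rw [queriesOf_snoc]
    simp only [List.length_append, List.length_singleton] at hi hl
    by_cases h : i < ys.length
    · rw [List.getD_append _ _ _ _ (by rwa [length_queriesOf])]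
      exact ih h (by omega)
    · obtain rfl : i = ys.length := by omega
      have : (queriesOf l ys ++ [alpha l y (queriesOf l ys)]).getD ys.length [] =
          alpha l y (queriesOf l ys) := by
        rw [List.getD_eq_getElem?_getD, List.getElem?_append_right (by rw [length_queriesOf])]
        simp [length_queriesOf]
      rw [this]
      exact (mem_unused.1 (alpha_mem (by rw [length_queriesOf]; omega))).1

theorem le_two_pow_lg (n : ℕ) : n ≤ 2 ^ Pol.lg n := Nat.le_pow_clog one_lt_two n

theorem respond_ready {u : List LogSofM} {t : List Bool} (h : Ready p n u t)
    (ys : List (List Bool)) : respond p n ys u = if t.length = n then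
      Sum.inr (some ((ys.getD n []).take (p n))) else Sum.inl (t.length, Sum.inr none) := by
  unfold respond
  rw [h.bits]
  have := h.last
  split
  · rename_i i m hi
    exact absurd hi (this _ _)
  · rfl

theorem respond_query {u : List LogSofM} {t : List Bool} (h : Ready p n u t)
    (ys : List (List Bool)) : respond p n ys (u ++ [Sum.inl (t.length, Sum.inr none),
      Sum.inl (t.length, Sum.inl none)]) = Sum.inl (t.length, Sum.inl (some
        ((queriesOf (Pol.lg n) ys).getD t.length []))) := by
  have : argBits (u ++ [Sum.inl (t.length, Sum.inr none),
      Sum.inl (t.length, Sum.inl none)]) = t := by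
    rw [argBits_append, h.bits]; simp [argBits]
  unfold respond
  rw [this]
  simp

/-- Responding to a move leads again to a nested play. -/
theorem Nested.respond {v : List LogSofM} {x : LogSofM} (hv : Nested p n v)
    (hx : v ++ [x] ∈ (logSof p).legal n) {ys : List (List Bool)}
    (hl : ys.length = (argBits (v ++ [x])).length + 1) (hp : ∀ y ∈ ys, p n ≤ y.length) :
    Nested p n (v ++ [x, respond p n ys (v ++ [x])]) := by
  rcases hv.step hx with ⟨t, ht⟩ | ⟨u, t, h, ht, rfl, rfl⟩
  · rw [show ∀ y, v ++ [x, y] = (v ++ [x]) ++ [y] by simp, respond_ready ht]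
    rw [ht.bits] at hl
    split_ifs with h
    · refine Nested.result ht h ?_
      rw [List.length_take, List.getD_eq_getElem _ _ (by omega)]
      exact min_eq_left (hp _ (List.getElem_mem _))
    · exact Nested.ask ht (lt_of_le_of_ne ht.length_le h)
  · have : argBits (u ++ [Sum.inl (t.length, Sum.inr none)] ++
        [Sum.inl (t.length, Sum.inl none)]) = t := by
      rw [argBits_append, argBits_append, h.bits]; simp [argBits]
    rw [this] at hl
    have e := respond_query h ys
    simp only [List.append_assoc, List.cons_append, List.nil_append]
    rw [e]
    have := le_two_pow_lg n
    exact Nested.query h ht (length_getD_queriesOf (by omega) (by omega))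

theorem Nested.argBits_le {v : List LogSofM} {x : LogSofM} (hv : Nested p n v)
    (hx : v ++ [x] ∈ (logSof p).legal n) : (argBits (v ++ [x])).length ≤ n := by
  rcases hv.step hx with ⟨t, ht⟩ | ⟨u, t, h, ht, rfl, rfl⟩
  · rw [ht.bits]; exact ht.length_le
  · rw [argBits_append, argBits_append, h.bits]
    simp [argBits]; omega


theorem prefixVals_snoc (O : List Bool → List Bool) (t : List Bool) (z : Bool) :
    prefixVals O (t ++ [z]) = prefixVals O t ++ [O (t ++ [z])] := by
  simp only [prefixVals, List.length_append, List.length_singleton]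
  rw [List.range_succ, List.map_append]
  congr 1
  · refine List.map_congr_left fun k hk => ?_
    rw [List.mem_range] at hk
    rw [List.take_append_of_le_length (by omega)]
  · rw [List.map_singleton, List.take_of_length_le (by simp)]

theorem length_prefixVals (O : List Bool → List Bool) (t : List Bool) :
    (prefixVals O t).length = t.length + 1 := by simp [prefixVals]

theorem prefixVals_getD (O : List Bool → List Bool) (t : List Bool) :
    (prefixVals O t).getD t.length [] = O t := by
  simp [prefixVals]

theorem mem_prefixVals {O : List Bool → List Bool} {t y : List Bool} (h : y ∈ prefixVals O t) :
    ∃ x, x.length ≤ t.length ∧ y = O x := by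
  simp only [prefixVals, List.mem_map, List.mem_range] at h
  obtain ⟨k, -, rfl⟩ := h
  exact ⟨_, by simp, rfl⟩

/-! ### The composition of `f_F` and `first2second` -/

/-- The key received in a play (the empty string if there is none). -/
def keyOf {M : Type} (s : List (StrM ⊕ M)) : List Bool := ((onLeft s).filterMap id).headD []

/-- The next move of the composition of `f_F` and `first2second`. -/
def compNext (F : List Bool → List Bool → List Bool) (p : Pol) (n : ℕ)
    (s : List (StrM ⊕ LogSofM)) : StrM ⊕ LogSofM :=
  if (onLeft s).isEmpty then Sum.inl none
  else Sum.inr (respond p n (prefixVals (F (keyOf s)) (argBits (onRight s))) (onRight s))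

variable {p w : Pol} {n : ℕ} {F : List Bool → List Bool → List Bool}

/-- The interaction sequences of `f_F` and `first2second` once the key has been given, when it is
the turn of the environment. -/
structure Exchange (p w : Pol) (F : List Bool → List Bool → List Bool) (n : ℕ)
    (e : List (StrM ⊕ (FunM ⊕ LogSofM))) (k : List Bool) (v : List LogSofM) : Prop where
  inter : Interaction (strGame Pol.iota) (funGame w) (logSof p) n (prfNext F) (f2sNext p n) e
  env : EnvTurn e
  length : k.length = n
  left : onLeft e = [none, some k]
  right : onRight (onRight e) = v
  nested : Nested p n v
  ne_nil : v ≠ []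
  slots : Slots (lolli (strLEGame Pol.iota) (strGame w)) Pol.iotaSucc n (onLeft (onRight e))
    ((argBits v).length + 1)
  vals : funVals (onRight e) = prefixVals (F k) (argBits v)

theorem funVals_append (s t : List (FunM ⊕ LogSofM)) :
    funVals (s ++ t) = funVals s ++ funVals t := by
  simp [funVals]

theorem funGame_legal_value {t y : List Bool} (ht : t.length ≤ n) (hy : y.length = w n) :
    [Sum.inr none, Sum.inl none, Sum.inl (some t), Sum.inr (some y)] ∈
      (lolli (strLEGame Pol.iota) (strGame w)).legal n :=
  ⟨by simp [AltFrom, strLEGame, ground, strGame], Or.inr (Or.inr ⟨t, ht, rfl⟩), strGame_legal hy⟩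

theorem prfNext_ask {s : List (StrM ⊕ FunM)} (h : s ≠ []) (i : ℕ) :
    prfNext F (s ++ [Sum.inr (i, Sum.inr none)]) = Sum.inr (i, Sum.inl none) := by
  simp [prfNext, h]

theorem prfNext_value (s : List (StrM ⊕ FunM)) (i : ℕ) (x : List Bool) :
    prfNext F (s ++ [Sum.inr (i, Sum.inl (some x))]) = Sum.inr (i, Sum.inr (some (F (keyOf s) x))) := by
  simp [prfNext, keyIn, keyOf]

theorem f2sNext_bit (s : List (FunM ⊕ LogSofM)) (i : ℕ) (z : Bool) :
    f2sNext p n (s ++ [Sum.inr (Sum.inl (i, Sum.inr (some z)))]) = Sum.inl (i + 1, Sum.inr none) := by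
  simp [f2sNext]

theorem f2sNext_arg (s : List (FunM ⊕ LogSofM)) (i : ℕ) :
    f2sNext p n (s ++ [Sum.inl (i, Sum.inl none)]) =
      Sum.inl (i, Sum.inl (some (argBits (onRight s)))) := by
  simp [f2sNext]

theorem f2sNext_value (s : List (FunM ⊕ LogSofM)) (i : ℕ) (y : List Bool) :
    f2sNext p n (s ++ [Sum.inl (i, Sum.inr (some y))]) =
      if i < n then Sum.inr (Sum.inl (i, Sum.inr none))
      else Sum.inr (Sum.inr (some (y.take (p n)))) := by
  simp [f2sNext]

theorem f2sNext_query (s : List (FunM ⊕ LogSofM)) (i : ℕ) :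
    f2sNext p n (s ++ [Sum.inr (Sum.inl (i, Sum.inl none))]) =
      Sum.inr (Sum.inl (i, Sum.inl (some ((queriesOf (Pol.lg n) (funVals s)).getD i [])))) := by
  simp [f2sNext, funVals]

theorem Ready.f2sNext_value {u : List LogSofM} {t : List Bool} (h : Ready p n u t)
    (s : List (FunM ⊕ LogSofM)) (O : List Bool → List Bool) :
    f2sNext p n (s ++ [Sum.inl (t.length, Sum.inr (some (O t)))]) =
      Sum.inr (respond p n (prefixVals O t) u) := by
  rw [HOCrypto.f2sNext_value, respond_ready h]
  have := h.length_le
  by_cases hn : t.length = n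
  · rw [if_neg (by omega), if_pos hn, ← hn, prefixVals_getD, hn]
  · rw [if_pos (by omega), if_neg hn]

theorem length_prefixVals_mem (hF : ∀ k x, x.length ≤ k.length → (F k x).length = w k.length)
    (hpw : ∀ n, p n ≤ w n) {k t y : List Bool} (hk : k.length = n) (ht : t.length ≤ n)
    (h : y ∈ prefixVals (F k) t) : p n ≤ y.length := by
  obtain ⟨x, hx, rfl⟩ := mem_prefixVals h
  rw [hF k x (by omega), hk]
  exact hpw n

/-- The key is asked for in the middle of the first evaluation of the function. The opening thus
spans two outside exchanges: the initial question answered by the request for the key, and the key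
answered by the first move in the second-order game. -/
theorem exchange_start (hF : ∀ k x, x.length ≤ k.length → (F k x).length = w k.length)
    (hpw : ∀ n, p n ≤ w n) {k : List Bool} (hk : k.length = n) :
    Exchange p w F n [Sum.inr (Sum.inr (Sum.inr none)), Sum.inr (Sum.inl (0, Sum.inr none)),
      Sum.inl none, Sum.inl (some k), Sum.inr (Sum.inl (0, Sum.inl none)),
      Sum.inr (Sum.inl (0, Sum.inl (some []))), Sum.inr (Sum.inl (0, Sum.inr (some (F k [])))),
      Sum.inr (Sum.inr (respond p n (prefixVals (F k) []) [Sum.inr none]))] k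
      [Sum.inr none, respond p n (prefixVals (F k) []) [Sum.inr none]] := by
  have hr : Ready p n [Sum.inr none] [] := ready_start
  have hn : Nested p n ([] ++ [Sum.inr none, respond p n (prefixVals (F k) []) ([] ++ [Sum.inr none])]) :=
    Nested.nil.respond hr.legal (by simp [length_prefixVals, argBits]) fun y hy =>
      length_prefixVals_mem hF hpw hk (by simp) hy
  have hb : argBits [Sum.inr none, respond p n (prefixVals (F k) []) [Sum.inr none]] = [] := by
    rw [respond_ready hr]
    split_ifs <;> rfl
  have hs := (Slots.nil (lolli (strLEGame Pol.iota) (strGame w)) Pol.iotaSucc n).succ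
    (show 0 < n + 1 by omega) (funGame_legal_value (n := n) (w := w) (t := []) (y := F k []) (by simp)
      (by rw [hF k [] (by simp), hk])) ⟨2, rfl⟩ (by simp)
  have hl := hn.legal
  have ho := (logSof p).alternating n _ hl
  simp only [List.nil_append, AltFrom] at ho
  refine ⟨⟨⟨?_, ?_, ?_⟩, ⟨?_, ?_, ?_⟩, ?_, ?_⟩, ?_, hk, rfl, rfl, hn, by simp, ?_, ?_⟩
  · simp [AltFrom, lolli, funGame, bang, strGame, strLEGame, ground]
  · exact strGame_legal (p := Pol.iota) hk
  · exact hs.legal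
  · simp only [onRight_inl, onRight_inr, onRight_nil, AltFrom, Sum.elim_inl, Sum.elim_inr,
      ho.2.1]
    simp [lolli, funGame, bang, strGame, strLEGame, ground, logSof]
  · exact hs.legal
  · exact hl
  · simp [Obeys, prfNext, keyIn, Nat.odd_iff]
  · refine ⟨by simp, by simp [f2sNext], by simp [Nat.odd_iff], by simp [f2sNext, argBits],
      by simp [Nat.odd_iff], fun _ => ?_, trivial⟩
    exact (hr.f2sNext_value [Sum.inr (Sum.inr none), Sum.inl (0, Sum.inr none),
      Sum.inl (0, Sum.inl none), Sum.inl (0, Sum.inl (some []))] (F k)).symm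
  · exact ⟨⟨3, rfl⟩, ⟨3, rfl⟩⟩
  · rw [hb]
    exact hs
  · rw [hb]
    rfl

theorem Exchange.ne_nil_seenLeft {e : List (StrM ⊕ (FunM ⊕ LogSofM))} {k : List Bool}
    {v : List LogSofM} (h : Exchange p w F n e k v) : seenLeft e ≠ [] := by
  intro h0
  have := onLeft_seenLeft e
  rw [h0, h.left] at this
  simp at this

/-- A new bit triggers one evaluation of the function, in a fresh copy: the value is asked for, the
argument is asked for and given as all the bits so far, and `F k` of it comes back. These four
internal moves precede the visible response. -/
theorem Exchange.bit (hF : ∀ k x, x.length ≤ k.length → (F k x).length = w k.length)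
    (hpw : ∀ n, p n ≤ w n) {e : List (StrM ⊕ (FunM ⊕ LogSofM))} {k : List Bool}
    {v : List LogSofM} (h : Exchange p w F n e k v) {z : Bool}
    (hr : Ready p n (v ++ [Sum.inl ((argBits v).length, Sum.inr (some z))]) (argBits v ++ [z])) :
    ∃ I : List FunM, Exchange p w F n
      (e ++ Sum.inr (Sum.inr (Sum.inl ((argBits v).length, Sum.inr (some z)))) ::
        I.map (fun m => Sum.inr (Sum.inl m)) ++ [Sum.inr (Sum.inr (respond p n
        (prefixVals (F k) (argBits v ++ [z]))
        (v ++ [Sum.inl ((argBits v).length, Sum.inr (some z))])))]) k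
      (v ++ [Sum.inl ((argBits v).length, Sum.inr (some z)), respond p n
        (prefixVals (F k) (argBits v ++ [z]))
        (v ++ [Sum.inl ((argBits v).length, Sum.inr (some z))])]) := by
  have hbits := hr.bits
  have hlen := hr.length_le
  have hk := h.length
  set x : LogSofM := Sum.inl ((argBits v).length, Sum.inr (some z)) with hx
  set t := argBits v ++ [z] with ht
  set r := respond p n (prefixVals (F k) t) (v ++ [x]) with hrr
  have htl : t.length = (argBits v).length + 1 := by simp [ht]
  have hn : Nested p n (v ++ [x, r]) := by
    refine h.nested.respond hr.legal (by rw [hbits, length_prefixVals]) fun y hy =>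
      length_prefixVals_mem hF hpw h.length hlen hy
  have hb : argBits (v ++ [x, r]) = t := by
    rw [show v ++ [x, r] = (v ++ [x]) ++ [r] by simp, argBits_append, hbits, hrr, respond_ready hr]
    split_ifs <;> simp [argBits]
  have hs := h.slots.succ (c := (argBits v).length + 1)
    (show (argBits v).length + 1 < n + 1 by omega)
    (funGame_legal_value (n := n) (w := w) (t := t) (y := F k t) hlen
      (by rw [hF k t (by omega), hk])) ⟨2, rfl⟩ (by simp)
  rw [← htl] at hs
  have hl := hn.legal
  have ho := (altFrom_append.1 ((logSof p).alternating n _ hl)).2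
  simp only [h.nested.even, decide_true, AltFrom] at ho
  have hr1 := h.right
  have he1 : Even (seenLeft e).length := h.env.1
  have he2 : Even (onRight e).length := h.env.2
  refine ⟨[(t.length, Sum.inr none), (t.length, Sum.inl none), (t.length, Sum.inl (some t)),
    (t.length, Sum.inr (some (F k t)))], ⟨⟨⟨?_, ?_, ?_⟩, ⟨?_, ?_, ?_⟩, ?_, ?_⟩, ?_, hk, ?_, ?_, hn,
      by simp, ?_, ?_⟩⟩
  · have := h.inter.left.1
    simp only [List.map_cons, List.map_nil, seenLeft_append, seenLeft_mid, seenLeft_right,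
      seenLeft_nil, List.append_nil]
    refine altFrom_append.2 ⟨this, ?_⟩
    simp [AltFrom, he1, funGame, bang, lolli, strGame, strLEGame, ground]
  · simpa [onLeft_seenLeft, h.left] using strGame_legal (p := Pol.iota) hk
  · simpa [onRight_seenLeft, funGame] using hs.legal
  · have := h.inter.right.1
    simp only [List.map_cons, List.map_nil, onRight_append, onRight_inr, onRight_nil,
      List.append_assoc]
    refine altFrom_append.2 ⟨this, ?_⟩
    simp only [List.cons_append, List.nil_append, AltFrom, he2, Sum.elim_inl, Sum.elim_inr, ho.1, ho.2.1]
    simp [funGame, bang, lolli, strGame, strLEGame, ground]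
  · simpa [funGame] using hs.legal
  · simpa [hr1] using hl
  · have := h.inter.obeys_left
    simp only [List.map_cons, List.map_nil, seenLeft_append, seenLeft_mid, seenLeft_right,
      seenLeft_nil, List.append_nil]
    refine obeys_append.2 ⟨this, ?_⟩
    have hne := h.ne_nil_seenLeft
    refine ⟨fun ho => absurd he1 (Nat.not_even_iff_odd.2 ho), fun _ => (prfNext_ask hne _).symm,
      fun ho => ?_, fun _ => ?_, trivial⟩
    · simp [Nat.odd_add_one, he1] at ho
    · refine Eq.trans ?_ (prfNext_value _ _ _).symm
      simp [keyOf, onLeft_seenLeft, h.left]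
  · have := h.inter.obeys_right
    simp only [List.map_cons, List.map_nil, onRight_append, onRight_inr, onRight_nil,
      List.append_assoc]
    refine obeys_append.2 ⟨this, ?_⟩
    simp only [List.nil_append, List.cons_append]
    refine ⟨fun ho => absurd he2 (Nat.not_even_iff_odd.2 ho), fun _ => ?_, fun ho => ?_, fun _ => ?_,
      fun ho => ?_, fun _ => ?_, trivial⟩
    · rw [htl]; exact (f2sNext_bit _ _ _).symm
    · simp [Nat.odd_add_one, he2] at ho
    · rw [f2sNext_arg]
      simp [hr1, hbits]
    · simp [Nat.odd_add_one, he2] at ho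
    · exact (hr.f2sNext_value _ (F k)).symm
  · constructor
    · simp [Nat.even_add_one, he1]
    · simp [Nat.even_add_one, he2]
  · simp [h.left]
  · simp [hr1]
  · rw [hb]
    simpa using hs
  · rw [hb, ht, prefixVals_snoc]
    simp only [onRight_append, funVals_append, h.vals]
    simp [funVals]

/-- The value that determines the query was obtained before the query was announced, so no internal
move takes place. -/
theorem Exchange.query (hF : ∀ k x, x.length ≤ k.length → (F k x).length = w k.length)
    (hpw : ∀ n, p n ≤ w n) {e : List (StrM ⊕ (FunM ⊕ LogSofM))} {k : List Bool}
    {u : List LogSofM} {t : List Bool} (hu : Ready p n u t) (ht : t.length < n)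
    (h : Exchange p w F n e k (u ++ [Sum.inl (t.length, Sum.inr none)])) :
    Exchange p w F n (e ++ Sum.inr (Sum.inr (Sum.inl (t.length, Sum.inl none))) ::
        ([] : List FunM).map (fun m => Sum.inr (Sum.inl m)) ++ [Sum.inr (Sum.inr (respond p n
        (prefixVals (F k) t) (u ++ [Sum.inl (t.length, Sum.inr none),
          Sum.inl (t.length, Sum.inl none)])))]) k
      ((u ++ [Sum.inl (t.length, Sum.inr none)]) ++ [Sum.inl (t.length, Sum.inl none),
        respond p n (prefixVals (F k) t) (u ++ [Sum.inl (t.length, Sum.inr none),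
          Sum.inl (t.length, Sum.inl none)])]) := by
  have hk := h.length
  have e0 := respond_query hu (prefixVals (F k) t)
  set r := respond p n (prefixVals (F k) t) (u ++ [Sum.inl (t.length, Sum.inr none),
          Sum.inl (t.length, Sum.inl none)]) with hr
  have hb0 : argBits (u ++ [Sum.inl (t.length, Sum.inr none)]) = t := by
    rw [argBits_append, hu.bits]; simp [argBits]
  have hlg : (u ++ [Sum.inl (t.length, Sum.inr none)]) ++ [Sum.inl (t.length, Sum.inl none)] ∈
      (logSof p).legal n := by
    simpa using hu.legal_extend (x := [Sum.inr none, Sum.inl none]) ht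
      (Game.mem_of_prefix (queryGame_legal_query (q := List.replicate (Pol.lg n) true)
        (by simp) true) (by simp))
  have hb1 : argBits ((u ++ [Sum.inl (t.length, Sum.inr none)]) ++
      [Sum.inl (t.length, Sum.inl none)]) = t := by
    rw [argBits_append, hb0]; simp [argBits]
  have hn := h.nested.respond hlg (ys := prefixVals (F k) t) (by rw [hb1, length_prefixVals])
    fun y hy => length_prefixVals_mem hF hpw hk ht.le hy
  simp only [List.append_assoc, List.cons_append, List.nil_append] at hn
  rw [← hr] at hn
  have hb : argBits (u ++ [Sum.inl (t.length, Sum.inr none), Sum.inl (t.length, Sum.inl none),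
      r]) = t := by
    rw [argBits_append, hu.bits, e0]; simp [argBits]
  have hr1 := h.right
  have he1 : Even (seenLeft e).length := h.env.1
  have he2 : Even (onRight e).length := h.env.2
  have hs := h.slots
  rw [hb0] at hs
  have hl := hn.legal
  simp only [List.append_assoc, List.cons_append, List.nil_append]
  refine ⟨⟨?_, ⟨?_, ?_, ?_⟩, ?_, ?_⟩, ?_, hk, ?_, ?_, hn, by simp, ?_, ?_⟩
  · simpa using h.inter.left
  · have := h.inter.right.1
    simp only [List.map_nil, onRight_append, onRight_inr, onRight_nil]
    refine altFrom_append.2 ⟨this, ?_⟩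
    rw [e0]
    simp [AltFrom, he2, logSof, bang, lolli, strGame, ground]
  · simpa [funGame] using hs.legal
  · simpa [hr1] using hl
  · simpa using h.inter.obeys_left
  · have := h.inter.obeys_right
    simp only [List.map_nil, onRight_append, onRight_inr, onRight_nil]
    refine obeys_append.2 ⟨this, ?_⟩
    refine ⟨fun ho => absurd he2 (Nat.not_even_iff_odd.2 ho), fun _ => ?_, trivial⟩
    rw [List.nil_append, f2sNext_query, e0, h.vals, hb0]
  · constructor
    · simpa using he1
    · simp [Nat.even_add_one, he2]
  · simp [h.left]
  · simp [hr1]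
  · rw [hb]
    simpa using hs
  · rw [hb]
    have := h.vals
    rw [hb0] at this
    simp only [List.map_nil, onRight_append, funVals_append, this]
    rw [e0]
    simp [funVals]


variable {p w : Pol} {n : ℕ} {F : List Bool → List Bool → List Bool}

/-- The interaction sequences of `f_F` and `first2second` when it is the turn of the environment. -/
inductive Exchanges (p w : Pol) (F : List Bool → List Bool → List Bool) (n : ℕ) :
    List (StrM ⊕ (FunM ⊕ LogSofM)) → Prop
  | nil : Exchanges p w F n []
  | start : Exchanges p w F n [Sum.inr (Sum.inr (Sum.inr none)),
      Sum.inr (Sum.inl (0, Sum.inr none)), Sum.inl none]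
  | play {e k v} (h : Exchange p w F n e k v) : Exchanges p w F n e

theorem Exchanges.interaction {e : List (StrM ⊕ (FunM ⊕ LogSofM))} (h : Exchanges p w F n e) :
    Interaction (strGame Pol.iota) (funGame w) (logSof p) n (prfNext F) (f2sNext p n) e ∧
      EnvTurn e := by
  cases h with
  | nil =>
    exact ⟨⟨Game.nil_mem _ _, Game.nil_mem _ _, trivial, trivial⟩, ⟨by simp, by simp⟩⟩
  | start =>
    have h1 : [(0, Sum.inr none)] ∈ (funGame w).legal n :=
      (Slots.nil (lolli (strLEGame Pol.iota) (strGame w)) Pol.iotaSucc n).extend (x := [Sum.inr none])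
        (show 0 < n + 1 by omega) (Game.mem_of_prefix (funGame_legal_value (t := [])
          (y := List.replicate (w n) true) (by simp) (by simp)) (by simp))
    refine ⟨⟨⟨?_, Or.inr (Or.inl rfl), h1⟩, ⟨?_, h1, ready_start.legal⟩, ?_, ?_⟩, ⟨1, rfl⟩, ⟨1, rfl⟩⟩
    · simp [AltFrom, lolli, funGame, bang, strGame, strLEGame, ground]
    · simp [AltFrom, lolli, funGame, bang, strGame, strLEGame, ground, logSof]
    · simp [Obeys, prfNext]
    · simp [Obeys, f2sNext]
  | play h => exact ⟨h.inter, h.env⟩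

theorem Exchange.compNext {e : List (StrM ⊕ (FunM ⊕ LogSofM))} {k : List Bool} {v : List LogSofM}
    (h : Exchange p w F n e k v) (x : LogSofM) :
    compNext F p n (seenOut e ++ [Sum.inr x]) = Sum.inr (respond p n
      (prefixVals (F k) (argBits (v ++ [x]))) (v ++ [x])) := by
  simp [HOCrypto.compNext, onLeft_seenOut, onRight_seenOut, h.left, h.right, keyOf]

/-- What the environment can do. -/
theorem Exchanges.opponent {e : List (StrM ⊕ (FunM ⊕ LogSofM))} (he : Exchanges p w F n e)
    {o : StrM ⊕ LogSofM} (ho : seenOut e ++ [o] ∈ (lolli (strGame Pol.iota) (logSof p)).legal n) :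
    (e = [] ∧ o = Sum.inr (Sum.inr none)) ∨
    (e = [Sum.inr (Sum.inr (Sum.inr none)), Sum.inr (Sum.inl (0, Sum.inr none)), Sum.inl none] ∧
      ∃ k : List Bool, k.length = n ∧ o = Sum.inl (some k)) ∨
    ∃ k v x, Exchange p w F n e k v ∧ o = Sum.inr x ∧ v ++ [x] ∈ (logSof p).legal n := by
  have hopp := Game.isOpp_of_snoc ho
  have hev := he.interaction.2.even_seenOut
  simp only [hev, decide_true] at hopp
  cases he with
  | nil =>
    rcases o with m | x
    · have := Game.isOpp_of_snoc (G := strGame Pol.iota) (s := []) (x := m) ho.2.1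
      simp [lolli, this] at hopp
    · obtain ⟨t, ht⟩ | ⟨u, t, -, -, h, -⟩ := Nested.nil.step (x := x) ho.2.2
      · have := ht.right
        rcases x with x | x <;> simp at this
        subst this
        exact Or.inl ⟨rfl, rfl⟩
      · simp at h
  | start =>
    rcases o with m | x
    · have h1 := ho.2.1
      obtain ⟨k, hk, rfl⟩ : ∃ k : List Bool, k.length = n ∧ m = some k := by
        simp [strGame, ground] at h1
        obtain ⟨k, hk, rfl⟩ := h1
        exact ⟨k, hk, rfl⟩
      exact Or.inr (Or.inl ⟨rfl, k, hk, rfl⟩)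
    · have h1 := ho.2.2
      have := Game.isOpp_of_snoc (G := logSof p) (s := [Sum.inr none]) (x := x) h1
      simp [lolli, this] at hopp
  | @play _ k v h =>
    rcases o with m | x
    · have h1 := ho.2.1
      rw [onLeft_append, onLeft_seenOut, h.left] at h1
      simp [strGame, ground] at h1
    · have h1 := ho.2.2
      rw [onRight_append, onRight_seenOut, h.right] at h1
      exact Or.inr (Or.inr ⟨k, v, x, h, rfl, h1⟩)

/-- The composition of `f_F` and `first2second` is given by prescribed moves. -/
theorem comp_eq (hF : ∀ k x, x.length ≤ k.length → (F k x).length = w k.length)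
    (hpw : ∀ n, p n ≤ w n) (n : ℕ) : comp (prfStrategy w F) (first2second w p) n =
      playsOf ((lolli (strGame Pol.iota) (logSof p)).legal n) (compNext F p n) ∧
      (∀ s ∈ playsOf ((lolli (strGame Pol.iota) (logSof p)).legal n) (compNext F p n),
        ∃ e, Exchanges p w F n e ∧ seenOut e = s) ∧
      ∀ s ∈ playsOf ((lolli (strGame Pol.iota) (logSof p)).legal n) (compNext F p n),
        ∀ o, s ++ [o] ∈ (lolli (strGame Pol.iota) (logSof p)).legal n →
        s ++ [o, compNext F p n (s ++ [o])] ∈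
          playsOf ((lolli (strGame Pol.iota) (logSof p)).legal n) (compNext F p n) := by
  refine comp_playsOf (C := Exchanges p w F n) (f := prfNext F) (g := f2sNext p n) rfl rfl
    Exchanges.nil (fun e he => he.interaction) fun e o he ho => ?_
  rcases he.opponent ho with ⟨rfl, rfl⟩ | ⟨rfl, k, hk, rfl⟩ | ⟨k, v, x, h, rfl, h1⟩
  · exact ⟨[(0, Sum.inr none)], Exchanges.start⟩
  · exact ⟨[(0, Sum.inl none), (0, Sum.inl (some [])), (0, Sum.inr (some (F k [])))],
      Exchanges.play (exchange_start hF hpw hk)⟩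
  · rw [h.compNext]
    rcases h.nested.opponent h1 with ⟨h2, -⟩ | ⟨z, rfl, hr⟩ | ⟨u, t, hu, ht, rfl, rfl⟩
    · exact absurd h2 h.ne_nil
    · rw [hr.bits]
      obtain ⟨I, hI⟩ := h.bit hF hpw hr
      exact ⟨I, Exchanges.play hI⟩
    · have hb1 : argBits ((u ++ [Sum.inl (t.length, Sum.inr none)]) ++
          [Sum.inl (t.length, Sum.inl none)]) = t := by
        rw [argBits_append, argBits_append, hu.bits]; simp [argBits]
      rw [hb1]
      refine ⟨[], Exchanges.play (k := k) (v := (u ++ [Sum.inl (t.length, Sum.inr none)]) ++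
        [Sum.inl (t.length, Sum.inl none), respond p n (prefixVals (F k) t)
          (u ++ [Sum.inl (t.length, Sum.inr none), Sum.inl (t.length, Sum.inl none)])]) ?_⟩
      have := h.query hF hpw hu ht
      simpa [ofOut] using this

theorem isStrategy_comp (hF : ∀ k x, x.length ≤ k.length → (F k x).length = w k.length)
    (hpw : ∀ n, p n ≤ w n) : IsStrategy (lolli (strGame Pol.iota) (logSof p))
      (comp (prfStrategy w F) (first2second w p)) := by
  rw [show comp (prfStrategy w F) (first2second w p) = fun n =>
    playsOf ((lolli (strGame Pol.iota) (logSof p)).legal n) (compNext F p n) from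
      funext fun n => (comp_eq hF hpw n).1]
  exact isStrategy_playsOf _ fun n s x hs hx => ((comp_eq hF hpw n).2.2 s hs x hx).1

/-! ### Trees from functions -/

theorem queriesOf_append (l : ℕ) (ys zs : List (List Bool)) :
    queriesOf l ys <+: queriesOf l (ys ++ zs) := by
  induction zs using List.reverseRecOn with
  | nil => simp
  | append_singleton zs z ih =>
    rw [← List.append_assoc, queriesOf_snoc]
    exact ih.trans (List.prefix_append _ _)

/-- Each query is chosen outside the previous ones, which is possible as long as fewer than `2 ^ l`
strings have been used. -/
theorem nodup_queriesOf {l : ℕ} {ys : List (List Bool)} (h : ys.length ≤ 2 ^ l) :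
    (queriesOf l ys).Nodup := by
  induction ys using List.reverseRecOn with
  | nil => simp [queriesOf]
  | append_singleton ys y ih =>
    simp only [List.length_append, List.length_singleton] at h
    rw [queriesOf_snoc, List.nodup_append_comm, List.singleton_append, List.nodup_cons]
    exact ⟨(mem_unused.1 (alpha_mem (by rw [length_queriesOf]; omega))).2, ih (by omega)⟩

theorem prefixVals_append (O : List Bool → List Bool) (t r : List Bool) :
    prefixVals O t <+: prefixVals O (t ++ r) := by
  induction r using List.reverseRecOn with
  | nil => simp
  | append_singleton r z ih =>
    rw [← List.append_assoc, prefixVals_snoc]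
    exact ih.trans (List.prefix_append _ _)

/-- The random choices that `first2second` extracts from the function `O`. -/
def treeOf (p : Pol) (n : ℕ) (O : List Bool → List Bool)
    (hO : ∀ x, x.length ≤ n → p n ≤ (O x).length) : RandTree (Pol.lg n) (p n) n where
  query t := ⟨(queriesOf (Pol.lg n) (prefixVals O t.1)).getD t.1.length [],
    length_getD_queriesOf (by simp [length_prefixVals]) (by
      have := t.2
      have := le_two_pow_lg n
      rw [length_prefixVals]; omega)⟩
  result t := ⟨(O t.1).take (p n), by
    rw [List.length_take]; exact min_eq_left (hO _ t.2.le)⟩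
  distinct t t' h hne e := by
    obtain ⟨t, ht⟩ := t
    obtain ⟨t', ht'⟩ := t'
    obtain ⟨r, rfl⟩ := h
    have hr : 0 < r.length := by
      rw [List.length_pos_iff]
      rintro rfl
      simp at hne
    have hlg := le_two_pow_lg n
    have e := congrArg Subtype.val e
    simp only at e
    obtain ⟨a, ha⟩ := prefixVals_append O t r
    obtain ⟨b, hb⟩ := queriesOf_append (Pol.lg n) (prefixVals O t) a
    -- Lengthening the branch only appends to the list of its queries. Hence both queries are
    -- entries, at different positions, of the duplicate-free list of the longer branch.
    have h1 : (queriesOf (Pol.lg n) (prefixVals O t)).getD t.length [] =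
        (queriesOf (Pol.lg n) (prefixVals O (t ++ r))).getD t.length [] := by
      rw [← ha, ← hb, List.getD_append _ _ _ _ (by simp [length_queriesOf, length_prefixVals])]
    have hl : (queriesOf (Pol.lg n) (prefixVals O (t ++ r))).length = (t ++ r).length + 1 := by
      rw [length_queriesOf, length_prefixVals]
    simp only [List.length_append] at hl e ht'
    rw [h1, List.getD_eq_getElem _ _ (by omega), List.getD_eq_getElem _ _ (by omega)] at e
    have := (List.Nodup.getElem_inj_iff (nodup_queriesOf (by
      rw [length_prefixVals, List.length_append]; omega))).1 e
    omega

theorem advance_ready {T : RandTree (Pol.lg n) (p n) n} {u : List LogSofM} {t : List Bool}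
    (h : Ready p n u t) : T.next u = T.advance t := by
  unfold RandTree.next
  rw [h.bits]
  have := h.last
  split
  · rename_i i m hi
    exact absurd hi (this _ _)
  · rfl

theorem next_query {T : RandTree (Pol.lg n) (p n) n} {u : List LogSofM} {t : List Bool}
    (h : Ready p n u t) (ht : t.length < n) : T.next (u ++ [Sum.inl (t.length, Sum.inr none)] ++
      [Sum.inl (t.length, Sum.inl none)]) =
      Sum.inl (t.length, Sum.inl (some (T.query ⟨t, ht⟩).toList)) := by
  have hb1 : argBits ((u ++ [Sum.inl (t.length, Sum.inr none)]) ++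
      [Sum.inl (t.length, Sum.inl none)]) = t := by
    rw [argBits_append, argBits_append, h.bits]; simp [argBits]
  unfold RandTree.next
  simp only [hb1, ht, dite_true]
  simp

theorem Nested.next (T : RandTree (Pol.lg n) (p n) n) {v : List LogSofM} {x : LogSofM}
    (hv : Nested p n v) (hx : v ++ [x] ∈ (logSof p).legal n) :
    Nested p n (v ++ [x, T.next (v ++ [x])]) := by
  rcases hv.step hx with ⟨t, ht⟩ | ⟨u, t, h, ht, rfl, rfl⟩
  · rw [advance_ready ht, show ∀ y, v ++ [x, y] = (v ++ [x]) ++ [y] by simp, RandTree.advance]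
    split_ifs with h
    · exact Nested.result ht h (by simp)
    · exact Nested.ask ht (lt_of_le_of_ne ht.length_le h)
  · rw [next_query h ht]
    simp only [List.append_assoc, List.cons_append, List.nil_append]
    exact Nested.query h ht (by simp)

/-- Links the two descriptions of the player: choices fixed in advance as a tree, and responses
computed from the oracle values at the prefixes of the bits received. -/
theorem treeOf_next {O : List Bool → List Bool} {hO : ∀ x, x.length ≤ n → p n ≤ (O x).length}
    {v : List LogSofM} {x : LogSofM} (hv : Nested p n v)
    (hx : v ++ [x] ∈ (logSof p).legal n) : (treeOf p n O hO).next (v ++ [x]) =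
      respond p n (prefixVals O (argBits (v ++ [x]))) (v ++ [x]) := by
  rcases hv.step hx with ⟨t, ht⟩ | ⟨u, t, h, ht, rfl, rfl⟩
  · rw [advance_ready ht, respond_ready ht, ht.bits, RandTree.advance]
    split_ifs with h
    · have := prefixVals_getD O t
      rw [h] at this
      rw [this]
      rfl
    · rfl
  · have hb1 : argBits ((u ++ [Sum.inl (t.length, Sum.inr none)]) ++
        [Sum.inl (t.length, Sum.inl none)]) = t := by
      rw [argBits_append, argBits_append, h.bits]; simp [argBits]
    rw [next_query h ht, hb1]
    have := respond_query h (prefixVals O t)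
    simp only [List.append_assoc, List.cons_append, List.nil_append] at this ⊢
    rw [this]
    rfl

theorem nested_of_randSof {T : RandTree (Pol.lg n) (p n) n} {v : List LogSofM}
    (hv : v ∈ randSof p n T) : Nested p n v :=
  playsOf_induction (C := Nested p n) Nested.nil (fun _ _ _ h hx _ => h.next T hx) v hv

/-- With a given key, the composition behaves like the tree of `F k`. -/
theorem app_comp (hF : ∀ k x, x.length ≤ k.length → (F k x).length = w k.length)
    (hpw : ∀ n, p n ≤ w n) {k : List Bool} (hk : k.length = n)
    (hO : ∀ x, x.length ≤ n → p n ≤ (F k x).length) :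
    app (keyPlays k) (comp (prfStrategy w F) (first2second w p) n) =
      randSof p n (treeOf p n (F k) hO) := by
  obtain ⟨h1, h2, h3⟩ := comp_eq hF hpw n
  have hstart (k' : List Bool) : onRight (seenOut ([Sum.inr (Sum.inr (Sum.inr none)),
      Sum.inr (Sum.inl (0, Sum.inr none)), Sum.inl none] : List (StrM ⊕ (FunM ⊕ LogSofM))) ++
      [Sum.inl (some k')]) = [Sum.inr none] := rfl
  have hnext : ∀ k', k'.length = n → compNext F p n (seenOut ([Sum.inr (Sum.inr (Sum.inr none)),
      Sum.inr (Sum.inl (0, Sum.inr none)), Sum.inl none] : List (StrM ⊕ (FunM ⊕ LogSofM))) ++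
      [Sum.inl (some k')]) = Sum.inr (respond p n (prefixVals (F k') []) [Sum.inr none]) :=
    fun k' _ => rfl
  have htree : (treeOf p n (F k) hO).next [Sum.inr none] =
      respond p n (prefixVals (F k) []) [Sum.inr none] :=
    treeOf_next Nested.nil ready_start.legal
  rw [h1]
  refine Set.ext fun s => ⟨?_, fun hs => ?_⟩
  · rintro ⟨u, hu, hl, rfl⟩
    -- The answer to the very first question is to ask for the key, so a non-empty play has moves on
    -- the left. Once the key `k` has been given, the right part is a play of the tree. A play that
    -- stops at the request for the key is not seen by `app`.
    have key : ∀ u ∈ playsOf ((lolli (strGame Pol.iota) (logSof p)).legal n) (compNext F p n),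
        (onLeft u = [] → u = []) ∧ (onLeft u = [none, some k] →
          onRight u ∈ randSof p n (treeOf p n (F k) hO)) := by
      refine playsOf_induction (by simp) fun s o hs ih ho ho' => ?_
      obtain ⟨e, he, rfl⟩ := h2 s hs
      rcases he.opponent ho with ⟨rfl, rfl⟩ | ⟨rfl, k', hk', rfl⟩ | ⟨k', v, x, h, rfl, h1⟩
      · simp [compNext]
      · refine ⟨by simp, fun h => ?_⟩
        have h' := h
        simp at h'
        obtain rfl := h'.1
        have : onRight (seenOut ([Sum.inr (Sum.inr (Sum.inr none)),
          Sum.inr (Sum.inl (0, Sum.inr none)), Sum.inl none] : List (StrM ⊕ (FunM ⊕ LogSofM))) ++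
          [Sum.inl (some k'), compNext F p n (seenOut ([Sum.inr (Sum.inr (Sum.inr none)),
          Sum.inr (Sum.inl (0, Sum.inr none)), Sum.inl none] : List (StrM ⊕ (FunM ⊕ LogSofM))) ++
          [Sum.inl (some k')])]) = [] ++ [Sum.inr none, (treeOf p n (F k') hO).next
            ([] ++ [Sum.inr none])] := by
          simp only [List.nil_append]
          rw [htree, hnext _ hk']
          rfl
        rw [this]
        exact mem_playsOf_snoc.2 ⟨mem_playsOf.2 ⟨Game.nil_mem _ _, by simp, trivial⟩,
          (Nested.nil.next _ ready_start.legal).legal, rfl⟩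
      · have hl' := h.left
        have hr' := h.right
        rw [h.compNext]
        refine ⟨by simp [onLeft_seenOut, hl'], fun e0 => ?_⟩
        obtain rfl : k' = k := by simpa [onLeft_seenOut, hl'] using e0
        have ih := ih.2 (by rw [onLeft_seenOut, hl'])
        rw [onRight_seenOut, hr'] at ih
        rw [← treeOf_next h.nested h1 (hO := hO), onRight_append, onRight_seenOut, hr']
        exact mem_playsOf_snoc.2 ⟨ih, (h.nested.next _ h1).legal, rfl⟩
    rcases hl with hl | hl
    · rw [(key u hu).1 hl]
      exact mem_playsOf.2 ⟨Game.nil_mem _ _, by simp, trivial⟩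
    · exact (key u hu).2 hl
  -- Conversely a play of the tree is lifted move by move. The first exchange of `s` lifts to two
  -- exchanges of `u`, since the key is obtained in between; every later one lifts to one.
  · have key : ∀ s ∈ randSof p n (treeOf p n (F k) hO), ∃ u ∈ playsOf
        ((lolli (strGame Pol.iota) (logSof p)).legal n) (compNext F p n), onRight u = s ∧
        (s = [] → u = []) ∧ (s ≠ [] → onLeft u = [none, some k]) := by
      refine playsOf_induction ⟨[], mem_playsOf.2 ⟨Game.nil_mem _ _, by simp, trivial⟩, rfl,
        fun _ => rfl, fun h => absurd rfl h⟩ fun s x hs ih hx hx' => ?_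
      have hn := nested_of_randSof hs
      obtain ⟨u, hu, hur, hu0, hu1⟩ := ih
      by_cases hs0 : s = []
      · subst hs0
        obtain rfl : x = Sum.inr none := by
          obtain ⟨t, ht⟩ | ⟨u, t, -, -, h, -⟩ := Nested.nil.step (x := x) hx
          · have := ht.right
            rcases x with x | x <;> simp at this
            rw [this]
          · simp at h
        have e1 := (Exchanges.start (p := p) (w := w) (F := F) (n := n)).interaction.1.seenOut_mem
        have e2 := h3 [] (mem_playsOf.2 ⟨Game.nil_mem _ _, by simp, trivial⟩)
          (Sum.inr (Sum.inr none)) (Game.mem_of_prefix e1 (by simp))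
        have e3 := (exchange_start (p := p) hF hpw hk).inter.seenOut_mem
        have e4 := h3 _ e2 (Sum.inl (some k)) (Game.mem_of_prefix e3 (by simp [compNext]))
        refine ⟨_, e4, ?_, by simp, fun _ => ?_⟩
        · simp only [List.nil_append, htree]; rfl
        · rfl
      · have hux : u ++ [Sum.inr x] ∈ (lolli (strGame Pol.iota) (logSof p)).legal n := by
          refine ⟨altFrom_snoc.2 ⟨hu.1.1, ?_⟩, ?_, ?_⟩
          · have := Game.isOpp_of_snoc hx
            simp [this, hu.2.1, hs.2.1]
          · rw [onLeft_append, hu1 hs0]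
            exact strGame_legal (p := Pol.iota) hk
          · rwa [onRight_append, hur]
        have e1 := h3 u hu _ hux
        have e2 : compNext F p n (u ++ [Sum.inr x]) =
            Sum.inr ((treeOf p n (F k) hO).next (s ++ [x])) := by
          rw [treeOf_next hn hx]
          simp [compNext, hu1 hs0, keyOf, hur]
        rw [e2] at e1
        exact ⟨_, e1, by simp [hur], by simp, fun _ => by simp [hu1 hs0]⟩
    obtain ⟨u, hu, hur, hu0, hu1⟩ := key s hs
    refine ⟨u, hu, ?_, hur.symm⟩
    by_cases hs0 : s = []
    · rw [hu0 hs0]; exact Or.inl rfl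
    · exact Or.inr (hu1 hs0)


/-! ### The composition is polynomial time -/

namespace PT

variable {α β γ : Type} [Rep α] [Rep β] [Rep γ]

theorem range {n : α → ℕ} (hn : PT n) : PT (fun a => List.range (n a)) := by
  obtain ⟨P, hP⟩ := hn.size
  have key : ∀ t : List Unit, t.foldl (fun (L : List ℕ) _ => L ++ [L.length]) [] =
      List.range t.length := by
    intro t
    induction t using List.reverseRecOn with
    | nil => rfl
    | append_singleton t x ih => simp [ih, List.range_succ]
  have hsize : ∀ k m : ℕ, k ≤ m → (code (List.range k)).length ≤ k * (2 * m + 2) + 1 := by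
    intro k m
    induction k with
    | zero => simp [code_nil]
    | succ k ih =>
      intro hk
      rw [List.range_succ, code_append_singleton, code_nat_length]
      have := ih (by omega)
      linarith
  refine (foldl (g := fun _ (L : List ℕ) (_ : Unit) => L ++ [L.length]) hn.units (const [])
    (PT.restrict (f := fun s : α × List ℕ × Unit => s.2.1 ++ [s.2.1.length])
      (snd'.fst.append (snd'.fst.length.cons (const []))) _) (P * (2 * P + 2) + 1)
    fun a t ht => ?_).congr fun a => by rw [key, List.length_replicate]
  rw [key]
  have h1 := ht.length_le
  have h2 := hP a
  rw [code_nat_length] at h2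
  rw [List.length_replicate] at h1
  refine (hsize _ (n a) h1).trans ?_
  simp only [Polynomial.eval_add, Polynomial.eval_mul, Polynomial.eval_one,
    Polynomial.eval_ofNat]
  gcongr <;> omega

theorem prefixVals {O : α → List Bool → List Bool} {t : α → List Bool} (ht : PT t)
    (hO : PT (fun s : {s : α × List Bool // s.2.length ≤ (t s.1).length} => O s.1.1 s.1.2)) :
    PT (fun a => prefixVals (O a) (t a)) :=
  map (f := fun a k => O a ((t a).take k)) ht.length.succ.range
    (hO.comp ((val.fst.pair (val.snd.take (ht.comp val.fst))).sub fun s => by simp))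

theorem prf {w : Pol} {F : List Bool → List Bool → List Bool} (hF : IsPRF w F)
    {k x : α → List Bool} (hk : PT k) (hx : PT x) (h : ∀ a, (x a).length ≤ (k a).length) :
    PT (fun a => F (k a) (x a)) := by
  obtain ⟨P, hP⟩ := w.bounded
  refine PT.of_polyTimeOn hF.polytime (fun a => (k a, x a)) h (hk.cons (hx.cons (const []))) P ?_
  rintro ⟨k, x⟩ h
  simp only [_root_.id]
  rw [hF.length k x h]
  refine (hP _).trans (eval_mono P ?_)
  simp [encList]

end PT

variable {p w : Pol} {F : List Bool → List Bool → List Bool}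

/-- The hypothesis `h` keeps `F` within its domain: its machine is only known to be correct on
arguments no longer than the key, and prefixes of the received bits are such arguments. -/
theorem pt_compNext (hp : p.UnaryPolyTime) (hF : IsPRF w F) {α : Type} [Rep α] {n : α → ℕ}
    {s : α → List (StrM ⊕ LogSofM)} (hn : PT n) (hs : PT s)
    (h : ∀ a, onLeft (s a) ≠ [] → (argBits (onRight (s a))).length ≤ (keyOf (s a)).length) :
    PT (fun a => compNext F p (n a) (s a)) := by
  have hk : PT (fun a => keyOf (s a)) :=
    (((hs.onLeft.filterMap (f := fun _ m => m) PT.val.snd).head?).option_getD (PT.const [])).congr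
      fun a => by simp [keyOf, List.headD_eq_head?_getD]
  refine hs.onLeft.isCons.cases_bool (g := fun _ => Sum.inl none)
    (f := fun a => Sum.inr (respond p (n a) (prefixVals (F (keyOf (s a)))
      (argBits (onRight (s a)))) (onRight (s a)))) ?_ (PT.const _) (fun a h => ?_) (fun a h => ?_)
  · refine (PT.respond hp (hn.restrict _) ?_ (hs.onRight.restrict _)).inr
    refine PT.prefixVals (O := fun a : {a // (!(onLeft (s a)).isEmpty) = true} =>
      F (keyOf (s a.1))) (hs.onRight.argBits.restrict _) ?_
    refine PT.prf hF ((hk.restrict _).comp PT.val.fst) PT.val.snd fun x => ?_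
    obtain ⟨⟨⟨a, ha⟩, x⟩, hx⟩ := x
    refine le_trans hx (h a ?_)
    simpa using ha
  · simp only [Bool.not_eq_true'] at h
    simp [compNext, h]
  · simp only [Bool.not_eq_false'] at h
    simp [compNext, h]

theorem playsOf_last {M : Type} {G : Game M} {n : ℕ} {next : List M → M} {s : List M} {x : M}
    (h : s ++ [x] ∈ playsOf (G.legal n) next) : x = next s ∧
      ∃ t y, s = t ++ [y] ∧ t ∈ playsOf (G.legal n) next ∧ t ++ [y] ∈ G.legal n := by
  obtain ⟨t, y, z, e⟩ := exists_snoc₂ h.2.1 (by simp)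
  have e' : s = t ++ [y] ∧ x = z := by
    have : s ++ [x] = (t ++ [y]) ++ [z] := by simpa using e
    simpa using List.append_inj' this rfl
  obtain ⟨rfl, rfl⟩ := e'
  obtain ⟨h1, h2, h3⟩ := mem_playsOf_snoc.1 (e ▸ h)
  exact ⟨h3, t, y, rfl, h1, Game.mem_of_prefix h2 (by simp)⟩

/-- The moves are decoded, `next` is applied, and its value is encoded. Correctness is needed only
on plays that have an answer, and there the answer is the prescribed one. -/
theorem isPolyTime_of_next {M : Type} [Rep M] {G : Game M} (hG : G.Coded)
    {next : ℕ → List M → M}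
    (h : PT (fun a : {a : ℕ × List M // a.2 ++ [next a.1 a.2] ∈
      playsOf (G.legal a.1) (next a.1)} => next a.1.1 a.1.2)) :
    IsPolyTime G fun n => playsOf (G.legal n) (next n) := by
  obtain ⟨d, hd, hdec⟩ := hG.dec
  have hmap : ∀ s : List M, (s.map G.enc).map d = s := by
    intro s; rw [List.map_map]; simp [Function.comp_def, hdec]
  have hparse : PT (fun l : List (List Bool) => ((l.headD []).length, l.tail.map d)) :=
    PT.pair (((PT.head? PT.id).option_getD (PT.const [])).length.congr fun l => by
      rw [List.headD_eq_head?_getD]) ((PT.tail PT.id).map (f := fun _ x => d x) (hd.comp PT.val.snd))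
  refine polyTimeOn_of (fun l => G.enc (next (l.headD []).length (l.tail.map d)))
    (hG.enc.comp (PT.comp_sub (g := fun a : ℕ × List M => next a.1 a.2) h (hparse.restrict _) ?_)) ?_
  · rintro ⟨l, ⟨n, s, x⟩, hs, rfl⟩
    simp only [List.headD_cons, List.tail_cons, hmap, unary, List.length_replicate]
    have hs : s ++ [x] ∈ playsOf (G.legal n) (next n) := hs
    rw [← (playsOf_last hs).1]
    exact hs
  · rintro ⟨n, s, x⟩ hs
    simp only [List.headD_cons, List.tail_cons, hmap, unary, List.length_replicate]
    rw [← (playsOf_last hs).1]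

theorem isPolyTime_comp (hp : p.UnaryPolyTime) (hF : IsPRF w F) (hpw : ∀ n, p n ≤ w n) :
    IsPolyTime (lolli (strGame Pol.iota) (logSof p))
      (comp (prfStrategy w F) (first2second w p)) := by
  rw [show comp (prfStrategy w F) (first2second w p) = fun n =>
    playsOf ((lolli (strGame Pol.iota) (logSof p)).legal n) (compNext F p n) from
      funext fun n => (comp_eq hF.length hpw n).1]
  refine isPolyTime_of_next ((Game.Coded.str _).lolli (Game.Coded.logSof p))
    (pt_compNext hp hF PT.val.fst PT.val.snd ?_)
  rintro ⟨⟨n, s⟩, hs⟩ hl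
  simp only at hs hl ⊢
  obtain ⟨h1, h2, h3⟩ := comp_eq hF.length hpw n
  obtain ⟨-, t, y, rfl, h4, h6⟩ := playsOf_last hs
  obtain ⟨e, he, rfl⟩ := h2 t h4
  rcases he.opponent h6 with ⟨rfl, rfl⟩ | ⟨rfl, k, hk, rfl⟩ | ⟨k, v, x, h, rfl, h7⟩
  · simp at hl
  · simp [argBits]
  · have h8 := h.nested.argBits_le h7
    simpa [onRight_seenOut, h.right, keyOf, onLeft_seenOut, h.left, h.length] using h8


/-! ### Simulation of an adversary -/

/-- The moves of the game of an adversary. -/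
abbrev AdvM : Type := Option Bool ⊕ ((ℕ × LogSofM) ⊕ Option Bool)

/-- The game of an adversary. -/
abbrev advGame (p q s : Pol) : Game AdvM :=
  lolli (oracleGame q) (lolli (bang s (logSof p)) boolGame)

/-- The play in the `i`-th copy. -/
def copyPlay (i : ℕ) (u : List AdvM) : List LogSofM := proj i (onLeft (onRight u))

theorem copyPlay_append (i : ℕ) (u v : List AdvM) :
    copyPlay i (u ++ v) = copyPlay i u ++ copyPlay i v := by
  simp [copyPlay, proj_append]

@[simp] theorem copyPlay_nil (i : ℕ) : copyPlay i [] = [] := rfl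

@[simp] theorem copyPlay_inl (i : ℕ) (m : Option Bool) (u : List AdvM) :
    copyPlay i (Sum.inl m :: u) = copyPlay i u := rfl

@[simp] theorem copyPlay_inr_inr (i : ℕ) (m : Option Bool) (u : List AdvM) :
    copyPlay i (Sum.inr (Sum.inr m) :: u) = copyPlay i u := rfl

theorem copyPlay_cons (i j : ℕ) (m : LogSofM) (u : List AdvM) :
    copyPlay i (Sum.inr (Sum.inl (j, m)) :: u) =
      if j = i then m :: copyPlay i u else copyPlay i u := by
  by_cases h : j = i <;> simp [copyPlay, proj, h]

/-- A reply in the copy of the preceding move opens no copy, so the condition on the order of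
opening is inherited from that move. -/
theorem bang_snoc {M : Type} {G : Game M} {s : Pol} {n : ℕ} {l : List (ℕ × M)} {i : ℕ} {m r : M}
    (h : l ++ [(i, m)] ∈ (bang s G).legal n) (hr : proj i l ++ [m, r] ∈ G.legal n)
    (ho : G.isOpp r = !G.isOpp m) : l ++ [(i, m), (i, r)] ∈ (bang s G).legal n := by
  have e0 : l ++ [(i, m), (i, r)] = (l ++ [(i, m)]) ++ [(i, r)] := by simp
  have h1 := (altFrom_snoc.1 h.1).2
  refine ⟨?_, fun j => ?_, ?_, ?_⟩
  · rw [e0]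
    refine altFrom_snoc.2 ⟨h.1, ?_⟩
    simp only at h1
    simp only [ho, h1]
    by_cases he : Even l.length <;> simp [Nat.even_add_one, he]
  · by_cases hj : i = j
    · subst hj
      rw [proj_append]
      simpa [proj] using hr
    · have := h.2.1 j
      rw [proj_append] at this ⊢
      simpa [proj, hj] using this
  · intro x hx
    simp only [List.mem_append, List.mem_cons, List.not_mem_nil, or_false] at hx
    have h2 : i < s n := h.2.2.1 (i, m) (by simp)
    rcases hx with hx | rfl | rfl
    · exact h.2.2.1 x (by simp [hx])
    · exact h2
    · exact h2
  · intro u v j x e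
    rw [e0] at e
    rcases List.eq_nil_or_concat v with rfl | ⟨v, y, rfl⟩
    · have := List.append_inj' e rfl
      simp only [List.cons.injEq, Prod.mk.injEq, and_true] at this
      obtain ⟨rfl, rfl, rfl⟩ := this
      obtain ⟨y, hy⟩ := h.2.2.2 l [] j m rfl
      exact ⟨y, by simp [hy]⟩
    · have : l ++ [(i, m)] ++ [(i, r)] = (u ++ (j + 1, x) :: v) ++ [y] := by simpa using e
      exact h.2.2.2 u v j x (List.append_inj' this rfl).1

variable {p q s : Pol} {n : ℕ} {A : Plays AdvM}

/-- It is the turn of the adversary in `u`, and all the copies have been played as nested plays. -/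
structure Pos (p q s : Pol) (A : Plays AdvM) (n : ℕ) (u : List AdvM) : Prop where
  legal : u ∈ (advGame p q s).legal n
  mem : ∃ u0 o, u = u0 ++ [o] ∧ u0 ∈ A n
  nested : ∀ i, Nested p n (copyPlay i u)
  coins : Even (onLeft u).length
  result : onRight (onRight u) = [none]
  odd : Odd u.length

theorem pos_start (hA : IsStrategy (advGame p q s) A) : Pos p q s A n [Sum.inr (Sum.inr none)] where
  legal := ⟨by simp [AltFrom, lolli, boolGame, ground], Game.nil_mem _ _,
    by simp [AltFrom, boolGame, ground], Game.nil_mem _ _, Or.inr (Or.inl rfl)⟩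
  mem := ⟨[], _, rfl, hA.nil_mem n⟩
  nested i := Nested.nil
  coins := by simp
  result := rfl
  odd := by simp

theorem Pos.exists_next (hA : IsStrategy (advGame p q s) A) {u : List AdvM}
    (h : Pos p q s A n u) : ∃ m, u ++ [m] ∈ A n := by
  obtain ⟨u0, o, rfl, h0⟩ := h.mem
  obtain ⟨y, hy⟩ := hA.total n u0 o h0 h.legal
  exact ⟨y, by simpa using hy⟩

/-- The moves of the adversary. -/
theorem Pos.next_cases (hA : IsStrategy (advGame p q s) A) {u : List AdvM}
    (h : Pos p q s A n u) {m : AdvM} (hm : u ++ [m] ∈ A n) :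
    m = Sum.inl none ∨ (∃ b, m = Sum.inr (Sum.inr (some b))) ∨
      ∃ i x, m = Sum.inr (Sum.inl (i, x)) ∧ copyPlay i u ++ [x] ∈ (logSof p).legal n := by
  have h1 := (hA.legal n _ hm).1
  have h2 := Game.isOpp_of_snoc h1
  have h3 := h.odd
  rw [← Nat.not_even_iff_odd] at h3
  simp only [h3, decide_false] at h2
  rcases m with o | ⟨i, x⟩ | o
  · cases o
    · exact Or.inl rfl
    · simp [lolli, oracleGame] at h2
  · refine Or.inr (Or.inr ⟨i, x, rfl, ?_⟩)
    have h4 := h1.2.2.2.1.2.1 i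
    simpa [copyPlay, proj] using h4
  · cases o
    · simp [lolli, boolGame, ground] at h2
    · exact Or.inr (Or.inl ⟨_, rfl⟩)

theorem Pos.coin (hA : IsStrategy (advGame p q s) A) {u : List AdvM}
    (h : Pos p q s A n u) (hm : u ++ [Sum.inl none] ∈ A n) (c : Bool) :
    Pos p q s A n (u ++ [Sum.inl none, Sum.inl (some c)]) where
  legal := by
    have h1 := (hA.legal n _ hm).1
    have h2 := h1.2.1
    have e : u ++ [Sum.inl none, Sum.inl (some c)] = (u ++ [Sum.inl none]) ++ [Sum.inl (some c)] := by
      simp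
    have h3 := h.odd
    have h4 := h.coins
    rw [e]
    refine ⟨altFrom_snoc.2 ⟨h1.1, ?_⟩, ⟨?_, ?_⟩, ?_⟩
    · simp [oracleGame, Nat.even_add_one]
      exact h3
    · rw [onLeft_append]
      refine altFrom_snoc.2 ⟨h2.1, ?_⟩
      simp [Nat.even_add_one, h4]
    · have := h2.2
      simpa using this
    · simpa using h1.2.2
  mem := ⟨u ++ [Sum.inl none], Sum.inl (some c), by simp, hm⟩
  nested i := by simpa [copyPlay_append] using h.nested i
  coins := by simpa [Nat.even_add] using h.coins
  result := by simpa using h.result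
  odd := by simpa [Nat.odd_add] using h.odd

theorem Pos.reply (hA : IsStrategy (advGame p q s) A) {u : List AdvM}
    (h : Pos p q s A n u) {i : ℕ} {x y : LogSofM} (hm : u ++ [Sum.inr (Sum.inl (i, x))] ∈ A n)
    (hy : Nested p n (copyPlay i u ++ [x, y])) :
    Pos p q s A n (u ++ [Sum.inr (Sum.inl (i, x)), Sum.inr (Sum.inl (i, y))]) where
  legal := by
    have h1 := (hA.legal n _ hm).1
    have e : u ++ [Sum.inr (Sum.inl (i, x)), Sum.inr (Sum.inl (i, y))] =
      (u ++ [Sum.inr (Sum.inl (i, x))]) ++ [Sum.inr (Sum.inl (i, y))] := by simp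
    have h3 := h.odd
    have hl := hy.legal
    have h6 : (logSof p).isOpp x = true := by
      have := Game.isOpp_of_snoc (Game.mem_of_prefix hl (show copyPlay i u ++ [x] <+: _ by simp))
      simpa [(h.nested i).even] using this
    have h7 : (logSof p).isOpp y = false := by
      have := Game.isOpp_of_snoc (s := copyPlay i u ++ [x]) (x := y) (by simpa using hl)
      simpa [Nat.even_add_one, (h.nested i).even] using this
    have h8 : onLeft (onRight u) ++ [(i, x), (i, y)] ∈ (bang s (logSof p)).legal n :=
      bang_snoc (by simpa using h1.2.2.2.1) hl (by simp [h6, h7])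
    have h9 := (altFrom_snoc.1 (show AltFrom _ true (onRight u ++ [Sum.inl (i, x)]) by
      simpa using h1.2.2.1)).2
    rw [e]
    refine ⟨altFrom_snoc.2 ⟨h1.1, ?_⟩, ?_, ?_, ?_, ?_⟩
    · simp [lolli, bang, Nat.even_add_one, h7]
      exact h3
    · simpa using h1.2.1
    · rw [onRight_append]
      refine altFrom_snoc.2 ⟨h1.2.2.1, ?_⟩
      simp only [bang, Sum.elim_inl, h6, Bool.not_true] at h9
      have h10 : ¬ Even (onRight u).length := by simpa using h9.symm
      simp [bang, h7, Nat.even_add_one, h10]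
    · simpa using h8
    · have := h1.2.2.2.2
      simpa using this
  mem := ⟨u ++ [Sum.inr (Sum.inl (i, x))], Sum.inr (Sum.inl (i, y)), by simp, hm⟩
  nested j := by
    rw [copyPlay_append, copyPlay_cons, copyPlay_cons]
    split_ifs with hj
    · subst hj; simpa using hy
    · simpa using h.nested j
  coins := by simpa using h.coins
  result := by simpa using h.result
  odd := by simpa [Nat.odd_add] using h.odd


variable {p q s : Pol} {n : ℕ} {A : Plays AdvM}

/-- The play `u`, the coins and the oracle answers that remain. -/
abbrev SimState : Type := List AdvM × List Bool × List (List Bool)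

/-- The outcome of a step: a new state, or an oracle query or final output. -/
abbrev SimResult : Type := SimState ⊕ (List Bool ⊕ Bool)

/-- What happens in a state after the move `m` of the adversary. -/
def simCont (p : Pol) (n : ℕ) (m : AdvM) (x : SimState) : SimResult :=
  match m with
  | Sum.inl _ =>
    match x.2.1 with
    | [] => Sum.inr (Sum.inr false)
    | c :: r => Sum.inl (x.1 ++ [Sum.inl none, Sum.inl (some c)], r, x.2.2)
  | Sum.inr (Sum.inl (i, m)) =>
    let v := copyPlay i x.1 ++ [m]
    let k := (argBits v).length
    if k < x.2.2.length then
      Sum.inl (x.1 ++ [Sum.inr (Sum.inl (i, m)),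
        Sum.inr (Sum.inl (i, respond p n (x.2.2.take (k + 1)) v))], x.2.1, x.2.2.drop (k + 1))
    else Sum.inr (Sum.inl ((argBits v).take x.2.2.length))
  | Sum.inr (Sum.inr b) => Sum.inr (Sum.inr (b.getD false))

open Classical in
/-- The move of the adversary after `u`. -/
noncomputable def advNext (A : Plays AdvM) (n : ℕ) (u : List AdvM) : AdvM :=
  if h : ∃ m, u ++ [m] ∈ A n then h.choose else Sum.inr (Sum.inr none)

theorem advNext_mem {u : List AdvM} (h : ∃ m, u ++ [m] ∈ A n) : u ++ [advNext A n u] ∈ A n := by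
  unfold advNext
  rw [dif_pos h]
  exact h.choose_spec

/-- One step of the simulation. -/
noncomputable def simStep (p : Pol) (A : Plays AdvM) (n : ℕ) (x : SimState) : SimResult :=
  simCont p n (advNext A n x.1) x

/-- The output of `k` steps of the simulation. -/
noncomputable def simRun (p : Pol) (A : Plays AdvM) (n k : ℕ) (x : SimState) : List Bool ⊕ Bool :=
  Sum.elim (fun _ => Sum.inr false) id ((Sum.elim (simStep p A n) Sum.inr)^[k] (Sum.inl x))

theorem simRun_succ (k : ℕ) (x : SimState) : simRun p A n (k + 1) x =
    Sum.elim (simRun p A n k) id (simStep p A n x) := by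
  unfold simRun
  rw [Function.iterate_succ_apply, Sum.elim_inl]
  cases simStep p A n x with
  | inl y => rfl
  | inr y =>
    rw [Function.iterate_fixed (by rfl)]
    rfl

/-- `advNext` is defined by a choice; determinism of the adversary makes the choice irrelevant. -/
theorem Pos.unique (hA : IsStrategy (advGame p q s) A) {u : List AdvM} (h : Pos p q s A n u)
    {m : AdvM} (hm : u ++ [m] ∈ A n) : m = advNext A n u := by
  have h1 := advNext_mem ⟨m, hm⟩
  obtain ⟨u0, o, rfl, h0⟩ := h.mem
  exact hA.deterministic n u0 o _ _ (by simpa using hm) (by simpa using h1)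

/-- The three kinds of steps. -/
theorem Pos.step_cases (hA : IsStrategy (advGame p q s) A) {u : List AdvM} (h : Pos p q s A n u) :
    (u ++ [Sum.inl none] ∈ A n ∧ ∀ r ys, simStep p A n (u, r, ys) =
      simCont p n (Sum.inl none) (u, r, ys)) ∨
    (∃ b, u ++ [Sum.inr (Sum.inr (some b))] ∈ A n ∧ ∀ r ys, simStep p A n (u, r, ys) =
      Sum.inr (Sum.inr b)) ∨
    ∃ i x, u ++ [Sum.inr (Sum.inl (i, x))] ∈ A n ∧ copyPlay i u ++ [x] ∈ (logSof p).legal n ∧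
      ∀ r ys, simStep p A n (u, r, ys) = simCont p n (Sum.inr (Sum.inl (i, x))) (u, r, ys) := by
  have hm := advNext_mem (h.exists_next hA)
  rcases h.next_cases hA hm with e | ⟨b, e⟩ | ⟨i, x, e, hl⟩
  · rw [e] at hm
    exact Or.inl ⟨hm, fun r ys => by rw [simStep, e]⟩
  · rw [e] at hm
    exact Or.inr (Or.inl ⟨b, hm, fun r ys => by rw [simStep, e]; rfl⟩)
  · rw [e] at hm
    exact Or.inr (Or.inr ⟨i, x, hm, hl, fun r ys => by rw [simStep, e]⟩)

theorem Pos.step (hA : IsStrategy (advGame p q s) A) {u u' : List AdvM} (h : Pos p q s A n u)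
    {r r' : List Bool} {ys ys' : List (List Bool)} (hy : ∀ y ∈ ys, p n ≤ y.length)
    (e : simStep p A n (u, r, ys) = Sum.inl (u', r', ys')) :
    Pos p q s A n u' ∧ (∃ k, r' = r.drop k) ∧ ∃ k, ys' = ys.drop k := by
  rcases h.step_cases hA with ⟨hm, h1⟩ | ⟨b, hm, h1⟩ | ⟨i, x, hm, hl, h1⟩
  · rw [h1, simCont] at e
    cases r with
    | nil => simp at e
    | cons c r =>
      simp only [Sum.inl.injEq, Prod.mk.injEq] at e
      obtain ⟨rfl, rfl, rfl⟩ := e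
      exact ⟨h.coin hA hm c, ⟨1, rfl⟩, 0, rfl⟩
  · simp [h1] at e
  · rw [h1, simCont] at e
    simp only at e
    split_ifs at e with hk
    simp only [Sum.inl.injEq, Prod.mk.injEq] at e
    obtain ⟨rfl, rfl, rfl⟩ := e
    refine ⟨h.reply hA hm ((h.nested i).respond hl ?_ ?_), ⟨0, rfl⟩, _, rfl⟩
    · rw [List.length_take]; omega
    · exact fun y hy' => hy y (List.mem_of_mem_take hy')

/-! ### Acceptance by the adversary, one step at a time -/

/-- Questions and answers for the coins `r`. -/
abbrev coinMoves (r : List Bool) : List (Option Bool ⊕ Option Bool) :=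
  r.flatMap (fun c => [Sum.inl none, Sum.inl (some c)])

/-- From `u`, the adversary accepts with the coins `r` against the strategy of `T`. -/
def Accepts (s : Pol) (A : Plays AdvM) (T : RandTree (Pol.lg n) (p n) n) (u : List AdvM)
    (r : List Bool) : Prop :=
  ∃ v, u ++ v ∈ A n ∧ onLeft (onRight (u ++ v)) ∈ bangPlays s (logSof p) n (randSof p n T) ∧
    seenOut v = coinMoves r ++ [Sum.inr (some true)]

theorem IsStrategy.mem_of_append {M : Type} {G : Game M} {σ : Plays M} (h : IsStrategy G σ)
    {n : ℕ} {u : List M} (hu : Even u.length) :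
    ∀ {v : List M}, u ++ v ∈ σ n → u ∈ σ n := by
  intro v
  induction hk : v.length using Nat.strong_induction_on generalizing v with
  | _ k ih =>
    intro hv
    have h1 := (h.legal n _ hv).2
    rw [List.length_append, Nat.even_add] at h1
    by_cases h0 : v = []
    · simpa [h0] using hv
    · obtain ⟨t, x, y, rfl⟩ := exists_snoc₂ (h1.1 hu) h0
      rw [← List.append_assoc] at hv
      exact ih t.length (by simp [← hk]) rfl (h.prefix_mem n _ x y hv)

theorem Pos.even_copies {u : List AdvM} (h : Pos p q s A n u) :
    Even (onLeft (onRight u)).length := by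
  have h1 := length_onLeft_add u
  have h2 := length_onLeft_add (onRight u)
  have h3 := h.odd
  have h4 := h.coins
  rw [h.result, List.length_singleton] at h2
  rw [← h1, ← h2] at h3
  rcases h4 with ⟨a, ha⟩
  rcases h3 with ⟨b, hb⟩
  exact ⟨b - a, by omega⟩

/-- The opponent answers the last move of the adversary. -/
theorem Pos.answer {u : List AdvM} (h : Pos p q s A n u) {m o : AdvM}
    (hl : u ++ [m, o] ∈ (advGame p q s).legal n) :
    (m = Sum.inl none → ∃ c, o = Sum.inl (some c)) ∧
      ∀ i x, m = Sum.inr (Sum.inl (i, x)) → ∃ y, o = Sum.inr (Sum.inl (i, y)) := by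
  have h0 : (advGame p q s).isOpp o = true := by
    have := Game.isOpp_of_snoc (s := u ++ [m]) (x := o) (by simpa using hl)
    have h3 := h.odd
    rw [← Nat.not_even_iff_odd] at h3
    simpa [Nat.even_add_one, h3] using this
  have hres : ∀ x, o = Sum.inr (Sum.inr x) → onRight (onRight [m]) = [] → False := by
    rintro x rfl hm
    have h1 := hl.2.2.2.2
    have e : onRight (onRight (u ++ [m, Sum.inr (Sum.inr x)])) = [none, x] := by
      rw [show u ++ [m, Sum.inr (Sum.inr x)] = u ++ ([m] ++ [Sum.inr (Sum.inr x)]) by simp]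
      rw [onRight_append, onRight_append, onRight_append, onRight_append, hm, h.result]
      simp
    rw [e] at h1
    have h2 := Game.isOpp_of_snoc (s := [none]) (x := x) h1
    have h3 : (advGame p q s).isOpp (Sum.inr (Sum.inr x)) = boolGame.isOpp x := rfl
    rw [h3, h2] at h0
    simp at h0
  constructor
  · rintro rfl
    rcases o with o | ⟨j, y⟩ | o
    · cases o
      · exact absurd h0 Bool.false_ne_true
      · exact ⟨_, rfl⟩
    · have h1 := hl.2.2.2.1
      have h2 := Game.isOpp_of_snoc (s := onLeft (onRight u)) (x := (j, y)) (by simpa using h1)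
      simp only [h.even_copies, decide_true] at h2
      have h3 : (advGame p q s).isOpp (Sum.inr (Sum.inl (j, y))) =
        !(bang s (logSof p)).isOpp (j, y) := rfl
      rw [h3, h2] at h0
      simp at h0
    · exact (hres o rfl (by simp)).elim
  · rintro i x rfl
    rcases o with o | ⟨j, y⟩ | o
    · have h1 := hl.2.1
      have h2 := Game.isOpp_of_snoc (s := onLeft u) (x := o) (by simpa using h1)
      simp only [h.coins, decide_true] at h2
      have h3 : (advGame p q s).isOpp (Sum.inl o) = !(oracleGame q).isOpp o := rfl
      rw [h3, h2] at h0
      simp at h0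
    · by_cases hij : i = j
      · subst hij; exact ⟨_, rfl⟩
      · have h1 := hl.2.2.2.1.2.1 j
        have h2 := Game.isOpp_of_snoc (s := copyPlay j u) (x := y) (by
          simpa [copyPlay, proj, hij] using h1)
        simp only [(h.nested j).even, decide_true] at h2
        have h3 : (advGame p q s).isOpp (Sum.inr (Sum.inl (j, y))) = !(logSof p).isOpp y := rfl
        rw [h3, h2] at h0
        simp at h0
    · exact (hres o rfl (by simp)).elim

variable {T : RandTree (Pol.lg n) (p n) n}

/-- Any accepting continuation has to begin with the unique move of the adversary. The three
equivalences that follow treat an output, a coin and a move in a copy; they match the three kinds of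
steps of the simulation. -/
theorem Pos.accepts_cases (hA : IsStrategy (advGame p q s) A) {u : List AdvM}
    (h : Pos p q s A n u) {m : AdvM} (hm : u ++ [m] ∈ A n) {r : List Bool}
    (ha : Accepts s A T u r) : ∃ v, u ++ m :: v ∈ A n ∧
      onLeft (onRight (u ++ m :: v)) ∈ bangPlays s (logSof p) n (randSof p n T) ∧
      seenOut (m :: v) = coinMoves r ++ [Sum.inr (some true)] := by
  obtain ⟨v, h1, h2, h3⟩ := ha
  cases v with
  | nil => simp at h3
  | cons m' v =>
    have h4 : u ++ [m'] ∈ A n := by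
      have := h.odd
      refine hA.mem_of_append (by simpa [Nat.even_add_one] using this) (v := v) ?_
      simpa using h1
    have : m' = m := (h.unique hA h4).trans (h.unique hA hm).symm
    subst this
    exact ⟨v, h1, h2, h3⟩

theorem Pos.accepts_final (hA : IsStrategy (advGame p q s) A) {u : List AdvM}
    (h : Pos p q s A n u) (hT : ∀ i, copyPlay i u ∈ randSof p n T) {b : Bool}
    (hm : u ++ [Sum.inr (Sum.inr (some b))] ∈ A n) {r : List Bool} :
    Accepts s A T u r ↔ b = true ∧ r = [] := by
  constructor
  · intro ha
    obtain ⟨v, h1, h2, h3⟩ := h.accepts_cases hA hm ha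
    cases r with
    | nil => simp at h3; exact ⟨h3.1, rfl⟩
    | cons c r => simp at h3
  · rintro ⟨rfl, rfl⟩
    refine ⟨_, hm, ⟨?_, ?_, fun i => ?_⟩, by simp⟩
    · exact (hA.legal n _ hm).1.2.2.2.1
    · simpa using h.even_copies
    · simpa [copyPlay] using hT i

theorem Pos.accepts_coin (hA : IsStrategy (advGame p q s) A) {u : List AdvM}
    (h : Pos p q s A n u) (hm : u ++ [Sum.inl none] ∈ A n) {r : List Bool} :
    Accepts s A T u r ↔ ∃ c r', r = c :: r' ∧
      Accepts s A T (u ++ [Sum.inl none, Sum.inl (some c)]) r' := by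
  constructor
  · intro ha
    obtain ⟨v, h1, h2, h3⟩ := h.accepts_cases hA hm ha
    cases r with
    | nil => simp at h3
    | cons c r =>
      cases v with
      | nil => simp at h3
      | cons o v =>
        obtain ⟨c', rfl⟩ := (h.answer (Game.mem_of_prefix (hA.legal n _ h1).1
          (show u ++ [Sum.inl none, o] <+: _ from ⟨v, by simp⟩))).1 rfl
        simp only [seenOut_left, List.flatMap_cons, List.cons_append, List.nil_append,
          List.cons.injEq, Sum.inl.injEq, Option.some.injEq, true_and] at h3
        obtain ⟨rfl, h3⟩ := h3
        exact ⟨c', r, rfl, v, by simpa using h1, by simpa using h2, h3⟩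
  · rintro ⟨c, r, rfl, v, h1, h2, h3⟩
    exact ⟨Sum.inl none :: Sum.inl (some c) :: v, by simpa using h1, by simpa using h2,
      by simp [h3]⟩

/-- By `Pos.answer` the opponent has to reply in the copy of the move, and a play of `randSof`
leaves only the reply prescribed by the tree. -/
theorem Pos.accepts_reply (hA : IsStrategy (advGame p q s) A) {u : List AdvM}
    (h : Pos p q s A n u) {i : ℕ} {x : LogSofM} (hm : u ++ [Sum.inr (Sum.inl (i, x))] ∈ A n)
    {r : List Bool} : Accepts s A T u r ↔
      Accepts s A T (u ++ [Sum.inr (Sum.inl (i, x)),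
        Sum.inr (Sum.inl (i, T.next (copyPlay i u ++ [x])))]) r := by
  constructor
  · intro ha
    obtain ⟨v, h1, h2, h3⟩ := h.accepts_cases hA hm ha
    cases v with
    | nil => simp at h3
    | cons o v =>
      have hl := Game.mem_of_prefix (hA.legal n _ h1).1
          (show u ++ [Sum.inr (Sum.inl (i, x)), o] <+: _ from ⟨v, by simp⟩)
      obtain ⟨y, rfl⟩ := (h.answer hl).2 i x rfl
      have h4 : y = T.next (copyPlay i u ++ [x]) := by
        have h5 := (h2.2.2 i).2.2 (copyPlay i u ++ [x]) (copyPlay i v) y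
          (by simp [copyPlay, proj]) (by
            have := (h.nested i).even
            simpa [Nat.odd_add_one] using this)
        exact h5
      subst h4
      exact ⟨v, by simpa using h1, by simpa using h2, by simpa using h3⟩
  · rintro ⟨v, h1, h2, h3⟩
    exact ⟨Sum.inr (Sum.inl (i, x)) :: Sum.inr (Sum.inl (i, T.next (copyPlay i u ++ [x]))) :: v,
      by simpa using h1, by simpa using h2, by simp [h3]⟩


/-! ### Runs of the simulation -/

/-- An algorithm in the middle of a run is an algorithm at its beginning with the known answers
built into its step function. -/
theorem runOracle_append {n : ℕ} {step : List (List Bool) → List Bool ⊕ Bool}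
    {O : List Bool → List Bool} (ys : List (List Bool)) : ∀ (fuel : ℕ) (zs : List (List Bool)),
    runOracle n step O fuel (ys ++ zs) = runOracle n (fun zs => step (ys ++ zs)) O fuel zs := by
  intro fuel
  induction fuel with
  | zero => intro zs; rw [runOracle, runOracle]
  | succ fuel ih =>
    intro zs
    rw [runOracle, runOracle]
    cases step (ys ++ zs) with
    | inl x =>
      simp only [List.append_assoc, ih (zs ++ [O x])]
    | inr b => rfl

theorem runOracle_query {n : ℕ} {step : List (List Bool) → List Bool ⊕ Bool}
    {O : List Bool → List Bool} {fuel : ℕ} {ys : List (List Bool)} {x : List Bool}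
    (h : step ys = Sum.inl x) (hx : x.length ≤ n) :
    runOracle n step O (fuel + 1) ys = runOracle n step O fuel (ys ++ [O x]) := by
  rw [runOracle, h]
  simp only [hx, if_true]

theorem runOracle_output {n : ℕ} {step : List (List Bool) → List Bool ⊕ Bool}
    {O : List Bool → List Bool} {fuel : ℕ} {ys : List (List Bool)} {b : Bool}
    (h : step ys = Sum.inr b) : runOracle n step O fuel ys = b := by
  cases fuel <;> rw [runOracle, h]

/-- An algorithm that begins by asking for the values at the prefixes of `t`. -/
theorem runOracle_prefixVals {n : ℕ} {step : List (List Bool) → List Bool ⊕ Bool}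
    {O : List Bool → List Bool} {t : List Bool} (ht : t.length ≤ n)
    (h : ∀ ys : List (List Bool), ys.length ≤ t.length → step ys = Sum.inl (t.take ys.length))
    (fuel : ℕ) : runOracle n step O (fuel + (t.length + 1)) [] =
      runOracle n (fun zs => step (prefixVals O t ++ zs)) O fuel [] := by
  suffices ∀ j ≤ t.length + 1, runOracle n step O (fuel + (t.length + 1)) [] =
      runOracle n step O (fuel + (t.length + 1 - j))
        ((List.range j).map fun k => O (t.take k)) by
    rw [this _ le_rfl, Nat.sub_self, Nat.add_zero]
    exact (congrArg _ (List.append_nil _).symm).trans (runOracle_append _ fuel [])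
  intro j hj
  induction j with
  | zero => rfl
  | succ j ih =>
    rw [ih (by omega), List.range_succ, List.map_append,
      show fuel + (t.length + 1 - j) = fuel + (t.length + 1 - (j + 1)) + 1 by omega,
      runOracle_query (h _ (by simp; omega)) (by simp; omega)]
    simp

variable {p q s : Pol} {n : ℕ} {A : Plays AdvM}

/-- For given coins `r` the adversary consumes a definite initial part `r0`, so at most one prefix
of `r` can be the exact list of coins of an accepting play. Every step lengthens the play or ends
the simulation, so with `K` above the length of all plays `k` steps are enough; a step costs at most
`n + 1` queries, one for each prefix of at most `n` bits. The assumption on `r` says that the coins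
left suffice for the requests that the adversary may still make. -/
theorem Pos.run (hA : IsStrategy (advGame p q s) A) {K : ℕ}
    (hK : ∀ u ∈ (advGame p q s).legal n, u.length < K) {O : List Bool → List Bool}
    {hO : ∀ x, x.length ≤ n → p n ≤ (O x).length} :
    ∀ (k : ℕ) (u : List AdvM) (r : List Bool) (fuel : ℕ), Pos p q s A n u →
      (∀ i, copyPlay i u ∈ randSof p n (treeOf p n O hO)) →
      q n ≤ (onLeft u).count none + r.length → K ≤ u.length + k → k * (n + 1) ≤ fuel →
      ∃ r0, ∀ r', (r' <+: r ∧ Accepts s A (treeOf p n O hO) u r') ↔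
        (runOracle n (fun zs => simRun p A n k (u, r, zs)) O fuel [] = true ∧ r' = r0) := by
  intro k
  induction k with
  | zero =>
    intro u r fuel h _ _ hk
    have := hK u h.legal
    omega
  | succ k ih =>
    intro u r fuel h hT hr hk hf
    rcases h.step_cases hA with ⟨hm, h1⟩ | ⟨b, hm, h1⟩ | ⟨i, x, hm, hl, h1⟩
    · cases r with
      -- Coins cannot run out: one more request would exceed the `q n` allowed by the oracle game.
      | nil =>
        have h2 := (hA.legal n _ hm).1.2.1.2
        simp at h2 hr
        omega
      | cons c r =>
        obtain ⟨r0, h0⟩ := ih (u ++ [Sum.inl none, Sum.inl (some c)]) r fuel (h.coin hA hm c)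
          (fun i => by simpa [copyPlay] using hT i)
          (by simp at hr ⊢; omega) (by simp; omega) (by rw [Nat.add_mul] at hf; omega)
        refine ⟨c :: r0, fun r' => ?_⟩
        have e : (fun zs => simRun p A n (k + 1) (u, c :: r, zs)) =
            fun zs => simRun p A n k (u ++ [Sum.inl none, Sum.inl (some c)], r, zs) := by
          funext zs
          rw [simRun_succ, h1]
          rfl
        rw [e, h.accepts_coin hA hm]
        constructor
        · rintro ⟨h2, c', r', rfl, h3⟩
          obtain ⟨rfl, h5⟩ := List.cons_prefix_cons.1 h2
          obtain ⟨h4, rfl⟩ := (h0 r').1 ⟨h5, h3⟩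
          exact ⟨h4, rfl⟩
        · rintro ⟨h2, rfl⟩
          obtain ⟨h3, h4⟩ := (h0 r0).2 ⟨h2, rfl⟩
          exact ⟨List.cons_prefix_cons.2 ⟨rfl, h3⟩, c, r0, rfl, h4⟩
    · refine ⟨[], fun r' => ?_⟩
      rw [runOracle_output (b := b) (by rw [simRun_succ, h1]; rfl), h.accepts_final hA hT hm]
      constructor
      · rintro ⟨-, h2⟩; exact h2
      · rintro ⟨h2, rfl⟩; exact ⟨List.nil_prefix, h2, rfl⟩
    · have hn := (h.nested i).argBits_le hl
      obtain ⟨f, rfl⟩ : ∃ f, fuel = f + ((argBits (copyPlay i u ++ [x])).length + 1) :=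
        ⟨fuel - ((argBits (copyPlay i u ++ [x])).length + 1), by
          rw [Nat.add_mul] at hf; omega⟩
      have hnx := treeOf_next (O := O) (hO := hO) (h.nested i) hl
      have hnest := (h.nested i).next (treeOf p n O hO) hl
      -- Once the values at all prefixes are available, the step consumes exactly these and the rest
      -- of the run only depends on `zs`. The simulation is replayed from its start whenever a new
      -- answer arrives, and prefixes are queried afresh for every response.
      have hc : ∀ zs, simRun p A n (k + 1) (u, r, prefixVals O (argBits (copyPlay i u ++ [x])) ++ zs) =
          simRun p A n k (u ++ [Sum.inr (Sum.inl (i, x)), Sum.inr (Sum.inl (i,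
            (treeOf p n O hO).next (copyPlay i u ++ [x])))], r, zs) := by
        intro zs
        have hlen := length_prefixVals O (argBits (copyPlay i u ++ [x]))
        rw [simRun_succ, h1, simCont]
        simp only
        rw [if_pos (by rw [List.length_append]; omega), Sum.elim_inl, List.take_left' hlen,
          List.drop_left' hlen, hnx]
      obtain ⟨r0, h0⟩ := ih _ r f (h.reply hA hm hnest)
        (fun j => by
          rw [copyPlay_append, copyPlay_cons, copyPlay_cons]
          split_ifs with hj
          · subst hj
            exact mem_playsOf_snoc.2 ⟨hT _, hnest.legal, rfl⟩
          · simpa using hT j)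
        (by simpa using hr) (by simp; omega) (by rw [Nat.add_mul] at hf; omega)
      refine ⟨r0, fun r' => ?_⟩
      rw [h.accepts_reply hA hm, h0 r', runOracle_prefixVals hn _ f]
      · simp only [hc]
      · intro ys hys
        rw [simRun_succ, h1, simCont]
        simp only
        rw [if_neg (by omega)]
        rfl


variable {p q s : Pol} {n : ℕ} {A : Plays AdvM}

theorem accepts_start (hA : IsStrategy (advGame p q s) A) {T : RandTree (Pol.lg n) (p n) n}
    {r : List Bool} : coinPlay r true ∈ appProb (bangPlays s (logSof p) n (randSof p n T)) (A n) ↔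
      Accepts s A T [Sum.inr (Sum.inr none)] r := by
  constructor
  · rintro ⟨u, h1, h2, h3⟩
    have hl := (hA.legal n _ h1).1
    have h3 : coinPlay r true = seenOut u := h3
    cases u with
    | nil => simp [coinPlay] at h3
    | cons o v =>
      have h4 := hl.1.1
      rcases o with o | o | o
      · have h5 := ((oracleGame q).alternating n _ hl.2.1).1
        simp only [Sum.elim_inl] at h4
        rw [h5] at h4
        simp at h4
      · have h5 := ((bang s (logSof p)).alternating n _ hl.2.2.2.1).1
        have h6 : (!(bang s (logSof p)).isOpp o) = true := h4
        rw [h5] at h6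
        simp at h6
      · cases o with
        | none =>
          refine ⟨v, h1, h2, ?_⟩
          simpa [coinPlay] using h3.symm
        | some b => exact absurd h4 (by simp [lolli, boolGame, ground])
  · rintro ⟨v, h1, h2, h3⟩
    exact ⟨_, h1, h2, by
      rw [show ([Sum.inr (Sum.inr none)] ++ v : List AdvM).filterMap _ =
        seenOut ([Sum.inr (Sum.inr none)] ++ v) from rfl]
      simp [coinPlay, h3]⟩

theorem Accepts.length_le (hA : IsStrategy (advGame p q s) A) {T : RandTree (Pol.lg n) (p n) n}
    {u : List AdvM} {r : List Bool} (h : Accepts s A T u r) : r.length ≤ q n := by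
  obtain ⟨v, h1, -, h3⟩ := h
  have h4 := (hA.legal n _ h1).1.2.1.2
  have h5 : (onLeft (coinMoves r ++ [Sum.inr (some true)])).count none = r.length := by
    clear h1 h3 h4
    induction r with
    | nil => simp
    | cons c r ih => simpa using ih
  rw [← h3, onLeft_seenOut] at h5
  rw [onLeft_append, List.count_append] at h4
  omega

theorem sum_take {Q k : ℕ} (hk : k ≤ Q) (f : List Bool → ℝ) :
    ∑ r : List.Vector Bool Q, f (r.toList.take k) =
      2 ^ (Q - k) * ∑ r : List.Vector Bool k, f r.toList := by
  induction k generalizing Q f with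
  | zero =>
    simp [card_vector]
  | succ k ih =>
    obtain ⟨Q, rfl⟩ : ∃ Q', Q = Q' + 1 := ⟨Q - 1, by omega⟩
    have e : ∀ (m : ℕ) (g : List Bool → ℝ), ∑ r : List.Vector Bool (m + 1), g r.toList =
        ∑ b : Bool, ∑ r : List.Vector Bool m, g (b :: r.toList) := by
      intro m g
      rw [← Fintype.sum_prod_type']
      refine (Fintype.sum_equiv (Equiv.ofBijective
        (fun x : Bool × List.Vector Bool m => x.1 ::ᵥ x.2) ⟨?_, ?_⟩) _ _ fun x => ?_).symm
      · rintro ⟨a, x⟩ ⟨b, y⟩ h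
        have h1 := congrArg List.Vector.head h
        have h2 := congrArg List.Vector.tail h
        simp at h1 h2
        rw [h1, h2]
      · intro r
        exact ⟨(r.head, r.tail), List.Vector.cons_head_tail r⟩
      · exact congrArg g (List.Vector.toList_cons x.1 x.2).symm
    rw [e Q fun l => f (l.take (k + 1)), e k, Finset.mul_sum]
    refine Finset.sum_congr rfl fun b _ => ?_
    simp only [List.take_succ_cons]
    rw [ih (by omega) fun l => f (b :: l)]
    simp

/-- The first `k` of `Q` independent coins are uniform. This compares `prObs`, which draws only the
coins that are used, with an algorithm that draws all its coins in advance. -/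
theorem expect_take {Q k : ℕ} (hk : k ≤ Q) (f : List Bool → ℝ) :
    (Finset.univ.expect fun r : List.Vector Bool Q => f (r.toList.take k)) =
      ∑ r : List.Vector Bool k, f r.toList * (1 / 2) ^ k := by
  rw [Fintype.expect_eq_sum_div_card, sum_take hk, card_vector, ← Finset.sum_mul,
    Fintype.card_bool]
  obtain ⟨d, rfl⟩ := Nat.exists_eq_add_of_le hk
  rw [Nat.add_sub_cancel_left]
  push_cast
  rw [pow_add, one_div, inv_pow]
  field_simp

-- The definition of `prAccept` sums over the number of coins used. Drawing `Q` coins in advance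
-- turns the summand for `k` into the probability that the first `k` of them are the coins of an
-- accepting play, and `Pos.run` relates these events to the run of the simulation.
open Classical in
theorem prAccept_eq (hA : IsStrategy (advGame p q s) A) {K : ℕ}
    (hK : ∀ u ∈ (advGame p q s).legal n, u.length < K) {O : List Bool → List Bool}
    {hO : ∀ x, x.length ≤ n → p n ≤ (O x).length} {Q fuel : ℕ} (hQ : q n ≤ Q)
    (hf : K * (n + 1) ≤ fuel) :
    prAccept q s (logSof p) n A (randSof p n (treeOf p n O hO)) =
      Finset.univ.expect fun r : List.Vector Bool Q =>
        if runOracle n (fun zs => simRun p A n K ([Sum.inr (Sum.inr none)], r.toList, zs)) O fuel []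
          = true then 1 else 0 := by
  set S := appProb (bangPlays s (logSof p) n (randSof p n (treeOf p n O hO))) (A n) with hS
  have h1 : prAccept q s (logSof p) n A (randSof p n (treeOf p n O hO)) =
      ∑ k ∈ Finset.range (q n + 1), Finset.univ.expect fun r : List.Vector Bool Q =>
        if coinPlay (r.toList.take k) true ∈ S then (1 : ℝ) else 0 := by
    rw [prAccept, prObs]
    refine Finset.sum_congr rfl fun k hk => ?_
    rw [Finset.mem_range] at hk
    rw [expect_take (by omega) fun l => if coinPlay l true ∈ S then (1 : ℝ) else 0]
    refine Finset.sum_congr rfl fun r _ => ?_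
    rw [← hS, ite_mul, one_mul, zero_mul]
  -- For fixed coins, only the length of `r0` can contribute to the sum over `k`, so the sum of the
  -- indicators is the indicator of acceptance.
  rw [h1, ← Finset.expect_sum_comm]
  refine Finset.expect_congr rfl fun r _ => ?_
  obtain ⟨r0, h0⟩ := (pos_start hA).run hA hK (O := O) (hO := hO) K _ r.toList fuel
    (fun i => ⟨Game.nil_mem _ _, by simp, by simp⟩) (by simpa using hQ) (by simp) hf
  have hmem : ∀ k ≤ q n, coinPlay (r.toList.take k) true ∈ S ↔
      (runOracle n (fun zs => simRun p A n K ([Sum.inr (Sum.inr none)], r.toList, zs)) O fuel []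
        = true ∧ r.toList.take k = r0) := by
    intro k _
    rw [hS, accepts_start hA, ← h0]
    simp [List.take_prefix]
  split_ifs with hrun
  · obtain ⟨h2, h3⟩ := (h0 r0).2 ⟨hrun, rfl⟩
    have h4 := h3.length_le hA
    rw [Finset.sum_eq_single_of_mem r0.length (by simp; omega)]
    · rw [if_pos ((hmem _ h4).2 ⟨hrun, (List.prefix_iff_eq_take.1 h2).symm⟩)]
    · intro k hk hne
      rw [Finset.mem_range] at hk
      rw [if_neg]
      intro h5
      have h6 := congrArg List.length ((hmem k (by omega)).1 h5).2
      rw [List.length_take, List.Vector.toList_length] at h6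
      omega
  · refine Finset.sum_eq_zero fun k hk => ?_
    rw [Finset.mem_range] at hk
    rw [if_neg fun h5 => hrun ((hmem k (by omega)).1 h5).1]


/-! ### The simulation is polynomial time -/

theorem PT.simCont {p : Pol} (hp : p.UnaryPolyTime) {α : Type} [Rep α] {n : α → ℕ} {m : α → AdvM}
    {x : α → SimState} (hn : PT n) (hm : PT m) (hx : PT x) :
    PT (fun a => HOCrypto.simCont p (n a) (m a) (x a)) := by
  have hcoin : PT (fun a => HOCrypto.simCont p (n a) (Sum.inl none) (x a)) := by
    refine hx.snd.fst.cases_list (f := fun _ => Sum.inr (Sum.inr false))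
      (g := fun a c r => Sum.inl ((x a).1 ++ [Sum.inl none, Sum.inl (Option.some c)], r, (x a).2.2))
      (const _) ?_ (fun a h => by simp [HOCrypto.simCont, h])
      (fun a c r h => by simp [HOCrypto.simCont, h])
    have hx' := hx.restrict fun _ => True
    refine PT.restrict (f := fun y : α × Bool × List Bool =>
      (Sum.inl ((x y.1).1 ++ [Sum.inl none, Sum.inl (Option.some y.2.1)], y.2.2, (x y.1).2.2) :
        SimResult)) ?_ _
    exact (((hx.comp fst').fst.append ((const _).cons (snd'.fst.some.inl.cons (const [])))).pair
      (snd'.snd.pair (hx.comp fst').snd.snd)).inl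
  have hreply : PT (fun y : α × (ℕ × LogSofM) =>
      HOCrypto.simCont p (n y.1) (Sum.inr (Sum.inl y.2)) (x y.1)) := by
    have hx' : PT fun y : α × (ℕ × LogSofM) => x y.1 := hx.comp fst'
    have hv : PT fun y : α × (ℕ × LogSofM) => copyPlay y.2.1 (x y.1).1 ++ [y.2.2] :=
      (proj snd'.fst hx'.fst.onRight.onLeft).append (snd'.snd.cons (const []))
    have hk : PT fun y : α × (ℕ × LogSofM) =>
      (HOCrypto.argBits (copyPlay y.2.1 (x y.1).1 ++ [y.2.2])).length := hv.argBits.length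
    refine ((hk.lt hx'.snd.snd.length).ite'
      (f := fun y : α × (ℕ × LogSofM) => (Sum.inl ((x y.1).1 ++ [Sum.inr (Sum.inl y.2),
        Sum.inr (Sum.inl (y.2.1, HOCrypto.respond p (n y.1) ((x y.1).2.2.take
          ((HOCrypto.argBits (copyPlay y.2.1 (x y.1).1 ++ [y.2.2])).length + 1))
            (copyPlay y.2.1 (x y.1).1 ++ [y.2.2])))], (x y.1).2.1,
        (x y.1).2.2.drop ((HOCrypto.argBits
          (copyPlay y.2.1 (x y.1).1 ++ [y.2.2])).length + 1)) : SimResult))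
      (g := fun y : α × (ℕ × LogSofM) => Sum.inr (Sum.inl ((HOCrypto.argBits
        (copyPlay y.2.1 (x y.1).1 ++ [y.2.2])).take (x y.1).2.2.length))) ?_ ?_).congr ?_
    · exact ((hx'.fst.append (snd'.inl.inr.cons (PT.cons (PT.inr (PT.inl (snd'.fst.pair
        (PT.respond hp (hn.comp fst') (hk.succ.take hx'.snd.snd) hv)))) (const [])))).pair
        (hx'.snd.fst.pair (hk.succ.drop hx'.snd.snd))).inl
    · exact (hx'.snd.snd.length.take hv.argBits).inl.inr
    · rintro ⟨a, i, m⟩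
      simp [HOCrypto.simCont]
  have hfinal : PT (fun y : α × Option Bool => (Sum.inr (Sum.inr (y.2.getD false)) : SimResult)) :=
    (snd'.option_getD (const false)).inr.inr
  have hright : PT (fun y : α × ((ℕ × LogSofM) ⊕ Option Bool) =>
      HOCrypto.simCont p (n y.1) (Sum.inr y.2) (x y.1)) :=
    PT.cases_sum (o := fun y : α × ((ℕ × LogSofM) ⊕ Option Bool) => y.2)
      (f := fun y m => HOCrypto.simCont p (n y.1) (Sum.inr (Sum.inl m)) (x y.1))
      (g := fun y b => Sum.inr (Sum.inr (b.getD false))) snd'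
      (hreply.comp ((val.fst.fst).pair val.snd)) (hfinal.comp ((val.fst.fst).pair val.snd))
      (fun a b h => by rw [h]) (fun a b h => by rw [h]; rfl)
  exact hm.cases_sum (f := fun a _ => HOCrypto.simCont p (n a) (Sum.inl none) (x a))
    (g := fun a b => HOCrypto.simCont p (n a) (Sum.inr b) (x a)) (hcoin.comp val.fst)
    (hright.comp val) (fun a b h => by rw [h]; rfl) (fun a b h => by rw [h])

variable {p q s : Pol} {A : Plays AdvM}

theorem advGame_coded (p q s : Pol) : (advGame p q s).Coded :=
  (Game.Coded.oracle q).lolli ((Game.Coded.logSof p).bang.lolli Game.Coded.bool)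

theorem enc_length_le {M : Type} {e : M → List Bool} {u : List M} {m : M} (h : m ∈ u) :
    (e m).length ≤ playSize e u := by
  have : (e m).length + 1 ≤ playSize e u :=
    List.single_le_sum (by simp) _ (List.mem_map_of_mem h)
  omega

theorem length_le_playSize {M : Type} {e : M → List Bool} (u : List M) :
    u.length ≤ playSize e u := by
  induction u with
  | nil => simp
  | cons m u ih => simp [playSize] at ih ⊢; omega

theorem code_list_le {α : Type} [Rep α] {B : ℕ} {l : List α} (h : ∀ a ∈ l, (code a).length ≤ B) :
    (code l).length ≤ l.length * (B + 1) + 1 := by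
  induction l with
  | nil => simp [code_nil]
  | cons a l ih =>
    have h1 := ih fun b hb => h b (by simp [hb])
    have h2 := h a (by simp)
    simp [code_cons, Nat.add_mul]
    omega

/-- Legal plays have codes of polynomial size. -/
theorem Game.Coded.size {M : Type} [Rep M] {G : Game M} (hG : G.Coded) :
    ∃ P : Polynomial ℕ, ∀ n, ∀ u ∈ G.legal n, (code u).length ≤ P.eval n := by
  obtain ⟨P, hP⟩ := G.bounded
  obtain ⟨d, hd, hdec⟩ := hG.dec
  obtain ⟨R, hR⟩ := hd.size
  refine ⟨P * (R.comp (4 * P + 1) + 1) + 1, fun n u hu => ?_⟩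
  have h1 := hP n u hu
  have h2 : ∀ m ∈ u, (code m).length ≤ R.eval (4 * P.eval n + 1) := by
    intro m hm
    have h3 := hR (G.enc m)
    rw [hdec] at h3
    refine h3.trans (eval_mono R ((code_bits_length_le _).trans ?_))
    have := enc_length_le (e := G.enc) hm
    omega
  refine (code_list_le h2).trans ?_
  simp only [Polynomial.eval_add, Polynomial.eval_mul, Polynomial.eval_comp, Polynomial.eval_one,
    Polynomial.eval_ofNat]
  gcongr
  exact (length_le_playSize u).trans h1

/-- At a position where the adversary is to move, its answer exists and is the chosen one, so the
machine of the adversary outputs the encoding of `advNext`; decoding gives the move. -/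
theorem PT.advNext (hA : IsStrategy (advGame p q s) A) (hA' : IsPolyTime (advGame p q s) A) :
    PT (fun a : {a : ℕ × List AdvM // Pos p q s A a.1 a.2} => advNext A a.1.1 a.1.2) := by
  obtain ⟨d, hd, hdec⟩ := (advGame_coded p q s).dec
  obtain ⟨P, hP⟩ := (advGame p q s).bounded
  have h1 : ∀ a : {a : ℕ × List AdvM // Pos p q s A a.1 a.2},
      a.1.2 ++ [HOCrypto.advNext A a.1.1 a.1.2] ∈ A a.1.1 :=
    fun a => advNext_mem (a.2.exists_next hA)
  refine (hd.comp (PT.of_polyTimeOn hA' (fun a : {a : ℕ × List AdvM // Pos p q s A a.1 a.2} =>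
    (a.1.1, a.1.2, HOCrypto.advNext A a.1.1 a.1.2)) h1 ?_ P ?_)).congr fun a => (hdec _).symm
  · exact (val.fst.replicate (const true)).cons (val.snd.map (f := fun _ m => (advGame p q s).enc m)
      ((advGame_coded p q s).enc.comp val.snd))
  · rintro ⟨n, u, m⟩ h
    refine (enc_length_le (e := (advGame p q s).enc) (u := u ++ [m]) (by simp)).trans
      ((hP n _ (hA.legal n _ h).1).trans (eval_mono P ?_))
    simp [encList, unary]


variable {p q s w : Pol} {n : ℕ} {A : Plays AdvM}

/-- What is true throughout a simulation with coins `r0` and oracle answers `ys0`. -/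
structure SimInv (p q s : Pol) (A : Plays AdvM) (n : ℕ) (r0 : List Bool) (ys0 : List (List Bool))
    (z : SimResult) : Prop where
  state : ∀ u r ys, z = Sum.inl (u, r, ys) → Pos p q s A n u ∧ (∃ k, r = r0.drop k) ∧
    ∃ k, ys = ys0.drop k
  query : ∀ t, z = Sum.inr (Sum.inl t) → t.length ≤ n

/-- The invariant serves the running time: all states reached contain legal plays and suffixes of
the initial data, so sizes stay polynomial, and the machine of the adversary is only run where it is
correct. -/
theorem simInv_iterate (hA : IsStrategy (advGame p q s) A) {r0 : List Bool}
    {ys0 : List (List Bool)} (hy : ∀ y ∈ ys0, p n ≤ y.length) (k : ℕ) :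
    SimInv p q s A n r0 ys0 ((Sum.elim (simStep p A n) Sum.inr)^[k]
      (Sum.inl ([Sum.inr (Sum.inr none)], r0, ys0))) := by
  induction k with
  | zero =>
    refine ⟨fun u r ys h => ?_, fun t h => by simp at h⟩
    simp only [Function.iterate_zero, id_eq, Sum.inl.injEq, Prod.mk.injEq] at h
    obtain ⟨rfl, rfl, rfl⟩ := h
    exact ⟨pos_start hA, ⟨0, rfl⟩, 0, rfl⟩
  | succ k ih =>
    rw [Function.iterate_succ_apply']
    generalize (Sum.elim (simStep p A n) Sum.inr)^[k]
      (Sum.inl ([Sum.inr (Sum.inr none)], r0, ys0)) = z at ih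
    rcases z with ⟨u, r, ys⟩ | z
    · obtain ⟨h1, ⟨k1, rfl⟩, ⟨k2, rfl⟩⟩ := ih.state u r ys rfl
      refine ⟨fun u' r' ys' h => ?_, fun t h => ?_⟩
      · obtain ⟨h2, ⟨k3, rfl⟩, ⟨k4, rfl⟩⟩ := h1.step hA (fun y hy' => hy y (List.mem_of_mem_drop hy')) h
        exact ⟨h2, ⟨k1 + k3, by rw [List.drop_drop]⟩, k2 + k4, by rw [List.drop_drop]⟩
      · simp only [Sum.elim_inl] at h
        rcases h1.step_cases hA with ⟨hm, h3⟩ | ⟨b, hm, h3⟩ | ⟨i, x, hm, hl, h3⟩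
        · rw [h3, simCont] at h
          simp only at h
          split at h <;> simp at h
        · simp [h3] at h
        · have h4 := (h1.nested i).argBits_le hl
          rw [h3, simCont] at h
          simp only at h
          split_ifs at h
          simp only [Sum.inr.injEq, Sum.inl.injEq] at h
          rw [← h, List.length_take]
          omega
    · exact ⟨fun u r ys h => by simp at h, fun t h => ih.query t h⟩

theorem code_inl_length {α β : Type} [Rep α] [Rep β] (a : α) :
    (code (Sum.inl a : α ⊕ β)).length = (code a).length + 2 := by
  simp [code, Rep.rep, Tree.code]

theorem code_inr_length {α β : Type} [Rep α] [Rep β] (b : β) :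
    (code (Sum.inr b : α ⊕ β)).length = (code b).length + 4 := by
  simp [code, Rep.rep, Tree.code]

/-- The simulation is polynomial time. -/
theorem PT.simRun (hA : IsStrategy (advGame p q s) A) (hA' : IsPolyTime (advGame p q s) A)
    (hp : p.UnaryPolyTime) {α : Type} [Rep α] {n k : α → ℕ} {r : α → List Bool}
    {ys : α → List (List Bool)} (hn : PT n) (hk : PT k) (hr : PT r) (hys : PT ys)
    (hy : ∀ a, ∀ y ∈ ys a, p (n a) ≤ y.length) :
    PT (fun a => HOCrypto.simRun p A (n a) (k a) ([Sum.inr (Sum.inr none)], r a, ys a)) := by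
  obtain ⟨C, hC⟩ := (advGame_coded p q s).size
  obtain ⟨N, hN⟩ := hn.size
  obtain ⟨R, hR⟩ := hr.size
  obtain ⟨Y, hY⟩ := hys.size
  have hx : PT fun a => (Sum.inl ([Sum.inr (Sum.inr none)], r a, ys a) : SimResult) :=
    ((const _).pair (hr.pair hys)).inl
  have hit := PT.iterate (g := fun a => Sum.elim (simStep p A (n a)) Sum.inr) hk hx ?_
    (C.comp N + R + Y + 4 * N + 20) ?_
  · exact hit.cases_sum (f := fun _ _ => Sum.inr false) (g := fun _ y => y) (const _) val.snd
      (fun a b h => by rw [HOCrypto.simRun, h]; rfl) (fun a b h => by rw [HOCrypto.simRun, h]; rfl)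
  · refine PT.cases_sum (o := fun y : {y : α × SimResult // ∃ j < k y.1, y.2 =
        (Sum.elim (simStep p A (n y.1)) Sum.inr)^[j] (Sum.inl ([Sum.inr (Sum.inr none)], r y.1,
          ys y.1))} => y.1.2)
      (f := fun y x => HOCrypto.simCont p (n y.1.1) (HOCrypto.advNext A (n y.1.1) x.1) x)
      (g := fun _ z => Sum.inr z) val.snd ?_ val.snd.inr (fun y b h => by rw [h]; rfl)
      (fun y b h => by rw [h]; rfl)
    refine PT.simCont hp (hn.comp (val.comp val.fst).fst) (PT.comp_sub (g := fun a : ℕ × List AdvM =>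
      HOCrypto.advNext A a.1 a.2) (PT.advNext hA hA')
        ((hn.comp (val.comp val.fst).fst).pair val.snd.fst) ?_) val.snd
    rintro ⟨⟨⟨⟨a, z⟩, j, -, hz⟩, x⟩, h⟩
    have h : z = Sum.inl x := h
    exact ((simInv_iterate hA (hy a) j).state x.1 x.2.1 x.2.2 (by rw [← hz, h])).1
  -- The play is legal, hence of polynomial size; the remaining coins and answers are suffixes of
  -- the given ones; a query has at most `n` bits.
  · intro a j _
    have h1 := simInv_iterate hA (r0 := r a) (hy a) j
    generalize (Sum.elim (simStep p A (n a)) Sum.inr)^[j]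
      (Sum.inl ([Sum.inr (Sum.inr none)], r a, ys a)) = z at h1
    have hna : n a ≤ N.eval (code a).length := by
      have := hN a
      rw [code_nat_length] at this
      omega
    simp only [Polynomial.eval_add, Polynomial.eval_comp, Polynomial.eval_mul,
      Polynomial.eval_ofNat]
    rcases z with ⟨u, r', ys'⟩ | t | b
    · obtain ⟨h2, ⟨k1, rfl⟩, ⟨k2, rfl⟩⟩ := h1.state _ _ _ rfl
      have h3 := (hC _ u h2.legal).trans (eval_mono C hna)
      have h4 := (code_length_drop (r a) k1).trans (hR a)
      have h5 := (code_length_drop (ys a) k2).trans (hY a)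
      rw [code_inl_length, code_pair, code_pair]
      simp only [List.length_cons, List.length_append]
      omega
    · have h2 := h1.query t rfl
      have h3 := code_bits_length_le t
      rw [code_inr_length, code_inl_length]
      omega
    · rw [code_inr_length, code_inr_length]
      cases b <;> simp [code_true, code_false]


variable {p q s w : Pol} {A : Plays AdvM}

theorem polyTimeOn_simRun (hA : IsStrategy (advGame p q s) A)
    (hA' : IsPolyTime (advGame p q s) A) (hp : p.UnaryPolyTime) (hpw : ∀ n, p n ≤ w n)
    (K : Polynomial ℕ) {S : Set (ℕ × List Bool × List (List Bool))}
    (hS : ∀ a ∈ S, ∀ y ∈ a.2.2, y.length = w a.1) :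
    PolyTimeOn (fun a : ℕ × List Bool × List (List Bool) => unary a.1 :: a.2.1 :: a.2.2)
      (Sum.elim (fun x => false :: x) (fun b => [true, b])) S
      (fun a => simRun p A a.1 (K.eval a.1) ([Sum.inr (Sum.inr none)], a.2.1, a.2.2)) := by
  refine polyTimeOn_of (fun l => Sum.elim (fun x => false :: x) (fun b => [true, b])
    (simRun p A (l.head?.getD []).length (K.eval (l.head?.getD []).length)
      ([Sum.inr (Sum.inr none)], l.tail.head?.getD [], l.tail.tail))) ?_ ?_
  · have hn : PT fun l : {l // ∃ a ∈ S, unary a.1 :: a.2.1 :: a.2.2 = l} =>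
        (l.1.head?.getD []).length := ((PT.head? PT.val).option_getD (PT.const [])).length
    have hr : PT fun l : {l // ∃ a ∈ S, unary a.1 :: a.2.1 :: a.2.2 = l} =>
        l.1.tail.head?.getD [] := (PT.head? (PT.tail PT.val)).option_getD (PT.const [])
    have hy : PT fun l : {l // ∃ a ∈ S, unary a.1 :: a.2.1 :: a.2.2 = l} => l.1.tail.tail :=
      PT.tail (PT.tail PT.val)
    refine (PT.simRun hA hA' hp hn (hn.eval K) hr hy ?_).cases_sum (f := fun _ x => false :: x)
      (g := fun _ b => [true, b]) ((PT.const _).cons PT.val.snd)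
      ((PT.const _).cons (PT.val.snd.cons (PT.const [])))
      (fun a b h => by rw [h]; rfl) (fun a b h => by rw [h]; rfl)
    intro l y hy'
    obtain ⟨l, ⟨n, r, ys⟩, h, rfl⟩ := l
    have h1 := hS _ h y hy'
    rw [h1]
    simpa [unary] using hpw n
  · rintro ⟨n, r, ys⟩ -
    simp [unary]

/-- An oracle algorithm which runs the adversary against the random choices extracted from its
oracle. -/
theorem exists_oracleAlg (hA : IsStrategy (advGame p q s) A) (hA' : IsPolyTime (advGame p q s) A)
    (hp : p.UnaryPolyTime) (hpw : ∀ n, p n ≤ w n) :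
    ∃ D : OracleAlg w, ∀ n (O : List Bool → List Bool)
      (hO : ∀ x, x.length ≤ n → p n ≤ (O x).length),
      prAccept q s (logSof p) n A (randSof p n (treeOf p n O hO)) = D.prAccept n O := by
  obtain ⟨Q, hQ⟩ := q.bounded
  obtain ⟨K, hK⟩ := (advGame p q s).bounded
  -- `K` bounds the length of plays, so `K + 1` steps suffice, each with at most `n + 1` queries.
  -- The number of coins has to be a polynomial, while `q` is only bounded by one, so `Q n ≥ q n`
  -- coins are drawn.
  refine ⟨⟨Q, (K + 1) * (.X + 1), fun n r ys =>
    simRun p A n ((K + 1).eval n) ([Sum.inr (Sum.inr none)], r, ys),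
    polyTimeOn_simRun hA hA' hp hpw _ fun a ha => ha.2.2⟩, fun n O hO => ?_⟩
  refine prAccept_eq hA (fun u hu => ?_) (hQ n) ?_
  · have h1 := hK n u hu
    have h2 := length_le_playSize (e := (advGame p q s).enc) u
    simp
    omega
  · simp


/-! ### Oracles with independent values -/

theorem prod_update {I Y : Type} [Fintype I] [DecidableEq I] (μ : I → Y → ℝ) (x : I) (m : Y → ℝ) (g : I → Y) :
    ∏ i, Function.update μ x m i (g i) = m (g x) * ∏ i ∈ Finset.univ.erase x, μ i (g i) := by
  rw [← Finset.mul_prod_erase _ _ (Finset.mem_univ x), Function.update_self]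
  congr 1
  refine Finset.prod_congr rfl fun i hi => ?_
  rw [Function.update_of_ne (Finset.ne_of_mem_erase hi)]

section Product

variable {I Y : Type} [Fintype I] [DecidableEq I] [Fintype Y]

/-- The expectation of `f` for independent values with the weights `μ i`. -/
def prodExpect (μ : I → Y → ℝ) (f : (I → Y) → ℝ) : ℝ := ∑ g, (∏ i, μ i (g i)) * f g

/-- `m` is a probability distribution. -/
structure IsWeight (m : Y → ℝ) : Prop where
  nonneg : ∀ y, 0 ≤ m y
  sum_eq : ∑ y, m y = 1

theorem isWeight_single [DecidableEq Y] (y : Y) : IsWeight (Pi.single y 1 : Y → ℝ) where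
  nonneg z := by
    rw [Pi.single_apply]
    split_ifs <;> simp
  sum_eq := by simp

theorem prodExpect_const {μ : I → Y → ℝ} (hμ : ∀ i, IsWeight (μ i)) (c : ℝ) :
    prodExpect μ (fun _ => c) = c := by
  rw [prodExpect, ← Finset.sum_mul, ← Fintype.prod_sum fun i y => μ i y]
  simp [(hμ _).sum_eq]

theorem abs_prodExpect_le {μ : I → Y → ℝ} (hμ : ∀ i, IsWeight (μ i)) {f : (I → Y) → ℝ}
    (hf : ∀ g, |f g| ≤ 1) : |prodExpect μ f| ≤ 1 := by
  calc |prodExpect μ f| ≤ ∑ g, |(∏ i, μ i (g i)) * f g| := Finset.abs_sum_le_sum_abs _ _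
    _ ≤ prodExpect μ (fun _ => 1) := by
      refine Finset.sum_le_sum fun g _ => ?_
      have h0 : 0 ≤ ∏ i, μ i (g i) := Finset.prod_nonneg fun i _ => (hμ i).nonneg _
      rw [abs_mul, abs_of_nonneg h0]
      gcongr
      exact hf g
    _ = 1 := prodExpect_const hμ 1

/-- Revealing one of the values. -/
theorem prodExpect_reveal [DecidableEq Y] (μ : I → Y → ℝ) (x : I) (f : (I → Y) → ℝ) :
    prodExpect μ f = ∑ y, μ x y * prodExpect (Function.update μ x (Pi.single y 1)) f := by
  simp only [prodExpect, prod_update, Finset.mul_sum]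
  rw [Finset.sum_comm]
  refine Finset.sum_congr rfl fun g _ => ?_
  rw [← Finset.mul_prod_erase _ _ (Finset.mem_univ x), Finset.sum_eq_single (g x)]
  · simp; ring
  · intro y _ hy
    simp [hy.symm]
  · simp

theorem prodExpect_congr_of_revealed [DecidableEq Y] (μ : I → Y → ℝ) (x : I) (y : Y) {f f' : (I → Y) → ℝ}
    (h : ∀ g, g x = y → f g = f' g) :
    prodExpect (Function.update μ x (Pi.single y 1)) f =
      prodExpect (Function.update μ x (Pi.single y 1)) f' := by
  simp only [prodExpect, prod_update]
  refine Finset.sum_congr rfl fun g _ => ?_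
  by_cases hg : g x = y
  · rw [h g hg]
  · simp [hg]

end Product

noncomputable instance (n : ℕ) : Fintype {x : List Bool // x.length ≤ n} := Fintype.ofFinite _

open Classical in
/-- Changing slightly the distribution of every value changes only slightly the output of an
algorithm which makes few queries. -/
theorem abs_sub_runOracle_le {n m : ℕ} {step : List (List Bool) → List Bool ⊕ Bool} {δ : ℝ}
    (hδ : 0 ≤ δ) : ∀ (fuel : ℕ) (ys : List (List Bool))
    (μ ν : {x : List Bool // x.length ≤ n} → List.Vector Bool m → ℝ), (∀ i, IsWeight (μ i)) →
    (∀ i, IsWeight (ν i)) → (∀ i, ∑ y, |μ i y - ν i y| ≤ δ) →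
    |prodExpect μ (fun g => if runOracle n step (FunLE.toOracle g) fuel ys = true then 1 else 0) -
      prodExpect ν (fun g => if runOracle n step (FunLE.toOracle g) fuel ys = true then 1 else 0)|
      ≤ fuel * δ := by
  intro fuel
  induction fuel with
  | zero =>
    intro ys μ ν hμ hν _
    -- Without fuel the output does not depend on the oracle, so its expectation is the same under
    -- both laws.
    have : ∀ g : FunLE n m, runOracle n step g.toOracle 0 ys =
        Sum.elim (fun _ => false) id (step ys) := fun g => by
      rw [runOracle]
      cases step ys <;> rfl
    simp only [this]
    rw [prodExpect_const hμ, prodExpect_const hν]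
    simp
  | succ fuel ih =>
    intro ys μ ν hμ hν hd
    have hpos : (0 : ℝ) ≤ (fuel + 1 : ℕ) * δ := by positivity
    rcases e : step ys with x | b
    · by_cases hx : x.length ≤ n
      -- The queried value is revealed: the law at `x` becomes a point mass at `y`, the others are
      -- unchanged. A later query of the same string then gets the same answer, and the laws remain
      -- products.
      · rw [prodExpect_reveal μ ⟨x, hx⟩, prodExpect_reveal ν ⟨x, hx⟩]
        set f : List.Vector Bool m → FunLE n m → ℝ := fun y g =>
          if runOracle n step g.toOracle fuel (ys ++ [y.toList]) = true then 1 else 0 with hf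
        have h1 : ∀ y, ∀ g : FunLE n m, g ⟨x, hx⟩ = y →
            (if runOracle n step g.toOracle (fuel + 1) ys = true then (1 : ℝ) else 0) = f y g := by
          intro y g hg
          rw [runOracle_query e hx, FunLE.toOracle, dif_pos hx, hg]
        have h2 : ∀ (κ : {x : List Bool // x.length ≤ n} → List.Vector Bool m → ℝ),
            ∑ y, κ ⟨x, hx⟩ y * prodExpect (Function.update κ ⟨x, hx⟩ (Pi.single y 1))
              (fun g => if runOracle n step (FunLE.toOracle g) (fuel + 1) ys = true then 1 else 0) =
            ∑ y, κ ⟨x, hx⟩ y * prodExpect (Function.update κ ⟨x, hx⟩ (Pi.single y 1)) (f y) :=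
          fun κ => Finset.sum_congr rfl fun y _ => by
            rw [prodExpect_congr_of_revealed _ _ _ (h1 y)]
        have hu : ∀ (κ : {x : List Bool // x.length ≤ n} → List.Vector Bool m → ℝ),
            (∀ i, IsWeight (κ i)) → ∀ y i,
            IsWeight (Function.update κ ⟨x, hx⟩ (Pi.single y 1) i) := by
          intro κ hκ y i
          by_cases hi : i = ⟨x, hx⟩
          · rw [hi, Function.update_self]; exact isWeight_single y
          · rw [Function.update_of_ne hi]; exact hκ i
        rw [h2, h2, ← Finset.sum_sub_distrib]
        have h3 : ∀ y, |μ ⟨x, hx⟩ y * prodExpect (Function.update μ ⟨x, hx⟩ (Pi.single y 1)) (f y) -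
            ν ⟨x, hx⟩ y * prodExpect (Function.update ν ⟨x, hx⟩ (Pi.single y 1)) (f y)| ≤
            μ ⟨x, hx⟩ y * (fuel * δ) + |μ ⟨x, hx⟩ y - ν ⟨x, hx⟩ y| := by
          intro y
          -- At the revealed string both laws are the same point mass, at distance `0 ≤ δ`, so the
          -- induction hypothesis applies. Summed over `y`, the first term of `h3` gives `fuel * δ`
          -- and the second at most one more `δ`.
          have h4 := ih (ys ++ [y.toList]) _ _ (hu μ hμ y) (hu ν hν y) fun i => by
            by_cases hi : i = ⟨x, hx⟩
            · rw [hi, Function.update_self, Function.update_self]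
              simpa using hδ
            · rw [Function.update_of_ne hi, Function.update_of_ne hi]; exact hd i
          have h5 := abs_prodExpect_le (hu ν hν y) (f := f y) fun g => by
            simp only [hf]
            split_ifs <;> simp
          set a := prodExpect (Function.update μ ⟨x, hx⟩ (Pi.single y 1)) (f y)
          set b := prodExpect (Function.update ν ⟨x, hx⟩ (Pi.single y 1)) (f y)
          calc |μ ⟨x, hx⟩ y * a - ν ⟨x, hx⟩ y * b|
              = |μ ⟨x, hx⟩ y * (a - b) + (μ ⟨x, hx⟩ y - ν ⟨x, hx⟩ y) * b| := by congr 1; ring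
            _ ≤ |μ ⟨x, hx⟩ y * (a - b)| + |(μ ⟨x, hx⟩ y - ν ⟨x, hx⟩ y) * b| := abs_add_le _ _
            _ ≤ _ := by
              rw [abs_mul, abs_mul, abs_of_nonneg ((hμ _).nonneg y)]
              have h6 := (hμ ⟨x, hx⟩).nonneg y
              gcongr
              exact mul_le_of_le_one_right (abs_nonneg _) h5
        calc _ ≤ _ := Finset.abs_sum_le_sum_abs _ _
          _ ≤ _ := Finset.sum_le_sum fun y _ => h3 y
          _ = fuel * δ + ∑ y, |μ ⟨x, hx⟩ y - ν ⟨x, hx⟩ y| := by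
            rw [Finset.sum_add_distrib, ← Finset.sum_mul, (hμ _).sum_eq, one_mul]
          _ ≤ _ := by
            have := hd ⟨x, hx⟩
            push_cast
            linarith
      · have : ∀ g : FunLE n m, runOracle n step g.toOracle (fuel + 1) ys = false := fun g => by
          rw [runOracle, e]
          simp [hx]
        simp only [this]
        rw [prodExpect_const hμ, prodExpect_const hν]
        simpa using hpos
    · have : ∀ g : FunLE n m, runOracle n step g.toOracle (fuel + 1) ys = b := fun g =>
        runOracle_output e
      simp only [this]
      rw [prodExpect_const hμ, prodExpect_const hν]
      simpa using hpos


/-! ### Numbers modulo `m` -/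

theorem strVal_snoc (y : List Bool) (b : Bool) : strVal (y ++ [b]) = 2 * strVal y + b.toNat := by
  simp [strVal]

theorem strVal_lt (y : List Bool) : strVal y < 2 ^ y.length := by
  induction y using List.reverseRecOn with
  | nil => simp [strVal]
  | append_singleton y b ih =>
    rw [strVal_snoc, List.length_append, List.length_singleton, pow_succ]
    have := Bool.toNat_le b
    omega

theorem strVal_inj {y z : List Bool} (hl : y.length = z.length) (h : strVal y = strVal z) :
    y = z := by
  induction y using List.reverseRecOn generalizing z with
  | nil => exact (List.length_eq_zero_iff.1 hl.symm).symm
  | append_singleton y b ih =>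
    rcases List.eq_nil_or_concat z with rfl | ⟨z, c, rfl⟩
    · simp at hl
    · rw [List.concat_eq_append] at h hl ⊢
      rw [strVal_snoc, strVal_snoc] at h
      have h1 : b = c := by cases b <;> cases c <;> simp at h ⊢ <;> omega
      subst h1
      rw [ih (by simpa using hl) (by omega)]

theorem sum_strVal (w : ℕ) (h : ℕ → ℝ) :
    ∑ y : List.Vector Bool w, h (strVal y.toList) = ∑ j ∈ Finset.range (2 ^ w), h j := by
  rw [← Fin.sum_univ_eq_sum_range]
  have hlt : ∀ y : List.Vector Bool w, strVal y.toList < 2 ^ w := fun y => by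
    simpa using strVal_lt y.toList
  refine Fintype.sum_bijective (fun y : List.Vector Bool w => (⟨_, hlt y⟩ : Fin (2 ^ w))) ?_ _ _
    fun y => rfl
  rw [Fintype.bijective_iff_injective_and_card]
  refine ⟨fun y z e => ?_, by simp [card_vector]⟩
  exact List.Vector.toList_injective (strVal_inj (by simp) (Fin.mk.inj e))

/-- The uniform distribution on strings. -/
noncomputable def uniformWeight (w : ℕ) (_ : List.Vector Bool w) : ℝ := (1 / 2) ^ w

theorem isWeight_uniform (w : ℕ) : IsWeight (uniformWeight w) where
  nonneg _ := by unfold uniformWeight; positivity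
  sum_eq := by simp [uniformWeight, card_vector]

/-- The uniform distribution on the strings whose values are less than the largest multiple of `m`
that is at most `2 ^ w`. -/
noncomputable def blockWeight (w m : ℕ) (y : List.Vector Bool w) : ℝ :=
  if strVal y.toList < m * (2 ^ w / m) then 1 / (m * (2 ^ w / m) : ℕ) else 0

section

variable {w m : ℕ}

theorem block_pos (h0 : 0 < m) (h : m ≤ 2 ^ w) : 0 < m * (2 ^ w / m) :=
  Nat.mul_pos h0 (Nat.div_pos h h0)

theorem isWeight_block (h0 : 0 < m) (h : m ≤ 2 ^ w) : IsWeight (blockWeight w m) where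
  nonneg y := by
    unfold blockWeight
    split_ifs <;> positivity
  sum_eq := by
    unfold blockWeight
    rw [sum_strVal w fun j => if j < m * (2 ^ w / m) then 1 / (m * (2 ^ w / m) : ℕ) else (0 : ℝ),
      ← Finset.sum_filter]
    have e : (Finset.range (2 ^ w)).filter (· < m * (2 ^ w / m)) =
        Finset.range (m * (2 ^ w / m)) := by
      ext j
      have := Nat.mul_div_le (2 ^ w) m
      simp
      omega
    have h1 : ((m * (2 ^ w / m) : ℕ) : ℝ) ≠ 0 := by exact_mod_cast (block_pos h0 h).ne'
    rw [e, Finset.sum_const, Finset.card_range, nsmul_eq_mul]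
    field_simp

/-- With `c = 2 ^ w / m`, the numbers below `m * c` contain every residue exactly `c` times, as `i +
m * k` with `k < c`, and each has weight `1 / (m * c)`. -/
theorem sum_blockWeight_mod (h0 : 0 < m) (h : m ≤ 2 ^ w) {i : ℕ} (hi : i < m) :
    ∑ y : List.Vector Bool w, (if strVal y.toList % m = i then blockWeight w m y else 0) =
      1 / m := by
  unfold blockWeight
  rw [sum_strVal w fun j => if j % m = i then
    if j < m * (2 ^ w / m) then 1 / (m * (2 ^ w / m) : ℕ) else (0 : ℝ) else 0]
  set c := 2 ^ w / m with hc
  have hle : m * c ≤ 2 ^ w := Nat.mul_div_le _ _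
  have hc0 : 0 < c := Nat.div_pos h h0
  simp only [← ite_and]
  rw [← Finset.sum_filter]
  have e : (Finset.range (2 ^ w)).filter (fun j => j % m = i ∧ j < m * c) =
      (Finset.range c).image fun k => i + m * k := by
    ext j
    simp only [Finset.mem_filter, Finset.mem_range, Finset.mem_image]
    constructor
    · rintro ⟨-, rfl, h2⟩
      exact ⟨j / m, Nat.div_lt_of_lt_mul h2, Nat.mod_add_div j m⟩
    · rintro ⟨k, hk, rfl⟩
      have h3 : i + m * k < m * c := by
        calc i + m * k < m * (k + 1) := by rw [Nat.mul_succ]; omega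
          _ ≤ m * c := Nat.mul_le_mul_left _ hk
      refine ⟨by omega, by rw [Nat.add_mul_mod_self_left, Nat.mod_eq_of_lt hi], h3⟩
  have h1 : (m : ℝ) ≠ 0 := by exact_mod_cast h0.ne'
  have h2 : (c : ℝ) ≠ 0 := by exact_mod_cast hc0.ne'
  rw [e, Finset.sum_const, Finset.card_image_of_injective _ fun a b hab => by
    simpa [h0.ne'] using hab, Finset.card_range, nsmul_eq_mul]
  push_cast
  field_simp

/-- Let `b` be the largest multiple of `m` up to `2 ^ w` and `d = 2 ^ w - b < m`. The `d` numbers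
from `b` on lose their weight `2 ^ (-w)`, and the same total mass is spread over the numbers below
`b`. Each part contributes `d / 2 ^ w`. -/
theorem sum_abs_uniform_sub_block_le (h0 : 0 < m) (h : m ≤ 2 ^ w) :
    ∑ y, |uniformWeight w y - blockWeight w m y| ≤ 2 * m * (1 / 2) ^ w := by
  unfold blockWeight uniformWeight
  rw [sum_strVal w fun j => |(1 / 2) ^ w -
    if j < m * (2 ^ w / m) then 1 / ((m * (2 ^ w / m) : ℕ) : ℝ) else 0|]
  set b := m * (2 ^ w / m) with hb
  have hle : b ≤ 2 ^ w := Nat.mul_div_le _ _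
  have hb0 : 0 < b := block_pos h0 h
  have hlt : 2 ^ w < b + m := by
    have := Nat.mod_add_div (2 ^ w) m
    have := Nat.mod_lt (2 ^ w) h0
    omega
  obtain ⟨d, hd⟩ := Nat.exists_eq_add_of_le hle
  have hbr : (0 : ℝ) < b := by exact_mod_cast hb0
  have hdr : (2 : ℝ) ^ w = b + d := by exact_mod_cast hd
  have hdm : (d : ℝ) ≤ m := by
    have : d ≤ m := by omega
    exact_mod_cast this
  rw [hd, Finset.sum_range_add]
  have h1 : ∑ j ∈ Finset.range b, |(1 / 2 : ℝ) ^ w - if j < b then 1 / (b : ℝ) else 0| =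
      d * (1 / 2) ^ w := by
    rw [Finset.sum_congr rfl fun j hj => by rw [if_pos (Finset.mem_range.1 hj)], Finset.sum_const,
      Finset.card_range, nsmul_eq_mul, abs_sub_comm, abs_of_nonneg]
    · rw [one_div, one_div, inv_pow, hdr]
      field_simp
      ring
    · rw [sub_nonneg, one_div, one_div, inv_pow]
      gcongr
      rw [hdr]
      simp
  have h2 : ∑ j ∈ Finset.range d, |(1 / 2 : ℝ) ^ w - if b + j < b then 1 / (b : ℝ) else 0| =
      d * (1 / 2) ^ w := by
    simp
  rw [h1, h2]
  have : (0 : ℝ) ≤ (1 / 2) ^ w := by positivity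
  nlinarith

end


/-! ### The distribution of the trees of functions -/

section

variable {l m n : ℕ}

/-- The query of a tree after the bits `t`. -/
def RandTree.queryAt (T : RandTree l m n) (t : List Bool) : List Bool :=
  if h : t.length < n then (T.query ⟨t, h⟩).toList else []

/-- The queries of a tree on the way to `t`. -/
def RandTree.before (T : RandTree l m n) (t : List Bool) : List (List Bool) :=
  (List.range t.length).map fun i => T.queryAt (t.take i)

theorem RandTree.length_before (T : RandTree l m n) (t : List Bool) :
    (T.before t).length = t.length := by simp [RandTree.before]

theorem RandTree.before_snoc (T : RandTree l m n) (t : List Bool) (z : Bool) :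
    T.before (t ++ [z]) = T.before t ++ [T.queryAt t] := by
  simp only [RandTree.before, List.length_append, List.length_singleton]
  rw [List.range_succ, List.map_append]
  congr 1
  · refine List.map_congr_left fun k hk => ?_
    rw [List.mem_range] at hk
    rw [List.take_append_of_le_length (by omega)]
  · simp

theorem RandTree.length_queryAt (T : RandTree l m n) {t : List Bool} (h : t.length < n) :
    (T.queryAt t).length = l := by simp [RandTree.queryAt, h]

theorem RandTree.queryAt_ne (T : RandTree l m n) {t t' : List Bool} (h : t <+: t')
    (hne : t.length < t'.length) (h' : t'.length < n) : T.queryAt t ≠ T.queryAt t' := by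
  rw [RandTree.queryAt, RandTree.queryAt, dif_pos h', dif_pos (hne.trans h')]
  intro e
  refine T.distinct ⟨t, hne.trans h'⟩ ⟨t', h'⟩ h (fun e' => ?_) (List.Vector.toList_injective e)
  rw [Subtype.mk.injEq] at e'
  exact hne.ne (congrArg List.length e')

theorem RandTree.queryAt_notMem (T : RandTree l m n) {t : List Bool} (h : t.length < n) :
    T.queryAt t ∉ T.before t := by
  intro h1
  simp only [RandTree.before, List.mem_map, List.mem_range] at h1
  obtain ⟨i, hi, e⟩ := h1
  exact T.queryAt_ne (List.take_prefix i t) (by simp; omega) h e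

theorem RandTree.nodup_before (T : RandTree l m n) {t : List Bool} (h : t.length ≤ n) :
    (T.before t).Nodup := by
  induction t using List.reverseRecOn with
  | nil => simp [RandTree.before]
  | append_singleton t z ih =>
    rw [List.length_append, List.length_singleton] at h
    rw [RandTree.before_snoc, List.nodup_append_comm, List.singleton_append, List.nodup_cons]
    exact ⟨T.queryAt_notMem (by omega), ih (by omega)⟩

theorem RandTree.length_of_mem_before (T : RandTree l m n) {t x : List Bool} (h : t.length ≤ n)
    (hx : x ∈ T.before t) : x.length = l := by
  simp only [RandTree.before, List.mem_map, List.mem_range] at hx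
  obtain ⟨i, hi, rfl⟩ := hx
  exact T.length_queryAt (by rw [List.length_take]; omega)

theorem length_unused {T : List (List Bool)} (h : T.Nodup) (h' : ∀ x ∈ T, x.length = l) :
    (unused l T).length = 2 ^ l - T.length := by
  have h1 : (T ++ unused l T).Perm (allStr l) := by
    rw [List.perm_ext_iff_of_nodup _ (nodup_allStr l)]
    · intro x
      simp only [List.mem_append, mem_unused, mem_allStr]
      constructor
      · rintro (h | h)
        · exact h' x h
        · exact h.1
      · intro hx
        by_cases hT : x ∈ T
        · exact Or.inl hT
        · exact Or.inr ⟨hx, hT⟩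
    · exact List.Nodup.append h ((nodup_allStr l).filter _) fun x hx hx' => (mem_unused.1 hx').2 hx
  have h2 := h1.length_eq
  rw [List.length_append, length_allStr] at h2
  omega

/-- The strings that designate a given unused string form a residue class. -/
theorem alpha_eq_iff {T : List (List Bool)} {x : List Bool} (hx : x ∈ unused l T) :
    ∃ i < (unused l T).length, ∀ y, alpha l y T = x ↔ strVal y % (unused l T).length = i := by
  obtain ⟨i, hi, rfl⟩ := List.getElem_of_mem hx
  refine ⟨i, hi, fun y => ?_⟩
  have h1 : strVal y % (unused l T).length < (unused l T).length := Nat.mod_lt _ (by omega)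
  have : alpha l y T = (unused l T)[strVal y % (unused l T).length] := by
    change (unused l T).getD (strVal y % (unused l T).length) [] = _
    rw [List.getD_eq_getElem _ _ h1]
  rw [this]
  exact List.Nodup.getElem_inj_iff ((nodup_allStr l).filter _)

/-- The value `y` at `x` is consistent with the tree `T`. -/
def RandTree.Fits (T : RandTree l m n) (x y : List Bool) : Prop :=
  (x.length < n → alpha l y (T.before x) = T.queryAt x) ∧
    ∀ h : x.length = n, y.take m = (T.result ⟨x, h⟩).toList

theorem RandTree.ext' {T T' : RandTree l m n} (h1 : ∀ t, t.length < n → T.queryAt t = T'.queryAt t)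
    (h2 : ∀ t (h : t.length = n), (T.result ⟨t, h⟩).toList = (T'.result ⟨t, h⟩).toList) :
    T = T' := by
  obtain ⟨a, b, _⟩ := T
  obtain ⟨c, d, _⟩ := T'
  have e1 : a = c := funext fun ⟨t, ht⟩ => by
    have := h1 t ht
    simp only [RandTree.queryAt, dif_pos ht] at this
    exact List.Vector.toList_injective this
  have e2 : b = d := funext fun ⟨t, ht⟩ => List.Vector.toList_injective (h2 t ht)
  subst e1 e2
  rfl

end

variable {p w : Pol} {n : ℕ}

/-- The queries determined by a function that fits a tree on the way to `t`. -/
theorem queriesOf_prefixVals {O : List Bool → List Bool} {l m : ℕ} {T : RandTree l m n}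
    {t : List Bool} (h : ∀ i < t.length, alpha l (O (t.take i)) (T.before (t.take i)) =
      T.queryAt (t.take i)) :
    queriesOf l (prefixVals O t) = T.before t ++ [alpha l (O t) (T.before t)] := by
  induction t using List.reverseRecOn with
  | nil => rfl
  | append_singleton t z ih =>
    have h1 := ih fun i hi => by
      have := h i (by simp; omega)
      rwa [List.take_append_of_le_length hi.le] at this
    have h2 := h t.length (by simp)
    rw [List.take_left] at h2
    rw [prefixVals_snoc, queriesOf_snoc, h1, h2, RandTree.before_snoc]

theorem getD_queriesOf_prefixVals {O : List Bool → List Bool} {l m : ℕ} {T : RandTree l m n}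
    {t : List Bool} (h : ∀ i < t.length, alpha l (O (t.take i)) (T.before (t.take i)) =
      T.queryAt (t.take i)) :
    (queriesOf l (prefixVals O t)).getD t.length [] = alpha l (O t) (T.before t) := by
  rw [queriesOf_prefixVals h, List.getD_eq_getElem?_getD,
    List.getElem?_append_right (by rw [RandTree.length_before])]
  simp [RandTree.length_before]

theorem treeOf_queryAt {O : List Bool → List Bool}
    {hO : ∀ x, x.length ≤ n → p n ≤ (O x).length} {t : List Bool} (h : t.length < n) :
    (treeOf p n O hO).queryAt t =
      (queriesOf (Pol.lg n) (prefixVals O t)).getD t.length [] := by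
  rw [RandTree.queryAt, dif_pos h]
  rfl

/-- The choice after `x` depends on earlier values only through the earlier queries, and these are
known once the tree is fixed. The event that `O` yields `T` thus splits into conditions that each
concern a single value `O x`, which is what independence needs. -/
theorem treeOf_eq_iff {O : List Bool → List Bool}
    {hO : ∀ x, x.length ≤ n → p n ≤ (O x).length} {T : RandTree (Pol.lg n) (p n) n} :
    treeOf p n O hO = T ↔ ∀ x, x.length ≤ n → T.Fits x (O x) := by
  constructor
  -- Strong induction on the length: the shorter prefixes fit, so the queries computed from the
  -- oracle are the queries of the tree up to this point.
  · rintro rfl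
    have h1 : ∀ k, ∀ t : List Bool, t.length = k → t.length < n →
        alpha (Pol.lg n) (O t) ((treeOf p n O hO).before t) = (treeOf p n O hO).queryAt t := by
      intro k
      induction k using Nat.strong_induction_on with
      | _ k ih =>
        intro t hk ht
        rw [treeOf_queryAt ht, getD_queriesOf_prefixVals]
        intro i hi
        exact ih i (by omega) _ (by rw [List.length_take]; omega) (by rw [List.length_take]; omega)
    exact fun x _ => ⟨fun hx => h1 _ x rfl hx, fun h => rfl⟩
  · intro h
    refine RandTree.ext' (fun t ht => ?_) fun t ht => (h t ht.le).2 ht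
    rw [treeOf_queryAt ht, getD_queriesOf_prefixVals (T := T) fun i hi => ?_]
    · exact (h t ht.le).1 ht
    · exact (h _ (by rw [List.length_take]; omega)).1 (by rw [List.length_take]; omega)

/-- Independent values for which the tree is uniformly distributed. -/
noncomputable def treeWeight (w : Pol) (n : ℕ) (x : {x : List Bool // x.length ≤ n}) :
    List.Vector Bool (w n) → ℝ :=
  if x.1.length < n then blockWeight (w n) (2 ^ Pol.lg n - x.1.length) else uniformWeight (w n)

theorem two_pow_lg_sub (hlg : Pol.lg n ≤ w n) {k : ℕ} (hk : k < n) :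
    0 < 2 ^ Pol.lg n - k ∧ 2 ^ Pol.lg n - k ≤ 2 ^ w n := by
  have h1 := le_two_pow_lg n
  have h2 : 2 ^ Pol.lg n ≤ 2 ^ w n := Nat.pow_le_pow_right (by norm_num) hlg
  omega

theorem isWeight_treeWeight (hlg : Pol.lg n ≤ w n) (x : {x : List Bool // x.length ≤ n}) :
    IsWeight (treeWeight w n x) := by
  unfold treeWeight
  split_ifs with h
  · exact isWeight_block (two_pow_lg_sub hlg h).1 (two_pow_lg_sub hlg h).2
  · exact isWeight_uniform _

open Classical in
/-- The probability of fitting a tree does not depend on the tree. -/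
theorem sum_fits (hlg : Pol.lg n ≤ w n) (hpw : p n ≤ w n) (T : RandTree (Pol.lg n) (p n) n)
    (x : {x : List Bool // x.length ≤ n}) :
    ∑ y, (if T.Fits x.1 y.toList then treeWeight w n x y else 0) =
      if x.1.length < n then 1 / ((2 ^ Pol.lg n - x.1.length : ℕ) : ℝ) else (1 / 2) ^ p n := by
  unfold treeWeight
  split_ifs with h
  -- The queries before `x` are distinct, so exactly `2 ^ ⌈lg n⌉ - |x|` strings are unused,
  -- whichever tree is considered. This is the modulus of the law `treeWeight` at `x`, and the
  -- required string is one residue class.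
  · have h1 := length_unused (T.nodup_before x.2) fun y hy => T.length_of_mem_before x.2 hy
    rw [T.length_before] at h1
    obtain ⟨i, hi, h2⟩ := alpha_eq_iff (mem_unused.2 ⟨T.length_queryAt h, T.queryAt_notMem h⟩)
    rw [h1] at h2 hi
    rw [← sum_blockWeight_mod (two_pow_lg_sub hlg h).1 (two_pow_lg_sub hlg h).2 hi]
    refine Finset.sum_congr rfl fun y _ => ?_
    have h3 : T.Fits x.1 y.toList ↔ strVal y.toList % (2 ^ Pol.lg n - x.1.length) = i := by
      rw [← h2]
      exact ⟨fun hf => hf.1 h, fun hf => ⟨fun _ => hf, fun e => by omega⟩⟩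
    simp only [h3]
  · have hx : x.1.length = n := le_antisymm x.2 (not_lt.1 h)
    have h3 : ∀ y : List Bool, T.Fits x.1 y ↔ y.take (p n) = (T.result ⟨x.1, hx⟩).toList :=
      fun y => ⟨fun hf => hf.2 hx, fun hf => ⟨fun h' => absurd h' h, fun _ => hf⟩⟩
    simp only [h3]
    -- For a result, the first `p n` bits of a uniform string of `w n` bits are uniform.
    have h4 := expect_take hpw fun y => if y = (T.result ⟨x.1, hx⟩).toList then (1 : ℝ) else 0
    rw [Fintype.expect_eq_sum_div_card, card_vector, Fintype.card_bool] at h4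
    have h5 : ∑ r : List.Vector Bool (p n), (if r.toList = (T.result ⟨x.1, hx⟩).toList
        then (1 : ℝ) else 0) * (1 / 2) ^ p n = (1 / 2) ^ p n := by
      rw [Finset.sum_eq_single_of_mem (T.result ⟨x.1, hx⟩) (Finset.mem_univ _)]
      · simp
      · intro r _ hr
        rw [if_neg fun e => hr (List.Vector.toList_injective e), zero_mul]
    rw [h5] at h4
    rw [← h4, Finset.sum_div]
    refine Finset.sum_congr rfl fun y _ => ?_
    unfold uniformWeight
    split_ifs <;> simp


/-! ### Uniform trees from independent values, and the statistical distance -/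

variable {p q s w : Pol} {n : ℕ}

theorem length_toOracle (hpw : p n ≤ w n) (g : FunLE n (w n)) (x : List Bool) (hx : x.length ≤ n) :
    p n ≤ (g.toOracle x).length := by
  rw [FunLE.toOracle, dif_pos hx, List.Vector.toList_length]
  exact hpw

open Classical in
/-- With these values, the trees of functions are uniformly distributed. -/
theorem prodExpect_treeWeight (hlg : Pol.lg n ≤ w n) (hpw : p n ≤ w n)
    (f : RandTree (Pol.lg n) (p n) n → ℝ) :
    prodExpect (treeWeight w n) (fun g => f (treeOf p n (FunLE.toOracle g)
      (length_toOracle hpw g))) = Finset.univ.expect f := by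
  set a : ℝ := ∏ x : {x : List Bool // x.length ≤ n},
    if x.1.length < n then 1 / ((2 ^ Pol.lg n - x.1.length : ℕ) : ℝ) else (1 / 2) ^ p n with ha
  have h1 : ∀ f : RandTree (Pol.lg n) (p n) n → ℝ, prodExpect (treeWeight w n)
      (fun g => f (treeOf p n (FunLE.toOracle g) (length_toOracle hpw g))) = a * ∑ T, f T := by
    intro f
    have h2 : ∀ T : RandTree (Pol.lg n) (p n) n, a = prodExpect (treeWeight w n) fun g =>
        if treeOf p n (FunLE.toOracle g) (length_toOracle hpw g) = T then 1 else 0 := by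
      intro T
      -- Expanding the product of sums gives a sum over all functions `g`; the product of the
      -- indicators is the indicator that every value fits, that is, that the tree of `g` is `T`.
      rw [ha, ← Finset.prod_congr rfl fun x _ => sum_fits hlg hpw T x, Fintype.prod_sum, prodExpect]
      refine Finset.sum_congr rfl fun g _ => ?_
      rw [Finset.prod_ite_zero, mul_ite, mul_one, mul_zero]
      have key : treeOf p n (FunLE.toOracle g) (length_toOracle hpw g) = T ↔
          ∀ x ∈ Finset.univ, T.Fits x.1 (g x).toList := by
        rw [treeOf_eq_iff]
        constructor
        · intro h x _
          have := h x.1 x.2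
          rwa [FunLE.toOracle, dif_pos x.2] at this
        · intro h x hx
          have := h ⟨x, hx⟩ (Finset.mem_univ _)
          rwa [FunLE.toOracle, dif_pos hx]
      by_cases h : treeOf p n (FunLE.toOracle g) (length_toOracle hpw g) = T
      · rw [if_pos h, if_pos (key.1 h)]
      · rw [if_neg h, if_neg (mt key.2 h)]
    rw [Finset.mul_sum, Finset.sum_congr rfl fun T _ => congrArg (· * f T) (h2 T)]
    simp only [prodExpect, Finset.sum_mul]
    rw [Finset.sum_comm]
    refine Finset.sum_congr rfl fun g _ => ?_
    simp only [mul_ite, mul_one, mul_zero, ite_mul, zero_mul]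
    rw [Finset.sum_ite_eq]
    simp
  -- The common probability `a` of the trees is found by taking `f = 1`: it is the inverse of the
  -- number of trees, so the trees need not be counted.
  have h3 := h1 fun _ => 1
  rw [prodExpect_const (isWeight_treeWeight hlg)] at h3
  simp only [Finset.sum_const, nsmul_eq_mul, mul_one, Finset.card_univ] at h3
  rw [h1, Fintype.expect_eq_sum_div_card, div_eq_inv_mul, ← eq_inv_of_mul_eq_one_left h3.symm]

theorem expect_pi {I Y : Type} [Fintype I] [DecidableEq I] [Fintype Y] (f : (I → Y) → ℝ) :
    Finset.univ.expect f = prodExpect (fun _ _ => (Fintype.card Y : ℝ)⁻¹) f := by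
  rw [Fintype.expect_eq_sum_div_card, prodExpect, Finset.sum_div]
  refine Finset.sum_congr rfl fun g _ => ?_
  simp only [Finset.prod_const, Finset.card_univ, Fintype.card_fun]
  rw [div_eq_inv_mul]
  push_cast
  rw [inv_pow]

theorem expect_eq_prodExpect {m : ℕ} [inst : Fintype (FunLE n m)] (f : FunLE n m → ℝ) :
    Finset.univ.expect f = prodExpect (fun _ => uniformWeight m) f := by
  obtain rfl : inst = Pi.instFintype := Subsingleton.elim _ _
  refine (expect_pi f).trans (congrArg (fun μ => prodExpect μ f) ?_)
  funext _ _
  simp [uniformWeight, card_vector]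

theorem two_pow_lg_le (n : ℕ) : 2 ^ Pol.lg n ≤ 2 * n + 1 := by
  by_cases h : n ≤ 1
  · have : Pol.lg n = 0 := Nat.clog_of_right_le_one h 2
    rw [this]; simp
  · have h1 := Nat.pow_pred_clog_lt_self one_lt_two (not_le.1 h)
    have h2 : 0 < Nat.clog 2 n := Nat.clog_pos one_lt_two (by omega)
    have h3 : 2 ^ Pol.lg n = 2 * 2 ^ (Nat.clog 2 n).pred := by
      rw [← pow_succ', ← Nat.succ_eq_add_one, Nat.succ_pred_eq_of_pos h2]; rfl
    omega

/-- The modulus is at most `2 ^ ⌈lg n⌉ ≤ 2n + 1`, and the loss from a modulus `m` is at most `2m / 2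
^ w`. On strings of length `n` the two laws agree. -/
theorem sum_abs_treeWeight_le (hlg : Pol.lg n ≤ w n) (x : {x : List Bool // x.length ≤ n}) :
    ∑ y, |uniformWeight (w n) y - treeWeight w n x y| ≤ (4 * n + 2) * (1 / 2) ^ w n := by
  unfold treeWeight
  split_ifs with h
  · refine (sum_abs_uniform_sub_block_le (two_pow_lg_sub hlg h).1 (two_pow_lg_sub hlg h).2).trans ?_
    gcongr
    have h1 := two_pow_lg_le n
    have h2 : 2 * (2 ^ Pol.lg n - x.1.length) ≤ 4 * n + 2 := by omega
    exact_mod_cast h2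
  · simp
    positivity

/-- An oracle algorithm hardly distinguishes uniform functions from those whose trees are
uniform. -/
theorem abs_prAccept_sub_le [Fintype (FunLE n (w n))] (hlg : Pol.lg n ≤ w n) (D : OracleAlg w) :
    |(Finset.univ.expect fun g : FunLE n (w n) => D.prAccept n g.toOracle) -
      prodExpect (treeWeight w n) (fun g => D.prAccept n (FunLE.toOracle g))| ≤
      D.queries.eval n * ((4 * n + 2) * (1 / 2) ^ w n) := by
  -- The coins are independent of the oracle, so it suffices to bound the difference for each fixed
  -- value of the coins.
  rw [expect_eq_prodExpect]
  have h1 : ∀ μ : {x : List Bool // x.length ≤ n} → List.Vector Bool (w n) → ℝ,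
      prodExpect μ (fun g => D.prAccept n (FunLE.toOracle g)) =
      Finset.univ.expect fun r : List.Vector Bool (D.coins.eval n) => prodExpect μ fun g =>
        if runOracle n (D.step n r.toList) (FunLE.toOracle g) (D.queries.eval n) [] = true
        then 1 else 0 := by
    intro μ
    simp only [prodExpect, OracleAlg.prAccept, Finset.mul_expect]
    rw [← Finset.expect_sum_comm]
  rw [h1, h1, ← Finset.expect_sub_distrib]
  refine (Finset.abs_expect_le _ _).trans (Finset.expect_le Finset.univ_nonempty fun r _ => ?_)
  convert abs_sub_runOracle_le (by positivity) (D.queries.eval n) []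
    (fun _ => uniformWeight (w n)) (treeWeight w n) (fun _ => isWeight_uniform _)
    (isWeight_treeWeight hlg) (sum_abs_treeWeight_le hlg) using 1

variable {F : List Bool → List Bool → List Bool} {A : Plays AdvM}

theorem negligible_queries (hw : Negligible fun n => (1 / 2 : ℝ) ^ w n) (P : Polynomial ℕ) :
    Negligible fun n => P.eval n * ((4 * n + 2) * (1 / 2 : ℝ) ^ w n) := by
  have h := Asymptotics.SuperpolynomialDecay.polynomial_mul hw
    (P.map (Nat.castRingHom ℝ) * (4 * .X + 2))
  refine h.congr fun n => ?_
  simp [Polynomial.eval_map, Polynomial.eval₂_at_natCast]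
  ring


/-! ### Conclusion: the advantage of the adversary -/

variable {p q s w : Pol} {F : List Bool → List Bool → List Bool} {A : Plays AdvM}

/-- Triangle inequality through the uniform function: pseudorandomness of `F` bounds the distance
from `F k` to it, and the statistical estimate bounds the distance from it to the independent values
whose tree is uniform. -/
theorem negligible_comp (hp : p.UnaryPolyTime) (hlg : ∀ n, Pol.lg n ≤ w n) (hpw : ∀ n, p n ≤ w n)
    (hw : Negligible fun n => (1 / 2 : ℝ) ^ w n) (hF : IsPRF w F)
    (hA : IsStrategy (advGame p q s) A) (hA' : IsPolyTime (advGame p q s) A) :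
    Negligible fun n =>
      |(Finset.univ.expect fun k : List.Vector Bool n => prAccept q s (logSof p) n A
          (app (keyPlays k.toList) (comp (prfStrategy w F) (first2second w p) n))) -
        (Finset.univ.expect fun T : RandTree (Pol.lg n) (p n) n =>
          prAccept q s (logSof p) n A (randSof p n T))| := by
  obtain ⟨D, hD⟩ := exists_oracleAlg (w := w) hA hA' hp hpw
  refine ((hF.secure D).add (negligible_queries hw D.queries)).trans_abs_le fun n => ?_
  have hk : ∀ k : List.Vector Bool n, ∀ x : List Bool, x.length ≤ n → p n ≤ (F k.toList x).length :=
    fun k x hx => by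
      rw [hF.length _ _ (by simpa using hx), List.Vector.toList_length]
      exact hpw n
  have h1 : ∀ k : List.Vector Bool n, prAccept q s (logSof p) n A
      (app (keyPlays k.toList) (comp (prfStrategy w F) (first2second w p) n)) =
      D.prAccept n (F k.toList) := fun k => by
    rw [app_comp hF.length hpw (by simp) (hk k), hD]
  -- The uniform tree is replaced by the tree of a function with independent values, so that the
  -- same algorithm `D` describes both experiments.
  rw [← prodExpect_treeWeight (hlg n) (hpw n)]
  simp only [h1, hD]
  have h2 := abs_prAccept_sub_le (hlg n) D
  rw [abs_abs]
  refine (abs_sub_le _ _ _).trans ((add_le_add le_rfl h2).trans (le_abs_self _))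

end HOCrypto

theorem mainTheorem4 (p w : HOCrypto.Pol) (hp : p.UnaryPolyTime)
    (hlg : ∀ n, HOCrypto.Pol.lg n ≤ w n) (hpw : ∀ n, p n ≤ w n)
    (hw : HOCrypto.Negligible fun n => (1 / 2 : ℝ) ^ w n)
    (F : List Bool → List Bool → List Bool) (hF : HOCrypto.IsPRF w F) :
    HOCrypto.IsSecondOrderPRF p
      (HOCrypto.comp (HOCrypto.prfStrategy w F) (HOCrypto.first2second w p)) :=
  ⟨HOCrypto.isStrategy_comp hF.length hpw, HOCrypto.isPolyTime_comp hp hF hpw,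
    fun _ _ _ hA hA' => HOCrypto.negligible_comp hp hlg hpw hw hF hA hA'⟩
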